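/- **Data.** Let $N\ge 2$ and let $\mathfrak F_N=\{f_1,\dots,f_N\}$ with $f_a(x)=\tfrac{t_a}{2}x^2+s_ax+r_a$ (real coefficients). Let $L_a=\{y=t_ax+s_a\}$, the graph of $df_a/dx$. Assume that the slopes $t_a$ are pairwise distinct and that no three distinct lines $L_a,L_b,L_c$ meet in a point. Put $f_{ab}=f_a-f_b$. For $a\ne b$ let $v_{ab}=L_a\cap L_b$, with first coordinate $x(v_{ab})$. Let $S$ be the set of all points $v_{ab}$ and $S_a$ the set of those on $L_a$. **Conventions.** An $A_\infty$-category has multilinear products $m_k$, $k\ge1$, of degree $2-k$ on composable sequences of morphisms, written from left to right, with $$\sum_{k+l=n+1}\ \sum_{j=0}^{k-1}(-1)^{(j+1)(l+1)+l(|w_1|+\cdots+|w_j|)}\,m_k(w_1,\dots,w_j,m_l(w_{j+1},\dots,w_{j+l}),w_{j+l+1},\dots,w_n)=0\qquad(n\ge1).$$ It is a DG category if $m_k=0$ for $k\ge3$. With $o_i=sw_i$, $|o_i|=|w_i|-1$, the suspended products are $m_n(o_1,\dots,o_n)=(-1)^{\sum_i(n-i)|o_i|}\,s\,m_n(w_1,\dots,w_n)$.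 An $A_\infty$-functor is a map on objects with multilinear maps $g_k$, $k\ge 1$, of degree $0$ on the suspensions, such that $\sum m_i(g_{k_1}\otimes\cdots\otimes g_{k_i})=\sum g_k(1^{\otimes i}\otimes m_l\otimes1^{\otimes j})$ (Koszul signs). It is a homotopy equivalence if it is bijective on objects and every $g_1$ induces isomorphisms on $m_1$-cohomology. **Step functions and delta forms.** For a finite $T\subset\mathbb R^2$ let $\tilde{\mathcal A}_T(\mathbb R)$ be the graded commutative DG algebra generated by $1$ and, for $v\in T$, by $\vartheta_v$ (degree $0$) and $\delta_v=d\vartheta_v$ (degree $1$), with the relations $\vartheta_v\vartheta_{v'}=\vartheta_{v'}$ and $\delta_v\vartheta_{v'}=0$, $\vartheta_v\delta_{v'}=\delta_{v'}$ for $x(v)<x(v')$; $\vartheta_v=\vartheta_{v'}$ for $x(v)=x(v')$; and $\delta_v\delta_{v'}=0$. The powers of a single $\vartheta_v$ are linearly independent: $\vartheta_v$ is a formal step at $x(v)$ with $\vartheta_v^2\neq\vartheta_v$. A function $\varphi$ multiplies delta forms by $\varphi\,\delta_v=\varphi(x(v))\,\delta_v$. Let $\mathcal A_T(\mathbb R)\subset\tilde{\mathcal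 A}_T(\mathbb R)$ be the part consisting in degree $0$ of the combinations $\sum c_{v,n}(\vartheta_v)^n$, $n\ge1$, with $\sum c_{v,n}=0$, and of everything in degree $1$. **The DG category $\mathcal C'_{DR}(\mathfrak F_N)$.** The objects are $1,\dots,N$. The space $\Omega'^{\,r}_{ab}$ consists of the elements $e^{f_{ab}}\alpha$, $\alpha\in\tilde{\mathcal A}^r_S(\mathbb R)$, that for $r=0$ are moreover combinations of (products of) step functions $\vartheta_v$, $v\in S$, with Schwartz functions as coefficients. The differential is $d_{ab}=d-df_{ab}\wedge$, that is, $d_{ab}(e^{f_{ab}}\alpha)=e^{f_{ab}}d\alpha$. The composition is the product. **The spaces $V_{ab}$.** $V_{aa}=\mathcal A_{S_a}(\mathbb R)$. For $a\ne b$, $V_{ab}=\mathbb R\,[v_{ab}]$ in degree $0$ if $t_a<t_b$ and in degree $1$ if $t_a>t_b$, where $[v_{ab}]=e^{f_{ab}-f_{ab}(x(v_{ab}))}$ if $t_a<t_b$ and $[v_{ab}]=\delta_{v_{ab}}$ if $t_a>t_b$. **Homotopies and projections.** Let $h_{aa}=0$ and $P_{aa}=\mathrm{Id}$. For $v\in S$,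 $n\ge1$: - if $t_a<t_b$: $h_{ab}(d(\vartheta_v)^n)=e^{f_{ab}-f_{ab}(x(v))}\bigl((\vartheta_v)^n-c\bigr)$ with $c=0,\ \tfrac1{2^n},\ 1$ for $x(v_{ab})<x(v)$, $x(v_{ab})=x(v)$, $x(v_{ab})>x(v)$ respectively; $P_{ab}(e^{f_{ab}})=e^{f_{ab}}$, $P_{ab}(e^{f_{ab}}(\vartheta_v)^n)=c'e^{f_{ab}}$ with $c'=1,\ \tfrac1{2^n},\ 0$ for $x(v)<x(v_{ab})$, $x(v)=x(v_{ab})$, $x(v)>x(v_{ab})$ respectively; $P_{ab}=0$ in degree $1$; - if $t_a>t_b$: $h_{ab}(d(\vartheta_v)^n)=e^{f_{ab}-f_{ab}(x(v))}\bigl((\vartheta_v)^n-\vartheta_{v_{ab}}\bigr)$; $P_{ab}(d(\vartheta_v)^n)=e^{f_{ab}(x(v_{ab}))-f_{ab}(x(v))}\,\delta_{v_{ab}}$; $P_{ab}=0$ in degree $0$. **Clockwise convex polygons.** A cyclic sequence $\vec v$ of points in the plane, each taken with a degree, is a CC-polygon if, after consecutive repetitions (cyclically) are removed, every angle $\mathrm{Angle}(v_{i-1}v_iv_{i+1})$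 lies in $(0,\pi]$ (clockwise convex), and if exactly two members of $\vec v$ have degree $0$, one, the $i$-th, at the left extremum of the first coordinate and one, the $j$-th, at the right extremum, all the others having degree $1$. Its sign is $\sigma(\vec v)=-1$ if $i<j$ and $+1$ if $j<i$. The point $v_{ab}$ gets the degree of $[v_{ab}]$. Write $\vartheta^{+1}_v=\vartheta_v$, $\vartheta_v^{-1}=1-\vartheta_v$. **Theorem.** $\mathcal C'_{DR}(\mathfrak F_N)$ is a DG category. The formulas above define unique linear maps $h_{ab}:\Omega'^{\,r}_{ab}\to\Omega'^{\,r-1}_{ab}$ (zero outside $r=1$), and linear projections $P_{ab}$, with $d_{ab}h_{ab}+h_{ab}d_{ab}=\mathrm{Id}-P_{ab}$, $P_{ab}^2=P_{ab}$ and $P_{ab}(\Omega'_{ab})=V_{ab}$ for $a\ne b$. There is an $A_\infty$-category $\mathcal C(\mathfrak F_N)$ with objects $1,\dots,N$ and morphism spaces $V_{ab}$, and an $A_\infty$-functor $\{g_k\}:\mathcal C(\mathfrak F_N)\to\mathcal C'_{DR}(\mathfrak F_N)$ which is a homotopy equivalence, is the identity on objects and has $g_1$ equal to the inclusion $V_{ab}\subset\Omega'_{ab}$,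 such that both are given by homological perturbation: for $n\ge2$, in the suspensions, $$g_n=-h\sum_{i\ge2}m_i(g_{k_1}\otimes\cdots\otimes g_{k_i}),\qquad m^{\mathcal C}_n=P\sum_{i\ge2}m_i(g_{k_1}\otimes\cdots\otimes g_{k_i}),\qquad k_1+\cdots+k_i=n,$$ with $m_i$ the products of $\mathcal C'_{DR}(\mathfrak F_N)$. The products $m_k$ of $\mathcal C(\mathfrak F_N)$ satisfy the following, where formulas in $(\vartheta_v)^n$, $n\ge 1$, are extended linearly to $V^0_{aa}$. 1. $m_1=d$ on $V_{aa}$, $m_1=0$ on $V_{ab}$ for $a\neq b$, $m_2$ on $V_{aa}$ is the product, and $m_k=0$ on $V_{aa}^{\otimes k}$ for $k\ge3$. 2. $m_k=0$ for $k\ge3$ on sequences with at least two entries in $\bigoplus_aV_{aa}^0$. 3. Let $a\neq b$, let $\Delta_i$ stand for $k_i\ge 0$ elements of $V^1_{aa}$ or $V^1_{bb}$, as composability requires, and let $\theta$ be an element of $V^0_{aa}$ or $V^0_{bb}$. The following vanish: (A) $m(\Delta_1,\theta,\Delta_2,[v_{ab}],\Delta_3)$ if $t_a<t_b$, $k_1\ne0$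 or if $t_a>t_b$, $k_2\ne0$; (B) $m(\Delta_1,[v_{ab}],\Delta_2,\theta,\Delta_3)$ if $t_a<t_b$, $k_3\ne0$ or if $t_a>t_b$, $k_2\ne0$; (C$_1$) $m(\Delta_1,[v_{ab}],\Delta_2,\theta,\Delta_3,[v_{ba}],\Delta_4)$ if $t_a<t_b$, $k_3\ne0$ or if $t_a>t_b$, $k_2\ne0$; (C$_2$) $m(\Delta_1,\theta,\Delta_2,[v_{ab}],\Delta_3,[v_{ba}],\Delta_4)$ if $t_a>t_b$, $k_2\ne0$; (C$_3$) $m(\Delta_1,[v_{ab}],\Delta_2,[v_{ba}],\Delta_3,\theta,\Delta_4)$ if $t_a<t_b$, $k_3\ne0$. 4. For $a\ne b$, $m_2((\vartheta_v)^n,[v_{ab}])$ for $v\in S_a$ and $m_2([v_{ab}],(\vartheta_v)^n)$ for $v\in S_b$ equal $[v_{ab}]$ times $1$ if $x(v)<x(v_{ab})$; $0$ if $x(v)>x(v_{ab})$; and, if $v=v_{ab}$, $\tfrac1{2^n}$ for $t_a<t_b$ and $\tfrac1{n+1}$ for $t_a>t_b$. 5. For $t_a<t_b$, $m_3([v_{ba}],(\vartheta_v)^n,[v_{ab}])$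 and $m_3((\vartheta_v)^n,[v_{ba}],[v_{ab}])$ equal $\tfrac1{n+1}\vartheta_{v_{ab}}(1-(\vartheta_{v_{ab}})^n)$, and $m_3([v_{ab}],(\vartheta_v)^n,[v_{ba}])$ and $m_3([v_{ab}],[v_{ba}],(\vartheta_v)^n)$ equal $-\tfrac1{n+1}\vartheta_{v_{ab}}(1-(\vartheta_{v_{ab}})^n)$, if $v=v_{ab}$; all four are $0$ if $v\ne v_{ab}$. 6. Let $k\ge2$ and $a_i\ne a_{i+1}$ for $1\le i\le k$. - If $a_1\ne a_{k+1}$ and $\vec v=(v_{a_1a_2},\dots,v_{a_ka_{k+1}},v_{a_{k+1}a_1})$ is a CC-polygon, then $m_k([v_{a_1a_2}],\dots,[v_{a_ka_{k+1}}])=\sigma(\vec v)^k\,e^{-\mathrm{Area}(\vec v)}\,[v_{a_1a_{k+1}}]$. - If $a_1=a_{k+1}=a$ and $\vec v=(v_{aa_2},\dots,v_{a_ka})$ is a CC-polygon, then $m_k([v_{aa_2}],\dots,[v_{a_ka}])=\sigma(\vec v)^k\,e^{-\mathrm{Area}(\vec v)}\,\vartheta_{v_{aa_2}}^{-\sigma(\vec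 v)}\,\vartheta_{v_{a_ka}}^{\sigma(\vec v)}$. - $m_2([v_{ab}],[v_{ba}])=\delta_{v_{ab}}$ for $a\ne b$. - In all other cases $m_k([v_{a_1a_2}],\dots,[v_{a_ka_{k+1}}])=0$. -/

import Mathlib

open scoped DirectSum Polynomial SchwartzMap

noncomputable section

/-! ## `A∞`-categories and `A∞`-functors over `ℝ`

A family of graded morphism spaces is a map `H : Ob → Ob → ℤ → Type`, with `H a b r` the degree `r`
part of `Hom(a, b)`.  -/

/-- Composable sequences `(w₁, …, wₙ)`, `n ≥ 0`, of homogeneous morphisms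
`wᵢ ∈ Hom(aᵢ, aᵢ₊₁)`, from the first object to the last one. -/
inductive HomPath {Ob : Type} (H : Ob → Ob → ℤ → Type) : Ob → Ob → Type
  | nil (a : Ob) : HomPath H a a
  | cons {a b c : Ob} {r : ℤ} (w : H a b r) (p : HomPath H b c) : HomPath H a c

namespace HomPath

variable {Ob : Type} {H : Ob → Ob → ℤ → Type}

/-- The sequence consisting of one morphism. -/
def single {a b : Ob} {r : ℤ} (w : H a b r) : HomPath H a b := cons w (nil b)

/-- Concatenation. -/
def append {a b c : Ob} : HomPath H a b → HomPath H b c → HomPath H a c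
  | nil _, q => q
  | cons w p, q => cons w (append p q)

/-- The number `n` of morphisms. -/
def length {a b : Ob} : HomPath H a b → ℕ
  | nil _ => 0
  | cons _ p => length p + 1

/-- The total degree `|w₁| + ⋯ + |wₙ|`. -/
def deg {a b : Ob} : HomPath H a b → ℤ
  | nil _ => 0
  | cons (r := r) _ p => r + deg p

/-- The total suspended degree `|o₁| + ⋯ + |oₙ|`, where `oᵢ = s wᵢ` has degree `|wᵢ| - 1`;
equivalently the total degree minus `n`. -/
def sdeg {a b : Ob} : HomPath H a b → ℤ
  | nil _ => 0
  | cons (r := r) _ p => (r - 1) + sdeg p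

/-- The exponent `∑ᵢ (n - i) |oᵢ|` of the sign relating a product and its suspension. -/
def suspExp {a b : Ob} : HomPath H a b → ℤ
  | nil _ => 0
  | cons (r := r) _ p => (length p : ℤ) * (r - 1) + suspExp p

/-- All ways to write a sequence as a concatenation of two (possibly empty) ones. -/
def splits {a c : Ob} : HomPath H a c → List (Σ b : Ob, HomPath H a b × HomPath H b c)
  | nil a => [⟨a, nil a, nil a⟩]
  | cons (a := a) w p =>
      ⟨a, nil a, cons w p⟩ :: (splits p).map fun s => ⟨s.1, cons w s.2.1, s.2.2⟩

end HomPath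

section AInfinity

variable {Ob Ob' : Type}

/-- The total space `⨁ᵣ Homʳ(a, b)`. -/
abbrev Tot (H : Ob → Ob → ℤ → Type) [∀ a b r, AddCommGroup (H a b r)] (a b : Ob) : Type :=
  ⨁ r : ℤ, H a b r

/-- A homogeneous morphism as an element of the total space. -/
def toTot {H : Ob → Ob → ℤ → Type} [∀ a b r, AddCommGroup (H a b r)] {a b : Ob} {r : ℤ}
    (w : H a b r) : Tot H a b :=
  DirectSum.of (fun r => H a b r) r w

/-- Operations `mₙ : Hom(a₁, a₂) ⊗ ⋯ ⊗ Hom(aₙ, aₙ₊₁) → Hom(a₁, aₙ₊₁)` of degree `2 - n`; the output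
degree is `|w₁| + ⋯ + |wₙ| + 2 - n = |o₁| + ⋯ + |oₙ| + 2`.  The value on the empty sequence
plays no role. -/
structure AInftyData (H : Ob → Ob → ℤ → Type) where
  m : ∀ {a b : Ob} (p : HomPath H a b), H a b (p.sdeg + 2)

namespace AInftyData

variable {H : Ob → Ob → ℤ → Type} [∀ a b r, AddCommGroup (H a b r)] [∀ a b r, Module ℝ (H a b r)]

/-- The left side of the `A∞`-relation
`∑_{j, l} (-1)^σ m_k(w₁, …, w_j, m_l(w_{j+1}, …, w_{j+l}), w_{j+l+1}, …, wₙ)`, `k + l = n + 1`,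
`l ≥ 1`, where `σ = (j + 1)(l + 1) + l (|w₁| + ⋯ + |w_j|)`. -/
def relationSum (C : AInftyData H) {a d : Ob} (p : HomPath H a d) : Tot H a d :=
  (p.splits.map fun s =>
    (s.2.2.splits.map fun u =>
      if u.2.1.length = 0 then 0
      else
        (-1 : ℝ) ^ (((s.2.1.length : ℤ) + 1) * ((u.2.1.length : ℤ) + 1)
            + (u.2.1.length : ℤ) * s.2.1.deg) •
          toTot (C.m (s.2.1.append (HomPath.cons (C.m u.2.1) u.2.2)))).sum).sum

/-- `C` is an `A∞`-category: the operations are multilinear and satisfy the `A∞`-relations. -/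
structure IsAInfty (C : AInftyData H) : Prop where
  map_add : ∀ {a b c d : Ob} {r : ℤ} (p : HomPath H a b) (x y : H b c r) (q : HomPath H c d),
    toTot (C.m (p.append (HomPath.cons (x + y) q)))
      = toTot (C.m (p.append (HomPath.cons x q))) + toTot (C.m (p.append (HomPath.cons y q)))
  map_smul : ∀ {a b c d : Ob} {r : ℤ} (p : HomPath H a b) (k : ℝ) (x : H b c r)
    (q : HomPath H c d),
    toTot (C.m (p.append (HomPath.cons (k • x) q)))
      = k • toTot (C.m (p.append (HomPath.cons x q)))
  relation : ∀ {a d : Ob} (p : HomPath H a d), 1 ≤ p.length → C.relationSum p = 0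

/-- A DG category is an `A∞`-category with `m₃ = m₄ = ⋯ = 0`. -/
structure IsDGCategory (C : AInftyData H) : Prop where
  isAInfty : C.IsAInfty
  higher : ∀ {a b : Ob} (p : HomPath H a b), 3 ≤ p.length → C.m p = 0

/-- The operations of the suspension,
`mₙ(o₁, …, oₙ) = (-1)^{∑ᵢ (n - i) |oᵢ|} s mₙ(w₁, …, wₙ)`. -/
def suspM (C : AInftyData H) {a b : Ob} (p : HomPath H a b) : Tot H a b :=
  (-1 : ℝ) ^ p.suspExp • toTot (C.m p)

end AInftyData

variable {H : Ob → Ob → ℤ → Type} {H' : Ob' → Ob' → ℤ → Type}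

/-- A map on objects and degree-preserving operations `g_k`, `k ≥ 1`, between suspensions: the output
`g_k(o₁, …, o_k)` has suspended degree `|o₁| + ⋯ + |o_k|`. The value on the empty sequence plays
no role. -/
structure FunctorData (C : AInftyData H) (D : AInftyData H') where
  obj : Ob → Ob'
  g : ∀ {a b : Ob} (p : HomPath H a b), H' (obj a) (obj b) (p.sdeg + 1)

namespace FunctorData

variable {C : AInftyData H} {D : AInftyData H'}

/-- Auxiliary to `blocks`: `acc` is the (nonempty) block that is being collected. -/
def blocksAux (F : FunctorData C D) {c : Ob} : ∀ {a b : Ob}, HomPath H a b → HomPath H b c →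
    List (HomPath H' (F.obj a) (F.obj c))
  | _, _, acc, .nil _ => [HomPath.single (F.g acc)]
  | _, _, acc, .cons w p =>
      blocksAux F (acc.append (HomPath.single w)) p
        ++ (blocksAux F (HomPath.single w) p).map fun q => HomPath.cons (F.g acc) q

/-- The sequences `(g_{k₁}(o₁, …), …, g_{kᵢ}(…, oₙ))` for all `k₁ + ⋯ + kᵢ = n`, `kⱼ ≥ 1`. -/
def blocks (F : FunctorData C D) {a c : Ob} : HomPath H a c →
    List (HomPath H' (F.obj a) (F.obj c))
  | .nil a => [HomPath.nil (F.obj a)]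
  | .cons w p => F.blocksAux (HomPath.single w) p

variable [∀ a b r, AddCommGroup (H' a b r)] [∀ a b r, Module ℝ (H' a b r)]

/-- `∑ g_k(1^{⊗ i} ⊗ m_l ⊗ 1^{⊗ j})` on a sequence, in the suspensions, including the sign
`(-1)^{|o₁| + ⋯ + |oᵢ|}` from moving the degree one map `m_l` past `o₁, …, oᵢ`. -/
def innerSum (F : FunctorData C D) {a d : Ob} (p : HomPath H a d) :
    Tot H' (F.obj a) (F.obj d) :=
  (p.splits.map fun s =>
    (s.2.2.splits.map fun u =>
      if u.2.1.length = 0 then 0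
      else
        (-1 : ℝ) ^ (s.2.1.sdeg + u.2.1.suspExp) •
          toTot (F.g (s.2.1.append (HomPath.cons (C.m u.2.1) u.2.2)))).sum).sum

/-- The data form an `A∞`-functor: multilinearity and
`∑ mᵢ(g_{k₁} ⊗ ⋯ ⊗ g_{kᵢ}) = ∑ g_k(1^{⊗ i} ⊗ m_l ⊗ 1^{⊗ j})`. -/
structure IsAInftyFunctor [∀ a b r, AddCommGroup (H a b r)] [∀ a b r, Module ℝ (H a b r)]
    (F : FunctorData C D) : Prop where
  map_add : ∀ {a b c d : Ob} {r : ℤ} (p : HomPath H a b) (x y : H b c r) (q : HomPath H c d),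
    toTot (F.g (p.append (HomPath.cons (x + y) q)))
      = toTot (F.g (p.append (HomPath.cons x q))) + toTot (F.g (p.append (HomPath.cons y q)))
  map_smul : ∀ {a b c d : Ob} {r : ℤ} (p : HomPath H a b) (k : ℝ) (x : H b c r)
    (q : HomPath H c d),
    toTot (F.g (p.append (HomPath.cons (k • x) q)))
      = k • toTot (F.g (p.append (HomPath.cons x q)))
  relation : ∀ {a d : Ob} (p : HomPath H a d), 1 ≤ p.length →
    ((F.blocks p).map fun q => D.suspM q).sum = F.innerSum p

/-- A homotopy equivalence: a bijection on objects such that `g₁` induces isomorphisms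
`Hʳ(Hom(a, b), m₁) → Hʳ(Hom(g a, g b), m₁)` for all `a`, `b`, `r`: every cocycle is
cohomologous to the image of a cocycle, and a cocycle with exact image is exact. -/
structure IsHomotopyEquivalence [∀ a b r, AddCommGroup (H a b r)]
    (F : FunctorData C D) : Prop where
  obj_bijective : Function.Bijective F.obj
  surj : ∀ (a b : Ob) (r : ℤ) (y : H' (F.obj a) (F.obj b) r), D.m (HomPath.single y) = 0 →
    ∃ x : H a b r, C.m (HomPath.single x) = 0 ∧
      ∃ z : H' (F.obj a) (F.obj b) (r - 1),
        toTot y = toTot (F.g (HomPath.single x)) + toTot (D.m (HomPath.single z))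
  inj : ∀ (a b : Ob) (r : ℤ) (x : H a b r), C.m (HomPath.single x) = 0 →
    (∃ z : H' (F.obj a) (F.obj b) (r - 1),
      toTot (F.g (HomPath.single x)) = toTot (D.m (HomPath.single z))) →
    ∃ w : H a b (r - 1), toTot x = toTot (C.m (HomPath.single w))

end FunctorData

/-! ### Homological perturbation -/

section Perturbation

variable {H : Ob → Ob → ℤ → Type} {H' : Ob' → Ob' → ℤ → Type}
  [∀ a b r, AddCommGroup (H' a b r)] [∀ a b r, Module ℝ (H' a b r)]

/-- `dh + hd = Id - P` and `P² = P` on all morphism spaces, where `d = m₁`. -/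
structure IsContraction (D : AInftyData H')
    (h : ∀ a b r, H' a b r →ₗ[ℝ] H' a b (r - 1)) (P : ∀ a b r, H' a b r →ₗ[ℝ] H' a b r) :
    Prop where
  homotopy : ∀ (a b : Ob') (r : ℤ) (w : H' a b r),
    toTot (D.m (HomPath.single (h a b r w))) + toTot (h a b _ (D.m (HomPath.single w)))
      = toTot w - toTot (P a b r w)
  idempotent : ∀ a b r, P a b r ∘ₗ P a b r = P a b r

/-- The map induced on the total space by maps `Hʳ → Hʳ⁻¹`. -/
def totH {a b : Ob'} (h : ∀ r, H' a b r →ₗ[ℝ] H' a b (r - 1)) : Tot H' a b →ₗ[ℝ] Tot H' a b :=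
  DirectSum.toModule ℝ ℤ _ fun r => DirectSum.lof ℝ ℤ (fun r => H' a b r) (r - 1) ∘ₗ h r

/-- The map induced on the total space by maps `Hʳ → Hʳ`. -/
def totP {a b : Ob'} (P : ∀ r, H' a b r →ₗ[ℝ] H' a b r) : Tot H' a b →ₗ[ℝ] Tot H' a b :=
  DirectSum.toModule ℝ ℤ _ fun r => DirectSum.lof ℝ ℤ (fun r => H' a b r) r ∘ₗ P r

variable {C : AInftyData H} {D : AInftyData H'}

/-- `∑_{i ≥ 2} mᵢ(g_{k₁} ⊗ ⋯ ⊗ g_{kᵢ})` on a sequence, in the suspensions. -/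
def FunctorData.treeSum (F : FunctorData C D) {a b : Ob} (p : HomPath H a b) :
    Tot H' (F.obj a) (F.obj b) :=
  ((F.blocks p).map fun q => if 2 ≤ q.length then D.suspM q else 0).sum

/-- `F` and the products of its source are given by the recursive formulas of homological
perturbation theory, `g_n = -h ∑_{i ≥ 2} mᵢ(g ⊗ ⋯ ⊗ g)` and `ι m'_n = P ∑_{i ≥ 2} mᵢ(g ⊗ ⋯ ⊗ g)`
for `n ≥ 2`, in the suspensions, with `ι = g₁`. -/
structure FunctorData.IsPerturbation (F : FunctorData C D)
    (h : ∀ a b r, H' a b r →ₗ[ℝ] H' a b (r - 1)) (P : ∀ a b r, H' a b r →ₗ[ℝ] H' a b r) :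
    Prop where
  functor : ∀ {a b : Ob} (p : HomPath H a b), 2 ≤ p.length →
    toTot (F.g p) = - totH (h (F.obj a) (F.obj b)) (F.treeSum p)
  product : ∀ {a b : Ob} (p : HomPath H a b), 2 ≤ p.length →
    (-1 : ℝ) ^ p.suspExp • toTot (F.g (HomPath.single (C.m p)))
      = totP (P (F.obj a) (F.obj b)) (F.treeSum p)

end Perturbation

end AInfinity

/-! ## Step functions and delta one-forms

`StepSpace` is an ambient ring for the algebras generated by functions on `ℝ`, step functions
`ϑ_v` and delta one-forms `δ_v = dϑ_v`.  A degree zero element assigns to `x ∈ ℝ` its value, where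
at a jump the value is a polynomial in the variable `ϑ` running from `0` to `1`; so
`ϑ_v ^ n` is `0` before `x(v)`, `ϑ ^ n` at `x(v)` and `1` after `x(v)`, and the powers of `ϑ_v` are
linearly independent.  A degree one element supported at points assigns to `x` the polynomial `q` of
its component `q(ϑ) dϑ`, so `ϑ_v ^ n · δ_v` is `ϑ ^ n` at `x(v)` and `0` elsewhere.  The products of
elements of degrees `(0, 0)`, `(0, 1)` and `(1, 0)` are pointwise; the product of two one-forms
is zero.  The relations `ϑ_v ϑ_v' = ϑ_v'`, `δ_v ϑ_v' = 0` for `x(v) < x(v')`,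
`α δ_v = α(x(v)) δ_v` and so on are all visible. -/

abbrev StepSpace : Type := ℝ → ℝ[X]

namespace StepSpace

/-- A function on `ℝ`. -/
def ofFun (φ : ℝ → ℝ) : StepSpace := fun x => Polynomial.C (φ x)

/-- The step function with jump at `p`. -/
def theta (p : ℝ) : StepSpace := fun x => if x < p then 0 else if x = p then Polynomial.X else 1

/-- The delta one-form at `p`. -/
def delta (p : ℝ) : StepSpace := fun x => if x = p then 1 else 0

/-- The differential on step functions: `d ϑ_v = δ_v`, with the Leibniz rule. -/
def d : StepSpace →ₗ[ℝ] StepSpace := LinearMap.pi fun x => Polynomial.derivative ∘ₗ LinearMap.proj x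

/-- `Ã⁰_S(ℝ)`: the algebra generated by the step functions with jumps in `S`, with unit. -/
def tildeA0 (S : Set ℝ) : Subalgebra ℝ StepSpace := Algebra.adjoin ℝ (theta '' S)

/-- `Ã¹_S(ℝ) = A¹_S(ℝ)`: the sum of the `Ã⁰_S(ℝ) · δ_v`. -/
def A1 (S : Set ℝ) : Submodule ℝ StepSpace :=
  (Submodule.span (tildeA0 S) (delta '' S)).restrictScalars ℝ

/-- `A⁰_S(ℝ)`: the combinations `∑ c_{v,n} ϑ_v ^ n`, `n ≥ 1`, with `∑ c_{v,n} = 0`. -/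
def A0 (S : Set ℝ) : Submodule ℝ StepSpace :=
  Submodule.span ℝ {u | ∃ p ∈ S, ∃ q ∈ S, ∃ m n : ℕ, 1 ≤ m ∧ 1 ≤ n ∧
    u = theta p ^ m - theta q ^ n}

/-- `A⁰_S(Ω(ℝ))`: the combinations of step functions with jumps in `S` with Schwartz functions as
coefficients. -/
def schwartzA0 (S : Set ℝ) : Submodule ℝ StepSpace :=
  Submodule.span ℝ {u | ∃ φ : 𝓢(ℝ, ℝ), ∃ α ∈ tildeA0 S, u = ofFun φ * α}

/-- The graded product of elements of degrees `r` and `r'` (both in `{0, 1}`). -/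
def gmul (r r' : ℤ) (u v : StepSpace) : StepSpace := if r = 1 ∧ r' = 1 then 0 else u * v

/-- The differential of an element of degree `r`. -/
def gd (r : ℤ) (u : StepSpace) : StepSpace := if r = 0 then d u else 0

theorem mul_mem_schwartzA0 {S : Set ℝ} {u v : StepSpace} (hu : u ∈ schwartzA0 S)
    (hv : v ∈ schwartzA0 S) : u * v ∈ schwartzA0 S := by
  have key := Submodule.mul_mem_mul hu hv
  rw [schwartzA0, Submodule.span_mul_span] at key
  refine Submodule.span_mono ?_ key
  rintro _ ⟨_, ⟨φ, α, hα, rfl⟩, _, ⟨ψ, β, hβ, rfl⟩, rfl⟩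
  refine ⟨SchwartzMap.pairing (ContinuousLinearMap.mul ℝ ℝ) φ ψ, α * β, mul_mem hα hβ, ?_⟩
  funext x
  simp only [Pi.mul_apply, ofFun, SchwartzMap.pairing_apply_apply, ContinuousLinearMap.mul_apply',
    Polynomial.C_mul]
  ring

theorem mul_mem_A1 {S : Set ℝ} {u v : StepSpace} (hu : u ∈ tildeA0 S) (hv : v ∈ A1 S) :
    u * v ∈ A1 S :=
  (Submodule.span (tildeA0 S) (delta '' S)).smul_mem ⟨u, hu⟩ hv

theorem d_mul (u v : StepSpace) : d (u * v) = u * d v + v * d u := by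
  funext x
  simp only [d, LinearMap.pi_apply, LinearMap.coe_comp, Function.comp_apply, LinearMap.proj_apply,
    Pi.mul_apply, Pi.add_apply, Polynomial.derivative_mul]
  ring

theorem d_theta (p : ℝ) : d (theta p) = delta p := by
  funext x
  simp only [d, LinearMap.pi_apply, LinearMap.coe_comp, Function.comp_apply, LinearMap.proj_apply,
    theta, delta]
  rcases lt_trichotomy x p with h | h | h
  · simp [h, h.ne]
  · simp [h]
  · simp [h.not_gt, h.ne']

theorem d_mem_A1 {S : Set ℝ} {u : StepSpace} (hu : u ∈ tildeA0 S) : d u ∈ A1 S := by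
  induction hu using Algebra.adjoin_induction with
  | mem x hx =>
    obtain ⟨p, hp, rfl⟩ := hx
    rw [d_theta]
    exact Submodule.subset_span ⟨p, hp, rfl⟩
  | algebraMap r =>
    have : d (algebraMap ℝ StepSpace r) = 0 := by
      funext x
      simp [d, Pi.algebraMap_apply]
    rw [this]
    exact Submodule.zero_mem _
  | add x y _ _ hx hy => rw [map_add]; exact Submodule.add_mem _ hx hy
  | mul x y hx hy hx' hy' =>
    rw [d_mul]
    exact Submodule.add_mem _ (mul_mem_A1 hx hy') (mul_mem_A1 hy hx')

theorem d_ofFun_mul (φ : ℝ → ℝ) (u : StepSpace) : d (ofFun φ * u) = ofFun φ * d u := by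
  funext x
  simp [d, ofFun]

end StepSpace

/-! ## Lines in the plane -/

/-- Functions `f_a(x) = (t_a / 2) x² + s_a x + r_a`, `a = 1, …, N`, whose graphs of derivatives, the
lines `L_a : y = t_a x + s_a`, have pairwise distinct slopes and such that no three distinct lines
meet in a point. -/
structure LineConfig (N : ℕ) where
  t : Fin N → ℝ
  s : Fin N → ℝ
  r : Fin N → ℝ
  slopes : ∀ a b, a ≠ b → t a ≠ t b
  generic : ∀ a b c, a ≠ b → b ≠ c → a ≠ c →
    ¬ ∃ x y : ℝ, y = t a * x + s a ∧ y = t b * x + s b ∧ y = t c * x + s c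

namespace LineConfig

open StepSpace

variable {N : ℕ} (L : LineConfig N)

/-- `f_{ab} = f_a - f_b`. -/
def f (a b : Fin N) (x : ℝ) : ℝ :=
  (L.t a / 2 * x ^ 2 + L.s a * x + L.r a) - (L.t b / 2 * x ^ 2 + L.s b * x + L.r b)

/-- The `x`-coordinate of the intersection point `v_{ab}` of `L_a` and `L_b`, for `a ≠ b`. -/
def xv (a b : Fin N) : ℝ := (L.s b - L.s a) / (L.t a - L.t b)

/-- The intersection point `v_{ab}`, for `a ≠ b`. -/
def v (a b : Fin N) : ℝ × ℝ := (L.xv a b, L.t a * L.xv a b + L.s a)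

/-- The `x`-coordinates of all intersection points. -/
def Sall : Set ℝ := {x | ∃ a b, a ≠ b ∧ x = L.xv a b}

/-- The `x`-coordinates of the intersection points on `L_a`. -/
def S (a : Fin N) : Set ℝ := {x | ∃ b, b ≠ a ∧ x = L.xv a b}

/-- The function `e^{f_{ab}}`. -/
def expf (a b : Fin N) : StepSpace := ofFun fun x => Real.exp (L.f a b x)

/-- The function `e^{f_{ab} - f_{ab}(p)}`. -/
def expfAt (a b : Fin N) (p : ℝ) : StepSpace :=
  ofFun fun x => Real.exp (L.f a b x - L.f a b p)

/-- The morphism space `Ω'_{ab} = {e^{f_{ab}} · α ∈ A(Ω(ℝ)) ∣ α ∈ Ã(ℝ)}`, for the set of all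
intersection points.  The condition to lie in `A(Ω(ℝ))` is automatic in degree one. -/
def Omega (a b : Fin N) (r : ℤ) : Submodule ℝ StepSpace :=
  if r = 0 then
    (tildeA0 L.Sall).toSubmodule.map (LinearMap.mulLeft ℝ (L.expf a b)) ⊓ schwartzA0 L.Sall
  else if r = 1 then (A1 L.Sall).map (LinearMap.mulLeft ℝ (L.expf a b))
  else ⊥

/-- Degree `r` morphisms of the DG category of de Rham type. -/
abbrev OmegaHom (a b : Fin N) (r : ℤ) : Type := L.Omega a b r

theorem expf_mul_mul (a b c : Fin N) (α β : StepSpace) :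
    L.expf a c * (α * β) = (L.expf a b * α) * (L.expf b c * β) := by
  have : L.expf a c = L.expf a b * L.expf b c := by
    funext x
    simp only [expf, ofFun, Pi.mul_apply, ← Polynomial.C_mul, ← Real.exp_add]
    congr 2
    unfold f
    ring
  rw [this]
  ring

theorem gd_mem {a b : Fin N} {r r₁ : ℤ} (h : r₁ = r + 1) {u : StepSpace}
    (hu : u ∈ L.Omega a b r) : gd r u ∈ L.Omega a b r₁ := by
  unfold gd
  split_ifs with hr
  · subst hr
    subst h
    simp only [Omega, if_true] at hu
    obtain ⟨⟨α, hα, rfl⟩, -⟩ := hu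
    simp only [Omega, zero_add, one_ne_zero, if_false, if_true]
    exact ⟨d α, d_mem_A1 hα, (d_ofFun_mul _ _).symm⟩
  · exact Submodule.zero_mem _

theorem gmul_mem {a b c : Fin N} {r r' r₁ : ℤ} (h : r₁ = r + r') {u w : StepSpace}
    (hu : u ∈ L.Omega a b r) (hw : w ∈ L.Omega b c r') : gmul r r' u w ∈ L.Omega a c r₁ := by
  subst h
  unfold gmul
  split_ifs with h11
  · exact Submodule.zero_mem _
  by_cases hr : r = 0
  · subst hr
    by_cases hr' : r' = 0
    · subst hr'
      simp only [Omega, if_true, add_zero] at hu hw ⊢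
      refine ⟨?_, mul_mem_schwartzA0 hu.2 hw.2⟩
      obtain ⟨α, hα, rfl⟩ := hu.1
      obtain ⟨β, hβ, rfl⟩ := hw.1
      exact ⟨α * β, (tildeA0 L.Sall).mul_mem hα hβ, L.expf_mul_mul a b c α β⟩
    · by_cases hr1 : r' = 1
      · subst hr1
        simp only [Omega, if_true, zero_add, one_ne_zero, if_false] at hu hw ⊢
        obtain ⟨α, hα, rfl⟩ := hu.1
        obtain ⟨β, hβ, rfl⟩ := hw
        exact ⟨α * β, mul_mem_A1 hα hβ, L.expf_mul_mul a b c α β⟩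
      · simp only [Omega, if_neg hr', if_neg hr1, Submodule.mem_bot] at hw
        rw [hw, mul_zero]
        exact Submodule.zero_mem _
  · by_cases hr1 : r = 1
    · subst hr1
      by_cases hr' : r' = 0
      · subst hr'
        simp only [Omega, if_true, add_zero, one_ne_zero, if_false] at hu hw ⊢
        obtain ⟨α, hα, rfl⟩ := hu
        obtain ⟨β, hβ, rfl⟩ := hw.1
        refine ⟨α * β, ?_, L.expf_mul_mul a b c α β⟩
        rw [mul_comm]
        exact mul_mem_A1 hβ hα
      · have hr1 : r' ≠ 1 := fun h => h11 ⟨rfl, h⟩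
        simp only [Omega, if_neg hr', if_neg hr1, Submodule.mem_bot] at hw
        rw [hw, mul_zero]
        exact Submodule.zero_mem _
    · simp only [Omega, if_neg hr, if_neg hr1, Submodule.mem_bot] at hu
      rw [hu, zero_mul]
      exact Submodule.zero_mem _

/-- The underlying element of the operations of the DG category: `m₁ = d_{ab}`, `m₂` is the product
and `mₙ = 0` for `n ≥ 3`.  Here `d_{ab} = d - df_{ab} ∧ = e^{f_{ab}} d e^{-f_{ab}}`, so
`d_{ab}(e^{f_{ab}} α) = e^{f_{ab}} dα`, which is the derivative in the jump variable. -/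
def deRhamVal : ∀ {a b : Fin N}, HomPath L.OmegaHom a b → StepSpace
  | _, _, .nil _ => 0
  | _, _, .cons (r := r) w (.nil _) => gd r w
  | _, _, .cons (r := r) w (.cons (r := r') w' (.nil _)) => gmul r r' w w'
  | _, _, .cons _ (.cons _ (.cons _ _)) => 0

theorem deRhamVal_mem {a b : Fin N} (p : HomPath L.OmegaHom a b) :
    L.deRhamVal p ∈ L.Omega a b (p.sdeg + 2) := by
  match p with
  | .nil _ => exact Submodule.zero_mem _
  | .cons (r := r) w (.nil _) =>
      exact L.gd_mem (by simp only [HomPath.sdeg]; ring) w.2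
  | .cons (r := r) w (.cons (r := r') w' (.nil _)) =>
      exact L.gmul_mem (by simp only [HomPath.sdeg]; ring) w.2 w'.2
  | .cons _ (.cons _ (.cons _ _)) => exact Submodule.zero_mem _

/-- The DG category generated by `e^{f_{ab}}` times step functions and delta one-forms. -/
def deRham : AInftyData L.OmegaHom where
  m p := ⟨L.deRhamVal p, L.deRhamVal_mem p⟩

/-! ### The homotopies and the projections -/

/-- The homotopies: `h_{aa} = 0`, and for `a ≠ b`, on the elements `d(ϑ_v)ⁿ`, `n ≥ 1`,
`h_{ab}(d(ϑ_v)ⁿ) = e^{f_{ab} - f_{ab}(x(v))} ((ϑ_v)ⁿ - c)` if `t_a < t_b`, where `c` is `0`, `1/2ⁿ`,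
`1` for `x(v_{ab}) < x(v)`, `=`, `>` respectively, and
`h_{ab}(d(ϑ_v)ⁿ) = e^{f_{ab} - f_{ab}(x(v))} ((ϑ_v)ⁿ - ϑ_{v_{ab}})` if `t_a > t_b`. -/
structure IsHomotopy (h : ∀ a b r, L.OmegaHom a b r →ₗ[ℝ] L.OmegaHom a b (r - 1)) : Prop where
  diag : ∀ a r, h a a r = 0
  lt : ∀ a b, L.t a < L.t b → ∀ p ∈ L.Sall, ∀ n : ℕ, 1 ≤ n → ∀ ω : L.OmegaHom a b 1,
    (ω : StepSpace) = d (theta p ^ n) →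
    (h a b 1 ω : StepSpace) = L.expfAt a b p * (theta p ^ n -
      ofFun fun _ => if L.xv a b < p then 0 else if L.xv a b = p then 1 / 2 ^ n else 1)
  gt : ∀ a b, L.t b < L.t a → ∀ p ∈ L.Sall, ∀ n : ℕ, 1 ≤ n → ∀ ω : L.OmegaHom a b 1,
    (ω : StepSpace) = d (theta p ^ n) →
    (h a b 1 ω : StepSpace) = L.expfAt a b p * (theta p ^ n - theta (L.xv a b))

/-- The projections: `P_{aa} = Id`; for `t_a < t_b`, `P_{ab}` sends `e^{f_{ab}}` to itself and
`e^{f_{ab}} (ϑ_v)ⁿ` to `e^{f_{ab}}` times `1`, `1/2ⁿ`, `0` for `x(v) < x(v_{ab})`, `=`, `>`, and is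
zero in degree one; for `t_a > t_b`, `P_{ab}` sends `d(ϑ_v)ⁿ` to
`e^{f_{ab}(x(v_{ab})) - f_{ab}(x(v))} δ_{v_{ab}}` and is zero in degree zero. -/
structure IsProjection (P : ∀ a b r, L.OmegaHom a b r →ₗ[ℝ] L.OmegaHom a b r) : Prop where
  diag : ∀ a r, P a a r = LinearMap.id
  lt_unit : ∀ a b, L.t a < L.t b → ∀ u : L.OmegaHom a b 0,
    (u : StepSpace) = L.expf a b → P a b 0 u = u
  lt_theta : ∀ a b, L.t a < L.t b → ∀ p ∈ L.Sall, ∀ n : ℕ, 1 ≤ n → ∀ u : L.OmegaHom a b 0,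
    (u : StepSpace) = L.expf a b * theta p ^ n →
    (P a b 0 u : StepSpace) =
      (if p < L.xv a b then 1 else if p = L.xv a b then 1 / 2 ^ n else 0 : ℝ) • L.expf a b
  lt_one : ∀ a b, L.t a < L.t b → P a b 1 = 0
  gt_delta : ∀ a b, L.t b < L.t a → ∀ p ∈ L.Sall, ∀ n : ℕ, 1 ≤ n → ∀ ω : L.OmegaHom a b 1,
    (ω : StepSpace) = d (theta p ^ n) →
    (P a b 1 ω : StepSpace) =
      Real.exp (L.f a b (L.xv a b) - L.f a b p) • delta (L.xv a b)
  gt_zero : ∀ a b, L.t b < L.t a → P a b 0 = 0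

/-! ### The morphism spaces of the category of lines -/

/-- The base `e_{ab}` representing `[v_{ab}]`, `a ≠ b`: `e^{f_{ab} - f_{ab}(x(v_{ab}))}` if
`t_a < t_b`, and `δ_{v_{ab}}` if `t_a > t_b`. -/
def e (a b : Fin N) : StepSpace :=
  if L.t a < L.t b then L.expfAt a b (L.xv a b) else delta (L.xv a b)

/-- The degree of `[v_{ab}]`, `a ≠ b`. -/
def vdeg (a b : Fin N) : ℤ := if L.t a < L.t b then 0 else 1

/-- The graded space `V_{ab}`: for `a ≠ b` the line spanned by `[v_{ab}]` in degree `0` if `t_a < t_b`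
and in degree `1` if `t_a > t_b`; for `a = b` the algebra `A_{S_a}(ℝ)`. -/
def V (a b : Fin N) (r : ℤ) : Submodule ℝ StepSpace :=
  if a = b then (if r = 0 then A0 (L.S a) else if r = 1 then A1 (L.S a) else ⊥)
  else if r = L.vdeg a b then Submodule.span ℝ {L.e a b} else ⊥

/-- Degree `r` morphisms of the category of lines. -/
abbrev VHom (a b : Fin N) (r : ℤ) : Type := L.V a b r

/-- The base `[v_{ab}]` of `V_{ab}`, for `a ≠ b`. -/
def vElt (a b : Fin N) : L.VHom a b (L.vdeg a b) :=
  ⟨if a = b then 0 else L.e a b, by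
    by_cases h : a = b
    · rw [if_pos h]
      exact Submodule.zero_mem _
    · rw [if_neg h]
      simp only [V, if_neg h, if_true]
      exact Submodule.mem_span_singleton_self (L.e a b)⟩

/-! ### Polygons -/

/-- The last object of the sequence `a, a₂, …, a_{k+1}`. -/
def lastObj : Fin N → List (Fin N) → Fin N
  | a, [] => a
  | _, b :: l => lastObj b l

/-- The composable sequence `([v_{a₁a₂}], …, [v_{a_k a_{k+1}}])`. -/
def basePath : ∀ (a : Fin N) (l : List (Fin N)), HomPath L.VHom a (lastObj a l)
  | a, [] => HomPath.nil a
  | a, b :: l => HomPath.cons (L.vElt a b) (basePath b l)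

/-- The points `v_{a₁a₂}, …, v_{a_k a_{k+1}}` with the degrees of the `[v_{aᵢaᵢ₊₁}]`. -/
def edgePoints : Fin N → List (Fin N) → List ((ℝ × ℝ) × ℤ)
  | _, [] => []
  | a, b :: l => (L.v a b, L.vdeg a b) :: edgePoints b l

/-- The sequence of points with degrees of `a₁, …, a_{k+1}`; it includes `v_{a_{k+1}a₁}` if
`a₁ ≠ a_{k+1}`. -/
def polygon (a : Fin N) (l : List (Fin N)) : List ((ℝ × ℝ) × ℤ) :=
  if a = lastObj a l then L.edgePoints a l
  else L.edgePoints a l ++ [(L.v (lastObj a l) a, L.vdeg (lastObj a l) a)]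

end LineConfig

/-- For `p ≠ q ≠ r`: the polygonal path `p, q, r` turns right or goes straight on at `q`, that is,
the interior angle at `q` of a clockwise polygon is in `(0, π]`. -/
def TurnsRight (p q r : ℝ × ℝ) : Prop :=
  let c := (q.1 - p.1) * (r.2 - q.2) - (q.2 - p.2) * (r.1 - q.1)
  c < 0 ∨ (c = 0 ∧ 0 < (q.1 - p.1) * (r.1 - q.1) + (q.2 - p.2) * (r.2 - q.2))

open Classical in
/-- The cyclic sequence of points without consecutive repetitions: from
`(v₁, …, v₁, v₂, …, v₂, …, vₙ, …, vₙ)` one obtains `(v₁, …, vₙ)` if `v₁ ≠ vₙ` and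
`(v₁, …, vₙ₋₁)` if `v₁ = vₙ`. -/
def cyclicReduction (ps : List (ℝ × ℝ)) : List (ℝ × ℝ) :=
  let l := ps.destutter (· ≠ ·)
  if l.head? = l.getLast? then l.dropLast else l

/-- Clockwise convex polygons: `0 < Angle(v_{i-1} v_i v_{i+1}) ≤ π` for all `i`. -/
def IsCCPolygon (ps : List (ℝ × ℝ)) : Prop :=
  let c := cyclicReduction ps
  c ≠ [] ∧ ∀ i < c.length,
    TurnsRight (c.getD i 0) (c.getD ((i + 1) % c.length) 0) (c.getD ((i + 2) % c.length) 0)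

/-- Clockwise convex polygons with degrees attached: there are exactly two points of degree zero, the
`i`-th, at the left extremum of the `x`-coordinates, and the `j`-th, at the right extremum. -/
structure IsCCPolygonWith (vs : List ((ℝ × ℝ) × ℤ)) (i j : ℕ) : Prop where
  convex : IsCCPolygon (vs.map Prod.fst)
  hi : i < vs.length
  hj : j < vs.length
  ne : i ≠ j
  deg : ∀ k (hk : k < vs.length), vs[k].2 = if k = i ∨ k = j then 0 else 1
  left : ∀ k (hk : k < vs.length), vs[i].1.1 ≤ vs[k].1.1
  right : ∀ k (hk : k < vs.length), vs[k].1.1 ≤ vs[j].1.1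

/-- The sign `σ` of a clockwise convex polygon: `-1` if `i < j` and `+1` if `j < i`. -/
def ccSign (i j : ℕ) : ℝ := if i < j then -1 else 1

/-- The area enclosed by a polygon. -/
def polygonArea (ps : List (ℝ × ℝ)) : ℝ :=
  |(List.zipWith (fun p q : ℝ × ℝ => p.1 * q.2 - q.1 * p.2) ps (ps.rotate 1)).sum| / 2

namespace HomPath

/-- A sequence of endomorphisms of `a`. -/
def loops {Ob : Type} {H : Ob → Ob → ℤ → Type} {a : Ob} : List (Σ r : ℤ, H a a r) → HomPath H a a
  | [] => nil a
  | w :: l => cons w.2 (loops l)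

/-- A sequence of degree one endomorphisms of `a`. -/
def loops1 {Ob : Type} {H : Ob → Ob → ℤ → Type} {a : Ob} (l : List (H a a 1)) : HomPath H a a :=
  loops (l.map fun w => ⟨1, w⟩)

/-- The number of degree zero endomorphisms in a sequence. -/
def numTheta {Ob : Type} [DecidableEq Ob] {H : Ob → Ob → ℤ → Type} {a b : Ob} :
    HomPath H a b → ℕ
  | nil _ => 0
  | cons (a := a) (b := b) (r := r) _ p => (if a = b ∧ r = 0 then 1 else 0) + numTheta p

end HomPath

namespace LineConfig

open StepSpace HomPath

variable {N : ℕ} (L : LineConfig N)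

/-- The coefficient of the action of `(ϑ_v)ⁿ` on `[v_{ab}]` from either side: `1` or `0` if
`x(v) < x(v_{ab})` or `x(v) > x(v_{ab})`; for `v = v_{ab}` it is `1/2ⁿ` if `[v_{ab}]` has
degree zero and `1/(n+1)` if it has degree one. -/
def actCoeff (a b : Fin N) (p : ℝ) (n : ℕ) : ℝ :=
  if p < L.xv a b then 1 else if L.xv a b < p then 0
  else if L.t a < L.t b then 1 / 2 ^ n else 1 / (n + 1)

/-- `(1/(n+1)) ϑ_{v_{ab}} (1 - (ϑ_{v_{ab}})ⁿ)` if `v = v_{ab}`, and `0` otherwise. -/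
def tripleValue (a b : Fin N) (p : ℝ) (n : ℕ) : StepSpace :=
  if p = L.xv a b then (1 / ((n : ℝ) + 1)) • (theta p * (1 - theta p ^ n)) else 0

/-- `ϑ_v^{+1} = ϑ_v` and `ϑ_v^{-1} = 1 - ϑ_v`. -/
def thetaPM (ε : ℝ) (p : ℝ) : StepSpace := if ε = 1 then theta p else 1 - theta p

/-- The products `m_k` of the category of lines.  Formulas for `(ϑ_v)ⁿ` are stated on the
differences `(ϑ_v)ⁿ - (ϑ_{v'})^{n'}`, which span `V⁰_{aa}`. -/
structure IsLineProducts (C : AInftyData L.VHom) : Prop where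
  /-- `m₁` is the differential of `A_{S_a}(ℝ)` on `V_{aa}`. -/
  diff_self : ∀ a r (w : L.VHom a a r), (C.m (single w) : StepSpace) = gd r w
  /-- `m₁ = 0` on `V_{ab}`, `a ≠ b`. -/
  diff_ne : ∀ a b r (w : L.VHom a b r), a ≠ b → C.m (single w) = 0
  /-- `m₂` is the product of `A_{S_a}(ℝ)` on `V_{aa}`. -/
  mul_self : ∀ a r r' (w : L.VHom a a r) (w' : L.VHom a a r'),
    (C.m (cons w (single w')) : StepSpace) = gmul r r' w w'
  /-- There are no higher products on `V_{aa}`. -/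
  higher_self : ∀ a (l : List (Σ r : ℤ, L.VHom a a r)), 3 ≤ l.length → C.m (loops l) = 0
  /-- Higher products with at least two degree zero endomorphisms vanish. -/
  two_theta : ∀ a b (p : HomPath L.VHom a b), 2 ≤ p.numTheta → 3 ≤ p.length → C.m p = 0
  /-- Products `δ, …, δ, ϑ, δ, …, δ, [v_{ab}], δ, …, δ` that vanish. -/
  typeA_zero : ∀ a b, a ≠ b → ∀ (l₁ l₂ : List (L.VHom a a 1)) (l₃ : List (L.VHom b b 1))
    (w : L.VHom a a 0), (L.t a < L.t b ∧ l₁ ≠ [] ∨ L.t b < L.t a ∧ l₂ ≠ []) →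
    C.m ((loops1 l₁).append (cons w ((loops1 l₂).append (cons (L.vElt a b) (loops1 l₃))))) = 0
  /-- Products `δ, …, δ, [v_{ab}], δ, …, δ, ϑ, δ, …, δ` that vanish. -/
  typeB_zero : ∀ a b, a ≠ b → ∀ (l₁ : List (L.VHom a a 1)) (l₂ l₃ : List (L.VHom b b 1))
    (w : L.VHom b b 0), (L.t a < L.t b ∧ l₃ ≠ [] ∨ L.t b < L.t a ∧ l₂ ≠ []) →
    C.m ((loops1 l₁).append (cons (L.vElt a b) ((loops1 l₂).append (cons w (loops1 l₃))))) = 0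
  /-- Products `δ, …, [v_{ab}], δ, …, ϑ, δ, …, [v_{ba}], δ, …` that vanish. -/
  typeC₁_zero : ∀ a b, a ≠ b → ∀ (l₁ l₄ : List (L.VHom a a 1)) (l₂ l₃ : List (L.VHom b b 1))
    (w : L.VHom b b 0), (L.t a < L.t b ∧ l₃ ≠ [] ∨ L.t b < L.t a ∧ l₂ ≠ []) →
    C.m ((loops1 l₁).append (cons (L.vElt a b) ((loops1 l₂).append (cons w
      ((loops1 l₃).append (cons (L.vElt b a) (loops1 l₄))))))) = 0
  /-- Products `δ, …, ϑ, δ, …, [v_{ab}], δ, …, [v_{ba}], δ, …` that vanish, `t_a > t_b`. -/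
  typeC₂_zero : ∀ a b, L.t b < L.t a → ∀ (l₁ l₂ l₄ : List (L.VHom a a 1))
    (l₃ : List (L.VHom b b 1)) (w : L.VHom a a 0), l₂ ≠ [] →
    C.m ((loops1 l₁).append (cons w ((loops1 l₂).append (cons (L.vElt a b)
      ((loops1 l₃).append (cons (L.vElt b a) (loops1 l₄))))))) = 0
  /-- Products `δ, …, [v_{ab}], δ, …, [v_{ba}], δ, …, ϑ, δ, …` that vanish, `t_a < t_b`. -/
  typeC₃_zero : ∀ a b, L.t a < L.t b → ∀ (l₁ l₃ l₄ : List (L.VHom a a 1))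
    (l₂ : List (L.VHom b b 1)) (w : L.VHom a a 0), l₃ ≠ [] →
    C.m ((loops1 l₁).append (cons (L.vElt a b) ((loops1 l₂).append (cons (L.vElt b a)
      ((loops1 l₃).append (cons w (loops1 l₄))))))) = 0
  /-- The left action of `V⁰_{aa}` on `[v_{ab}]`. -/
  act_left : ∀ a b, a ≠ b → ∀ p ∈ L.S a, ∀ q ∈ L.S a, ∀ n n' : ℕ, 1 ≤ n → 1 ≤ n' →
    ∀ w : L.VHom a a 0, (w : StepSpace) = theta p ^ n - theta q ^ n' →
    (C.m (cons w (single (L.vElt a b))) : StepSpace)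
      = (L.actCoeff a b p n - L.actCoeff a b q n') • L.e a b
  /-- The right action of `V⁰_{bb}` on `[v_{ab}]`. -/
  act_right : ∀ a b, a ≠ b → ∀ p ∈ L.S b, ∀ q ∈ L.S b, ∀ n n' : ℕ, 1 ≤ n → 1 ≤ n' →
    ∀ w : L.VHom b b 0, (w : StepSpace) = theta p ^ n - theta q ^ n' →
    (C.m (cons (L.vElt a b) (single w)) : StepSpace)
      = (L.actCoeff a b p n - L.actCoeff a b q n') • L.e a b
  /-- `m₃([v_{ba}], ϑ, [v_{ab}])`, `t_a < t_b`. -/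
  triple₁ : ∀ a b, L.t a < L.t b → ∀ p ∈ L.S a, ∀ q ∈ L.S a, ∀ n n' : ℕ, 1 ≤ n → 1 ≤ n' →
    ∀ w : L.VHom a a 0, (w : StepSpace) = theta p ^ n - theta q ^ n' →
    (C.m (cons (L.vElt b a) (cons w (single (L.vElt a b)))) : StepSpace)
      = L.tripleValue a b p n - L.tripleValue a b q n'
  /-- `m₃(ϑ, [v_{ba}], [v_{ab}])`, `t_a < t_b`. -/
  triple₂ : ∀ a b, L.t a < L.t b → ∀ p ∈ L.S b, ∀ q ∈ L.S b, ∀ n n' : ℕ, 1 ≤ n → 1 ≤ n' →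
    ∀ w : L.VHom b b 0, (w : StepSpace) = theta p ^ n - theta q ^ n' →
    (C.m (cons w (cons (L.vElt b a) (single (L.vElt a b)))) : StepSpace)
      = L.tripleValue a b p n - L.tripleValue a b q n'
  /-- `m₃([v_{ab}], ϑ, [v_{ba}])`, `t_a < t_b`. -/
  triple₃ : ∀ a b, L.t a < L.t b → ∀ p ∈ L.S b, ∀ q ∈ L.S b, ∀ n n' : ℕ, 1 ≤ n → 1 ≤ n' →
    ∀ w : L.VHom b b 0, (w : StepSpace) = theta p ^ n - theta q ^ n' →
    (C.m (cons (L.vElt a b) (cons w (single (L.vElt b a)))) : StepSpace)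
      = -(L.tripleValue a b p n - L.tripleValue a b q n')
  /-- `m₃([v_{ab}], [v_{ba}], ϑ)`, `t_a < t_b`. -/
  triple₄ : ∀ a b, L.t a < L.t b → ∀ p ∈ L.S a, ∀ q ∈ L.S a, ∀ n n' : ℕ, 1 ≤ n → 1 ≤ n' →
    ∀ w : L.VHom a a 0, (w : StepSpace) = theta p ^ n - theta q ^ n' →
    (C.m (cons (L.vElt a b) (cons (L.vElt b a) (single w))) : StepSpace)
      = -(L.tripleValue a b p n - L.tripleValue a b q n')
  /-- `m_k([v_{a₁a₂}], …, [v_{a_k a_{k+1}}]) = σ^k e^{-Area} [v_{a₁a_{k+1}}]`, `a₁ ≠ a_{k+1}`, if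
  the points form a clockwise convex polygon. -/
  polygon_open : ∀ (a : Fin N) (l : List (Fin N)), 2 ≤ l.length → (a :: l).IsChain (· ≠ ·) →
    a ≠ lastObj a l → ∀ i j, IsCCPolygonWith (L.polygon a l) i j →
    (C.m (L.basePath a l) : StepSpace)
      = (ccSign i j ^ l.length * Real.exp (-polygonArea ((L.polygon a l).map Prod.fst)))
          • L.e a (lastObj a l)
  /-- For `a₁ = a_{k+1} = a`, if the points form a clockwise convex polygon,
  `m_k([v_{aa₂}], …, [v_{a_k a}]) = σ^k e^{-Area} ϑ_{v_{aa₂}}^{-σ} ϑ_{v_{a_k a}}^{σ}`. -/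
  polygon_closed : ∀ (a : Fin N) (l : List (Fin N)), 2 ≤ l.length → (a :: l).IsChain (· ≠ ·) →
    a = lastObj a l → ∀ i j, IsCCPolygonWith (L.polygon a l) i j →
    (C.m (L.basePath a l) : StepSpace)
      = (ccSign i j ^ l.length * Real.exp (-polygonArea ((L.polygon a l).map Prod.fst)))
          • (thetaPM (-ccSign i j) (L.polygon a l).headI.1.1
              * thetaPM (ccSign i j) (L.polygon a l).getLastI.1.1)
  /-- `m₂([v_{ab}], [v_{ba}]) = δ_{v_{ab}}`. -/
  point : ∀ a b, a ≠ b →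
    (C.m (cons (L.vElt a b) (single (L.vElt b a))) : StepSpace) = delta (L.xv a b)
  /-- All other products of the `[v_{ab}]` vanish. -/
  polygon_zero : ∀ (a : Fin N) (l : List (Fin N)), 2 ≤ l.length → (a :: l).IsChain (· ≠ ·) →
    (¬ ∃ i j, IsCCPolygonWith (L.polygon a l) i j) →
    ¬ (l.length = 2 ∧ a = lastObj a l) → C.m (L.basePath a l) = 0

end LineConfig

end

/-! ## The algebra of step functions -/

namespace StepSpace

open Polynomial

/-! All computations take place in a space where the forms are explicit. A step function assigns to
each real x a polynomial in a jump variable running from 0 to 1, and a delta form assigns to each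
jump a polynomial density. The differential is then polynomial differentiation jump by jump, a
primitive is a sum of antiderivatives (`prim`), and its value far to the right is the integral
(`total`). Conjugation by e^{f_ab} turns d_ab into d. The homotopy h_ab becomes `prim` corrected by
a constant if t_a < t_b, namely the value of the primitive at v_ab with jump variable 1/2, and by a
multiple of ϑ_{v_ab} if t_a > t_b, so that the result vanishes at both ends. The Schwartz condition
is analysed in `exists_of_mem_Omega_zero`: a decaying Gaussian makes it vacuous, and for t_a ≥ t_b
it forces the step function to vanish at both ends. The contraction is `homotopyOp_d` together with
`d_homotopyOp`.

Homological perturbation is done on words of untyped letters. With g the perturbed inclusion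
(`incl`), T the signed sum of products g·g over all cuts of a word (`tree`), and D the insertion of
transferred products (`insertProd`), the recursion is g = -hT. Since D is a coderivation
(`insertProd_tree`) and the product of forms is associative (`tree_assoc`), dT = -DT. Together with
dh + hd = 1 - P this gives the functor relation (`incl_relation_and_prod_mem`) and the A∞-relations
(`insertProd_prod`). One point is not formal: P_aa is the identity on a space larger than V_aa, so
products from a to a must be shown to be supported on L_a. Their one-form part involves only the
first or the last letter of the word (`tree_snd_mem`), and in degree zero the same is applied to dT.
The homotopy equivalence comes from the contraction off the diagonal and from integration on the
diagonal, where N ≥ 2 puts a point on each line.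

The vanishing statements rest on two facts: on words of at least two letters g is zero if the word
is closed, because h_aa = 0, and zero unless the suspended degree is -1, because h takes values in
degree zero.

For words of base elements, degree reasons leave those with one or two letters of degree zero, that
is, ascents of the slope. With one ascent, at m, only the first or the last letter can be split off.
If the points x_t move away from x_m in one direction ε on both sides, T has the form Φ dΘ up to
constants and e^{f}, where Θ is the product of the steps at the outer points and Φ is the step
function telling on which side of the first line the last one lies; integration by parts gives h(Φ
dΘ) = ΘΦ (`stepHomotopy_sideStep_mul`). Otherwise g is zero. This is `inclFormula`. With two ascents
m < n the word is cut between them into two such words of opposite directions, and the contributions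
of the cuts telescope (`sum_joinStep`). Conversely, a nonvanishing contribution forces the x_t to be
cyclically monotone between the two extrema (`exists_joined`).

Such sequences (`IsConvexSeq`) are the clockwise convex polygons: along a monotone stretch the
slopes decrease, at an extremum they increase, and both are right turns. In the other direction a
polygon of the theorem cannot repeat a point (`Extremal.isRunEnd`), so its turns are strict and
propagate the direction from one extremum to the other. The exponent, the sum of the f_{o_t
o_{t+1}}(x_t), is the enclosed area by the shoelace formula (`IsConvexSeq.polygonArea_eq`). -/

/-- The antiderivative of a polynomial without constant term. -/
noncomputable def integ : ℝ[X] →ₗ[ℝ] ℝ[X] :=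
  lsum fun n => monomial (n + 1) ∘ₗ LinearMap.mulLeft ℝ (1 / ((n : ℝ) + 1))

theorem integ_monomial (n : ℕ) (c : ℝ) :
    integ (monomial n c) = monomial (n + 1) (1 / ((n : ℝ) + 1) * c) := by
  simp [integ, lsum_apply, sum_monomial_index]

theorem derivative_integ (q : ℝ[X]) : derivative (integ q) = q := by
  induction q using Polynomial.induction_on' with
  | add p q hp hq => rw [map_add, map_add, hp, hq]
  | monomial n c =>
    rw [integ_monomial, derivative_monomial]
    have : (n : ℝ) + 1 ≠ 0 := by positivity
    congr 1
    push_cast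
    field_simp

theorem eval_zero_integ (q : ℝ[X]) : (integ q).eval 0 = 0 := by
  induction q using Polynomial.induction_on' with
  | add p q hp hq => rw [map_add, eval_add, hp, hq, add_zero]
  | monomial n c => simp [integ_monomial]

theorem integ_derivative (q : ℝ[X]) : integ (derivative q) = q - C (q.eval 0) := by
  induction q using Polynomial.induction_on' with
  | add p q hp hq => rw [map_add, map_add, hp, hq, eval_add, C_add]; ring
  | monomial n c =>
    rw [derivative_monomial, integ_monomial]
    rcases n with _ | n
    · simp
    · have : (n : ℝ) + 1 ≠ 0 := by positivity
      simp only [Nat.add_sub_cancel, eval_monomial, ne_eq, Nat.add_eq_zero_iff, one_ne_zero,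
        and_false, not_false_eq_true, zero_pow, mul_zero, C_0, sub_zero]
      congr 1
      push_cast
      field_simp

theorem integ_C (c : ℝ) : integ (C c) = C c * X := by
  rw [← monomial_zero_left, integ_monomial]
  simp [C_mul_X_eq_monomial]

theorem integ_one : integ 1 = X := by
  simpa using integ_C 1

theorem aeval_theta_apply (p x : ℝ) (q : ℝ[X]) :
    (aeval (theta p) q : StepSpace) x =
      if x < p then C (q.eval 0) else if x = p then q else C (q.eval 1) := by
  have h : (aeval (theta p) q : StepSpace) x = aeval (theta p x) q :=
    (aeval_algHom_apply (Pi.evalAlgHom ℝ (fun _ : ℝ => ℝ[X]) x) (theta p) q).symm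
  rw [h]
  unfold theta
  split_ifs
  · rw [show (0 : ℝ[X]) = C 0 by simp, ← algebraMap_eq, aeval_algebraMap_apply]; simp
  · simp
  · rw [show (1 : ℝ[X]) = C 1 by simp, ← algebraMap_eq, aeval_algebraMap_apply]; simp

theorem theta_apply_of_lt {p x : ℝ} (h : x < p) : theta p x = 0 := if_pos h

theorem theta_apply_self (p : ℝ) : theta p p = X := by simp [theta]

theorem theta_apply_of_gt {p x : ℝ} (h : p < x) : theta p x = 1 := by
  simp [theta, h.not_gt, h.ne']

theorem delta_apply_of_ne {p x : ℝ} (h : x ≠ p) : delta p x = 0 := if_neg h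

theorem delta_apply_self (p : ℝ) : delta p p = 1 := if_pos rfl

theorem d_apply (u : StepSpace) (x : ℝ) : d u x = derivative (u x) := rfl

theorem d_aeval_theta (p : ℝ) (q : ℝ[X]) :
    d (aeval (theta p) q) = aeval (theta p) (derivative q) * delta p := by
  funext x
  rw [d_apply, aeval_theta_apply, Pi.mul_apply, aeval_theta_apply]
  rcases lt_trichotomy x p with h | h | h
  · simp [h, delta_apply_of_ne h.ne]
  · simp [h, delta_apply_self]
  · simp [h.not_gt, h.ne', delta_apply_of_ne h.ne']

theorem d_algebraMap (c : ℝ) : d (algebraMap ℝ StepSpace c) = 0 := by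
  funext x
  simp [d_apply]

/-- The primitive, vanishing at `-∞`, of a one-form supported on `S`. -/
noncomputable def prim (S : Finset ℝ) : StepSpace →ₗ[ℝ] StepSpace :=
  ∑ p ∈ S, (aeval (theta p)).toLinearMap ∘ₗ integ ∘ₗ LinearMap.proj p

/-- The integral of a one-form supported on `S`. -/
noncomputable def total (S : Finset ℝ) : StepSpace →ₗ[ℝ] ℝ :=
  ∑ p ∈ S, leval 1 ∘ₗ integ ∘ₗ LinearMap.proj p

theorem prim_apply (S : Finset ℝ) (w : StepSpace) :
    prim S w = ∑ p ∈ S, aeval (theta p) (integ (w p)) := by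
  simp [prim, LinearMap.sum_apply]

theorem total_apply (S : Finset ℝ) (w : StepSpace) :
    total S w = ∑ p ∈ S, (integ (w p)).eval 1 := by
  simp [total, LinearMap.sum_apply]

theorem prim_single {S : Finset ℝ} {p : ℝ} (hp : p ∈ S) {w : StepSpace}
    (hw : ∀ x, x ≠ p → w x = 0) : prim S w = aeval (theta p) (integ (w p)) := by
  rw [prim_apply]
  refine Finset.sum_eq_single p (fun x _ hx => ?_) (fun h => absurd hp h)
  rw [hw x hx]; simp

theorem total_single {S : Finset ℝ} {p : ℝ} (hp : p ∈ S) {w : StepSpace}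
    (hw : ∀ x, x ≠ p → w x = 0) : total S w = (integ (w p)).eval 1 := by
  rw [total_apply]
  refine Finset.sum_eq_single p (fun x _ hx => ?_) (fun h => absurd hp h)
  rw [hw x hx]; simp

theorem prim_d_aeval_theta {S : Finset ℝ} {p : ℝ} (hp : p ∈ S) (q : ℝ[X]) :
    prim S (d (aeval (theta p) q)) = aeval (theta p) q - algebraMap ℝ StepSpace (q.eval 0) := by
  rw [d_aeval_theta, prim_single hp fun x hx => by
    rw [Pi.mul_apply, delta_apply_of_ne hx, mul_zero]]
  rw [Pi.mul_apply, delta_apply_self, aeval_theta_apply]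
  simp only [lt_irrefl, if_false, if_true, mul_one]
  rw [integ_derivative, map_sub, aeval_C]

theorem total_d_aeval_theta {S : Finset ℝ} {p : ℝ} (hp : p ∈ S) (q : ℝ[X]) :
    total S (d (aeval (theta p) q)) = q.eval 1 - q.eval 0 := by
  rw [d_aeval_theta, total_single hp fun x hx => by
    rw [Pi.mul_apply, delta_apply_of_ne hx, mul_zero]]
  rw [Pi.mul_apply, delta_apply_self, aeval_theta_apply]
  simp only [lt_irrefl, if_false, if_true, mul_one]
  rw [integ_derivative]
  simp

theorem theta_pow_eq_aeval (p : ℝ) (n : ℕ) : theta p ^ n = aeval (theta p) (X ^ n : ℝ[X]) := by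
  simp

theorem aeval_theta_mem {S : Set ℝ} {p : ℝ} (hp : p ∈ S) (q : ℝ[X]) :
    aeval (theta p) q ∈ tildeA0 S := by
  have h := aeval_mem_adjoin_singleton ℝ (p := q) (theta p)
  have hs : ({theta p} : Set StepSpace) ⊆ theta '' S :=
    Set.singleton_subset_iff.mpr (Set.mem_image_of_mem _ hp)
  exact Algebra.adjoin_mono hs h

theorem theta_mem {S : Set ℝ} {p : ℝ} (hp : p ∈ S) : theta p ∈ tildeA0 S :=
  Algebra.subset_adjoin ⟨p, hp, rfl⟩

theorem prim_mem {S : Finset ℝ} (w : StepSpace) : prim S w ∈ tildeA0 (S : Set ℝ) := by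
  rw [prim_apply]
  exact sum_mem fun p hp => aeval_theta_mem hp _

theorem theta_mul_theta {p q : ℝ} (h : p < q) : theta p * theta q = theta q := by
  funext x
  rw [Pi.mul_apply]
  rcases lt_trichotomy x q with hx | hx | hx
  · simp [theta_apply_of_lt hx]
  · rw [theta_apply_of_gt (hx ▸ h), one_mul]
  · rw [theta_apply_of_gt (h.trans hx), one_mul]

theorem theta_pow_mul_theta {p q : ℝ} (h : p < q) (m : ℕ) :
    theta p ^ m * theta q = theta q := by
  induction m with
  | zero => rw [pow_zero, one_mul]
  | succ m ih => rw [pow_succ, mul_assoc, theta_mul_theta h, ih]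

theorem theta_pow_mul_theta_pow {p q : ℝ} (h : p < q) (m : ℕ) {n : ℕ} (hn : 1 ≤ n) :
    theta p ^ m * theta q ^ n = theta q ^ n := by
  obtain ⟨n, rfl⟩ := Nat.exists_eq_add_of_le' hn
  rw [pow_succ', ← mul_assoc, theta_pow_mul_theta h]

/-- Of two powers at different jumps the later one absorbs the earlier, so the listed elements are
already closed under multiplication. -/
theorem tildeA0_eq_span (S : Set ℝ) :
    Subalgebra.toSubmodule (tildeA0 S) =
      Submodule.span ℝ ({1} ∪ {u | ∃ p ∈ S, ∃ n : ℕ, 1 ≤ n ∧ u = theta p ^ n}) := by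
  apply le_antisymm
  · rw [tildeA0, Algebra.adjoin_eq_span]
    refine Submodule.span_mono fun u hu => ?_
    induction hu using Submonoid.closure_induction with
    | mem x hx =>
      obtain ⟨p, hp, rfl⟩ := hx
      exact Or.inr ⟨p, hp, 1, le_rfl, (pow_one _).symm⟩
    | one => exact Or.inl rfl
    | mul x y _ _ hx hy =>
      rcases hx with hx | ⟨p, hp, m, hm, rfl⟩
      · rw [Set.mem_singleton_iff.mp hx, one_mul]; exact hy
      rcases hy with hy | ⟨q, hq, n, hn, rfl⟩
      · rw [Set.mem_singleton_iff.mp hy, mul_one]; exact Or.inr ⟨p, hp, m, hm, rfl⟩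
      right
      rcases lt_trichotomy p q with h | h | h
      · exact ⟨q, hq, n, hn, theta_pow_mul_theta_pow h m hn⟩
      · exact ⟨p, hp, m + n, by omega, by rw [h, pow_add]⟩
      · exact ⟨p, hp, m, hm, by rw [mul_comm, theta_pow_mul_theta_pow h n hm]⟩
  · rw [Submodule.span_le]
    rintro u (hu | ⟨p, hp, n, -, rfl⟩)
    · rw [Set.mem_singleton_iff.mp hu]; exact (tildeA0 S).one_mem
    · exact (tildeA0 S).pow_mem (theta_mem hp) n

/-- A step function is recovered from its value at `-∞` and its differential. -/
theorem exists_eq_add_prim {S : Finset ℝ} {u : StepSpace} (hu : u ∈ tildeA0 (S : Set ℝ)) :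
    ∃ c : ℝ, u = algebraMap ℝ StepSpace c + prim S (d u) := by
  have hu' : u ∈ Subalgebra.toSubmodule (tildeA0 (S : Set ℝ)) := hu
  rw [tildeA0_eq_span] at hu'
  induction hu' using Submodule.span_induction with
  | mem x hx =>
    rcases hx with hx | ⟨p, hp, n, hn, rfl⟩
    · refine ⟨1, ?_⟩
      rw [Set.mem_singleton_iff.mp hx, ← map_one (algebraMap ℝ StepSpace), d_algebraMap]
      simp
    · refine ⟨0, ?_⟩
      rw [theta_pow_eq_aeval, prim_d_aeval_theta hp]
      have : n ≠ 0 := by omega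
      simp [this]
  | zero => exact ⟨0, by simp⟩
  | add x y hx' hy' hx hy =>
    rw [← tildeA0_eq_span] at hx' hy'
    obtain ⟨c, hc⟩ := hx hx'
    obtain ⟨c', hc'⟩ := hy hy'
    refine ⟨c + c', ?_⟩
    rw [map_add, map_add, map_add]
    conv_lhs => rw [hc, hc']
    ring
  | smul k x hx' hx =>
    rw [← tildeA0_eq_span] at hx'
    obtain ⟨c, hc⟩ := hx hx'
    refine ⟨k * c, ?_⟩
    rw [map_smul, map_smul, map_mul]
    conv_lhs => rw [hc]
    rw [smul_add, ← Algebra.smul_def]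

/-- The step function obtained by substituting ϑ_p into a polynomial q has the value q at p, so
every polynomial occurs as the coefficient of δ_p, independently of the other jumps. -/
theorem mem_A1_iff {S : Finset ℝ} {w : StepSpace} :
    w ∈ A1 (S : Set ℝ) ↔ ∀ x, x ∉ S → w x = 0 := by
  constructor
  · intro hw x hx
    change w ∈ Submodule.span (tildeA0 (S : Set ℝ)) (delta '' S) at hw
    induction hw using Submodule.span_induction with
    | mem w hw =>
      obtain ⟨p, hp, rfl⟩ := hw
      exact delta_apply_of_ne fun h => hx (h ▸ hp)
    | zero => rfl
    | add u v _ _ hu hv => rw [Pi.add_apply, hu, hv, add_zero]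
    | smul a u _ hu =>
      change ((a : StepSpace) * u) x = 0
      rw [Pi.mul_apply, hu, mul_zero]
  · intro hw
    have : w = ∑ p ∈ S, aeval (theta p) (w p) * delta p := by
      funext x
      rw [Finset.sum_apply]
      by_cases hx : x ∈ S
      · rw [Finset.sum_eq_single x]
        · simp [delta_apply_self, aeval_theta_apply]
        · intro p _ hp
          rw [Pi.mul_apply, delta_apply_of_ne hp.symm, mul_zero]
        · exact fun h => absurd hx h
      · rw [hw x hx, Finset.sum_eq_zero]
        intro p hp
        have : x ≠ p := fun h => hx (h ▸ hp)
        rw [Pi.mul_apply, delta_apply_of_ne this, mul_zero]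
    rw [this]
    refine Submodule.sum_mem _ fun p hp => mul_mem_A1 (aeval_theta_mem hp _) ?_
    exact Submodule.subset_span ⟨p, hp, rfl⟩

theorem delta_mem_A1 {S : Set ℝ} {p : ℝ} (hp : p ∈ S) : delta p ∈ A1 S :=
  Submodule.subset_span ⟨p, hp, rfl⟩

theorem d_prim {S : Finset ℝ} {w : StepSpace} (hw : w ∈ A1 (S : Set ℝ)) : d (prim S w) = w := by
  rw [mem_A1_iff] at hw
  funext x
  rw [prim_apply, map_sum, Finset.sum_apply]
  simp only [d_aeval_theta, derivative_integ, Pi.mul_apply]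
  by_cases hx : x ∈ S
  · rw [Finset.sum_eq_single x]
    · simp [delta_apply_self, aeval_theta_apply]
    · intro p _ hp
      rw [delta_apply_of_ne hp.symm, mul_zero]
    · exact fun h => absurd hx h
  · rw [hw x hx, Finset.sum_eq_zero]
    intro p hp
    have : x ≠ p := fun h => hx (h ▸ hp)
    rw [delta_apply_of_ne this, mul_zero]

theorem prim_apply_of_lt {S : Finset ℝ} (w : StepSpace) {x : ℝ} (hx : ∀ p ∈ S, x < p) :
    prim S w x = 0 := by
  rw [prim_apply, Finset.sum_apply]
  refine Finset.sum_eq_zero fun p hp => ?_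
  rw [aeval_theta_apply, if_pos (hx p hp), eval_zero_integ, C_0]

theorem prim_apply_of_gt {S : Finset ℝ} (w : StepSpace) {x : ℝ} (hx : ∀ p ∈ S, p < x) :
    prim S w x = C (total S w) := by
  rw [prim_apply, Finset.sum_apply, total_apply, map_sum]
  refine Finset.sum_congr rfl fun p hp => ?_
  rw [aeval_theta_apply, if_neg (hx p hp).not_gt, if_neg (hx p hp).ne']

theorem theta_sub_theta_mem_A0 {S : Set ℝ} {p q : ℝ} (hp : p ∈ S) (hq : q ∈ S) {m n : ℕ}
    (hm : 1 ≤ m) (hn : 1 ≤ n) : theta p ^ m - theta q ^ n ∈ A0 S :=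
  Submodule.subset_span ⟨p, hp, q, hq, m, n, hm, hn, rfl⟩

theorem A0_le_tildeA0 {S : Set ℝ} {u : StepSpace} (hu : u ∈ A0 S) : u ∈ tildeA0 S := by
  have : A0 S ≤ Subalgebra.toSubmodule (tildeA0 S) := by
    rw [A0, Submodule.span_le]
    rintro _ ⟨p, hp, q, hq, m, n, -, -, rfl⟩
    exact (tildeA0 S).sub_mem ((tildeA0 S).pow_mem (theta_mem hp) m)
      ((tildeA0 S).pow_mem (theta_mem hq) n)
  exact this hu

/-- Every positive power of ϑ_p may be traded for ϑ_{p₀} modulo A⁰, which leaves the sum of the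
coefficients, the value at 1. Inside the proof the constant term is split off, so that induction
over monomials applies. -/
theorem aeval_theta_sub_mem_A0 {S : Set ℝ} {p p₀ : ℝ} (hp : p ∈ S) (hp₀ : p₀ ∈ S) (q : ℝ[X])
    (hq : q.eval 0 = 0) : aeval (theta p) q - q.eval 1 • theta p₀ ∈ A0 S := by
  have key : ∀ r : ℝ[X], aeval (theta p) r - (r.eval 1 - r.eval 0) • theta p₀
      - algebraMap ℝ StepSpace (r.eval 0) ∈ A0 S := by
    intro r
    induction r using Polynomial.induction_on' with
    | add r s hr hs =>
      convert Submodule.add_mem _ hr hs using 1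
      simp only [map_add, eval_add, sub_smul, add_smul]
      ring
    | monomial n c =>
      rcases n with _ | n
      · have : aeval (theta p) (monomial 0 c) = algebraMap ℝ StepSpace c := by
          rw [monomial_zero_left, aeval_C]
        rw [this]
        simp
      · have : aeval (theta p) (monomial (n + 1) c) = c • theta p ^ (n + 1) := by
          rw [aeval_monomial, Algebra.smul_def]
        rw [this]
        simp only [eval_monomial, one_pow, mul_one, ne_eq, Nat.add_eq_zero_iff, one_ne_zero,
          and_false, not_false_eq_true, zero_pow, mul_zero, sub_zero, map_zero, ← smul_sub]
        have := theta_sub_theta_mem_A0 hp hp₀ (Nat.le_add_left 1 n) le_rfl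
        rw [pow_one] at this
        exact Submodule.smul_mem _ c this
  simpa [hq] using key q

/-- The step functions in `A⁰_S` are those vanishing at both ends. -/
theorem prim_mem_A0 {S T : Finset ℝ} (hTS : T ⊆ S) {w : StepSpace} (hw : w ∈ A1 (T : Set ℝ))
    (h0 : total S w = 0) : prim S w ∈ A0 (T : Set ℝ) := by
  rw [mem_A1_iff] at hw
  have hp : prim S w = prim T w := by
    rw [prim_apply, prim_apply]
    refine (Finset.sum_subset hTS fun x _ hx => ?_).symm
    rw [hw x hx]; simp
  have ht : total S w = total T w := by
    rw [total_apply, total_apply]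
    refine (Finset.sum_subset hTS fun x _ hx => ?_).symm
    rw [hw x hx]; simp
  rw [hp]
  rw [ht] at h0
  rcases T.eq_empty_or_nonempty with rfl | ⟨p₀, hp₀⟩
  · rw [prim_apply]; simp
  -- The integrals at the individual jumps add up to zero, so subtracting them as multiples of one
  -- fixed step changes nothing and puts each summand into `A0`.
  · have : prim T w = ∑ p ∈ T, (aeval (theta p) (integ (w p))
        - (integ (w p)).eval 1 • theta p₀) := by
      rw [Finset.sum_sub_distrib, ← Finset.sum_smul, ← total_apply, h0, zero_smul, sub_zero,
        prim_apply]
    rw [this]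
    exact Submodule.sum_mem _ fun p hp => aeval_theta_sub_mem_A0 hp hp₀ _ (eval_zero_integ _)

end StepSpace

/-! ## Schwartz functions -/

section Gaussian

open Polynomial

theorem exists_exp_quadratic_le {a : ℝ} (ha : a < 0) (b c : ℝ) :
    ∃ B, ∀ x : ℝ, Real.exp (a * x ^ 2 + b * x + c) ≤ B := by
  refine ⟨Real.exp (c - b ^ 2 / (4 * a)), fun x => Real.exp_le_exp.mpr ?_⟩
  have h : c - b ^ 2 / (4 * a) - (a * x ^ 2 + b * x + c) = -a * (x + b / (2 * a)) ^ 2 := by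
    have := ha.ne
    field_simp
    ring
  have : 0 ≤ -a * (x + b / (2 * a)) ^ 2 := mul_nonneg (by linarith) (sq_nonneg _)
  linarith

/-- The power is dominated by a multiple of e^{|x|} ≤ e^x + e^{-x}, and these factors only shift the
linear coefficient of the exponent by ±1. -/
theorem exists_pow_mul_exp_quadratic_le {a : ℝ} (ha : a < 0) (b c : ℝ) (n : ℕ) :
    ∃ B, ∀ x : ℝ, |x| ^ n * Real.exp (a * x ^ 2 + b * x + c) ≤ B := by
  obtain ⟨B₁, h₁⟩ := exists_exp_quadratic_le ha (b + 1) c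
  obtain ⟨B₂, h₂⟩ := exists_exp_quadratic_le ha (b - 1) c
  refine ⟨n.factorial * (B₁ + B₂), fun x => ?_⟩
  have hf : (0 : ℝ) < n.factorial := by exact_mod_cast n.factorial_pos
  have h3 : |x| ^ n ≤ n.factorial * Real.exp |x| := by
    have := Real.pow_div_factorial_le_exp |x| (abs_nonneg x) n
    rw [div_le_iff₀ hf] at this
    linarith
  have h4 : Real.exp |x| ≤ Real.exp x + Real.exp (-x) := by
    rcases abs_cases x with ⟨h, -⟩ | ⟨h, -⟩ <;> rw [h] <;>
      linarith [Real.exp_pos x, Real.exp_pos (-x)]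
  have h5 : (Real.exp x + Real.exp (-x)) * Real.exp (a * x ^ 2 + b * x + c) ≤ B₁ + B₂ := by
    rw [add_mul, ← Real.exp_add, ← Real.exp_add]
    have e1 : x + (a * x ^ 2 + b * x + c) = a * x ^ 2 + (b + 1) * x + c := by ring
    have e2 : -x + (a * x ^ 2 + b * x + c) = a * x ^ 2 + (b - 1) * x + c := by ring
    rw [e1, e2]
    exact add_le_add (h₁ x) (h₂ x)
  calc |x| ^ n * Real.exp (a * x ^ 2 + b * x + c)
      ≤ (n.factorial * (Real.exp x + Real.exp (-x))) * Real.exp (a * x ^ 2 + b * x + c) := by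
        refine mul_le_mul_of_nonneg_right (h3.trans ?_) (Real.exp_pos _).le
        exact mul_le_mul_of_nonneg_left h4 hf.le
    _ = n.factorial * ((Real.exp x + Real.exp (-x)) * Real.exp (a * x ^ 2 + b * x + c)) := by ring
    _ ≤ _ := mul_le_mul_of_nonneg_left h5 hf.le

theorem exists_eval_mul_exp_quadratic_le {a : ℝ} (ha : a < 0) (b c : ℝ) (q : ℝ[X]) (k : ℕ) :
    ∃ B, ∀ x : ℝ, |x| ^ k * |q.eval x * Real.exp (a * x ^ 2 + b * x + c)| ≤ B := by
  induction q using Polynomial.induction_on' with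
  | add p q hp hq =>
    obtain ⟨B₁, h₁⟩ := hp
    obtain ⟨B₂, h₂⟩ := hq
    refine ⟨B₁ + B₂, fun x => (?_ : _ ≤ _).trans (add_le_add (h₁ x) (h₂ x))⟩
    rw [← mul_add, eval_add, add_mul]
    exact mul_le_mul_of_nonneg_left (abs_add_le _ _) (by positivity)
  | monomial n r =>
    obtain ⟨B, h⟩ := exists_pow_mul_exp_quadratic_le ha b c (k + n)
    refine ⟨|r| * B, fun x => ?_⟩
    rw [eval_monomial, abs_mul, abs_mul, abs_pow, Real.abs_exp]
    calc _ = |r| * (|x| ^ (k + n) * Real.exp (a * x ^ 2 + b * x + c)) := by rw [pow_add]; ring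
      _ ≤ _ := mul_le_mul_of_nonneg_left (h x) (abs_nonneg r)

theorem exists_iteratedDeriv_exp_quadratic (a b c : ℝ) (n : ℕ) :
    ∃ q : ℝ[X], iteratedDeriv n (fun x : ℝ => Real.exp (a * x ^ 2 + b * x + c))
      = fun x => q.eval x * Real.exp (a * x ^ 2 + b * x + c) := by
  induction n with
  | zero => exact ⟨1, by simp⟩
  | succ n ih =>
    obtain ⟨q, hq⟩ := ih
    refine ⟨derivative q + q * (C (2 * a) * X + C b), ?_⟩
    rw [iteratedDeriv_succ, hq]
    funext x
    have h1 : HasDerivAt (fun x : ℝ => a * x ^ 2 + b * x + c) (2 * a * x + b) x := by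
      have := (((hasDerivAt_pow 2 x).const_mul a).add ((hasDerivAt_id x).const_mul b)).add_const c
      exact this.congr_deriv (by push_cast; ring)
    have h2 := ((q.hasDerivAt x).mul h1.exp).deriv
    rw [show (fun x => q.eval x * Real.exp (a * x ^ 2 + b * x + c))
      = (fun x => q.eval x) * fun x => Real.exp (a * x ^ 2 + b * x + c) from rfl, h2]
    simp only [eval_add, eval_mul, eval_C, eval_X]
    ring

/-- The Schwartz function `e^{a x² + b x + c}`, `a < 0`. -/
noncomputable def gaussianSchwartz {a : ℝ} (ha : a < 0) (b c : ℝ) : 𝓢(ℝ, ℝ) where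
  toFun x := Real.exp (a * x ^ 2 + b * x + c)
  smooth' := by fun_prop
  decay' k n := by
    obtain ⟨q, hq⟩ := exists_iteratedDeriv_exp_quadratic a b c n
    obtain ⟨B, hB⟩ := exists_eval_mul_exp_quadratic_le ha b c q k
    refine ⟨B, fun x => ?_⟩
    rw [norm_iteratedFDeriv_eq_norm_iteratedDeriv, hq]
    exact hB x

end Gaussian

namespace StepSpace

open Polynomial Filter Topology

/-- A step function vanishing at both ends, times a smooth function, has Schwartz coefficients. -/
theorem ofFun_mul_mem_schwartzA0 {S : Finset ℝ} {φ : ℝ → ℝ} (hφ : ContDiff ℝ ((⊤ : ℕ∞) : WithTop ℕ∞) φ)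
    {w : StepSpace} (h0 : total S w = 0) :
    ofFun φ * prim S w ∈ schwartzA0 (S : Set ℝ) := by
  obtain ⟨R, hR⟩ : ∃ R : ℝ, 0 < R ∧ ∀ p ∈ S, |p| < R := by
    refine ⟨1 + ∑ p ∈ S, |p|, ?_, fun p hp => ?_⟩
    · have : 0 ≤ ∑ p ∈ S, |p| := Finset.sum_nonneg fun _ _ => abs_nonneg _
      linarith
    · have := Finset.single_le_sum (f := fun p => |p|) (fun _ _ => abs_nonneg _) hp
      linarith
  -- The bump is 1 on a ball containing all jumps, and outside this ball the primitive vanishes; so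
  -- φ may be replaced by the compactly supported function B φ.
  let B : ContDiffBump (0 : ℝ) := ⟨R, R + 1, hR.1, by linarith⟩
  have hc : HasCompactSupport (fun x => B x * φ x) := B.hasCompactSupport.mul_right
  have hs : ContDiff ℝ ((⊤ : ℕ∞) : WithTop ℕ∞) (fun x => B x * φ x) := B.contDiff.mul hφ
  refine Submodule.subset_span ⟨hc.toSchwartzMap hs, prim S w, prim_mem w, ?_⟩
  funext x
  simp only [Pi.mul_apply]
  by_cases hx : |x| ≤ R
  · have : B x = 1 := B.one_of_mem_closedBall (by simpa using hx)
    simp [ofFun, this]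
  · have : prim S w x = 0 := by
      rcases le_abs'.mp (not_le.mp hx).le with h | h
      · refine prim_apply_of_lt w fun p hp => ?_
        have := (abs_lt.mp (hR.2 p hp)).1
        linarith
      · rw [prim_apply_of_gt, h0, C_0]
        intro p hp
        have := (abs_lt.mp (hR.2 p hp)).2
        linarith
    rw [this, mul_zero, mul_zero]

/-- Beyond all jumps a step function is constant, so a Schwartz coefficient makes the product decay.
Evaluation at 0 turns the polynomial values, which are constants there, into numbers. -/
theorem tendsto_of_mem_schwartzA0 {S : Finset ℝ} {u : StepSpace}
    (hu : u ∈ schwartzA0 (S : Set ℝ)) {l : Filter ℝ} (hl : l = atBot ∨ l = atTop) :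
    Tendsto (fun x => (u x).eval 0) l (𝓝 0) := by
  rw [schwartzA0] at hu
  induction hu using Submodule.span_induction with
  | mem u hu =>
    obtain ⟨φ, α, hα, rfl⟩ := hu
    obtain ⟨c, hc⟩ := exists_eq_add_prim hα
    have hev : ∃ k : ℝ, ∀ᶠ x in l, (α x).eval 0 = k := by
      rcases hl with rfl | rfl
      · refine ⟨c, ?_⟩
        have : ∀ᶠ x in atBot, ∀ p ∈ S, x < p := by
          rw [Finset.eventually_all]
          exact fun p _ => eventually_lt_atBot p
        filter_upwards [this] with x hx
        rw [hc, Pi.add_apply, prim_apply_of_lt _ hx]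
        simp
      · refine ⟨c + total S (d α), ?_⟩
        have : ∀ᶠ x in atTop, ∀ p ∈ S, p < x := by
          rw [Finset.eventually_all]
          exact fun p _ => eventually_gt_atTop p
        filter_upwards [this] with x hx
        rw [hc, Pi.add_apply, prim_apply_of_gt _ hx, ← hc]
        simp
    obtain ⟨k, hk⟩ := hev
    have h1 : Tendsto φ l (𝓝 0) := by
      have h := φ.toZeroAtInfty.zero_at_infty'
      refine Tendsto.mono_left h ?_
      rcases hl with rfl | rfl
      · exact atBot_le_cocompact
      · exact atTop_le_cocompact
    have h2 : Tendsto (fun x => φ x * k) l (𝓝 0) := by simpa using h1.mul_const k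
    refine h2.congr' ?_
    filter_upwards [hk] with x hx
    simp [ofFun, hx]
  | zero => simpa using tendsto_const_nhds
  | add u v _ _ hu hv => simpa using hu.add hv
  | smul c u _ hu => simpa using hu.const_mul c

end StepSpace

namespace LineConfig

open StepSpace Polynomial Filter Topology

variable {N : ℕ} (L : LineConfig N)

theorem Sall_finite : L.Sall.Finite := by
  refine (Set.finite_range fun ab : Fin N × Fin N => L.xv ab.1 ab.2).subset ?_
  rintro x ⟨a, b, -, rfl⟩
  exact ⟨(a, b), rfl⟩

theorem S_subset (a : Fin N) : L.S a ⊆ L.Sall := by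
  rintro x ⟨b, hb, rfl⟩
  exact ⟨a, b, hb.symm, rfl⟩

/-- The finite set of the `x`-coordinates of all intersection points. -/
noncomputable def Sfin : Finset ℝ := L.Sall_finite.toFinset

theorem coe_Sfin : (L.Sfin : Set ℝ) = L.Sall := L.Sall_finite.coe_toFinset

/-- The finite set of the `x`-coordinates of the intersection points on `L_a`. -/
noncomputable def Sfin' (a : Fin N) : Finset ℝ := (L.Sall_finite.subset (L.S_subset a)).toFinset

theorem coe_Sfin' (a : Fin N) : (L.Sfin' a : Set ℝ) = L.S a := Set.Finite.coe_toFinset _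

theorem Sfin'_subset (a : Fin N) : L.Sfin' a ⊆ L.Sfin := by
  rw [← Finset.coe_subset, coe_Sfin, coe_Sfin']
  exact L.S_subset a

theorem xv_comm (a b : Fin N) : L.xv a b = L.xv b a := by
  unfold xv
  rw [← neg_sub (L.t b), ← neg_sub (L.s a), neg_div_neg_eq]

theorem xv_mem_S {a b : Fin N} (h : a ≠ b) : L.xv a b ∈ L.S a := ⟨b, h.symm, rfl⟩

theorem xv_mem_S' {a b : Fin N} (h : a ≠ b) : L.xv a b ∈ L.S b := ⟨a, h, L.xv_comm a b⟩

theorem xv_mem_Sall {a b : Fin N} (h : a ≠ b) : L.xv a b ∈ L.Sall := ⟨a, b, h, rfl⟩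

theorem xv_mem_Sfin {a b : Fin N} (h : a ≠ b) : L.xv a b ∈ L.Sfin := by
  rw [← Finset.mem_coe, coe_Sfin]; exact L.xv_mem_Sall h

theorem f_self (a : Fin N) (x : ℝ) : L.f a a x = 0 := by simp [f]

theorem f_swap (a b : Fin N) (x : ℝ) : L.f b a x = - L.f a b x := by
  unfold f; ring

theorem expf_self (a : Fin N) : L.expf a a = 1 := by
  funext x
  simp [expf, ofFun, f_self]

theorem expf_mul (a b c : Fin N) : L.expf a b * L.expf b c = L.expf a c := by
  have := L.expf_mul_mul a b c 1 1
  simpa using this.symm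

theorem expf_mul_swap (a b : Fin N) : L.expf a b * L.expf b a = 1 := by
  rw [expf_mul, expf_self]

theorem expfAt_eq (a b : Fin N) (p : ℝ) :
    L.expfAt a b p = Real.exp (-L.f a b p) • L.expf a b := by
  funext x
  simp only [expfAt, expf, ofFun, Pi.smul_apply, smul_C, smul_eq_mul, ← Real.exp_add]
  congr 2
  ring

theorem expf_mul_apply (a b : Fin N) (u : StepSpace) (x : ℝ) :
    (L.expf a b * u) x = Real.exp (L.f a b x) • u x := by
  simp [expf, ofFun, smul_eq_C_mul]

theorem expf_mul_mem_schwartzA0_of_lt {a b : Fin N} (h : L.t a < L.t b) {u : StepSpace}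
    (hu : u ∈ tildeA0 L.Sall) : L.expf a b * u ∈ schwartzA0 L.Sall := by
  have ha : (L.t a - L.t b) / 2 < 0 := by linarith
  refine Submodule.subset_span
    ⟨gaussianSchwartz ha (L.s a - L.s b) (L.r a - L.r b), u, hu, ?_⟩
  congr 1
  funext x
  change C (Real.exp (L.f a b x)) = C (Real.exp _)
  unfold f
  congr 2
  ring

/-- Membership in `Ω'⁰_{ab}` for `t_a < t_b`. -/
theorem expf_mul_mem_Omega_of_lt {a b : Fin N} (h : L.t a < L.t b) {u : StepSpace}
    (hu : u ∈ tildeA0 L.Sall) : L.expf a b * u ∈ L.Omega a b 0 := by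
  rw [Omega, if_pos rfl]
  exact ⟨⟨u, hu, rfl⟩, L.expf_mul_mem_schwartzA0_of_lt h hu⟩

/-- Membership in `Ω'⁰_{ab}` of step functions vanishing at both ends. -/
theorem expf_mul_prim_mem_Omega (a b : Fin N) {w : StepSpace} (h0 : total L.Sfin w = 0) :
    L.expf a b * prim L.Sfin w ∈ L.Omega a b 0 := by
  rw [Omega, if_pos rfl]
  have h1 := prim_mem (S := L.Sfin) w
  rw [coe_Sfin] at h1
  refine ⟨⟨_, h1, rfl⟩, ?_⟩
  have hs : ContDiff ℝ ((⊤ : ℕ∞) : WithTop ℕ∞) fun x => Real.exp (L.f a b x) := by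
    unfold f; fun_prop
  have h2 := ofFun_mul_mem_schwartzA0 hs h0
  rw [coe_Sfin] at h2
  exact h2

/-- Multiplication by e^{-f_ab} preserves the limit, because this factor is bounded for t_b < t_a
and equal to 1 for a = b; what is left is the constant c. This excludes nonzero end values in Ω'⁰.
-/
theorem eq_zero_of_tendsto_exp_mul {a b : Fin N} (h : L.t b ≤ L.t a) (hab : L.t a = L.t b → a = b)
    {c : ℝ} {l : Filter ℝ} [NeBot l]
    (hc : Tendsto (fun x => Real.exp (L.f a b x) * c) l (𝓝 0)) : c = 0 := by
  rcases h.eq_or_lt with h | h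
  · have : a = b := hab h.symm
    subst this
    simp only [f_self, Real.exp_zero, one_mul] at hc
    exact tendsto_nhds_unique tendsto_const_nhds hc
  · have hf : ∃ B, ∀ x, Real.exp (-L.f a b x) ≤ B := by
      have ha : (L.t b - L.t a) / 2 < 0 := by linarith
      obtain ⟨B, hB⟩ := exists_exp_quadratic_le ha (L.s b - L.s a) (L.r b - L.r a)
      refine ⟨B, fun x => ?_⟩
      convert hB x using 2
      unfold f
      ring
    obtain ⟨B, hB⟩ := hf
    have : Tendsto (fun x => Real.exp (-L.f a b x) * (Real.exp (L.f a b x) * c)) l (𝓝 0) := by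
      refine bdd_le_mul_tendsto_zero' B (Eventually.of_forall fun x => ?_) hc
      rw [Real.abs_exp]
      exact hB x
    simp only [← mul_assoc, ← Real.exp_add, neg_add_cancel, Real.exp_zero, one_mul] at this
    exact tendsto_nhds_unique tendsto_const_nhds this

/-- The elements of `Ω'⁰_{ab}`. -/
theorem exists_of_mem_Omega_zero {a b : Fin N} {u : StepSpace} (hu : u ∈ L.Omega a b 0) :
    ∃ (α : StepSpace) (c : ℝ), α ∈ tildeA0 L.Sall ∧ u = L.expf a b * α ∧
      α = algebraMap ℝ StepSpace c + prim L.Sfin (d α) ∧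
      (¬ L.t a < L.t b → c = 0 ∧ total L.Sfin (d α) = 0) := by
  rw [Omega, if_pos rfl] at hu
  obtain ⟨⟨α, hα, rfl⟩, hs⟩ := hu
  have hα' : α ∈ tildeA0 (L.Sfin : Set ℝ) := by rw [coe_Sfin]; exact hα
  obtain ⟨c, hc⟩ := exists_eq_add_prim hα'
  refine ⟨α, c, hα, rfl, hc, fun hlt => ?_⟩
  rw [← coe_Sfin] at hs
  have hab : L.t a = L.t b → a = b := fun h => by
    by_contra hne
    exact L.slopes a b hne h
  -- The constant is the value of α at -∞, and adding the integral of dα gives its value at +∞. Both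
  -- vanish, since a combination with Schwartz coefficients decays while e^{f_ab} does not.
  have hc0 : c = 0 := by
    refine L.eq_zero_of_tendsto_exp_mul (not_lt.mp hlt) hab (c := c) (l := atBot) ?_
    refine (tendsto_of_mem_schwartzA0 hs (Or.inl rfl)).congr' ?_
    have : ∀ᶠ x in atBot, ∀ p ∈ L.Sfin, x < p := by
      rw [Finset.eventually_all]
      exact fun p _ => eventually_lt_atBot p
    filter_upwards [this] with x hx
    rw [LinearMap.mulLeft_apply, expf_mul_apply, hc, Pi.add_apply, prim_apply_of_lt _ hx]
    simp
  refine ⟨hc0, ?_⟩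
  refine L.eq_zero_of_tendsto_exp_mul (not_lt.mp hlt) hab (l := atTop) ?_
  refine (tendsto_of_mem_schwartzA0 hs (Or.inr rfl)).congr' ?_
  have : ∀ᶠ x in atTop, ∀ p ∈ L.Sfin, p < x := by
    rw [Finset.eventually_all]
    exact fun p _ => eventually_gt_atTop p
  filter_upwards [this] with x hx
  rw [LinearMap.mulLeft_apply, expf_mul_apply, hc, Pi.add_apply, prim_apply_of_gt _ hx, ← hc, hc0]
  simp

/-- `Ω'¹_{ab}` consists of the one-forms supported on the intersection points. -/
theorem mem_Omega_one_iff {a b : Fin N} {w : StepSpace} :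
    w ∈ L.Omega a b 1 ↔ w ∈ A1 L.Sall := by
  rw [Omega, if_neg one_ne_zero, if_pos rfl]
  have key : ∀ c e : Fin N, ∀ v ∈ A1 L.Sall, L.expf c e * v ∈ A1 L.Sall := by
    intro c e v hv
    rw [← coe_Sfin, mem_A1_iff] at hv ⊢
    intro x hx
    rw [Pi.mul_apply, hv x hx, mul_zero]
  constructor
  · rintro ⟨v, hv, rfl⟩
    exact key a b v hv
  · intro hw
    refine ⟨L.expf b a * w, key b a w hw, ?_⟩
    rw [LinearMap.mulLeft_apply, ← mul_assoc, expf_mul_swap, one_mul]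

theorem Omega_eq_bot {a b : Fin N} {r : ℤ} (h0 : r ≠ 0) (h1 : r ≠ 1) : L.Omega a b r = ⊥ := by
  rw [Omega, if_neg h0, if_neg h1]

end LineConfig

/-! ## The contraction -/

namespace LineConfig

open StepSpace Polynomial

variable {N : ℕ} (L : LineConfig N)

/-- The homotopy for the differential of step functions that corresponds to `h_{ab}`, without the
factor `e^{f_{ab}}`. -/
noncomputable def stepHomotopy (a b : Fin N) : StepSpace →ₗ[ℝ] StepSpace :=
  if a = b then 0
  else if L.t a < L.t b then
    prim L.Sfin - Algebra.linearMap ℝ StepSpace ∘ₗ leval (1 / 2) ∘ₗ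
      LinearMap.proj (L.xv a b) ∘ₗ prim L.Sfin
  else prim L.Sfin - (total L.Sfin).smulRight (theta (L.xv a b))

/-- The homotopy `h_{ab}`. -/
noncomputable def homotopyOp (a b : Fin N) : StepSpace →ₗ[ℝ] StepSpace :=
  LinearMap.mulLeft ℝ (L.expf a b) ∘ₗ L.stepHomotopy a b ∘ₗ LinearMap.mulLeft ℝ (L.expf b a)

/-- The projection `P_{ab}` in degree `r`. -/
noncomputable def projOp (a b : Fin N) (r : ℤ) : StepSpace →ₗ[ℝ] StepSpace :=
  if a = b then LinearMap.id
  else if L.t a < L.t b then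
    (if r = 0 then
      (leval (1 / 2) ∘ₗ LinearMap.proj (L.xv a b) ∘ₗ LinearMap.mulLeft ℝ (L.expf b a)).smulRight
        (L.expf a b)
    else 0)
  else
    (if r = 1 then
      (total L.Sfin ∘ₗ LinearMap.mulLeft ℝ (L.expf b a)).smulRight
        (L.expf a b * delta (L.xv a b))
    else 0)

theorem stepHomotopy_self (a : Fin N) : L.stepHomotopy a a = 0 := if_pos rfl

theorem ne_of_lt {a b : Fin N} (h : L.t a < L.t b) : a ≠ b := fun e => by
  subst e; exact lt_irrefl _ h

theorem lt_of_not_lt {a b : Fin N} (hab : a ≠ b) (h : ¬ L.t a < L.t b) : L.t b < L.t a :=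
  lt_of_le_of_ne (not_lt.mp h) (L.slopes b a hab.symm)

/-- Evaluating the jump variable at 1/2 is what produces the constants 0, 1/2ⁿ and 1 in the formula
for h_ab. -/
theorem stepHomotopy_lt {a b : Fin N} (h : L.t a < L.t b) (w : StepSpace) :
    L.stepHomotopy a b w = prim L.Sfin w
      - algebraMap ℝ StepSpace ((prim L.Sfin w (L.xv a b)).eval (1 / 2)) := by
  rw [stepHomotopy, if_neg (L.ne_of_lt h), if_pos h]
  rfl

/-- Subtracting the whole integral as a step at v_ab makes the result vanish at the right end as
well, as the growing exponential requires. -/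
theorem stepHomotopy_gt {a b : Fin N} (h : L.t b < L.t a) (w : StepSpace) :
    L.stepHomotopy a b w = prim L.Sfin w - total L.Sfin w • theta (L.xv a b) := by
  rw [stepHomotopy, if_neg (L.ne_of_lt h).symm, if_neg h.not_gt]
  rfl

theorem homotopyOp_self (a : Fin N) : L.homotopyOp a a = 0 := by
  rw [homotopyOp, stepHomotopy_self]; simp

theorem homotopyOp_apply (a b : Fin N) (w : StepSpace) :
    L.homotopyOp a b w = L.expf a b * L.stepHomotopy a b (L.expf b a * w) := rfl

theorem projOp_self (a : Fin N) (r : ℤ) : L.projOp a a r = LinearMap.id := if_pos rfl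

theorem projOp_lt_zero {a b : Fin N} (h : L.t a < L.t b) (u : StepSpace) :
    L.projOp a b 0 u = ((L.expf b a * u) (L.xv a b)).eval (1 / 2) • L.expf a b := by
  rw [projOp, if_neg (L.ne_of_lt h), if_pos h, if_pos rfl]
  rfl

theorem projOp_lt_ne_zero {a b : Fin N} (h : L.t a < L.t b) {r : ℤ} (hr : r ≠ 0) :
    L.projOp a b r = 0 := by
  rw [projOp, if_neg (L.ne_of_lt h), if_pos h, if_neg hr]

theorem projOp_gt_one {a b : Fin N} (h : L.t b < L.t a) (w : StepSpace) :
    L.projOp a b 1 w = total L.Sfin (L.expf b a * w) • (L.expf a b * delta (L.xv a b)) := by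
  rw [projOp, if_neg (L.ne_of_lt h).symm, if_neg h.not_gt, if_pos rfl]
  rfl

theorem projOp_gt_ne_one {a b : Fin N} (h : L.t b < L.t a) {r : ℤ} (hr : r ≠ 1) :
    L.projOp a b r = 0 := by
  rw [projOp, if_neg (L.ne_of_lt h).symm, if_neg h.not_gt, if_neg hr]

theorem mul_delta (u : StepSpace) (p c : ℝ) (h : u p = C c) : u * delta p = c • delta p := by
  funext x
  rw [Pi.mul_apply, Pi.smul_apply]
  by_cases hx : x = p
  · subst hx; rw [h, smul_eq_C_mul]
  · simp [delta_apply_of_ne hx]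

theorem expf_mul_delta (a b : Fin N) (p : ℝ) :
    L.expf a b * delta p = Real.exp (L.f a b p) • delta p := mul_delta _ _ _ rfl

theorem expf_swap_mul_expf_mul (a b : Fin N) (u : StepSpace) :
    L.expf b a * (L.expf a b * u) = u := by
  rw [← mul_assoc, expf_mul_swap, one_mul]

theorem d_expf_mul (a b : Fin N) (u : StepSpace) : d (L.expf a b * u) = L.expf a b * d u :=
  d_ofFun_mul _ _

theorem prim_mem_Sall (w : StepSpace) : prim L.Sfin w ∈ tildeA0 L.Sall := by
  have := prim_mem (S := L.Sfin) w
  rwa [coe_Sfin] at this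

theorem prim_delta {p : ℝ} (hp : p ∈ L.Sall) : prim L.Sfin (delta p) = theta p := by
  rw [prim_single (p := p) (by rwa [← Finset.mem_coe, coe_Sfin])
    fun x hx => delta_apply_of_ne hx, delta_apply_self, integ_one]
  simp

theorem total_delta {p : ℝ} (hp : p ∈ L.Sall) : total L.Sfin (delta p) = 1 := by
  rw [total_single (p := p) (by rwa [← Finset.mem_coe, coe_Sfin])
    fun x hx => delta_apply_of_ne hx, delta_apply_self, integ_one]
  simp

theorem homotopyOp_mem (a b : Fin N) (w : StepSpace) : L.homotopyOp a b w ∈ L.Omega a b 0 := by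
  by_cases hab : a = b
  · subst hab; rw [homotopyOp_self]; exact Submodule.zero_mem _
  rw [homotopyOp_apply]
  by_cases h : L.t a < L.t b
  · rw [L.stepHomotopy_lt h]
    exact L.expf_mul_mem_Omega_of_lt h
      (sub_mem (L.prim_mem_Sall _) (Subalgebra.algebraMap_mem _ _))
  · rw [L.stepHomotopy_gt (L.lt_of_not_lt hab h)]
    set w' := L.expf b a * w
    have hx := L.xv_mem_Sall hab
    -- As the primitive of a form of integral zero the function vanishes at both ends, so it meets
    -- the Schwartz condition whatever the exponential factor.
    have : prim L.Sfin w' - total L.Sfin w' • theta (L.xv a b)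
        = prim L.Sfin (w' - total L.Sfin w' • delta (L.xv a b)) := by
      rw [map_sub, map_smul, L.prim_delta hx]
    rw [this]
    refine L.expf_mul_prim_mem_Omega a b ?_
    rw [map_sub, map_smul, L.total_delta hx]
    simp

theorem expf_mem_Omega {a b : Fin N} (h : L.t a < L.t b) : L.expf a b ∈ L.Omega a b 0 := by
  have := L.expf_mul_mem_Omega_of_lt h (one_mem (tildeA0 L.Sall))
  rwa [mul_one] at this

theorem delta_mem_Omega {a b : Fin N} {p : ℝ} (hp : p ∈ L.Sall) : delta p ∈ L.Omega a b 1 :=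
  L.mem_Omega_one_iff.mpr (delta_mem_A1 hp)

theorem projOp_mem (a b : Fin N) (r : ℤ) {u : StepSpace} (hu : u ∈ L.Omega a b r) :
    L.projOp a b r u ∈ L.Omega a b r := by
  by_cases hab : a = b
  · subst hab; rw [projOp_self]; exact hu
  by_cases h : L.t a < L.t b
  · by_cases hr : r = 0
    · subst hr
      rw [L.projOp_lt_zero h]
      exact Submodule.smul_mem _ _ (L.expf_mem_Omega h)
    · rw [L.projOp_lt_ne_zero h hr]; exact Submodule.zero_mem _
  · have h' := L.lt_of_not_lt hab h
    by_cases hr : r = 1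
    · subst hr
      rw [L.projOp_gt_one h', expf_mul_delta]
      exact Submodule.smul_mem _ _ (Submodule.smul_mem _ _ (L.delta_mem_Omega (L.xv_mem_Sall hab)))
    · rw [L.projOp_gt_ne_one h' hr]; exact Submodule.zero_mem _

theorem expf_mul_mem_A1 (a b : Fin N) {w : StepSpace} (hw : w ∈ A1 L.Sall) :
    L.expf a b * w ∈ A1 L.Sall := by
  rw [← coe_Sfin, mem_A1_iff] at hw ⊢
  intro x hx
  rw [Pi.mul_apply, hw x hx, mul_zero]

/-- The primitive of dα recovers α up to its value at -∞. For t_a < t_b the normalisation at v_ab is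
insensitive to that constant and removes exactly the value read off by P; for t_a > t_b both the
constant and the integral of dα are zero. -/
theorem homotopyOp_d {a b : Fin N} {u : StepSpace} (hu : u ∈ L.Omega a b 0) :
    L.homotopyOp a b (d u) = u - L.projOp a b 0 u := by
  by_cases hab : a = b
  · subst hab; rw [homotopyOp_self, projOp_self]; simp
  obtain ⟨α, c, -, rfl, hc, h0⟩ := L.exists_of_mem_Omega_zero hu
  rw [homotopyOp_apply, d_expf_mul, expf_swap_mul_expf_mul]
  by_cases h : L.t a < L.t b
  · rw [L.stepHomotopy_lt h, L.projOp_lt_zero h, expf_swap_mul_expf_mul]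
    have e1 : prim L.Sfin (d α) = α - algebraMap ℝ StepSpace c := by
      conv_rhs => rw [hc]
      ring
    rw [e1, mul_sub]
    simp only [Pi.sub_apply, eval_sub, Pi.algebraMap_apply, algebraMap_eq, eval_C, map_sub]
    rw [Algebra.smul_def]
    ring
  · have h' := L.lt_of_not_lt hab h
    obtain ⟨hc0, ht⟩ := h0 h
    rw [L.stepHomotopy_gt h', L.projOp_gt_ne_one h' zero_ne_one, ht]
    conv_rhs => rw [hc, hc0]
    simp

/-- Differentiation kills the correcting constant, and turns the correcting step into δ_{v_ab} with
the integral as its coefficient, which is the value of P. -/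
theorem d_homotopyOp {a b : Fin N} {w : StepSpace} (hw : w ∈ L.Omega a b 1) :
    d (L.homotopyOp a b w) = w - L.projOp a b 1 w := by
  by_cases hab : a = b
  · subst hab; rw [homotopyOp_self, projOp_self]; simp
  rw [mem_Omega_one_iff] at hw
  have hw' := L.expf_mul_mem_A1 b a hw
  rw [← coe_Sfin] at hw'
  rw [homotopyOp_apply, d_expf_mul]
  by_cases h : L.t a < L.t b
  · rw [L.stepHomotopy_lt h, map_sub, d_prim hw', d_algebraMap, sub_zero,
      expf_swap_mul_expf_mul, L.projOp_lt_ne_zero h one_ne_zero]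
    simp
  · have h' := L.lt_of_not_lt hab h
    rw [L.stepHomotopy_gt h', L.projOp_gt_one h', map_sub, map_smul, d_prim hw', d_theta, mul_sub,
      expf_swap_mul_expf_mul, mul_smul_comm]

theorem projOp_idem (a b : Fin N) (r : ℤ) (u : StepSpace) :
    L.projOp a b r (L.projOp a b r u) = L.projOp a b r u := by
  by_cases hab : a = b
  · subst hab; rw [projOp_self]; rfl
  by_cases h : L.t a < L.t b
  · by_cases hr : r = 0
    · subst hr
      rw [L.projOp_lt_zero h u, map_smul, L.projOp_lt_zero h, expf_mul_swap]
      simp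
    · rw [L.projOp_lt_ne_zero h hr]; simp
  · have h' := L.lt_of_not_lt hab h
    by_cases hr : r = 1
    · subst hr
      rw [L.projOp_gt_one h' u, map_smul, L.projOp_gt_one h', expf_swap_mul_expf_mul,
        L.total_delta (L.xv_mem_Sall hab), one_smul]
    · rw [L.projOp_gt_ne_one h' hr]; simp

theorem e_lt {a b : Fin N} (h : L.t a < L.t b) :
    L.e a b = Real.exp (-L.f a b (L.xv a b)) • L.expf a b := by
  rw [e, if_pos h, expfAt_eq]

theorem e_gt {a b : Fin N} (h : L.t b < L.t a) : L.e a b = delta (L.xv a b) := by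
  rw [e, if_neg h.not_gt]

theorem vdeg_lt {a b : Fin N} (h : L.t a < L.t b) : L.vdeg a b = 0 := if_pos h

theorem vdeg_gt {a b : Fin N} (h : L.t b < L.t a) : L.vdeg a b = 1 := if_neg h.not_gt

theorem V_self_zero (a : Fin N) : L.V a a 0 = A0 (L.S a) := by simp [V]

theorem V_self_one (a : Fin N) : L.V a a 1 = A1 (L.S a) := by simp [V]

theorem V_of_ne {a b : Fin N} (h : a ≠ b) : L.V a b (L.vdeg a b) = Submodule.span ℝ {L.e a b} := by
  simp [V, h]

theorem V_of_ne_bot {a b : Fin N} (h : a ≠ b) {r : ℤ} (hr : r ≠ L.vdeg a b) : L.V a b r = ⊥ := by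
  simp [V, h, hr]

theorem V_eq_bot {a b : Fin N} {r : ℤ} (h0 : r ≠ 0) (h1 : r ≠ 1) : L.V a b r = ⊥ := by
  by_cases h : a = b
  · simp [V, h, h0, h1]
  · refine L.V_of_ne_bot h fun hr => ?_
    unfold vdeg at hr
    split_ifs at hr <;> contradiction

theorem e_mem_Omega {a b : Fin N} (h : a ≠ b) : L.e a b ∈ L.Omega a b (L.vdeg a b) := by
  by_cases hlt : L.t a < L.t b
  · rw [L.vdeg_lt hlt, L.e_lt hlt]
    exact Submodule.smul_mem _ _ (L.expf_mem_Omega hlt)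
  · have h' := L.lt_of_not_lt h hlt
    rw [L.vdeg_gt h', L.e_gt h']
    exact L.delta_mem_Omega (L.xv_mem_Sall h)

theorem A0_mono {S T : Set ℝ} (h : S ⊆ T) : A0 S ≤ A0 T := by
  refine Submodule.span_mono ?_
  rintro _ ⟨p, hp, q, hq, m, n, hm, hn, rfl⟩
  exact ⟨p, h hp, q, h hq, m, n, hm, hn, rfl⟩

/-- `Ω'⁰_{aa} = A⁰_S(ℝ)` for the set `S` of all intersection points. -/
theorem A0_le_Omega (a : Fin N) : A0 L.Sall ≤ L.Omega a a 0 := by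
  rw [A0, Submodule.span_le]
  rintro _ ⟨p, hp, q, hq, m, n, hm, hn, rfl⟩
  have hp' : p ∈ L.Sfin := by rwa [← Finset.mem_coe, coe_Sfin]
  have hq' : q ∈ L.Sfin := by rwa [← Finset.mem_coe, coe_Sfin]
  have h0 : ∀ {n : ℕ}, 1 ≤ n → (X ^ n : ℝ[X]).eval 0 = 0 := fun hn => by
    simp [Nat.one_le_iff_ne_zero.mp hn]
  have h1 : theta p ^ m - theta q ^ n = prim L.Sfin (d (theta p ^ m - theta q ^ n)) := by
    rw [map_sub, map_sub, theta_pow_eq_aeval, theta_pow_eq_aeval, prim_d_aeval_theta hp',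
      prim_d_aeval_theta hq', h0 hm, h0 hn]
    simp
  have h2 : total L.Sfin (d (theta p ^ m - theta q ^ n)) = 0 := by
    rw [map_sub, map_sub, theta_pow_eq_aeval, theta_pow_eq_aeval, total_d_aeval_theta hp',
      total_d_aeval_theta hq', h0 hm, h0 hn]
    simp
  have h3 := L.expf_mul_prim_mem_Omega a a h2
  rwa [expf_self, one_mul, ← h1] at h3

/-- An element of `Ω'⁰_{aa}` whose differential is supported on `L_a` lies in `V⁰_{aa}`. -/
theorem mem_A0_of_d_mem {a : Fin N} {u : StepSpace} (hu : u ∈ L.Omega a a 0)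
    (hd : d u ∈ A1 (L.S a)) : u ∈ A0 (L.S a) := by
  obtain ⟨α, c, -, rfl, hc, h0⟩ := L.exists_of_mem_Omega_zero hu
  obtain ⟨rfl, ht⟩ := h0 (lt_irrefl _)
  rw [expf_self, one_mul] at hd ⊢
  rw [map_zero, zero_add] at hc
  rw [hc, ← coe_Sfin']
  rw [← coe_Sfin'] at hd
  exact prim_mem_A0 (L.Sfin'_subset a) hd ht

theorem A1_mono {S T : Finset ℝ} (h : S ⊆ T) : A1 (S : Set ℝ) ≤ A1 (T : Set ℝ) := fun w hw => by
  rw [mem_A1_iff] at hw ⊢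
  exact fun x hx => hw x fun hxS => hx (h hxS)

theorem A1_le_Omega (a : Fin N) : A1 (L.S a) ≤ L.Omega a a 1 := fun w hw => by
  rw [mem_Omega_one_iff, ← coe_Sfin]
  rw [← coe_Sfin'] at hw
  exact A1_mono (L.Sfin'_subset a) hw

theorem V_le_Omega (a b : Fin N) (r : ℤ) : L.V a b r ≤ L.Omega a b r := by
  by_cases hab : a = b
  · subst hab
    by_cases h0 : r = 0
    · subst h0
      rw [V_self_zero]
      exact (A0_mono (L.S_subset a)).trans (L.A0_le_Omega a)
    · by_cases h1 : r = 1
      · subst h1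
        rw [V_self_one]
        exact L.A1_le_Omega a
      · rw [L.V_eq_bot h0 h1]; exact bot_le
  · by_cases hr : r = L.vdeg a b
    · subst hr
      rw [L.V_of_ne hab, Submodule.span_singleton_le_iff_mem]
      exact L.e_mem_Omega hab
    · rw [L.V_of_ne_bot hab hr]; exact bot_le

/-- The image of `P_{ab}`. -/
theorem projOp_mem_V {a b : Fin N} (hab : a ≠ b) {r : ℤ} {u : StepSpace}
    (hu : u ∈ L.Omega a b r) : L.projOp a b r u ∈ L.V a b r := by
  by_cases h : L.t a < L.t b
  · by_cases hr : r = 0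
    · subst hr
      rw [L.projOp_lt_zero h, ← L.vdeg_lt h, L.V_of_ne hab]
      refine Submodule.smul_mem _ _ (Submodule.mem_span_singleton.mpr
        ⟨Real.exp (L.f a b (L.xv a b)), ?_⟩)
      rw [L.e_lt h, smul_smul, ← Real.exp_add]
      simp
    · rw [L.projOp_lt_ne_zero h hr]; exact Submodule.zero_mem _
  · have h' := L.lt_of_not_lt hab h
    by_cases hr : r = 1
    · subst hr
      rw [L.projOp_gt_one h', expf_mul_delta, ← L.vdeg_gt h', L.V_of_ne hab, L.e_gt h']
      exact Submodule.smul_mem _ _ (Submodule.smul_mem _ _ (Submodule.mem_span_singleton_self _))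
    · rw [L.projOp_gt_ne_one h' hr]; exact Submodule.zero_mem _

theorem projOp_e {a b : Fin N} (hab : a ≠ b) :
    L.projOp a b (L.vdeg a b) (L.e a b) = L.e a b := by
  by_cases h : L.t a < L.t b
  · rw [L.vdeg_lt h, L.e_lt h, map_smul, L.projOp_lt_zero h, expf_mul_swap]
    simp
  · have h' := L.lt_of_not_lt hab h
    rw [L.vdeg_gt h', L.e_gt h', L.projOp_gt_one h', expf_mul_delta, expf_mul_delta, map_smul,
      L.total_delta (L.xv_mem_Sall hab), smul_smul]
    simp only [smul_eq_mul, mul_one]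
    rw [← Real.exp_add, f_swap]
    simp

theorem projOp_of_mem_V {a b : Fin N} {r : ℤ} {u : StepSpace} (hu : u ∈ L.V a b r) :
    L.projOp a b r u = u := by
  by_cases hab : a = b
  · subst hab; rw [projOp_self]; rfl
  by_cases hr : r = L.vdeg a b
  · subst hr
    rw [L.V_of_ne hab, Submodule.mem_span_singleton] at hu
    obtain ⟨c, rfl⟩ := hu
    rw [map_smul, L.projOp_e hab]
  · rw [L.V_of_ne_bot hab hr, Submodule.mem_bot] at hu
    rw [hu, map_zero]

/-- The homotopies `h_{ab}` on homogeneous morphisms. -/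
noncomputable def homotopyMap (a b : Fin N) (r : ℤ) :
    L.OmegaHom a b r →ₗ[ℝ] L.OmegaHom a b (r - 1) :=
  LinearMap.codRestrict _ ((if r = 1 then L.homotopyOp a b else 0) ∘ₗ (L.Omega a b r).subtype)
    fun w => by
      by_cases hr : r = 1
      · subst hr
        simp only [if_true, sub_self, LinearMap.comp_apply]
        exact L.homotopyOp_mem a b _
      · simp [hr]

/-- The projections `P_{ab}` on homogeneous morphisms. -/
noncomputable def projMap (a b : Fin N) (r : ℤ) : L.OmegaHom a b r →ₗ[ℝ] L.OmegaHom a b r :=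
  LinearMap.codRestrict _ (L.projOp a b r ∘ₗ (L.Omega a b r).subtype) fun w =>
    L.projOp_mem a b r w.2

theorem coe_homotopyMap_one (a b : Fin N) (w : L.OmegaHom a b 1) :
    (L.homotopyMap a b 1 w : StepSpace) = L.homotopyOp a b w := rfl

theorem homotopyMap_of_ne {a b : Fin N} {r : ℤ} (hr : r ≠ 1) : L.homotopyMap a b r = 0 := by
  ext w : 2
  simp [homotopyMap, hr]

theorem coe_projMap (a b : Fin N) (r : ℤ) (w : L.OmegaHom a b r) :
    (L.projMap a b r w : StepSpace) = L.projOp a b r w := rfl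

theorem d_theta_pow_apply_of_ne {p x : ℝ} (n : ℕ) (hx : x ≠ p) : d (theta p ^ n) x = 0 := by
  rw [theta_pow_eq_aeval, d_aeval_theta, Pi.mul_apply, delta_apply_of_ne hx, mul_zero]

theorem expf_mul_eq_smul {a b : Fin N} {w : StepSpace} {p : ℝ} (hw : ∀ x, x ≠ p → w x = 0) :
    L.expf a b * w = Real.exp (L.f a b p) • w := by
  funext x
  rw [expf_mul_apply, Pi.smul_apply]
  by_cases hx : x = p
  · rw [hx]
  · rw [hw x hx]; simp

theorem isHomotopy_homotopyMap : L.IsHomotopy L.homotopyMap where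
  diag a r := by
    by_cases hr : r = 1
    · subst hr
      ext w : 2
      rw [coe_homotopyMap_one, homotopyOp_self]
      rfl
    · exact L.homotopyMap_of_ne hr
  lt a b h p hp n hn ω hω := by
    have hp' : p ∈ L.Sfin := by rwa [← Finset.mem_coe, coe_Sfin]
    have hn' : n ≠ 0 := Nat.one_le_iff_ne_zero.mp hn
    rw [coe_homotopyMap_one, hω, homotopyOp_apply,
      L.expf_mul_eq_smul fun x hx => d_theta_pow_apply_of_ne n hx, map_smul, L.stepHomotopy_lt h,
      theta_pow_eq_aeval, prim_d_aeval_theta hp', mul_smul_comm, expfAt_eq, smul_mul_assoc, f_swap,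
      Pi.sub_apply, aeval_theta_apply]
    congr 2
    simp only [eval_pow, eval_X, ne_eq, hn', not_false_eq_true, zero_pow, map_zero, sub_zero]
    congr 1
    funext x
    simp only [Pi.algebraMap_apply, algebraMap_eq, ofFun]
    congr 1
    split_ifs <;> simp
  gt a b h p hp n hn ω hω := by
    have hp' : p ∈ L.Sfin := by rwa [← Finset.mem_coe, coe_Sfin]
    have hn' : n ≠ 0 := Nat.one_le_iff_ne_zero.mp hn
    rw [coe_homotopyMap_one, hω, homotopyOp_apply,
      L.expf_mul_eq_smul fun x hx => d_theta_pow_apply_of_ne n hx, map_smul, L.stepHomotopy_gt h,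
      theta_pow_eq_aeval, prim_d_aeval_theta hp', total_d_aeval_theta hp', mul_smul_comm, expfAt_eq,
      smul_mul_assoc, f_swap]
    simp [hn']

theorem isProjection_projMap : L.IsProjection L.projMap where
  diag a r := by
    ext w : 2
    rw [coe_projMap, projOp_self]
    rfl
  lt_unit a b h u hu := by
    apply Subtype.ext
    rw [coe_projMap, hu, L.projOp_lt_zero h, expf_mul_swap]
    simp
  lt_theta a b h p hp n hn u hu := by
    have hn' : n ≠ 0 := Nat.one_le_iff_ne_zero.mp hn
    rw [coe_projMap, hu, L.projOp_lt_zero h, expf_swap_mul_expf_mul, theta_pow_eq_aeval,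
      aeval_theta_apply]
    congr 1
    rcases lt_trichotomy p (L.xv a b) with h1 | h1 | h1
    · simp [h1.not_gt, h1, h1.ne']
    · simp [h1]
    · simp [h1.not_gt, h1, h1.ne', hn']
  lt_one a b h := by
    ext w : 2
    rw [coe_projMap, L.projOp_lt_ne_zero h one_ne_zero]
    rfl
  gt_delta a b h p hp n hn ω hω := by
    have hp' : p ∈ L.Sfin := by rwa [← Finset.mem_coe, coe_Sfin]
    have hn' : n ≠ 0 := Nat.one_le_iff_ne_zero.mp hn
    rw [coe_projMap, hω, L.projOp_gt_one h,
      L.expf_mul_eq_smul fun x hx => d_theta_pow_apply_of_ne n hx, map_smul,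
      theta_pow_eq_aeval, total_d_aeval_theta hp', expf_mul_delta, smul_smul, f_swap]
    simp only [eval_pow, eval_X, one_pow, ne_eq, hn', not_false_eq_true, zero_pow, sub_zero,
      smul_eq_mul, mul_one]
    rw [← Real.exp_add]
    congr 2
    ring
  gt_zero a b h := by
    ext w : 2
    rw [coe_projMap, L.projOp_gt_ne_one h zero_ne_one]
    rfl

/-- The one-forms are spanned by the `d (ϑ_p)ⁿ`. -/
theorem A1_le_span (S : Finset ℝ) : A1 (S : Set ℝ) ≤
    Submodule.span ℝ {w | ∃ p ∈ S, ∃ n : ℕ, 1 ≤ n ∧ w = d (theta p ^ n)} := by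
  intro w hw
  rw [← d_prim hw, prim_apply, map_sum]
  refine Submodule.sum_mem _ fun p hp => ?_
  generalize integ (w p) = q
  induction q using Polynomial.induction_on' with
  | add q r hq hr => rw [map_add, map_add]; exact Submodule.add_mem _ hq hr
  | monomial n c =>
    have : aeval (theta p) (monomial n c) = c • theta p ^ n := by
      rw [aeval_monomial, Algebra.smul_def]
    rw [this, map_smul]
    refine Submodule.smul_mem _ _ ?_
    rcases n with _ | n
    · rw [pow_zero, ← map_one (algebraMap ℝ StepSpace), d_algebraMap]
      exact Submodule.zero_mem _
    · exact Submodule.subset_span ⟨p, hp, n + 1, Nat.le_add_left 1 n, rfl⟩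

/-- The forms d(ϑ_p)ⁿ, on which the values are prescribed, span the one-forms; in the remaining
degrees the source or the target is zero. -/
theorem isHomotopy_unique {h h' : ∀ a b r, L.OmegaHom a b r →ₗ[ℝ] L.OmegaHom a b (r - 1)}
    (hh : L.IsHomotopy h) (hh' : L.IsHomotopy h') : h' = h := by
  funext a b r
  by_cases hab : a = b
  · subst hab; rw [hh.diag, hh'.diag]
  by_cases hr : r = 1
  · subst hr
    have key : ∀ w : StepSpace, w ∈ A1 L.Sall → ∀ hw : w ∈ L.Omega a b 1,
        h' a b 1 ⟨w, hw⟩ = h a b 1 ⟨w, hw⟩ := by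
      intro w hw1
      rw [← coe_Sfin] at hw1
      have hw2 := A1_le_span _ hw1
      clear hw1
      induction hw2 using Submodule.span_induction with
      | mem w hw =>
        obtain ⟨p, hp, n, hn, rfl⟩ := hw
        rw [← Finset.mem_coe, coe_Sfin] at hp
        intro hw
        apply Subtype.ext
        by_cases hlt : L.t a < L.t b
        · rw [hh.lt a b hlt p hp n hn _ rfl, hh'.lt a b hlt p hp n hn _ rfl]
        · have hgt := L.lt_of_not_lt hab hlt
          rw [hh.gt a b hgt p hp n hn _ rfl, hh'.gt a b hgt p hp n hn _ rfl]
      | zero =>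
        intro hw
        have : (⟨0, hw⟩ : L.OmegaHom a b 1) = 0 := rfl
        rw [this, map_zero, map_zero]
      | add u v hu' hv' hu hv =>
        intro hw
        have key : ∀ u ∈ Submodule.span ℝ {w | ∃ p ∈ L.Sfin, ∃ n : ℕ, 1 ≤ n ∧ w = d (theta p ^ n)},
            u ∈ L.Omega a b 1 := by
          intro u hu
          rw [mem_Omega_one_iff]
          refine (Submodule.span_le.mpr ?_ : _ ≤ A1 L.Sall) hu
          rintro _ ⟨p, hp, n, hn, rfl⟩
          rw [← Finset.mem_coe, coe_Sfin] at hp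
          exact d_mem_A1 ((tildeA0 _).pow_mem (theta_mem hp) n)
        have : (⟨u + v, hw⟩ : L.OmegaHom a b 1) = ⟨u, key u hu'⟩ + ⟨v, key v hv'⟩ := rfl
        rw [this, map_add, map_add, hu, hv]
      | smul c u hu' hu =>
        intro hw
        -- Only the multiple c • u is known to lie in the morphism space; for c ≠ 0 this gives the
        -- membership of u.
        by_cases hc : c = 0
        · subst hc
          have : (⟨(0 : ℝ) • u, hw⟩ : L.OmegaHom a b 1) = 0 := Subtype.ext (zero_smul _ _)
          rw [this, map_zero, map_zero]
        · have hu1 : u ∈ L.Omega a b 1 := by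
            have := Submodule.smul_mem _ c⁻¹ hw
            rwa [smul_smul, inv_mul_cancel₀ hc, one_smul] at this
          have : (⟨c • u, hw⟩ : L.OmegaHom a b 1) = c • ⟨u, hu1⟩ := rfl
          rw [this, map_smul, map_smul, hu]
    ext w : 1
    exact key w (L.mem_Omega_one_iff.mp w.2) w.2
  · ext w : 2
    by_cases hr0 : r = 0
    · subst hr0
      have hb : L.Omega a b (0 - 1) = ⊥ := L.Omega_eq_bot (by norm_num) (by norm_num)
      rw [(Submodule.eq_bot_iff _).mp hb _ (h' a b 0 w).2,
        (Submodule.eq_bot_iff _).mp hb _ (h a b 0 w).2]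
    · have hw : w = 0 :=
        Subtype.ext ((Submodule.eq_bot_iff _).mp (L.Omega_eq_bot hr0 hr) _ w.2)
      rw [hw, map_zero, map_zero]

theorem map_range_projMap {a b : Fin N} (r : ℤ) (hab : a ≠ b) :
    (LinearMap.range (L.projMap a b r)).map (L.Omega a b r).subtype = L.V a b r := by
  ext u
  constructor
  · rintro ⟨_, ⟨w, rfl⟩, rfl⟩
    exact L.projOp_mem_V hab w.2
  · intro hu
    exact ⟨⟨u, L.V_le_Omega a b r hu⟩, ⟨⟨u, L.V_le_Omega a b r hu⟩,
      Subtype.ext (L.projOp_of_mem_V hu)⟩, rfl⟩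

end LineConfig

/-! ## Sums over the decompositions of a list -/

section SplitSum

variable {α M : Type*} [AddCommMonoid M]

/-- The sum of `f p q` over all decompositions `w = p ++ q`. -/
def splitSum : (List α → List α → M) → List α → M
  | f, [] => f [] []
  | f, x :: l => f [] (x :: l) + splitSum (fun p q => f (x :: p) q) l

theorem splitSum_congr {f g : List α → List α → M} {w : List α}
    (h : ∀ p q, p ++ q = w → f p q = g p q) : splitSum f w = splitSum g w := by
  induction w generalizing f g with
  | nil => exact h [] [] rfl
  | cons x l ih =>
    simp only [splitSum]
    rw [h [] (x :: l) rfl, ih fun p q hpq => h (x :: p) q (by rw [← hpq]; rfl)]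

theorem splitSum_add (f g : List α → List α → M) (w : List α) :
    splitSum (fun p q => f p q + g p q) w = splitSum f w + splitSum g w := by
  induction w generalizing f g with
  | nil => rfl
  | cons x l ih => simp only [splitSum]; rw [ih]; exact add_add_add_comm _ _ _ _

theorem splitSum_map {M' : Type*} [AddCommMonoid M'] (φ : M →+ M') (f : List α → List α → M)
    (w : List α) : φ (splitSum f w) = splitSum (fun p q => φ (f p q)) w := by
  induction w generalizing f with
  | nil => rfl
  | cons x l ih => simp only [splitSum]; rw [map_add, ih]

theorem splitSum_zero (w : List α) : splitSum (fun _ _ => (0 : M)) w = 0 := by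
  induction w with
  | nil => rfl
  | cons x l ih => simp only [splitSum]; rw [ih, add_zero]

theorem splitSum_eq_zero {f : List α → List α → M} {w : List α}
    (h : ∀ p q, p ++ q = w → f p q = 0) : splitSum f w = 0 :=
  (splitSum_congr h).trans (splitSum_zero w)

theorem splitSum_induction {f : List α → List α → M} {w : List α} {P : M → Prop}
    (hadd : ∀ x y, P x → P y → P (x + y)) (h : ∀ p q, p ++ q = w → P (f p q)) :
    P (splitSum f w) := by
  induction w generalizing f with
  | nil => exact h [] [] rfl
  | cons x l ih =>
    exact hadd _ _ (h [] (x :: l) rfl) (ih fun p q hpq => h (x :: p) q (by rw [← hpq]; rfl))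

/-- A cut passes either to the left or to the right of the distinguished letter x. -/
theorem splitSum_append_cons (f : List α → List α → M) (p : List α) (x : α) (q : List α) :
    splitSum f (p ++ x :: q) = splitSum (fun p₁ p₂ => f p₁ (p₂ ++ x :: q)) p
      + splitSum (fun q₁ q₂ => f (p ++ x :: q₁) q₂) q := by
  induction p generalizing f with
  | nil => rfl
  | cons y p ih =>
    simp only [List.cons_append, splitSum]
    rw [ih, add_assoc]

/-- Coassociativity of deconcatenation: both sides run over all cuts of the word into three pieces.
-/
theorem splitSum_assoc (f : List α → List α → List α → M) (w : List α) :
    splitSum (fun p r => splitSum (fun a b => f a b r) p) w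
      = splitSum (fun a s => splitSum (fun b r => f a b r) s) w := by
  induction w generalizing f with
  | nil => rfl
  | cons x l ih =>
    simp only [splitSum]
    rw [splitSum_add, ih fun a b r => f (x :: a) b r, add_assoc]

theorem splitSum_comm {β : Type*} (f : List α → List α → List β → List β → M) (w : List α)
    (v : List β) :
    splitSum (fun a b => splitSum (fun c e => f a b c e) v) w
      = splitSum (fun c e => splitSum (fun a b => f a b c e) w) v := by
  induction w generalizing f with
  | nil => rfl
  | cons x l ih =>
    simp only [splitSum]
    rw [ih, splitSum_add]

theorem splitSum_eq_left {f : List α → List α → M} {w : List α}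
    (h : ∀ p q, p ++ q = w → p ≠ [] → f p q = 0) : splitSum f w = f [] w := by
  cases w with
  | nil => rfl
  | cons x l =>
    simp only [splitSum]
    rw [splitSum_eq_zero, add_zero]
    exact fun p q hpq => h (x :: p) q (by rw [← hpq]; rfl) (List.cons_ne_nil _ _)

theorem splitSum_eq_right {f : List α → List α → M} {w : List α}
    (h : ∀ p q, p ++ q = w → q ≠ [] → f p q = 0) : splitSum f w = f w [] := by
  induction w generalizing f with
  | nil => rfl
  | cons x l ih =>
    simp only [splitSum]
    rw [h [] (x :: l) rfl (List.cons_ne_nil _ _), zero_add,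
      ih fun p q hpq hq => h (x :: p) q (by rw [← hpq]; rfl) hq]

end SplitSum

/-! ## Graded step forms -/

namespace StepSpace

/-- Step functions plus delta forms; the product of two one-forms is zero. -/
abbrev Forms : Type := DualNumber StepSpace

/-- The embedding of the homogeneous elements of degree `r`. -/
noncomputable def emb (r : ℤ) : StepSpace →ₗ[ℝ] Forms :=
  if r = 0 then
    { toFun := TrivSqZeroExt.inl, map_add' := TrivSqZeroExt.inl_add _
      map_smul' := TrivSqZeroExt.inl_smul _ }
  else if r = 1 then
    { toFun := TrivSqZeroExt.inr, map_add' := TrivSqZeroExt.inr_add _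
      map_smul' := TrivSqZeroExt.inr_smul _ }
  else 0

theorem emb_zero_deg (u : StepSpace) : emb 0 u = TrivSqZeroExt.inl u := rfl

theorem emb_one_deg (u : StepSpace) : emb 1 u = TrivSqZeroExt.inr u := rfl

theorem emb_of_ne {r : ℤ} (h0 : r ≠ 0) (h1 : r ≠ 1) : emb r = 0 := by
  rw [emb, if_neg h0, if_neg h1]

/-- The component of degree zero. -/
def fstL : Forms →ₗ[ℝ] StepSpace where
  toFun k := k.fst
  map_add' _ _ := rfl
  map_smul' _ _ := rfl

/-- The component of degree one. -/
def sndL : Forms →ₗ[ℝ] StepSpace where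
  toFun k := k.snd
  map_add' _ _ := rfl
  map_smul' _ _ := rfl

/-- The differential on forms. -/
noncomputable def dForms : Forms →ₗ[ℝ] Forms := emb 1 ∘ₗ d ∘ₗ fstL

theorem dForms_apply (k : Forms) : dForms k = TrivSqZeroExt.inr (d k.fst) := rfl

/-- The usual sign would be felt only for k of degree one, and then k · dl is a product of two
one-forms and vanishes. This is why the graded Leibniz rule can be written without signs. -/
theorem dForms_mul (k l : Forms) : dForms (k * l) = dForms k * l + k * dForms l := by
  apply TrivSqZeroExt.ext
  · simp [dForms_apply]
  · simp only [dForms_apply, TrivSqZeroExt.fst_mul, TrivSqZeroExt.snd_inr, TrivSqZeroExt.snd_add,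
      DualNumber.snd_mul, TrivSqZeroExt.fst_inr, zero_mul, zero_add, d_mul]
    ring

theorem dForms_dForms (k : Forms) : dForms (dForms k) = 0 := by
  simp [dForms_apply]

theorem inr_mul_dForms (u : StepSpace) (k : Forms) : TrivSqZeroExt.inr u * dForms k = 0 := by
  rw [dForms_apply, TrivSqZeroExt.inr_mul_inr]

/-- The hypotheses exclude nonzero factors outside degrees 0 and 1: in degrees 2 and -2, for
instance, `gmul` is the ordinary product while the embeddings of both factors are zero. -/
theorem emb_gmul (r r' : ℤ) {u v : StepSpace} (hu : r ≠ 0 → r ≠ 1 → u = 0)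
    (hv : r' ≠ 0 → r' ≠ 1 → v = 0) : emb (r + r') (gmul r r' u v) = emb r u * emb r' v := by
  by_cases h0 : r = 0
  · subst h0
    have hg : gmul 0 r' u v = u * v := by simp [gmul]
    rw [hg, zero_add]
    by_cases h0' : r' = 0
    · subst h0'; simp [emb_zero_deg]
    by_cases h1' : r' = 1
    · subst h1'
      rw [emb_one_deg, emb_zero_deg, emb_one_deg, TrivSqZeroExt.inl_mul_inr]
      rfl
    · rw [emb_of_ne h0' h1']; simp
  by_cases h1 : r = 1
  · subst h1
    by_cases h0' : r' = 0
    · subst h0'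
      have hg : gmul 1 0 u v = u * v := by simp [gmul]
      rw [hg, add_zero, emb_one_deg, emb_one_deg, emb_zero_deg, TrivSqZeroExt.inr_mul_inl]
      rfl
    by_cases h1' : r' = 1
    · subst h1'
      rw [emb_one_deg, emb_one_deg, TrivSqZeroExt.inr_mul_inr]
      simp [gmul]
    · rw [hv h0' h1']; simp [gmul]
  · rw [hu h0 h1]; simp [gmul]

theorem emb_gd (r : ℤ) (u : StepSpace) : emb (r + 1) (gd r u) = dForms (emb r u) := by
  by_cases h0 : r = 0
  · subst h0; rfl
  · rw [gd, if_neg h0, map_zero]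
    by_cases h1 : r = 1
    · subst h1; rw [emb_one_deg, dForms_apply]; simp
    · rw [emb_of_ne h0 h1]; simp

end StepSpace

/-! ## Homological perturbation for words of forms -/

namespace LineConfig

open StepSpace Polynomial

variable {N : ℕ} (L : LineConfig N)

/-- The homogeneous forms of degree `r` in `Ω'_{ab}`. -/
noncomputable def omegaForms (a b : Fin N) (r : ℤ) : Submodule ℝ Forms :=
  (L.Omega a b r).map (emb r)

/-- The homogeneous forms of degree `r` in `V_{ab}`. -/
noncomputable def vForms (a b : Fin N) (r : ℤ) : Submodule ℝ Forms := (L.V a b r).map (emb r)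

/-- The homotopy on forms. -/
noncomputable def hForms (a b : Fin N) : Forms →ₗ[ℝ] Forms := emb 0 ∘ₗ L.homotopyOp a b ∘ₗ sndL

/-- The projection on forms. -/
noncomputable def pForms (a b : Fin N) : Forms →ₗ[ℝ] Forms :=
  emb 0 ∘ₗ L.projOp a b 0 ∘ₗ fstL + emb 1 ∘ₗ L.projOp a b 1 ∘ₗ sndL

theorem hForms_apply (a b : Fin N) (k : Forms) :
    L.hForms a b k = TrivSqZeroExt.inl (L.homotopyOp a b k.snd) := rfl

theorem hForms_self (a : Fin N) : L.hForms a a = 0 := by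
  rw [hForms, homotopyOp_self]; simp

theorem pForms_apply (a b : Fin N) (k : Forms) :
    L.pForms a b k = TrivSqZeroExt.inl (L.projOp a b 0 k.fst)
      + TrivSqZeroExt.inr (L.projOp a b 1 k.snd) := rfl

theorem pForms_self (a : Fin N) (k : Forms) : L.pForms a a k = k := by
  rw [pForms_apply, projOp_self, projOp_self]
  exact TrivSqZeroExt.inl_fst_add_inr_snd_eq k

theorem hForms_emb_one (a b : Fin N) (w : StepSpace) :
    L.hForms a b (emb 1 w) = emb 0 (L.homotopyOp a b w) := rfl

theorem hForms_emb_of_ne (a b : Fin N) {r : ℤ} (hr : r ≠ 1) (w : StepSpace) :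
    L.hForms a b (emb r w) = 0 := by
  rw [hForms_apply]
  by_cases h0 : r = 0
  · subst h0; rw [emb_zero_deg]; simp
  · rw [emb_of_ne h0 hr]; simp

theorem pForms_emb (a b : Fin N) (r : ℤ) (w : StepSpace) :
    L.pForms a b (emb r w) = emb r (L.projOp a b r w) := by
  rw [pForms_apply]
  by_cases h0 : r = 0
  · subst h0; simp [emb_zero_deg]
  by_cases h1 : r = 1
  · subst h1; simp [emb_one_deg]
  · rw [emb_of_ne h0 h1]; simp

theorem eq_zero_of_mem_Omega {a b : Fin N} {r : ℤ} {u : StepSpace} (hu : u ∈ L.Omega a b r) :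
    r ≠ 0 → r ≠ 1 → u = 0 := fun h0 h1 => by
  rwa [L.Omega_eq_bot h0 h1, Submodule.mem_bot] at hu

theorem mul_mem_omegaForms {a b c : Fin N} {r r' r₁ : ℤ} (h : r₁ = r + r') {k l : Forms}
    (hk : k ∈ L.omegaForms a b r) (hl : l ∈ L.omegaForms b c r') :
    k * l ∈ L.omegaForms a c r₁ := by
  obtain ⟨u, hu, rfl⟩ := hk
  obtain ⟨v, hv, rfl⟩ := hl
  subst h
  exact ⟨gmul r r' u v, L.gmul_mem rfl hu hv,
    emb_gmul r r' (L.eq_zero_of_mem_Omega hu) (L.eq_zero_of_mem_Omega hv)⟩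

theorem dForms_mem {a b : Fin N} {r : ℤ} {k : Forms} (hk : k ∈ L.omegaForms a b r) :
    dForms k ∈ L.omegaForms a b (r + 1) := by
  obtain ⟨u, hu, rfl⟩ := hk
  exact ⟨gd r u, L.gd_mem rfl hu, emb_gd r u⟩

theorem hForms_mem {a b : Fin N} {r : ℤ} {k : Forms} (hk : k ∈ L.omegaForms a b (r + 1)) :
    L.hForms a b k ∈ L.omegaForms a b r := by
  obtain ⟨u, hu, rfl⟩ := hk
  by_cases hr : r = 0
  · subst hr
    exact ⟨_, L.homotopyOp_mem a b u, rfl⟩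
  · rw [L.hForms_emb_of_ne a b (by omega)]
    exact Submodule.zero_mem _

theorem vForms_le (a b : Fin N) (r : ℤ) : L.vForms a b r ≤ L.omegaForms a b r :=
  Submodule.map_mono (L.V_le_Omega a b r)

theorem pForms_mem {a b : Fin N} (hab : a ≠ b) {r : ℤ} {k : Forms}
    (hk : k ∈ L.omegaForms a b r) : L.pForms a b k ∈ L.vForms a b r := by
  obtain ⟨u, hu, rfl⟩ := hk
  rw [pForms_emb]
  exact ⟨_, L.projOp_mem_V hab hu, rfl⟩

theorem contraction_forms {a b : Fin N} {r : ℤ} {k : Forms} (hk : k ∈ L.omegaForms a b r) :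
    dForms (L.hForms a b k) + L.hForms a b (dForms k) = k - L.pForms a b k := by
  obtain ⟨u, hu, rfl⟩ := hk
  rw [← emb_gd, pForms_emb]
  by_cases h0 : r = 0
  · subst h0
    rw [L.hForms_emb_of_ne a b zero_ne_one, map_zero, zero_add, zero_add, hForms_emb_one]
    have : gd 0 u = d u := rfl
    rw [this, L.homotopyOp_d hu, map_sub]
  by_cases h1 : r = 1
  · subst h1
    rw [hForms_emb_one, ← emb_gd, L.hForms_emb_of_ne a b (by norm_num), add_zero, zero_add]
    have : gd 0 (L.homotopyOp a b u) = d (L.homotopyOp a b u) := rfl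
    rw [this, L.d_homotopyOp hu, map_sub]
  · rw [L.eq_zero_of_mem_Omega hu h0 h1, gd]
    split_ifs; simp

theorem dForms_pForms {a b : Fin N} {r : ℤ} {k : Forms} (hk : k ∈ L.omegaForms a b r) :
    dForms (L.pForms a b k) = L.pForms a b (dForms k) := by
  have h1 := congrArg dForms (L.contraction_forms hk)
  have h2 := L.contraction_forms (L.dForms_mem hk)
  rw [map_add, dForms_dForms, zero_add, map_sub] at h1
  rw [dForms_dForms, map_zero, add_zero] at h2
  rw [h2] at h1
  exact (sub_right_inj.mp h1).symm

/-- A form together with a source, a target and a degree. -/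
structure Letter (N : ℕ) where
  src : Fin N
  tgt : Fin N
  deg : ℤ
  val : Forms

/-- The total suspended degree of a word. -/
def wdeg : List (Letter N) → ℤ
  | [] => 0
  | x :: l => (x.deg - 1) + wdeg l

theorem wdeg_append (p q : List (Letter N)) : wdeg (p ++ q) = wdeg p + wdeg q := by
  induction p with
  | nil => simp [wdeg]
  | cons x p ih => simp only [List.cons_append, wdeg, ih]; ring

/-- The sign `(-1)^{|o₁| + ⋯ + |oₙ|}` of a word. -/
noncomputable def wsign (w : List (Letter N)) : ℝ := (-1) ^ wdeg w

theorem wsign_append (p q : List (Letter N)) : wsign (p ++ q) = wsign p * wsign q := by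
  rw [wsign, wdeg_append, zpow_add₀ (by norm_num)]; rfl

theorem wsign_mul_self (w : List (Letter N)) : wsign w * wsign w = 1 := by
  rw [wsign, ← mul_zpow]; simp

theorem wsign_nil : wsign ([] : List (Letter N)) = 1 := by simp [wsign, wdeg]

/-- The target of a nonempty word. -/
def lastTgt : Letter N → List (Letter N) → Fin N
  | x, [] => x.tgt
  | _, y :: l => lastTgt y l

/-- The recursion for the perturbed inclusion, with a bound on the depth. -/
noncomputable def inclFuel : ℕ → List (Letter N) → Forms
  | 0, _ => 0
  | _ + 1, [] => 0
  | _ + 1, [x] => x.val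
  | n + 1, x :: y :: l => - L.hForms x.src (lastTgt y l)
      (splitSum (fun p q => wsign p • (inclFuel n p * inclFuel n q)) (x :: y :: l))

/-- The perturbed inclusion `g` on words. -/
noncomputable def incl (w : List (Letter N)) : Forms := L.inclFuel w.length w

/-- The sum `∑ m₂(g, g)` on words. -/
noncomputable def tree (w : List (Letter N)) : Forms :=
  splitSum (fun p q => wsign p • (L.incl p * L.incl q)) w

theorem inclFuel_nil (n : ℕ) : L.inclFuel n [] = 0 := by cases n <;> rfl

/-- An empty factor contributes zero, so the recursion is effectively on two strictly shorter words,
and any fuel not below the length of the word gives the same value. -/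
theorem inclFuel_eq (n : ℕ) (w : List (Letter N)) (hn : w.length ≤ n) :
    L.inclFuel n w = L.incl w := by
  suffices H : ∀ k (w : List (Letter N)), w.length = k → ∀ n m, k ≤ n → k ≤ m →
      L.inclFuel n w = L.inclFuel m w from H _ w rfl n _ hn le_rfl
  intro k
  induction k using Nat.strong_induction_on with
  | _ k ih =>
    intro w hw n m hn hm
    rcases w with _ | ⟨x, _ | ⟨y, l⟩⟩
    · rw [inclFuel_nil, inclFuel_nil]
    · simp only [List.length_cons, List.length_nil] at hw
      obtain ⟨n, rfl⟩ := Nat.exists_eq_add_of_le' (hw ▸ hn : 0 + 1 ≤ n)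
      obtain ⟨m, rfl⟩ := Nat.exists_eq_add_of_le' (hw ▸ hm : 0 + 1 ≤ m)
      rfl
    · have hk : 1 ≤ k := by rw [← hw]; simp
      obtain ⟨n, rfl⟩ := Nat.exists_eq_add_of_le' (hk.trans hn)
      obtain ⟨m, rfl⟩ := Nat.exists_eq_add_of_le' (hk.trans hm)
      simp only [inclFuel]
      congr 2
      refine splitSum_congr fun p q hpq => ?_
      have hlen : p.length + q.length = k := by rw [← hw, ← hpq, List.length_append]
      rcases p with _ | ⟨z, p⟩
      · rw [inclFuel_nil, inclFuel_nil, zero_mul, zero_mul]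
      rcases q with _ | ⟨z', q⟩
      · rw [inclFuel_nil, inclFuel_nil, mul_zero, mul_zero]
      simp only [List.length_cons] at hlen
      rw [ih (p.length + 1) (by omega) (z :: p) rfl n m (by omega) (by omega),
        ih (q.length + 1) (by omega) (z' :: q) rfl n m (by omega) (by omega)]

theorem incl_nil : L.incl [] = 0 := rfl

theorem incl_single (x : Letter N) : L.incl [x] = x.val := rfl

theorem incl_cons_cons (x y : Letter N) (l : List (Letter N)) :
    L.incl (x :: y :: l) = - L.hForms x.src (lastTgt y l) (L.tree (x :: y :: l)) := by
  have : L.incl (x :: y :: l) = - L.hForms x.src (lastTgt y l)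
      (splitSum (fun p q => wsign p • (L.inclFuel (l.length + 1) p * L.inclFuel (l.length + 1) q))
        (x :: y :: l)) := rfl
  rw [this, tree]
  refine congrArg (fun k => - L.hForms x.src (lastTgt y l) k) (splitSum_congr fun p q hpq => ?_)
  have hlen : p.length + q.length = l.length + 2 := by rw [← List.length_append, hpq]; rfl
  rcases p with _ | ⟨z, p⟩
  · rw [inclFuel_nil, incl_nil, zero_mul, zero_mul]
  rcases q with _ | ⟨z', q⟩
  · rw [inclFuel_nil, incl_nil, mul_zero, mul_zero]
  simp only [List.length_cons] at hlen
  rw [inclFuel_eq _ _ _ (by simp only [List.length_cons]; omega),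
    inclFuel_eq _ _ _ (by simp only [List.length_cons]; omega)]

theorem tree_nil : L.tree [] = 0 := by simp [tree, splitSum, incl_nil]

theorem tree_single (x : Letter N) : L.tree [x] = 0 := by simp [tree, splitSum, incl_nil]

/-- The transferred operations on words, in the suspensions. -/
noncomputable def prod : List (Letter N) → Forms
  | [] => 0
  | [x] => dForms x.val
  | x :: y :: l => L.pForms x.src (lastTgt y l) (L.tree (x :: y :: l))

/-- The product of a nonempty word, as a letter. -/
noncomputable def prodLetter (x : Letter N) (l : List (Letter N)) : Letter N :=
  ⟨x.src, lastTgt x l, wdeg (x :: l) + 2, L.prod (x :: l)⟩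

/-- `∑ (-1)^{|p|} F(p, μ(u), q)` over all decompositions `w = p ++ u ++ q` with `u` nonempty. -/
noncomputable def insertProd (F : List (Letter N) → Forms) (w : List (Letter N)) : Forms :=
  splitSum (fun p r => splitSum (fun u q => match u with
    | [] => 0
    | x :: l => wsign p • F (p ++ L.prodLetter x l :: q)) r) w

theorem insertProd_nil (F : List (Letter N) → Forms) : L.insertProd F [] = 0 := rfl

/-- The transferred operations have suspended degree one, so replacing a subword by its product
changes the parity. -/
theorem wsign_prodLetter (p : List (Letter N)) (x : Letter N) (l q : List (Letter N)) :
    wsign (p ++ L.prodLetter x l :: q) = - wsign (p ++ (x :: l) ++ q) := by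
  have : wdeg (p ++ L.prodLetter x l :: q) = wdeg (p ++ (x :: l) ++ q) + 1 := by
    simp only [wdeg_append, wdeg, prodLetter]; ring
  rw [wsign, this, zpow_add_one₀ (by norm_num), wsign]; ring

section
variable {M M' : Type*} [AddCommGroup M] [AddCommGroup M']

theorem splitSum_mul_left (k : Forms) (f : List (Letter N) → List (Letter N) → Forms)
    (w : List (Letter N)) : k * splitSum f w = splitSum (fun p q => k * f p q) w :=
  splitSum_map (AddMonoidHom.mulLeft k) f w

theorem splitSum_mul_right (k : Forms) (f : List (Letter N) → List (Letter N) → Forms)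
    (w : List (Letter N)) : splitSum f w * k = splitSum (fun p q => f p q * k) w :=
  splitSum_map (AddMonoidHom.mulRight k) f w

theorem splitSum_smul (c : ℝ) (f : List (Letter N) → List (Letter N) → Forms)
    (w : List (Letter N)) : c • splitSum f w = splitSum (fun p q => c • f p q) w :=
  splitSum_map (DistribSMul.toAddMonoidHom Forms c) f w

theorem splitSum_neg (f : List (Letter N) → List (Letter N) → Forms)
    (w : List (Letter N)) : - splitSum f w = splitSum (fun p q => - f p q) w :=
  splitSum_map (negAddMonoidHom : Forms →+ Forms) f w

end

/-- Inserting products is a coderivation. -/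
theorem insertProd_tree (w : List (Letter N)) :
    L.insertProd L.tree w =
      splitSum (fun p q => - (wsign p • (L.insertProd L.incl p * L.incl q))
        + L.incl p * L.insertProd L.incl q) w := by
  -- After the insertion, the cut made by the tree sum lies to the left or to the right of the new
  -- letter. Regrouping by the corresponding cut of the original word gives an insertion in the
  -- right or in the left factor.
  have h1 : L.insertProd L.tree w =
      splitSum (fun p r => splitSum (fun u q => splitSum (fun p₁ p₂ => match u with
        | [] => 0
        | x :: l => (wsign p * wsign p₁) • (L.incl p₁ * L.incl (p₂ ++ L.prodLetter x l :: q))) p) r) w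
      + splitSum (fun p r => splitSum (fun u q => splitSum (fun q₁ q₂ => match u with
        | [] => 0
        | x :: l => (wsign p * wsign (p ++ L.prodLetter x l :: q₁)) •
          (L.incl (p ++ L.prodLetter x l :: q₁) * L.incl q₂)) q) r) w := by
    rw [← splitSum_add]
    refine splitSum_congr fun p r _ => ?_
    rw [← splitSum_add]
    refine splitSum_congr fun u q _ => ?_
    rcases u with _ | ⟨x, l⟩
    · simp only [splitSum_zero, add_zero]
    · simp only [tree, splitSum_append_cons, smul_add, splitSum_smul, smul_smul]
  rw [h1, splitSum_add, add_comm]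
  congr 1
  · have h2 : ∀ p r : List (Letter N), splitSum (fun u q => splitSum (fun q₁ q₂ => match u with
        | [] => (0 : Forms)
        | x :: l => (wsign p * wsign (p ++ L.prodLetter x l :: q₁)) •
          (L.incl (p ++ L.prodLetter x l :: q₁) * L.incl q₂)) q) r
        = splitSum (fun r₁ q₂ => splitSum (fun u q₁ => match u with
        | [] => (0 : Forms)
        | x :: l => (wsign p * wsign (p ++ L.prodLetter x l :: q₁)) •
          (L.incl (p ++ L.prodLetter x l :: q₁) * L.incl q₂)) r₁) r := fun p r =>
      (splitSum_assoc _ r).symm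
    simp only [h2]
    rw [← splitSum_assoc]
    refine splitSum_congr fun w₁ q₂ _ => ?_
    rw [insertProd, splitSum_mul_right, splitSum_smul, splitSum_neg]
    refine splitSum_congr fun p r hpr => ?_
    rw [splitSum_mul_right, splitSum_smul, splitSum_neg]
    refine splitSum_congr fun u q₁ huq => ?_
    rcases u with _ | ⟨x, l⟩
    · simp
    · simp only
      rw [wsign_prodLetter, List.append_assoc, huq, hpr, smul_mul_assoc, smul_smul, ← neg_smul]
      congr 1
      ring
  · have h2 : ∀ p r : List (Letter N), splitSum (fun u q => splitSum (fun p₁ p₂ => match u with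
        | [] => (0 : Forms)
        | x :: l => (wsign p * wsign p₁) • (L.incl p₁ * L.incl (p₂ ++ L.prodLetter x l :: q))) p) r
        = splitSum (fun p₁ p₂ => splitSum (fun u q => match u with
        | [] => (0 : Forms)
        | x :: l => (wsign (p₁ ++ p₂) * wsign p₁) •
            (L.incl p₁ * L.incl (p₂ ++ L.prodLetter x l :: q))) r) p := fun p r => by
      rw [splitSum_comm]
      refine splitSum_congr fun p₁ p₂ hp => ?_
      rw [hp]
    simp only [h2]
    rw [splitSum_assoc]
    refine splitSum_congr fun p₁ s _ => ?_
    rw [insertProd, splitSum_mul_left]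
    refine splitSum_congr fun p₂ r _ => ?_
    rw [splitSum_mul_left]
    refine splitSum_congr fun u q _ => ?_
    rcases u with _ | ⟨x, l⟩
    · simp
    · simp only
      rw [wsign_append, mul_comm (wsign p₁), mul_assoc, wsign_mul_self, mul_one, mul_smul_comm]

/-- Associativity. -/
theorem tree_assoc (w : List (Letter N)) :
    splitSum (fun p q => wsign p • (L.tree p * L.incl q)) w
      = splitSum (fun p q => L.incl p * L.tree q) w := by
  have h1 : ∀ p q : List (Letter N), wsign p • (L.tree p * L.incl q)
      = splitSum (fun a b => wsign b • (L.incl a * L.incl b * L.incl q)) p := fun p q => by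
    rw [tree, splitSum_mul_right, splitSum_smul]
    refine splitSum_congr fun a b hab => ?_
    rw [← hab, wsign_append, smul_mul_assoc, smul_smul, mul_comm (wsign a), mul_assoc,
      wsign_mul_self, mul_one]
  simp only [h1]
  rw [splitSum_assoc]
  refine splitSum_congr fun a s _ => ?_
  rw [tree, splitSum_mul_left]
  refine splitSum_congr fun b r _ => ?_
  rw [mul_smul_comm, mul_assoc]

/-- Words of composable letters of the category of lines. -/
def IsWord : Fin N → Fin N → List (Letter N) → Prop
  | a, b, [] => a = b
  | a, b, x :: l => x.src = a ∧ x.val ∈ L.vForms x.src x.tgt x.deg ∧ IsWord x.tgt b l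

theorem IsWord.append_iff {a c : Fin N} {p q : List (Letter N)} :
    L.IsWord a c (p ++ q) ↔ ∃ b, L.IsWord a b p ∧ L.IsWord b c q := by
  induction p generalizing a with
  | nil => simp [IsWord]
  | cons x p ih =>
    simp only [List.cons_append, IsWord, ih]
    constructor
    · rintro ⟨h1, h2, b, h3, h4⟩; exact ⟨b, ⟨h1, h2, h3⟩, h4⟩
    · rintro ⟨b, ⟨h1, h2, h3⟩, h4⟩; exact ⟨h1, h2, b, h3, h4⟩

theorem IsWord.lastTgt {a b : Fin N} {x : Letter N} {l : List (Letter N)}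
    (h : L.IsWord a b (x :: l)) : lastTgt x l = b := by
  induction l generalizing a x with
  | nil => exact h.2.2
  | cons y l ih => exact ih h.2.2

theorem incl_mem {a b : Fin N} {w : List (Letter N)} (hw : L.IsWord a b w) (h0 : w ≠ []) :
    L.incl w ∈ L.omegaForms a b (wdeg w + 1) ∧ L.tree w ∈ L.omegaForms a b (wdeg w + 2) := by
  suffices H : ∀ n (w : List (Letter N)), w.length = n → ∀ a b, L.IsWord a b w → w ≠ [] →
      L.incl w ∈ L.omegaForms a b (wdeg w + 1) ∧ L.tree w ∈ L.omegaForms a b (wdeg w + 2) from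
    H _ w rfl a b hw h0
  intro n
  induction n using Nat.strong_induction_on with
  | _ n ih =>
    intro w hwn a b hw h0
    have ht : L.tree w ∈ L.omegaForms a b (wdeg w + 2) := by
      refine splitSum_induction (P := fun k => k ∈ L.omegaForms a b (wdeg w + 2))
        (fun _ _ => Submodule.add_mem _) fun p q hpq => ?_
      rcases p with _ | ⟨z, p⟩
      · rw [incl_nil, zero_mul, smul_zero]; exact Submodule.zero_mem _
      rcases q with _ | ⟨z', q⟩
      · rw [incl_nil, mul_zero, smul_zero]; exact Submodule.zero_mem _
      have hlen := congrArg List.length hpq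
      simp only [List.length_append, List.length_cons] at hlen
      have hw' := hw
      rw [← hpq, IsWord.append_iff] at hw'
      obtain ⟨c, hp, hq⟩ := hw'
      have h1 := (ih _ (by simp only [List.length_cons]; omega) (z :: p) rfl a c hp
        (List.cons_ne_nil _ _)).1
      have h2 := (ih _ (by simp only [List.length_cons]; omega) (z' :: q) rfl c b hq
        (List.cons_ne_nil _ _)).1
      refine Submodule.smul_mem _ _ (L.mul_mem_omegaForms ?_ h1 h2)
      rw [← hpq, wdeg_append]; ring
    refine ⟨?_, ht⟩
    rcases w with _ | ⟨x, _ | ⟨y, l⟩⟩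
    · exact absurd rfl h0
    · obtain ⟨rfl, hx, hb⟩ := hw
      have hb : x.tgt = b := hb
      subst hb
      have : wdeg [x] + 1 = x.deg := by simp [wdeg]
      rw [this]
      exact L.vForms_le _ _ _ hx
    · have hl : lastTgt y l = b := hw.lastTgt
      obtain ⟨rfl, -, -⟩ := hw
      rw [incl_cons_cons, hl]
      refine Submodule.neg_mem _ (L.hForms_mem ?_)
      rwa [add_assoc]

/-- Only a degree zero value of g survives multiplication by an exact one-form, and then the
suspended degree of the word is -1. This supplies the sign with which d passes the left factor. -/
theorem smul_incl_mul_dForms {a b : Fin N} {w : List (Letter N)} (hw : L.IsWord a b w) (k : Forms) :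
    wsign w • (L.incl w * dForms k) = - (L.incl w * dForms k) := by
  rcases eq_or_ne w [] with rfl | h0
  · simp [incl_nil]
  obtain ⟨u, hu, hw'⟩ := (L.incl_mem hw h0).1
  by_cases h1 : wdeg w + 1 = 1
  · rw [← hw', h1, emb_one_deg, inr_mul_dForms]; simp
  by_cases h2 : wdeg w + 1 = 0
  · have : wdeg w = -1 := by omega
    rw [wsign, this]
    simp
  · rw [← hw', emb_of_ne h2 h1]; simp

/-- The relation between the differential of the trees and the insertion of products, given the
functor relation on shorter words. -/
theorem dForms_tree {a b : Fin N} {w : List (Letter N)} (hw : L.IsWord a b w)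
    (hrel : ∀ v : List (Letter N), v.length < w.length → ∀ c e, L.IsWord c e v →
      dForms (L.incl v) + L.tree v = L.insertProd L.incl v) :
    dForms (L.tree w) = - L.insertProd L.tree w := by
  rw [insertProd_tree, splitSum_neg]
  -- Associativity in the form of a vanishing sum. Adding it to the expansion of dT turns each dg
  -- into dg + T, which the hypothesis identifies with the insertion of products.
  have h1 : splitSum (fun p q => wsign p • (L.tree p * L.incl q) - L.incl p * L.tree q) w = 0 := by
    have h := L.tree_assoc w
    simp only [sub_eq_add_neg]
    rw [splitSum_add, ← splitSum_neg, h, add_neg_cancel]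
  have h2 : dForms (L.tree w)
      = splitSum (fun p q => dForms (wsign p • (L.incl p * L.incl q))) w :=
    splitSum_map dForms.toAddMonoidHom _ w
  rw [h2, ← add_zero (splitSum _ w), ← h1, ← splitSum_add]
  refine splitSum_congr fun p q hpq => ?_
  rcases eq_or_ne p [] with rfl | hp0
  · simp [incl_nil, tree_nil, insertProd_nil]
  rcases eq_or_ne q [] with rfl | hq0
  · simp [incl_nil, tree_nil, insertProd_nil]
  have hlen := congrArg List.length hpq
  rw [List.length_append] at hlen
  have hp1 := List.length_pos_iff.mpr hp0
  have hq1 := List.length_pos_iff.mpr hq0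
  have hw' := hw
  rw [← hpq, IsWord.append_iff] at hw'
  obtain ⟨c, hp, hq⟩ := hw'
  rw [← hrel p (by omega) a c hp, ← hrel q (by omega) c b hq, map_smul, dForms_mul, smul_add,
    L.smul_incl_mul_dForms hp]
  rw [add_mul, smul_add, mul_add]
  abel

/-- The letters of a word, as one-forms, are supported on the lines at either end. -/
theorem snd_mem_of_vForms {a b : Fin N} {r : ℤ} {k : Forms} (hk : k ∈ L.vForms a b r) :
    k.snd ∈ A1 (L.S a) ∧ k.snd ∈ A1 (L.S b) := by
  obtain ⟨u, hu, rfl⟩ := hk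
  by_cases h1 : r = 1
  · subst h1
    rw [emb_one_deg, TrivSqZeroExt.snd_inr]
    by_cases hab : a = b
    · subst hab
      rw [SetLike.mem_coe, V_self_one] at hu
      exact ⟨hu, hu⟩
    by_cases hr : 1 = L.vdeg a b
    · rw [SetLike.mem_coe, hr, L.V_of_ne hab, Submodule.mem_span_singleton] at hu
      obtain ⟨c, rfl⟩ := hu
      have hlt : ¬ L.t a < L.t b := fun h => by
        rw [L.vdeg_lt h] at hr; exact one_ne_zero hr
      rw [L.e_gt (L.lt_of_not_lt hab hlt)]
      exact ⟨Submodule.smul_mem _ _ (delta_mem_A1 (L.xv_mem_S hab)),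
        Submodule.smul_mem _ _ (delta_mem_A1 (L.xv_mem_S' hab))⟩
    · rw [SetLike.mem_coe, L.V_of_ne_bot hab hr, Submodule.mem_bot] at hu
      rw [hu]
      exact ⟨Submodule.zero_mem _, Submodule.zero_mem _⟩
  · have : (emb r u).snd = 0 := by
      by_cases h0 : r = 0
      · subst h0; rfl
      · rw [emb_of_ne h0 h1]; rfl
    rw [this]
    exact ⟨Submodule.zero_mem _, Submodule.zero_mem _⟩

theorem incl_snd_of_long (x y : Letter N) (l : List (Letter N)) : (L.incl (x :: y :: l)).snd = 0 := by
  rw [incl_cons_cons, hForms_apply]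
  simp

theorem mul_mem_A1_of_mem {a : Fin N} (u : StepSpace) {w : StepSpace} (hw : w ∈ A1 (L.S a)) :
    u * w ∈ A1 (L.S a) := by
  rw [← coe_Sfin', mem_A1_iff] at hw ⊢
  intro x hx
  rw [Pi.mul_apply, hw x hx, mul_zero]

/-- In a product g(p) g(q) a one-form factor can come only from a single letter, as g has degree
zero on longer words. Such a letter is the first one of the word, starting at a, or the last one,
ending at a; multiplying it by a function does not enlarge its support. -/
theorem tree_snd_mem {a : Fin N} {w : List (Letter N)} (hw : L.IsWord a a w) :
    (L.tree w).snd ∈ A1 (L.S a) := by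
  refine splitSum_induction (P := fun k : Forms => k.snd ∈ A1 (L.S a))
    (fun x y hx hy => Submodule.add_mem _ hx hy) fun p q hpq => ?_
  rw [← hpq, IsWord.append_iff] at hw
  obtain ⟨c, hp, hq⟩ := hw
  have h1 : (L.incl p).snd ∈ A1 (L.S a) := by
    rcases p with _ | ⟨x, _ | ⟨y, l⟩⟩
    · exact Submodule.zero_mem _
    · obtain ⟨rfl, hx, -⟩ := hp
      exact (L.snd_mem_of_vForms hx).1
    · rw [incl_snd_of_long]; exact Submodule.zero_mem _
  have h2 : (L.incl q).snd ∈ A1 (L.S a) := by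
    rcases q with _ | ⟨x, _ | ⟨y, l⟩⟩
    · exact Submodule.zero_mem _
    · obtain ⟨rfl, hx, hb⟩ := hq
      have hb : x.tgt = a := hb
      subst hb
      exact (L.snd_mem_of_vForms hx).2
    · rw [incl_snd_of_long]; exact Submodule.zero_mem _
  rw [TrivSqZeroExt.snd_smul, DualNumber.snd_mul]
  refine Submodule.smul_mem _ _ (Submodule.add_mem _ (L.mul_mem_A1_of_mem _ h2) ?_)
  rw [mul_comm]
  exact L.mul_mem_A1_of_mem _ h1

theorem dForms_mem_vForms {a b : Fin N} {r : ℤ} {k : Forms} (hk : k ∈ L.vForms a b r) :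
    dForms k ∈ L.vForms a b (r + 1) := by
  obtain ⟨u, hu, rfl⟩ := hk
  rw [← emb_gd]
  refine ⟨_, ?_, rfl⟩
  rw [SetLike.mem_coe] at hu ⊢
  unfold gd
  split_ifs with h0
  · subst h0
    by_cases hab : a = b
    · subst hab
      rw [V_self_zero] at hu
      rw [zero_add, V_self_one]
      exact d_mem_A1 (A0_le_tildeA0 hu)
    by_cases hr : 0 = L.vdeg a b
    · rw [hr, L.V_of_ne hab, Submodule.mem_span_singleton] at hu
      obtain ⟨c, rfl⟩ := hu
      have hlt : L.t a < L.t b := by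
        by_contra h
        rw [L.vdeg_gt (L.lt_of_not_lt hab h)] at hr; exact zero_ne_one hr
      have : d (L.expf a b) = 0 := by
        have := L.d_expf_mul a b 1
        rw [mul_one, ← map_one (algebraMap ℝ StepSpace), d_algebraMap, mul_zero] at this
        exact this
      rw [L.e_lt hlt, map_smul, map_smul, this]
      simp
    · rw [L.V_of_ne_bot hab hr, Submodule.mem_bot] at hu
      rw [hu, map_zero]; exact Submodule.zero_mem _
  · exact Submodule.zero_mem _

theorem lastTgt_append_cons (y : Letter N) (p : List (Letter N)) (x : Letter N)
    (q : List (Letter N)) : lastTgt y (p ++ x :: q) = lastTgt x q := by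
  induction p generalizing y with
  | nil => rfl
  | cons z p ih => exact ih z

theorem incl_cons_append_cons (z : Letter N) (p : List (Letter N)) (x : Letter N)
    (q : List (Letter N)) : L.incl (z :: (p ++ x :: q))
      = - L.hForms z.src (lastTgt x q) (L.tree (z :: (p ++ x :: q))) := by
  cases p with
  | nil => exact L.incl_cons_cons z x q
  | cons y p =>
    rw [List.cons_append, incl_cons_cons, lastTgt_append_cons]

theorem prod_cons_append_cons (z : Letter N) (p : List (Letter N)) (x : Letter N)
    (q : List (Letter N)) : L.prod (z :: (p ++ x :: q))
      = L.pForms z.src (lastTgt x q) (L.tree (z :: (p ++ x :: q))) := by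
  cases p with
  | nil => rfl
  | cons y p =>
    rw [List.cons_append, prod, lastTgt_append_cons]

theorem lastTgt_prodLetter {a b : Fin N} {x : Letter N} {l q : List (Letter N)}
    (hw : L.IsWord a b (x :: l ++ q)) : lastTgt (L.prodLetter x l) q = b := by
  cases q with
  | nil =>
    rw [List.append_nil] at hw
    exact hw.lastTgt
  | cons y q =>
    obtain ⟨c, -, hc⟩ := (IsWord.append_iff L).mp hw
    exact hc.lastTgt

/-- Inserting the product of the whole word leaves a single letter, on which F need not be given by
op; as the tree sum of a single letter is zero, this term can be split off and op passes through all
the others. It serves for F = g with op = -h, and for the transferred product with op = P. -/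
theorem insertProd_eq_of_op {a b : Fin N} {x y : Letter N} {l : List (Letter N)}
    (hw : L.IsWord a b (x :: y :: l)) (F : List (Letter N) → Forms) (op : Forms →ₗ[ℝ] Forms)
    (hF : ∀ z z' v, z.src = a → lastTgt z' v = b → F (z :: z' :: v) = op (L.tree (z :: z' :: v))) :
    L.insertProd F (x :: y :: l)
      = F [L.prodLetter x (y :: l)] + op (L.insertProd L.tree (x :: y :: l)) := by
  have e1 : op (L.insertProd L.tree (x :: y :: l))
      = splitSum (fun p r => splitSum (fun u q => match u with
        | [] => 0
        | z :: v => wsign p • op (L.tree (p ++ L.prodLetter z v :: q))) r)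
        (x :: y :: l) := by
    rw [insertProd]
    refine (splitSum_map op.toAddMonoidHom _ _).trans ?_
    refine splitSum_congr fun p r _ => ?_
    refine (splitSum_map op.toAddMonoidHom _ _).trans ?_
    refine splitSum_congr fun u q _ => ?_
    rcases u with _ | ⟨z, v⟩
    · exact map_zero _
    · exact map_smul op _ _
  have e2 : F [L.prodLetter x (y :: l)] = splitSum (fun p r => splitSum (fun u q =>
      if p = [] ∧ q = [] then F [L.prodLetter x (y :: l)] else 0) r) (x :: y :: l) := by
    rw [splitSum_eq_left fun p q _ hp => splitSum_eq_zero fun _ _ _ => if_neg fun h => hp h.1,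
      splitSum_eq_right fun p q _ hq => if_neg fun h => hq h.2]
    simp
  rw [e1]
  conv_rhs => rw [e2]
  rw [insertProd, ← splitSum_add]
  refine splitSum_congr fun p r hpr => ?_
  rw [← splitSum_add]
  refine splitSum_congr fun u q huq => ?_
  rcases u with _ | ⟨z, v⟩
  · rw [if_neg, add_zero]
    rintro ⟨rfl, rfl⟩
    rw [← huq] at hpr
    exact List.cons_ne_nil _ _ hpr.symm
  rw [← hpr, ← huq] at hw
  obtain ⟨c, -, hc⟩ := (IsWord.append_iff L).mp hw
  have hlast := L.lastTgt_prodLetter hc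
  dsimp only
  rcases p with _ | ⟨p₁, p⟩
  · rcases q with _ | ⟨q₁, q⟩
    · rw [if_pos ⟨rfl, rfl⟩]
      have : z :: v = x :: y :: l := by rw [← hpr, ← huq]; simp
      injection this with h1 h2
      rw [List.nil_append, tree_single, map_zero, smul_zero, add_zero, wsign_nil, one_smul, h1, h2]
    · rw [if_neg (by simp), zero_add, List.nil_append, hF (L.prodLetter z v) q₁ q hw.1 hlast]
  · rw [if_neg (by simp), zero_add, List.cons_append]
    rcases p with _ | ⟨p₂, p⟩
    · rw [List.nil_append, hF _ _ _ hw.1 hlast]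
    · rw [List.cons_append, hF _ _ _ hw.1 (by rw [lastTgt_append_cons, hlast])]

/-- The functor relation and closedness of the category of lines under the products. -/
theorem incl_relation_and_prod_mem {a b : Fin N} {w : List (Letter N)} (hw : L.IsWord a b w) :
    dForms (L.incl w) + L.tree w = L.insertProd L.incl w ∧
      dForms (L.tree w) = - L.insertProd L.tree w ∧
      (w ≠ [] → L.prod w ∈ L.vForms a b (wdeg w + 2)) := by
  suffices H : ∀ n (w : List (Letter N)), w.length = n → ∀ a b, L.IsWord a b w →
      dForms (L.incl w) + L.tree w = L.insertProd L.incl w ∧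
      dForms (L.tree w) = - L.insertProd L.tree w ∧
      (w ≠ [] → L.prod w ∈ L.vForms a b (wdeg w + 2)) from H _ w rfl a b hw
  intro n
  induction n using Nat.strong_induction_on with
  | _ n ih =>
    intro w hwn a b hw
    have hd : dForms (L.tree w) = - L.insertProd L.tree w :=
      L.dForms_tree hw fun v hv c e hcv => (ih _ (hwn ▸ hv) v rfl c e hcv).1
    rcases w with _ | ⟨x, _ | ⟨y, l⟩⟩
    · simp [incl_nil, tree_nil, insertProd_nil]
    · refine ⟨?_, hd, fun _ => ?_⟩
      · rw [incl_single, tree_single]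
        simp only [insertProd, splitSum, List.nil_append, wsign_nil, incl_single,
          prodLetter, prod, one_smul]
        simp
      · obtain ⟨rfl, hx, hb⟩ := hw
        have hb : x.tgt = b := hb
        subst hb
        have : wdeg [x] + 2 = x.deg + 1 := by simp only [wdeg]; ring
        rw [this]
        exact L.dForms_mem_vForms hx
    · have hl : lastTgt y l = b := hw.lastTgt
      have hsrc : x.src = a := hw.1
      have htree := (L.incl_mem hw (List.cons_ne_nil _ _)).2
      have hprod : L.prod (x :: y :: l) = L.pForms a b (L.tree (x :: y :: l)) := by
        rw [prod, hl, hsrc]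
      refine ⟨?_, hd, fun _ => ?_⟩
      · have h1 : L.insertProd L.incl (x :: y :: l)
            = L.prod (x :: y :: l) + (- L.hForms a b) (L.insertProd L.tree (x :: y :: l)) := by
          refine L.insertProd_eq_of_op hw L.incl (- L.hForms a b) fun z z' v hz hv => ?_
          rw [incl_cons_cons, hz, hv]
          rfl
        rw [h1, hprod, incl_cons_cons, hl, hsrc, map_neg, LinearMap.neg_apply, ← neg_neg (L.insertProd L.tree _), ← hd,
          map_neg]
        -- The left side is -dhT + T and the right side is PT + h dT, using DT = -dT; this is the
        -- contraction identity applied to T.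
        linear_combination -L.contraction_forms htree
      · rw [hprod]
        -- For a = b the projection is the identity, so membership in V_aa has to come from the
        -- support. In degree one this is `tree_snd_mem`; in degree zero the same lemma is applied
        -- to the words occurring in dT = -DT, whose inserted letters lie in the category of lines
        -- by induction.
        by_cases hab : a = b
        · subst hab
          rw [pForms_self]
          obtain ⟨u, hu, huw⟩ := htree
          have hsnd := L.tree_snd_mem hw
          rw [← huw]
          refine ⟨u, ?_, rfl⟩
          by_cases h0 : wdeg (x :: y :: l) + 2 = 0
          · rw [h0] at hu huw ⊢
            rw [SetLike.mem_coe, V_self_zero]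
            refine L.mem_A0_of_d_mem hu ?_
            have h1 : d u = (dForms (L.tree (x :: y :: l))).snd := by
              rw [← huw]; rfl
            rw [h1, hd, TrivSqZeroExt.snd_neg]
            refine Submodule.neg_mem _ ?_
            refine splitSum_induction (P := fun k : Forms => k.snd ∈ A1 (L.S a))
              (fun x y hx hy => Submodule.add_mem _ hx hy) fun p r hpr => ?_
            refine splitSum_induction (P := fun k : Forms => k.snd ∈ A1 (L.S a))
              (fun x y hx hy => Submodule.add_mem _ hx hy) fun v q hvq => ?_
            rcases v with _ | ⟨z, v⟩
            · exact Submodule.zero_mem _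
            simp only [TrivSqZeroExt.snd_smul]
            refine Submodule.smul_mem _ _ ?_
            rw [← hpr, ← hvq] at hw
            obtain ⟨c, hp, hc⟩ := IsWord.append_iff L |>.mp hw
            obtain ⟨e, hv, hq⟩ := IsWord.append_iff L |>.mp hc
            by_cases hpq : p = [] ∧ q = []
            · rw [hpq.1, hpq.2, List.nil_append, tree_single]; exact Submodule.zero_mem _
            refine L.tree_snd_mem (IsWord.append_iff L |>.mpr ⟨c, hp, hv.1, ?_, ?_⟩)
            · have hlen : (z :: v).length < n := by
                rw [← hwn, ← hpr, ← hvq, List.length_append, List.length_append]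
                rw [not_and_or] at hpq
                rcases hpq with h | h
                · have := List.length_pos_iff.mpr h; omega
                · have := List.length_pos_iff.mpr h; omega
              have := (ih _ hlen (z :: v) rfl c e hv).2.2 (List.cons_ne_nil _ _)
              have h3 : lastTgt z v = e := hv.lastTgt
              simp only [prodLetter]
              rwa [h3, hv.1]
            · simp only [prodLetter]
              rwa [hv.lastTgt]
          by_cases h1 : wdeg (x :: y :: l) + 2 = 1
          · rw [h1] at huw ⊢
            rw [SetLike.mem_coe, V_self_one]
            rw [← huw] at hsnd
            exact hsnd
          · rw [SetLike.mem_coe, L.eq_zero_of_mem_Omega hu h0 h1]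
            exact Submodule.zero_mem _
        · exact L.pForms_mem hab htree

/-- The `A∞`-relations on words, in the suspensions. -/
theorem insertProd_prod {a b : Fin N} {w : List (Letter N)} (hw : L.IsWord a b w) :
    L.insertProd L.prod w = 0 := by
  rcases w with _ | ⟨x, _ | ⟨y, l⟩⟩
  · rfl
  · simp only [insertProd, splitSum, List.nil_append, wsign_nil, prodLetter, prod, one_smul,
      dForms_dForms]
    simp
  · have hl : lastTgt y l = b := hw.lastTgt
    have htree := (L.incl_mem hw (List.cons_ne_nil _ _)).2
    rw [L.insertProd_eq_of_op hw L.prod (L.pForms a b) fun z z' v hz hv => by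
      rw [prod, hz, hv]]
    have h1 : L.prod [L.prodLetter x (y :: l)] = dForms (L.pForms a b (L.tree (x :: y :: l))) := by
      rw [prod, prodLetter, prod, hl, hw.1]
    -- The two contributions are dPT and P(DT) = -P(dT), and d commutes with P.
    rw [h1, L.dForms_pForms htree, (L.incl_relation_and_prod_mem hw).2.1, map_neg, neg_add_cancel]

/-- Linearity of an operation on words in one of the letters. -/
def IsMultilinear (F : List (Letter N) → Forms) : Prop :=
  ∀ (p q : List (Letter N)) (a b : Fin N) (r : ℤ) (c : ℝ) (k k' : Forms),
    F (p ++ ⟨a, b, r, c • k + k'⟩ :: q) = c • F (p ++ ⟨a, b, r, k⟩ :: q) + F (p ++ ⟨a, b, r, k'⟩ :: q)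

theorem wsign_congr (p q : List (Letter N)) (a b : Fin N) (r : ℤ) (k k' : Forms) :
    wsign (p ++ ⟨a, b, r, k⟩ :: q) = wsign (p ++ ⟨a, b, r, k'⟩ :: q) := by
  simp only [wsign, wdeg_append, wdeg]

theorem lastTgt_congr (q : List (Letter N)) (a b : Fin N) (r : ℤ) (k k' : Forms) :
    lastTgt ⟨a, b, r, k⟩ q = lastTgt ⟨a, b, r, k'⟩ q := by
  cases q <;> rfl

/-- The tree sum of a word uses g only on shorter words, and on at least two letters g is a linear
image of the tree sum; the induction runs over the number of the remaining letters and treats both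
together. -/
theorem isMultilinear_incl_tree : IsMultilinear L.incl ∧ IsMultilinear L.tree := by
  have key : ∀ (n : ℕ), (∀ (p q : List (Letter N)) (a b : Fin N) (r : ℤ) (c : ℝ) (k k' : Forms),
      p.length + q.length < n → L.incl (p ++ ⟨a, b, r, c • k + k'⟩ :: q)
        = c • L.incl (p ++ ⟨a, b, r, k⟩ :: q) + L.incl (p ++ ⟨a, b, r, k'⟩ :: q)) →
      ∀ (p q : List (Letter N)) (a b : Fin N) (r : ℤ) (c : ℝ) (k k' : Forms),
      p.length + q.length = n → L.tree (p ++ ⟨a, b, r, c • k + k'⟩ :: q)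
        = c • L.tree (p ++ ⟨a, b, r, k⟩ :: q) + L.tree (p ++ ⟨a, b, r, k'⟩ :: q) := by
    intro n ih p q a b r c k k' hn
    simp only [tree, splitSum_append_cons]
    rw [smul_add, add_add_add_comm, splitSum_smul, splitSum_smul, ← splitSum_add, ← splitSum_add]
    congr 1
    · refine splitSum_congr fun p₁ p₂ hp => ?_
      rcases p₁ with _ | ⟨z, p₁⟩
      · simp [incl_nil]
      · have hlen := congrArg List.length hp
        simp only [List.length_append, List.length_cons] at hlen
        rw [ih p₂ q a b r c k k' (by omega), mul_add, mul_smul_comm, smul_add,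
          smul_comm (wsign _)]
    · refine splitSum_congr fun q₁ q₂ hq => ?_
      rcases eq_or_ne q₂ [] with rfl | h0
      · simp [incl_nil]
      · have hlen := congrArg List.length hq
        have hpos := List.length_pos_iff.mpr h0
        simp only [List.length_append] at hlen
        rw [ih p q₁ a b r c k k' (by omega), add_mul, smul_mul_assoc, smul_add,
          smul_comm (wsign _), wsign_congr p q₁ a b r (c • k + k') k,
          wsign_congr p q₁ a b r k' k]
  have hincl : ∀ (n : ℕ) (p q : List (Letter N)) (a b : Fin N) (r : ℤ) (c : ℝ) (k k' : Forms),
      p.length + q.length < n → L.incl (p ++ ⟨a, b, r, c • k + k'⟩ :: q)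
        = c • L.incl (p ++ ⟨a, b, r, k⟩ :: q) + L.incl (p ++ ⟨a, b, r, k'⟩ :: q) := by
    intro n
    induction n with
    | zero => intro p q a b r c k k' h; omega
    | succ n ih =>
      intro p q a b r c k k' h
      by_cases hlt : p.length + q.length < n
      · exact ih p q a b r c k k' hlt
      have ht := key n ih p q a b r c k k' (by omega)
      rcases p with _ | ⟨z, p⟩
      · rcases q with _ | ⟨y, q⟩
        · rfl
        · simp only [List.nil_append] at ht ⊢
          rw [incl_cons_cons, incl_cons_cons, incl_cons_cons, ht, map_add, map_smul, neg_add,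
            smul_neg]
      · simp only [List.cons_append] at ht ⊢
        rw [incl_cons_append_cons, incl_cons_append_cons, incl_cons_append_cons, ht, map_add,
          map_smul, neg_add, smul_neg, lastTgt_congr q a b r (c • k + k') k,
          lastTgt_congr q a b r k' k]
  exact ⟨fun p q a b r c k k' => hincl _ p q a b r c k k' (Nat.lt_succ_self _),
    fun p q a b r c k k' => key _ (hincl _) p q a b r c k k' rfl⟩

theorem isMultilinear_prod : IsMultilinear L.prod := by
  intro p q a b r c k k'
  have ht := L.isMultilinear_incl_tree.2 p q a b r c k k'
  rcases p with _ | ⟨z, p⟩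
  · rcases q with _ | ⟨y, q⟩
    · simp only [List.nil_append, prod, map_add, map_smul]
    · simp only [List.nil_append] at ht ⊢
      simp only [prod]
      rw [ht, map_add, map_smul]
  · simp only [List.cons_append] at ht ⊢
    rw [prod_cons_append_cons, prod_cons_append_cons, prod_cons_append_cons, ht, map_add,
      map_smul, lastTgt_congr q a b r (c • k + k') k, lastTgt_congr q a b r k' k]

theorem IsMultilinear.smul {F : List (Letter N) → Forms} (hF : IsMultilinear F)
    (p q : List (Letter N)) (a b : Fin N) (r : ℤ) (c : ℝ) (k : Forms) :
    F (p ++ ⟨a, b, r, c • k⟩ :: q) = c • F (p ++ ⟨a, b, r, k⟩ :: q) := by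
  have h0 : F (p ++ ⟨a, b, r, 0⟩ :: q) = 0 := by
    have := hF p q a b r (-1) 0 0
    simpa using this
  have := hF p q a b r c k 0
  rwa [add_zero, h0, add_zero] at this

theorem IsMultilinear.zero {F : List (Letter N) → Forms} (hF : IsMultilinear F)
    (p q : List (Letter N)) (a b : Fin N) (r : ℤ) : F (p ++ ⟨a, b, r, 0⟩ :: q) = 0 := by
  have := hF.smul p q a b r 0 0
  rwa [smul_zero, zero_smul] at this

theorem IsMultilinear.add {F : List (Letter N) → Forms} (hF : IsMultilinear F)
    (p q : List (Letter N)) (a b : Fin N) (r : ℤ) (k k' : Forms) :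
    F (p ++ ⟨a, b, r, k + k'⟩ :: q) = F (p ++ ⟨a, b, r, k⟩ :: q) + F (p ++ ⟨a, b, r, k'⟩ :: q) := by
  have := hF p q a b r 1 k k'
  rwa [one_smul, one_smul] at this

end LineConfig

/-! ## From words of forms to the typed categories -/

namespace LineConfig

open StepSpace HomPath

variable {N : ℕ}

section Typed

variable (W : Fin N → Fin N → ℤ → Submodule ℝ StepSpace)

/-- The morphism spaces given by a family of subspaces. -/
abbrev SubHom (a b : Fin N) (r : ℤ) : Type := W a b r

/-- The word of forms underlying a composable sequence. -/
noncomputable def toWord : ∀ {a b : Fin N}, HomPath (SubHom W) a b → List (Letter N)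
  | _, _, .nil _ => []
  | a, _, .cons (b := b) (r := r) w p => ⟨a, b, r, emb r w⟩ :: toWord p

theorem toWord_append {a b c : Fin N} (p : HomPath (SubHom W) a b) (q : HomPath (SubHom W) b c) :
    toWord W (p.append q) = toWord W p ++ toWord W q := by
  induction p with
  | nil => rfl
  | cons w p ih => simp only [append, toWord, ih, List.cons_append]

theorem toWord_single {a b : Fin N} {r : ℤ} (w : SubHom W a b r) :
    toWord W (single w) = [⟨a, b, r, emb r w⟩] := rfl

theorem length_toWord {a b : Fin N} (p : HomPath (SubHom W) a b) :
    (toWord W p).length = p.length := by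
  induction p with
  | nil => rfl
  | cons w p ih => simp only [toWord, List.length_cons, ih, length]

theorem wdeg_toWord {a b : Fin N} (p : HomPath (SubHom W) a b) :
    wdeg (toWord W p) = p.sdeg := by
  induction p with
  | nil => rfl
  | cons w p ih => simp only [toWord, wdeg, ih, sdeg]

theorem lastTgt_toWord {a b c : Fin N} {r : ℤ} (w : SubHom W a b r) (p : HomPath (SubHom W) b c) :
    lastTgt ⟨a, b, r, emb r w⟩ (toWord W p) = c := by
  induction p generalizing a r with
  | nil => rfl
  | cons w' p ih => exact ih w'

/-- The exponent of the suspension sign of a word. -/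
def wsusp : List (Letter N) → ℤ
  | [] => 0
  | x :: l => (l.length : ℤ) * (x.deg - 1) + wsusp l

theorem wsusp_append (p q : List (Letter N)) :
    wsusp (p ++ q) = wsusp p + q.length * wdeg p + wsusp q := by
  induction p with
  | nil => simp [wsusp, wdeg]
  | cons x p ih =>
    simp only [List.cons_append, wsusp, wdeg, ih, List.length_append]
    push_cast
    ring

theorem wsusp_toWord {a b : Fin N} (p : HomPath (SubHom W) a b) :
    wsusp (toWord W p) = p.suspExp := by
  induction p with
  | nil => rfl
  | cons w p ih => simp only [toWord, wsusp, ih, suspExp, length_toWord]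

theorem deg_eq_sdeg_add {Ob : Type} {H : Ob → Ob → ℤ → Type} {a b : Ob} (p : HomPath H a b) :
    p.deg = p.sdeg + p.length := by
  induction p with
  | nil => rfl
  | cons w p ih => simp only [deg, sdeg, length, ih]; push_cast; ring

/-- The bridge from dependently typed sequences to plain lists: the typed decompositions run through
the cuts of the underlying word in the same order. -/
theorem sum_splits {M : Type*} [AddCommMonoid M] {a c : Fin N} (p : HomPath (SubHom W) a c)
    (F : (Σ b : Fin N, HomPath (SubHom W) a b × HomPath (SubHom W) b c) → M)
    (φ : List (Letter N) → List (Letter N) → M)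
    (h : ∀ (b : Fin N) (p' : HomPath (SubHom W) a b) (q : HomPath (SubHom W) b c),
      p'.append q = p → F ⟨b, p', q⟩ = φ (toWord W p') (toWord W q)) :
    (p.splits.map F).sum = splitSum φ (toWord W p) := by
  induction p generalizing φ with
  | nil a => simp [splits, splitSum, h _ (nil a) (nil a) rfl, toWord]
  | cons w p ih =>
    simp only [splits, List.map_cons, List.sum_cons, List.map_map, toWord, splitSum]
    rw [h _ (nil _) (cons w p) rfl]
    congr 1
    exact ih _ _ fun b p' q hp => h _ _ _ (congrArg (cons w) hp)

/-- The total space as a space of forms. -/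
noncomputable def totForms (a b : Fin N) : Tot (SubHom W) a b →ₗ[ℝ] Forms :=
  DirectSum.toModule ℝ ℤ _ fun r => emb r ∘ₗ (W a b r).subtype

theorem totForms_toTot {a b : Fin N} {r : ℤ} (w : SubHom W a b r) :
    totForms W a b (toTot w) = emb r w := by
  rw [totForms, toTot, ← DirectSum.lof_eq_of ℝ, DirectSum.toModule_lof]
  rfl

theorem fst_totForms {a b : Fin N} (x : Tot (SubHom W) a b) :
    (totForms W a b x).fst = (x 0 : StepSpace) := by
  induction x using DirectSum.induction_on with
  | zero => simp
  | of r w =>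
    refine (congrArg TrivSqZeroExt.fst (totForms_toTot W w)).trans ?_
    by_cases h0 : r = 0
    · subst h0; rw [DirectSum.of_eq_same]; rfl
    · rw [DirectSum.of_eq_of_ne _ _ _ (Ne.symm h0)]
      by_cases h1 : r = 1
      · subst h1; rfl
      · rw [emb_of_ne h0 h1]; rfl
  | add x y hx hy => rw [map_add, TrivSqZeroExt.fst_add, hx, hy]; rfl

theorem snd_totForms {a b : Fin N} (x : Tot (SubHom W) a b) :
    (totForms W a b x).snd = (x 1 : StepSpace) := by
  induction x using DirectSum.induction_on with
  | zero => simp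
  | of r w =>
    refine (congrArg TrivSqZeroExt.snd (totForms_toTot W w)).trans ?_
    by_cases h1 : r = 1
    · subst h1; rw [DirectSum.of_eq_same]; rfl
    · rw [DirectSum.of_eq_of_ne _ _ _ (Ne.symm h1)]
      by_cases h0 : r = 0
      · subst h0; rfl
      · rw [emb_of_ne h0 h1]; rfl
  | add x y hx hy => rw [map_add, TrivSqZeroExt.snd_add, hx, hy]; rfl

/-- The family is concentrated in degrees zero and one. -/
def InDegrees : Prop := ∀ a b r, r ≠ 0 → r ≠ 1 → W a b r = ⊥

variable {W}

/-- An element of the total space has only components of degrees 0 and 1, and these are the two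
components of the form. It reduces identities whose sides have formally different degrees to
identities of forms. -/
theorem totForms_injective (hW : InDegrees W) (a b : Fin N) :
    Function.Injective (totForms W a b) := by
  intro x y hxy
  refine DFinsupp.ext fun r => ?_
  by_cases h0 : r = 0
  · subst h0
    exact Subtype.ext (by rw [← fst_totForms W x, ← fst_totForms W y, hxy])
  by_cases h1 : r = 1
  · subst h1
    exact Subtype.ext (by rw [← snd_totForms W x, ← snd_totForms W y, hxy])
  · have : ∀ z : SubHom W a b r, z = 0 := fun z => by
      have hz : (z : StepSpace) ∈ (⊥ : Submodule ℝ StepSpace) := hW a b r h0 h1 ▸ z.2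
      exact Subtype.ext ((Submodule.mem_bot ℝ).mp hz)
    rw [this (x r), this (y r)]

theorem emb_injective (hW : InDegrees W) {a b : Fin N} {r : ℤ} {u v : SubHom W a b r}
    (h : emb r (u : StepSpace) = emb r v) : u = v := by
  have := totForms_injective hW a b (a₁ := toTot u) (a₂ := toTot v) (by
    rw [totForms_toTot, totForms_toTot, h])
  exact DirectSum.of_injective r this

theorem neg_one_zpow_congr {m n : ℤ} (h : Even (m - n)) : (-1 : ℝ) ^ m = (-1) ^ n := by
  have : m = n + (m - n) := by ring
  rw [this, zpow_add₀ (by norm_num), h.neg_one_zpow, mul_one]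

theorem neg_one_zpow_mul_self (n : ℤ) : (-1 : ℝ) ^ n * (-1) ^ n = 1 := by
  rw [← mul_zpow]; simp

/-- `∑ (-1)^{|p|} μ(p, μ(u), q)` over all decompositions `w = p ++ u ++ q` with `u` nonempty. -/
noncomputable def insertSelf (μ : List (Letter N) → Forms) (w : List (Letter N)) : Forms :=
  splitSum (fun p r => splitSum (fun u q => match u with
    | [] => 0
    | x :: l => wsign p • μ (p ++ ⟨x.src, lastTgt x l, wdeg (x :: l) + 2, μ (x :: l)⟩ :: q)) r) w

/-- The suspended relation carries only the Koszul sign. Multiplied by (-1) to the power length + 1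
+ suspension exponent of the whole sequence, which does not depend on the decomposition, it becomes
the unsuspended one: term by term the exponents differ by twice the product of the lengths of the
prefix and of the inserted subword. -/
theorem isAInfty_of_words (hW : InDegrees W) (C : AInftyData (SubHom W))
    (μ : List (Letter N) → Forms) (hμ : IsMultilinear μ)
    (hC : ∀ {a b : Fin N} (p : HomPath (SubHom W) a b),
      emb (p.sdeg + 2) (C.m p : StepSpace) = (-1 : ℝ) ^ p.suspExp • μ (toWord W p))
    (h : ∀ {a b : Fin N} (p : HomPath (SubHom W) a b), insertSelf μ (toWord W p) = 0) :
    C.IsAInfty where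
  map_add p x y q := by
    refine totForms_injective hW _ _ ?_
    rw [map_add]
    simp only [totForms_toTot, hC, ← wsusp_toWord, toWord_append, toWord]
    rw [Submodule.coe_add, map_add, hμ.add, smul_add]
    simp only [wsusp_append, wsusp, List.length_cons]
  map_smul p k x q := by
    refine totForms_injective hW _ _ ?_
    rw [map_smul]
    simp only [totForms_toTot, hC, ← wsusp_toWord, toWord_append, toWord]
    rw [Submodule.coe_smul, map_smul, hμ.smul, smul_comm]
    simp only [wsusp_append, wsusp, List.length_cons]
  relation {a d} p _ := by
    refine totForms_injective hW _ _ ?_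
    rw [map_zero, AInftyData.relationSum, map_list_sum, List.map_map]
    have key : (-1 : ℝ) ^ ((p.length : ℤ) + 1 + p.suspExp) • insertSelf μ (toWord W p) = 0 := by
      rw [h p, smul_zero]
    rw [insertSelf, splitSum_smul] at key
    refine (sum_splits W p _ _ fun b p₁ r hr => ?_).trans key
    simp only [Function.comp_apply]
    rw [map_list_sum, List.map_map, splitSum_smul]
    refine sum_splits W r _ _ fun c u q hu => ?_
    simp only [Function.comp_apply]
    rcases u with _ | ⟨w, u⟩
    · simp [length, toWord]
    rw [if_neg (by simp [length]), map_smul, totForms_toTot, hC, toWord_append]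
    simp only [toWord]
    rw [hC, hμ.smul, smul_smul, smul_smul, smul_smul, lastTgt_toWord]
    subst hu
    subst hr
    simp only [← wsusp_toWord, ← length_toWord, toWord_append, deg_eq_sdeg_add, ← wdeg_toWord W p₁,
      toWord, ← wdeg_toWord W (cons w u)]
    congr 1
    rw [wsign, ← zpow_add₀ (by norm_num), ← zpow_add₀ (by norm_num), ← zpow_add₀ (by norm_num)]
    refine neg_one_zpow_congr ⟨(toWord W p₁).length * ((toWord W u).length + 1), ?_⟩
    simp only [wsusp_append, wsusp, wdeg, List.length_append, List.length_cons]
    push_cast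
    ring

end Typed

/-! ### The DG category, the category of lines and the functor between them. -/

variable (L : LineConfig N)

theorem inDegrees_Omega : InDegrees L.Omega := fun _ _ _ h0 h1 => L.Omega_eq_bot h0 h1

theorem inDegrees_V : InDegrees L.V := fun _ _ _ h0 h1 => L.V_eq_bot h0 h1

/-- The suspended operations of the DG category on words. -/
noncomputable def deRhamWord : List (Letter N) → Forms
  | [x] => dForms x.val
  | [x, y] => wsign [x] • (x.val * y.val)
  | _ => 0

theorem wsign_single (x : Letter N) : wsign [x] = (-1) ^ (x.deg - 1) := by
  simp [wsign, wdeg]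

theorem deRhamWord_of_three_le {w : List (Letter N)} (h : 3 ≤ w.length) : deRhamWord w = 0 := by
  match w, h with
  | _ :: _ :: _ :: _, _ => rfl

theorem deRhamWord_of_val_zero {p q : List (Letter N)} {x : Letter N} (h : x.val = 0) :
    deRhamWord (p ++ x :: q) = 0 := by
  match p, q with
  | [], [] => simp [deRhamWord, h]
  | [], [y] => simp [deRhamWord, h]
  | [], _ :: _ :: _ => rfl
  | [y], [] => simp [deRhamWord, h]
  | [y], _ :: _ => rfl
  | _ :: _ :: l, q => exact deRhamWord_of_three_le (by simp; omega)

theorem emb_deRham {a b : Fin N} (p : HomPath (SubHom L.Omega) a b) :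
    emb (p.sdeg + 2) (L.deRham.m p : StepSpace)
      = (-1 : ℝ) ^ p.suspExp • deRhamWord (toWord L.Omega p) := by
  match p with
  | .nil _ => simp [deRham, deRhamVal, deRhamWord, toWord]
  | .cons (r := r) w (.nil _) =>
    simp only [sdeg, suspExp, toWord, deRhamWord, length, deRham, deRhamVal]
    have : r - 1 + 0 + 2 = r + 1 := by ring
    rw [this, emb_gd]
    simp
  | .cons (r := r) w (.cons (r := r') w' (.nil _)) =>
    simp only [sdeg, suspExp, toWord, deRhamWord, length, deRham, deRhamVal, wsign_single]
    have : r - 1 + (r' - 1 + 0) + 2 = r + r' := by ring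
    rw [this, emb_gmul _ _ (L.eq_zero_of_mem_Omega w.2) (L.eq_zero_of_mem_Omega w'.2), smul_smul,
      ← zpow_add₀ (by norm_num)]
    rw [Even.neg_one_zpow ⟨r - 1, by push_cast; ring⟩, one_smul]
  | .cons _ (.cons _ (.cons _ _)) => simp [deRham, deRhamVal, deRhamWord, toWord]

theorem isMultilinear_deRhamWord : IsMultilinear (deRhamWord (N := N)) := by
  intro p q a b r c k k'
  match p, q with
  | [], [] => simp [deRhamWord]
  | [], [y] => simp [deRhamWord, wsign_single, add_mul, smul_add, smul_comm c]
  | [], _ :: _ :: _ => simp [deRhamWord]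
  | [y], [] => simp [deRhamWord, wsign_single, mul_add, smul_add, smul_comm c]
  | [y], _ :: _ => simp [deRhamWord]
  | _ :: _ :: l, q =>
    rw [deRhamWord_of_three_le (by simp; omega), deRhamWord_of_three_le (by simp; omega),
      deRhamWord_of_three_le (by simp; omega), smul_zero, add_zero]

/-- A nonzero term composes two operations of at most two inputs each, so only words of at most
three letters matter, and there the relations are d² = 0, the Leibniz rule and associativity. -/
theorem insertSelf_deRhamWord {a b : Fin N} (p : HomPath (SubHom L.Omega) a b) :
    insertSelf deRhamWord (toWord L.Omega p) = 0 := by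
  match p with
  | .nil _ => rfl
  | .cons (r := r) w (.nil _) =>
    simp [insertSelf, toWord, splitSum, deRhamWord, wsign_nil, dForms_dForms]
  | .cons (r := r) w (.cons (r := r') w' (.nil _)) =>
    simp only [insertSelf, toWord, splitSum, deRhamWord, wsign_nil, wsign_single, List.nil_append,
      List.cons_append, wdeg, map_smul, dForms_mul]
    have h1 : (-1 : ℝ) ^ (r - 1 + 0 + 2 - 1) = - (-1) ^ (r - 1) := by
      rw [show r - 1 + 0 + 2 - 1 = r - 1 + 1 by ring, zpow_add_one₀ (by norm_num)]; ring
    have h2 := neg_one_zpow_mul_self (r - 1)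
    rw [h1, smul_smul (_ ^ _), h2]
    have h3 : ((-1 : ℝ) ^ (r - 1) + 1) • (emb r (w : StepSpace) * dForms (emb r' (w' : StepSpace))) = 0 := by
      by_cases h0 : r = 0
      · subst h0; norm_num
      by_cases h1 : r = 1
      · subst h1; rw [emb_one_deg, inr_mul_dForms, smul_zero]
      · rw [emb_of_ne h0 h1]; simp
    simp only [zero_add, add_zero, one_smul, neg_smul, smul_add] at h3 ⊢
    rw [add_smul, one_smul] at h3
    linear_combination h3
  | .cons (r := r) w (.cons (r := r') w' (.cons (r := r'') w'' (.nil _))) =>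
    simp only [insertSelf, toWord, splitSum, deRhamWord, wsign_nil, wsign_single, List.nil_append,
      List.cons_append, wdeg, smul_zero, map_zero, add_zero, zero_add, one_smul]
    have h1 : (-1 : ℝ) ^ (r - 1 + (r' - 1) + 2 - 1) = - ((-1) ^ (r - 1) * (-1) ^ (r' - 1)) := by
      rw [← zpow_add₀ (by norm_num), show r - 1 + (r' - 1) + 2 - 1 = (r - 1 + (r' - 1)) + 1 by ring,
        zpow_add_one₀ (by norm_num)]; ring
    have h2 := neg_one_zpow_mul_self (r - 1)
    rw [h1, smul_mul_assoc, mul_smul_comm, smul_smul, smul_smul, smul_smul, mul_assoc, h2, neg_mul,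
      mul_right_comm, h2]
    simp
  | .cons _ (.cons _ (.cons _ (.cons _ p))) =>
    rw [insertSelf]
    refine splitSum_eq_zero fun p' r' hp => splitSum_eq_zero fun u q hu => ?_
    rcases u with _ | ⟨x, l⟩
    · rfl
    have hlen : p'.length + (l.length + 1 + q.length) = (toWord L.Omega p).length + 4 := by
      have := congrArg List.length hp
      rw [← hu] at this
      simp only [toWord, List.length_append, List.length_cons] at this
      omega
    dsimp only
    by_cases h3 : 3 ≤ (x :: l).length
    · rw [deRhamWord_of_three_le h3, deRhamWord_of_val_zero rfl, smul_zero]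
    · rw [deRhamWord_of_three_le, smul_zero]
      simp only [List.length_append, List.length_cons] at h3 ⊢
      omega

theorem isDGCategory_deRham : L.deRham.IsDGCategory where
  isAInfty := isAInfty_of_words L.inDegrees_Omega _ deRhamWord isMultilinear_deRhamWord
    L.emb_deRham L.insertSelf_deRhamWord
  higher p hp := by
    match p, hp with
    | .cons _ (.cons _ (.cons _ _)), _ => rfl

theorem totForms_suspM {a b : Fin N} (p : HomPath (SubHom L.Omega) a b) :
    totForms L.Omega a b (L.deRham.suspM p) = deRhamWord (toWord L.Omega p) := by
  rw [AInftyData.suspM, map_smul, totForms_toTot, emb_deRham, smul_smul, neg_one_zpow_mul_self,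
    one_smul]

theorem isWord_toWord {a b : Fin N} (p : HomPath (SubHom L.V) a b) :
    L.IsWord a b (toWord L.V p) := by
  induction p with
  | nil => rfl
  | cons w p ih => exact ⟨rfl, ⟨_, w.2, rfl⟩, ih⟩

/-- The component of degree `r` of a form. -/
noncomputable def component (r : ℤ) (k : Forms) : StepSpace :=
  if r = 0 then k.fst else if r = 1 then k.snd else 0

theorem component_emb {r : ℤ} {u : StepSpace} (h : r ≠ 0 → r ≠ 1 → u = 0) :
    component r (emb r u) = u := by
  by_cases h0 : r = 0
  · subst h0; rfl
  by_cases h1 : r = 1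
  · subst h1; rfl
  · rw [component, if_neg h0, if_neg h1, h h0 h1]

theorem component_mem {W : Fin N → Fin N → ℤ → Submodule ℝ StepSpace} (hW : InDegrees W)
    {a b : Fin N} {r : ℤ} {k : Forms} (hk : k ∈ (W a b r).map (emb r)) :
    component r k ∈ W a b r ∧ emb r (component r k) = k := by
  obtain ⟨u, hu, rfl⟩ := hk
  rw [component_emb fun h0 h1 => by rwa [hW a b r h0 h1] at hu]
  exact ⟨hu, rfl⟩

theorem prod_toWord_mem {a b : Fin N} (p : HomPath (SubHom L.V) a b) :
    L.prod (toWord L.V p) ∈ (L.V a b (p.sdeg + 2)).map (emb (p.sdeg + 2)) := by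
  by_cases h : toWord L.V p = []
  · rw [h]; exact Submodule.zero_mem _
  · have := (L.incl_relation_and_prod_mem (L.isWord_toWord p)).2.2 h
    rwa [wdeg_toWord] at this

theorem incl_toWord_mem {a b : Fin N} (p : HomPath (SubHom L.V) a b) :
    L.incl (toWord L.V p) ∈ (L.Omega a b (p.sdeg + 1)).map (emb (p.sdeg + 1)) := by
  by_cases h : toWord L.V p = []
  · rw [h]; exact Submodule.zero_mem _
  · have := (L.incl_mem (L.isWord_toWord p) h).1
    rwa [wdeg_toWord] at this

/-- The category of lines. -/
noncomputable def lineCategory : AInftyData (SubHom L.V) where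
  m p := (-1 : ℝ) ^ p.suspExp •
    ⟨component (p.sdeg + 2) (L.prod (toWord L.V p)),
      (component_mem L.inDegrees_V (L.prod_toWord_mem p)).1⟩

theorem emb_lineCategory {a b : Fin N} (p : HomPath (SubHom L.V) a b) :
    emb (p.sdeg + 2) (L.lineCategory.m p : StepSpace)
      = (-1 : ℝ) ^ p.suspExp • L.prod (toWord L.V p) := by
  rw [lineCategory, Submodule.coe_smul, map_smul,
    (component_mem L.inDegrees_V (L.prod_toWord_mem p)).2]

/-- The perturbed inclusion of the category of lines. -/
@[reducible] noncomputable def lineFunctor : FunctorData (L.lineCategory : AInftyData L.VHom) L.deRham where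
  obj a := a
  g p := ⟨component (p.sdeg + 1) (L.incl (toWord L.V p)),
    (component_mem L.inDegrees_Omega (L.incl_toWord_mem p)).1⟩

theorem emb_lineFunctor {a b : Fin N} (p : HomPath (SubHom L.V) a b) :
    emb (p.sdeg + 1) (L.lineFunctor.g p : StepSpace) = L.incl (toWord L.V p) :=
  (component_mem L.inDegrees_Omega (L.incl_toWord_mem p)).2

theorem isAInfty_lineCategory : L.lineCategory.IsAInfty :=
  isAInfty_of_words L.inDegrees_V _ L.prod L.isMultilinear_prod L.emb_lineCategory
    fun p => L.insertProd_prod (L.isWord_toWord p)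

theorem append_nil {Ob : Type} {H : Ob → Ob → ℤ → Type} {a b : Ob} (p : HomPath H a b) :
    p.append (nil b) = p := by
  induction p with
  | nil => rfl
  | cons w p ih => exact congrArg (cons w) ih

theorem append_single_append {Ob : Type} {H : Ob → Ob → ℤ → Type} {a b c e : Ob} {r : ℤ}
    (p : HomPath H a b) (w : H b c r) (q : HomPath H c e) :
    (p.append (single w)).append q = p.append (cons w q) := by
  induction p with
  | nil => rfl
  | cons w' p ih => exact congrArg (cons w') (ih w)

/-- The value of the functor on a nonempty sequence, as a letter. -/
noncomputable def inclLetter {a b : Fin N} (p : HomPath (SubHom L.V) a b) : Letter N :=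
  ⟨a, b, p.sdeg + 1, L.incl (toWord L.V p)⟩

theorem toWord_cons_g {a b c : Fin N} (p : HomPath (SubHom L.V) a b)
    (q : HomPath (SubHom L.Omega) b c) :
    toWord L.Omega (cons (L.lineFunctor.g p) q) = L.inclLetter p :: toWord L.Omega q := by
  rw [inclLetter, ← L.emb_lineFunctor p]
  rfl

theorem blocksAux_pos {a b c : Fin N} (acc : HomPath (SubHom L.V) a b)
    (p : HomPath (SubHom L.V) b c) :
    ∀ q ∈ L.lineFunctor.blocksAux acc p, toWord L.Omega q ≠ [] := by
  induction p generalizing a with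
  | nil =>
    intro q hq
    simp only [FunctorData.blocksAux, List.mem_singleton] at hq
    subst hq
    exact List.cons_ne_nil _ _
  | cons w p ih =>
    intro q hq
    simp only [FunctorData.blocksAux, List.mem_append, List.mem_map] at hq
    rcases hq with hq | ⟨q, -, rfl⟩
    · exact ih _ q hq
    · exact List.cons_ne_nil _ _

theorem sum_blocksAux_of_two_le {a b c : Fin N} (acc : HomPath (SubHom L.V) a b)
    (p : HomPath (SubHom L.V) b c) (ψ : List (Letter N) → Forms)
    (hψ : ∀ v, 2 ≤ v.length → ψ v = 0) :
    ((L.lineFunctor.blocksAux acc p).map fun q => ψ (toWord L.Omega q)).sum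
      = ψ [L.inclLetter (acc.append p)] := by
  induction p generalizing a with
  | nil b =>
    simp only [FunctorData.blocksAux, List.map_cons, List.map_nil, List.sum_cons, List.sum_nil,
      add_zero, append_nil]
    exact congrArg ψ (L.toWord_cons_g acc (nil _))
  | cons w p ih =>
    simp only [FunctorData.blocksAux, List.map_append, List.sum_append, List.map_map]
    rw [ih, append_single_append, add_eq_left]
    refine List.sum_eq_zero fun k hk => ?_
    simp only [List.mem_map, Function.comp_apply] at hk
    obtain ⟨q, hq, rfl⟩ := hk
    refine hψ _ ?_
    have := List.length_pos_iff.mpr (L.blocksAux_pos _ _ q hq)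
    simp only [toWord, List.length_cons]
    omega

/-- The suspended operations of the DG category with the differential multiplied by `c`. -/
noncomputable def deRhamScaled (c : ℝ) : List (Letter N) → Forms
  | [x] => c • dForms x.val
  | [x, y] => wsign [x] • (x.val * y.val)
  | _ => 0

theorem deRhamScaled_zero (w : List (Letter N)) :
    deRhamScaled 0 w = if 2 ≤ w.length then deRhamWord w else 0 := by
  match w with
  | [] => rfl
  | [x] => simp [deRhamScaled]
  | [x, y] => rfl
  | _ :: _ :: _ :: _ => simp [deRhamScaled, deRhamWord]

theorem deRhamScaled_one (w : List (Letter N)) : deRhamScaled 1 w = deRhamWord w := by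
  match w with
  | [] => rfl
  | [x] => simp [deRhamScaled, deRhamWord]
  | [x, y] => rfl
  | _ :: _ :: _ :: _ => rfl

/-- Since operations of three or more inputs vanish, only decompositions into one block, giving dg,
or into two blocks, giving the sum over cuts, contribute. The scale c serves two purposes: 1 gives
the left side of the functor relation and 0 the tree sum. -/
theorem sum_blocksAux {a b e : Fin N} (acc : HomPath (SubHom L.V) a b)
    (p : HomPath (SubHom L.V) b e) (c : ℝ) :
    ((L.lineFunctor.blocksAux acc p).map fun q => deRhamScaled c (toWord L.Omega q)).sum
      = c • dForms (L.incl (toWord L.V (acc.append p)))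
        + splitSum (fun p q => wsign (toWord L.V acc ++ p)
            • (L.incl (toWord L.V acc ++ p) * L.incl q)) (toWord L.V p) := by
  induction p generalizing a with
  | nil b =>
    simp only [FunctorData.blocksAux, List.map_cons, List.map_nil, List.sum_cons, List.sum_nil,
      add_zero, append_nil, toWord, splitSum, incl_nil, mul_zero, smul_zero]
    exact congrArg (deRhamScaled c) (L.toWord_cons_g acc (nil _))
  | @cons _ _ e _ w p ih =>
    simp only [FunctorData.blocksAux, List.map_append, List.sum_append, List.map_map]
    rw [ih, append_single_append]
    have h6 : toWord L.V (acc.append (single w)) = toWord L.V acc ++ toWord L.V (single w) :=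
      toWord_append _ _ _
    rw [h6]
    have h2 := L.sum_blocksAux_of_two_le (single w) p
      (fun v => deRhamScaled c (L.inclLetter acc :: v)) fun v hv => by
        match v, hv with
        | _ :: _ :: _, _ => rfl
    have h3 : (fun q : HomPath (SubHom L.Omega) _ e => deRhamScaled c (toWord L.Omega q)) ∘
        (fun q : HomPath (SubHom L.Omega) _ e => cons (L.lineFunctor.g acc) q)
        = fun q : HomPath (SubHom L.Omega) _ e =>
          deRhamScaled c (L.inclLetter acc :: toWord L.Omega q) := by
      funext q
      simp only [Function.comp_apply]
      rw [← toWord_cons_g]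
    have h4 := (congrArg (fun F => ((L.lineFunctor.blocksAux (single w) p).map F).sum) h3).trans h2
    refine (congrArg₂ (· + ·) rfl h4).trans ?_
    simp only [toWord, splitSum, deRhamScaled, List.append_nil, List.append_assoc]
    have h5 : wsign [L.inclLetter acc] = wsign (toWord L.V acc) := by
      rw [wsign_single, wsign, wdeg_toWord, inclLetter, add_sub_cancel_right]
    rw [h5, add_assoc, add_comm (splitSum _ _)]
    rfl

theorem sum_blocks {a b : Fin N} (p : HomPath (SubHom L.V) a b) (hp : 1 ≤ p.length) (c : ℝ) :
    ((L.lineFunctor.blocks p).map fun q => deRhamScaled c (toWord L.Omega q)).sum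
      = c • dForms (L.incl (toWord L.V p)) + L.tree (toWord L.V p) := by
  rcases p with _ | ⟨w, p⟩
  · simp [length] at hp
  refine (L.sum_blocksAux (single w) p c).trans ?_
  rw [tree, toWord, splitSum, incl_nil, zero_mul, smul_zero, zero_add]
  rfl

theorem totForms_treeSum {a b : Fin N} (p : HomPath (SubHom L.V) a b) (hp : 1 ≤ p.length) :
    totForms L.Omega a b (L.lineFunctor.treeSum p) = L.tree (toWord L.V p) := by
  have := L.sum_blocks p hp 0
  rw [zero_smul, zero_add] at this
  rw [← this, FunctorData.treeSum]
  refine (map_list_sum _ _).trans ?_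
  rw [List.map_map]
  refine congrArg List.sum (List.map_congr_left fun q _ => ?_)
  simp only [Function.comp_apply]
  rw [deRhamScaled_zero, length_toWord]
  split_ifs with h
  · exact L.totForms_suspM q
  · exact map_zero _

theorem isAInftyFunctor_lineFunctor : L.lineFunctor.IsAInftyFunctor where
  map_add {a b c e r} p x y q := by
    refine totForms_injective L.inDegrees_Omega _ _ ?_
    rw [map_add]
    refine (totForms_toTot L.Omega _).trans (Eq.trans ?_ (congrArg₂ (· + ·)
      (totForms_toTot L.Omega _) (totForms_toTot L.Omega _)).symm)
    rw [emb_lineFunctor, emb_lineFunctor, emb_lineFunctor, toWord_append, toWord_append,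
      toWord_append]
    simp only [toWord]
    rw [Submodule.coe_add, map_add, L.isMultilinear_incl_tree.1.add]
  map_smul {a b c e r} p k x q := by
    refine totForms_injective L.inDegrees_Omega _ _ ?_
    rw [map_smul]
    refine (totForms_toTot L.Omega _).trans (Eq.trans ?_ (congrArg (k • ·)
      (totForms_toTot L.Omega _)).symm)
    rw [emb_lineFunctor, emb_lineFunctor, toWord_append, toWord_append]
    simp only [toWord]
    rw [Submodule.coe_smul, map_smul, L.isMultilinear_incl_tree.1.smul]
  relation {a e} p hp := by
    refine totForms_injective L.inDegrees_Omega _ _ ?_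
    have h1 := L.sum_blocks p hp 1
    rw [one_smul, (L.incl_relation_and_prod_mem (L.isWord_toWord p)).1] at h1
    refine Eq.trans ((map_list_sum _ _).trans ?_) (h1.trans ?_)
    · rw [List.map_map]
      refine congrArg List.sum (List.map_congr_left fun q _ => ?_)
      exact (L.totForms_suspM q).trans (deRhamScaled_one _).symm
    · rw [FunctorData.innerSum]
      refine Eq.symm ((map_list_sum _ _).trans ?_)
      rw [List.map_map, insertProd]
      refine sum_splits L.V p _ _ fun b p₁ r hr => ?_
      simp only [Function.comp_apply]
      refine (map_list_sum _ _).trans ?_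
      rw [List.map_map]
      refine sum_splits L.V r _ _ fun c u q hu => ?_
      simp only [Function.comp_apply]
      rcases u with _ | ⟨w, u⟩
      · simp [length, toWord]
      rw [if_neg (by simp [length]), map_smul]
      refine (congrArg (_ • ·) (totForms_toTot L.Omega _)).trans ?_
      rw [emb_lineFunctor, toWord_append]
      simp only [toWord]
      rw [emb_lineCategory, L.isMultilinear_incl_tree.1.smul, smul_smul, prodLetter, lastTgt_toWord,
        wsign, wdeg_toWord, zpow_add₀ (by norm_num), mul_assoc, neg_one_zpow_mul_self, mul_one]
      rw [← toWord, wdeg_toWord]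

theorem totForms_totH {a b : Fin N} (x : Tot (SubHom L.Omega) a b) :
    totForms L.Omega a b (totH (L.homotopyMap a b) x) = L.hForms a b (totForms L.Omega a b x) := by
  induction x using DirectSum.induction_on with
  | zero => simp
  | add x y hx hy => rw [map_add, map_add, hx, hy, map_add, map_add]
  | of r w =>
    refine Eq.trans ?_ (congrArg (L.hForms a b) (totForms_toTot L.Omega w)).symm
    rw [totH, ← DirectSum.lof_eq_of ℝ, DirectSum.toModule_lof]
    refine (totForms_toTot L.Omega (L.homotopyMap a b r w)).trans ?_
    by_cases h : r = 1
    · subst h; rfl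
    · rw [L.homotopyMap_of_ne h, L.hForms_emb_of_ne a b h]; simp

theorem totForms_totP {a b : Fin N} (x : Tot (SubHom L.Omega) a b) :
    totForms L.Omega a b (totP (L.projMap a b) x) = L.pForms a b (totForms L.Omega a b x) := by
  induction x using DirectSum.induction_on with
  | zero => simp
  | add x y hx hy => rw [map_add, map_add, hx, hy, map_add, map_add]
  | of r w =>
    refine Eq.trans ?_ (congrArg (L.pForms a b) (totForms_toTot L.Omega w)).symm
    rw [totP, ← DirectSum.lof_eq_of ℝ, DirectSum.toModule_lof]
    refine (totForms_toTot L.Omega (L.projMap a b r w)).trans ?_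
    rw [pForms_emb, coe_projMap]

theorem isPerturbation_lineFunctor : L.lineFunctor.IsPerturbation L.homotopyMap L.projMap where
  functor {a b} p hp := by
    refine totForms_injective L.inDegrees_Omega _ _ ?_
    refine (totForms_toTot L.Omega _).trans ?_
    rw [map_neg, emb_lineFunctor]
    refine Eq.trans ?_ (congrArg Neg.neg (L.totForms_totH _)).symm
    refine Eq.trans ?_ (congrArg (fun k => - L.hForms a b k)
      (L.totForms_treeSum p (by omega))).symm
    match p, hp with
    | .cons w (.cons w' p), _ =>
      simp only [toWord]
      rw [incl_cons_cons, lastTgt_toWord]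
  product {a b} p hp := by
    refine totForms_injective L.inDegrees_Omega _ _ ?_
    rw [map_smul]
    refine (congrArg (_ • ·) (totForms_toTot L.Omega _)).trans ?_
    refine Eq.trans ?_ (L.totForms_totP _).symm
    refine Eq.trans ?_ (congrArg (L.pForms a b) (L.totForms_treeSum p (by omega))).symm
    rw [emb_lineFunctor, toWord_single, incl_single, emb_lineCategory, smul_smul,
      neg_one_zpow_mul_self, one_smul]
    match p, hp with
    | .cons w (.cons w' p), _ =>
      simp only [toWord]
      rw [prod, lastTgt_toWord]

theorem emb_deRham_single {a b : Fin N} {r : ℤ} (w : SubHom L.Omega a b r) :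
    totForms L.Omega a b (toTot (L.deRham.m (single w))) = dForms (emb r w) := by
  refine (totForms_toTot L.Omega _).trans ?_
  rw [emb_deRham]
  simp [suspExp, single, deRhamWord, toWord, length]

theorem emb_lineCategory_single {a b : Fin N} {r : ℤ} (w : SubHom L.V a b r) :
    totForms L.V a b (toTot (L.lineCategory.m (single w))) = dForms (emb r w) := by
  refine (totForms_toTot L.V _).trans ?_
  rw [emb_lineCategory]
  simp [suspExp, single, prod, toWord, length]

theorem isContraction_homotopyMap : IsContraction L.deRham L.homotopyMap L.projMap where
  homotopy a b r w := by
    refine totForms_injective L.inDegrees_Omega _ _ ?_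
    rw [map_add, map_sub]
    have h1 := L.contraction_forms (k := emb r w) ⟨_, w.2, rfl⟩
    refine Eq.trans (congrArg₂ (· + ·) ((L.emb_deRham_single _).trans ?_) ?_)
      (h1.trans (congrArg₂ (· - ·) (totForms_toTot L.Omega w) ?_).symm)
    · rw [← totForms_toTot L.Omega w, ← totForms_totH]
      refine congrArg _ ?_
      refine (totForms_toTot L.Omega _).symm.trans ?_
      rw [totH, toTot, toTot, ← DirectSum.lof_eq_of ℝ, ← DirectSum.lof_eq_of ℝ,
        DirectSum.toModule_lof]
      rfl
    · rw [← emb_deRham_single, ← totForms_totH]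
      rw [totH, toTot, toTot, ← DirectSum.lof_eq_of ℝ, ← DirectSum.lof_eq_of ℝ,
        DirectSum.toModule_lof]
      rfl
    · refine (totForms_toTot L.Omega _).trans ?_
      rw [pForms_emb]
      rfl
  idempotent a b r := by
    ext w : 2
    exact L.projOp_idem a b r w

end LineConfig

/-! ### The functor is a homotopy equivalence. -/

namespace LineConfig

open StepSpace HomPath

variable {N : ℕ} (L : LineConfig N)

/-- The integral is the only obstruction to exactness among functions vanishing at both ends, and a
delta form at one point of L_a accounts for it. A second line is needed for such a point to exist.
-/
theorem exists_total_delta (hN : 2 ≤ N) {a : Fin N} {y : StepSpace} (hy : y ∈ L.Omega a a 1) :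
    ∃ x ∈ L.V a a 1, ∃ z ∈ L.Omega a a 0, y = x + d z := by
  obtain ⟨b, hb⟩ : ∃ b : Fin N, b ≠ a := by
    have : Nontrivial (Fin N) := Fin.nontrivial_iff_two_le.mpr hN
    exact exists_ne a
  have hy' := L.mem_Omega_one_iff.mp hy
  have hp : L.xv a b ∈ L.S a := ⟨b, hb, rfl⟩
  have hp' : L.xv a b ∈ L.Sfin := L.xv_mem_Sfin hb.symm
  refine ⟨total L.Sfin y • delta (L.xv a b), ?_,
    prim L.Sfin y - total L.Sfin y • theta (L.xv a b), ?_, ?_⟩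
  · rw [V_self_one]
    exact Submodule.smul_mem _ _ (delta_mem_A1 hp)
  · refine L.A0_le_Omega a ?_
    have hdel : delta (L.xv a b) ∈ A1 (L.Sfin : Set ℝ) := by
      rw [coe_Sfin]; exact delta_mem_A1 (L.xv_mem_Sall hb.symm)
    have := prim_mem_A0 (S := L.Sfin) subset_rfl
      (w := y - total L.Sfin y • delta (L.xv a b)) (Submodule.sub_mem _ (by rwa [coe_Sfin])
      (Submodule.smul_mem _ _ hdel)) (by
        rw [map_sub, map_smul, L.total_delta (L.xv_mem_Sall hb.symm), smul_eq_mul, mul_one, sub_self])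
    rwa [map_sub, map_smul, L.prim_delta (L.xv_mem_Sall hb.symm), coe_Sfin] at this
  · rw [← coe_Sfin] at hy'
    rw [map_sub, map_smul, d_theta, d_prim hy']
    abel

theorem dForms_emb_of_ne {r : ℤ} (hr : r ≠ 0) (u : StepSpace) : dForms (emb r u) = 0 := by
  by_cases h : r = 1
  · subst h; rw [dForms_apply, emb_one_deg, TrivSqZeroExt.fst_inr, map_zero, TrivSqZeroExt.inr_zero]
  · rw [emb_of_ne hr h]; simp

theorem form_eq_zero {W : Fin N → Fin N → ℤ → Submodule ℝ StepSpace} (hW : InDegrees W)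
    {a b : Fin N} {r : ℤ} (w : SubHom W a b r) (h : emb r (w : StepSpace) = 0) : w = 0 :=
  emb_injective hW (h.trans (map_zero _).symm)

theorem lineFunctor_single {a b : Fin N} {r : ℤ} (w : SubHom L.V a b r) :
    (L.lineFunctor.g (single w) : StepSpace) = w := by
  have : (single w).sdeg + 1 = r := by simp only [single, sdeg]; ring
  change component ((single w).sdeg + 1) (emb r (w : StepSpace)) = w
  rw [this]
  exact component_emb fun h0 h1 => L.eq_zero_of_mem_Omega (L.V_le_Omega a b r w.2) h0 h1

/-- Off the diagonal P is a chain projection onto V_ab homotopic to the identity. On the diagonal a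
function of Ω'⁰_aa whose differential is supported on L_a already lies in V_aa, which settles
cocycles of degree zero and exactness in degree one; classes of degree one are represented by a
delta form. -/
theorem isHomotopyEquivalence_lineFunctor (hN : 2 ≤ N) :
    L.lineFunctor.IsHomotopyEquivalence where
  obj_bijective := Function.bijective_id
  surj a b r y hy := by
    have hd : dForms (emb r (y : StepSpace)) = 0 := by
      rw [← emb_deRham_single, hy]
      exact (totForms_toTot L.Omega (0 : SubHom L.Omega a b _)).trans (map_zero _)
    suffices H : ∃ x : SubHom L.V a b r, dForms (emb r x) = 0 ∧
        ∃ z : SubHom L.Omega a b (r - 1), emb r (y : StepSpace) = emb r x + dForms (emb (r - 1) z) by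
      obtain ⟨x, hx, z, hz⟩ := H
      refine ⟨x, form_eq_zero L.inDegrees_V _ ?_, z, ?_⟩
      · exact (totForms_toTot L.V _).symm.trans ((L.emb_lineCategory_single x).trans hx)
      · refine totForms_injective L.inDegrees_Omega _ _ ?_
        rw [map_add]
        refine (totForms_toTot L.Omega _).trans (hz.trans (congrArg₂ (· + ·) ?_ ?_))
        · refine Eq.symm ((totForms_toTot L.Omega _).trans ?_)
          rw [emb_lineFunctor, toWord_single, incl_single]
        · exact (L.emb_deRham_single z).symm
    by_cases hab : a = b
    · subst hab
      by_cases h0 : r = 0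
      · subst h0
        refine ⟨⟨y, ?_⟩, hd, 0, ?_⟩
        · rw [V_self_zero]
          refine L.mem_A0_of_d_mem y.2 ?_
          have : d (y : StepSpace) = 0 := congrArg TrivSqZeroExt.snd hd
          rw [this]
          exact Submodule.zero_mem _
        · simp
      by_cases h1 : r = 1
      · subst h1
        obtain ⟨x, hx, z, hz, h⟩ := L.exists_total_delta hN y.2
        refine ⟨⟨x, hx⟩, ?_, ⟨z, hz⟩, ?_⟩
        · rfl
        · rw [h, map_add]; rfl
      · refine ⟨0, by simp, 0, ?_⟩
        rw [emb_of_ne h0 h1]; simp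
    · refine ⟨⟨L.projOp a b r y, L.projOp_mem_V hab y.2⟩, ?_, L.homotopyMap a b r y, ?_⟩
      · rw [← pForms_emb, L.dForms_pForms ⟨_, y.2, rfl⟩, hd, map_zero]
      · have := L.contraction_forms (k := emb r (y : StepSpace)) ⟨_, y.2, rfl⟩
        rw [hd, map_zero, add_zero, pForms_emb] at this
        have h2 : emb (r - 1) (L.homotopyMap a b r y : StepSpace) = L.hForms a b (emb r (y : StepSpace)) := by
          by_cases h : r = 1
          · subst h; rfl
          · rw [L.homotopyMap_of_ne h, L.hForms_emb_of_ne a b h]; simp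
        rw [h2, this]; abel
  inj a b r x hx := by
    rintro ⟨z, hz⟩
    have hz' : emb r (x : StepSpace) = dForms (emb (r - 1) (z : StepSpace)) := by
      have h1 := congrArg (totForms L.Omega a b) hz
      have h2 : totForms L.Omega a b (toTot (L.lineFunctor.g (single x))) = emb r (x : StepSpace) := by
        refine (totForms_toTot L.Omega _).trans ?_
        rw [emb_lineFunctor, toWord_single, incl_single]
      exact h2.symm.trans (h1.trans (L.emb_deRham_single z))
    suffices H : ∃ w : SubHom L.V a b (r - 1), emb r (x : StepSpace) = dForms (emb (r - 1) w) by
      obtain ⟨w, hw⟩ := H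
      refine ⟨w, totForms_injective L.inDegrees_V _ _ ?_⟩
      exact (totForms_toTot L.V x).trans (hw.trans (L.emb_lineCategory_single w).symm)
    by_cases hab : a = b
    · subst hab
      by_cases h1 : r = 1
      · subst h1
        refine ⟨⟨z, ?_⟩, hz'⟩
        have h3 : (x : StepSpace) = d (z : StepSpace) := congrArg TrivSqZeroExt.snd hz'
        have hx2 := (L.V_self_one a).le x.2
        rw [h3] at hx2
        exact (L.V_self_zero a).ge (L.mem_A0_of_d_mem z.2 hx2)
      · refine ⟨0, ?_⟩
        rw [hz']
        rw [dForms_emb_of_ne (by omega)]; simp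
    · refine ⟨⟨L.projOp a b (r - 1) z, L.projOp_mem_V hab z.2⟩, ?_⟩
      rw [← pForms_emb, L.dForms_pForms ⟨_, z.2, rfl⟩, ← hz', pForms_emb, L.projOp_of_mem_V x.2]

end LineConfig

/-! ## Products with few letters -/

namespace LineConfig

open StepSpace HomPath Polynomial

variable {N : ℕ} (L : LineConfig N)

theorem coe_lineCategory_m {a b : Fin N} (p : HomPath (SubHom L.V) a b) :
    (L.lineCategory.m p : StepSpace)
      = (-1 : ℝ) ^ p.suspExp • component (p.sdeg + 2) (L.prod (toWord L.V p)) := rfl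

theorem lineCategory_m_eq_zero {a b : Fin N} {p : HomPath (SubHom L.V) a b}
    (h : L.prod (toWord L.V p) = 0) : L.lineCategory.m p = 0 := by
  refine emb_injective L.inDegrees_V ?_
  rw [emb_lineCategory, h, smul_zero]
  exact (map_zero _).symm

theorem lineCategory_m_single {a b : Fin N} {r : ℤ} (w : SubHom L.V a b r) :
    (L.lineCategory.m (single w) : StepSpace) = gd r w := by
  have h : (single w).sdeg + 2 = r + 1 := by simp only [single, sdeg]; ring
  have h2 : (single w).suspExp = 0 := by simp [single, suspExp, length]
  rw [coe_lineCategory_m, h, h2, zpow_zero, one_smul, toWord_single, prod, ← emb_gd]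
  refine component_emb fun h0 _ => ?_
  rw [gd]
  split_ifs with h3
  · subst h3; omega
  · rfl

/-- The suspension sign and the sign in the tree sum are both (-1)^(r-1) and cancel. -/
theorem lineCategory_m_pair {a b c : Fin N} {r r' : ℤ} (w : SubHom L.V a b r)
    (w' : SubHom L.V b c r') :
    (L.lineCategory.m (cons w (single w')) : StepSpace)
      = L.projOp a c (r + r') (gmul r r' w w') := by
  have h : (cons w (single w')).sdeg + 2 = r + r' := by simp only [single, sdeg]; ring
  have h2 : (cons w (single w')).suspExp = r - 1 := by simp [single, suspExp, length]
  have hw := L.V_le_Omega a b r w.2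
  have hw' := L.V_le_Omega b c r' w'.2
  have h3 : L.prod (toWord L.V (cons w (single w')))
      = (-1 : ℝ) ^ (r - 1) • emb (r + r') (L.projOp a c (r + r') (gmul r r' w w')) := by
    rw [← pForms_emb, emb_gmul r r' (L.eq_zero_of_mem_Omega hw) (L.eq_zero_of_mem_Omega hw')]
    simp only [toWord, single, prod, tree, splitSum, incl_nil, incl_single, wsign_single, lastTgt]
    simp
  rw [coe_lineCategory_m, h, h2, h3, ← map_smul, component_emb, smul_smul, neg_one_zpow_mul_self,
    one_smul]
  intro h0 h1
  rw [L.eq_zero_of_mem_Omega (L.projOp_mem a c _ (L.gmul_mem rfl hw hw')) h0 h1, smul_zero]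

theorem coe_vElt {a b : Fin N} (h : a ≠ b) : (L.vElt a b : StepSpace) = L.e a b := if_neg h

theorem lineCategory_m_single_of_ne {a b : Fin N} {r : ℤ} (w : SubHom L.V a b r) (h : a ≠ b) :
    L.lineCategory.m (single w) = 0 := by
  refine Subtype.ext ?_
  rw [lineCategory_m_single, gd]
  split_ifs with h0
  · subst h0
    by_cases hlt : L.t a < L.t b
    · have hV : L.V a b 0 ≤ Submodule.span ℝ {L.e a b} := by
        rw [← L.vdeg_lt hlt, L.V_of_ne h]
      have := hV w.2
      obtain ⟨c, hc⟩ := Submodule.mem_span_singleton.mp this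
      rw [← hc, map_smul, e_lt _ hlt, map_smul, expf, ← mul_one (ofFun _), d_ofFun_mul]
      have : d (1 : StepSpace) = 0 := by simpa using d_algebraMap 1
      rw [this]; simp
    · have := (L.V_of_ne_bot h (r := 0) (by rw [L.vdeg_gt (L.lt_of_not_lt h hlt)]; norm_num)).le w.2
      rw [(Submodule.mem_bot ℝ).mp this, map_zero]; rfl
  · rfl

theorem lineCategory_m_loops_pair {a : Fin N} {r r' : ℤ} (w : SubHom L.V a a r)
    (w' : SubHom L.V a a r') :
    (L.lineCategory.m (cons w (single w')) : StepSpace) = gmul r r' w w' := by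
  rw [lineCategory_m_pair, projOp_self]; rfl

theorem eval_half_theta_pow (p x : ℝ) {n : ℕ} (hn : 1 ≤ n) :
    ((theta p ^ n) x).eval (1 / 2) = if p < x then 1 else if x < p then 0 else 1 / 2 ^ n := by
  rw [Pi.pow_apply]
  rcases lt_trichotomy p x with h | rfl | h
  · rw [theta_apply_of_gt h, if_pos h]; simp
  · rw [theta_apply_self, if_neg (lt_irrefl _), if_neg (lt_irrefl _)]; simp
  · rw [theta_apply_of_lt h, if_neg h.not_gt, if_pos h, zero_pow (by omega)]; simp

/-- The origin of the coefficient 1/(n+1): the integral of ϑⁿ over the jump, in contrast to the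
value 1/2ⁿ at jump variable 1/2. -/
theorem eval_one_integ_theta_pow (p x : ℝ) {n : ℕ} (hn : 1 ≤ n) :
    (integ ((theta p ^ n) x)).eval 1 =
      if p < x then 1 else if x < p then 0 else 1 / ((n : ℝ) + 1) := by
  rw [Pi.pow_apply]
  rcases lt_trichotomy p x with h | rfl | h
  · rw [theta_apply_of_gt h, if_pos h, one_pow, integ_one]; simp
  · rw [theta_apply_self, if_neg (lt_irrefl _), if_neg (lt_irrefl _), X_pow_eq_monomial,
      integ_monomial]
    simp
  · rw [theta_apply_of_lt h, if_neg h.not_gt, if_pos h, zero_pow (by omega)]; simp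

theorem total_mul_delta {x : ℝ} (hx : x ∈ L.Sall) (u : StepSpace) :
    total L.Sfin (u * delta x) = (integ (u x)).eval 1 := by
  rw [total_single (p := x) (by rwa [← Finset.mem_coe, coe_Sfin])
    fun y hy => by rw [Pi.mul_apply, delta_apply_of_ne hy, mul_zero]]
  rw [Pi.mul_apply, delta_apply_self, mul_one]

theorem prim_mul_delta {x : ℝ} (hx : x ∈ L.Sall) (u : StepSpace) :
    prim L.Sfin (u * delta x) = aeval (theta x) (integ (u x)) := by
  rw [prim_single (p := x) (by rwa [← Finset.mem_coe, coe_Sfin])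
    fun y hy => by rw [Pi.mul_apply, delta_apply_of_ne hy, mul_zero]]
  rw [Pi.mul_apply, delta_apply_self, mul_one]

/-- The action of step functions on the base elements. -/
theorem projOp_mul_e {a b : Fin N} (hab : a ≠ b) (u : StepSpace) :
    L.projOp a b (L.vdeg a b) (u * L.e a b)
      = (if L.t a < L.t b then (u (L.xv a b)).eval (1 / 2) else (integ (u (L.xv a b))).eval 1)
        • L.e a b := by
  by_cases h : L.t a < L.t b
  · rw [if_pos h, L.vdeg_lt h, L.e_lt h, mul_smul_comm, map_smul, L.projOp_lt_zero h, mul_left_comm,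
      expf_mul_swap, mul_one, smul_comm]
  · have h' := L.lt_of_not_lt hab h
    rw [if_neg h, L.vdeg_gt h', L.e_gt h', L.projOp_gt_one h', mul_left_comm, expf_mul_delta,
      mul_smul_comm, map_smul, L.total_mul_delta (L.xv_mem_Sall hab), expf_mul_delta, smul_smul,
      smul_eq_mul, mul_right_comm, ← Real.exp_add, L.f_swap b a, add_neg_cancel, Real.exp_zero,
      one_mul]

theorem projOp_theta_pow_mul_e {a b : Fin N} (hab : a ≠ b) (p q : ℝ) {n n' : ℕ} (hn : 1 ≤ n)
    (hn' : 1 ≤ n') :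
    L.projOp a b (L.vdeg a b) ((theta p ^ n - theta q ^ n') * L.e a b)
      = (L.actCoeff a b p n - L.actCoeff a b q n') • L.e a b := by
  have key : ∀ (p : ℝ) {n : ℕ}, 1 ≤ n →
      (if L.t a < L.t b then ((theta p ^ n) (L.xv a b)).eval (1 / 2)
        else (integ ((theta p ^ n) (L.xv a b))).eval 1) = L.actCoeff a b p n := by
    intro p n hn
    rw [eval_half_theta_pow p _ hn, eval_one_integ_theta_pow p _ hn, actCoeff]
    split_ifs <;> rfl
  rw [sub_mul, map_sub, projOp_mul_e _ hab, projOp_mul_e _ hab, key p hn, key q hn', sub_smul]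

theorem gmul_zero_left (r : ℤ) (u v : StepSpace) : gmul 0 r u v = u * v := by
  rw [gmul, if_neg]; simp

theorem gmul_zero_right (r : ℤ) (u v : StepSpace) : gmul r 0 u v = u * v := by
  rw [gmul, if_neg]; simp

theorem lineCategory_act_left {a b : Fin N} (hab : a ≠ b) (p q : ℝ) {n n' : ℕ} (hn : 1 ≤ n)
    (hn' : 1 ≤ n') (w : SubHom L.V a a 0) (hw : (w : StepSpace) = theta p ^ n - theta q ^ n') :
    (L.lineCategory.m (cons w (single (H := SubHom L.V) (L.vElt a b))) : StepSpace)
      = (L.actCoeff a b p n - L.actCoeff a b q n') • L.e a b := by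
  rw [lineCategory_m_pair, gmul_zero_left, hw, L.coe_vElt hab, zero_add]
  exact L.projOp_theta_pow_mul_e hab p q hn hn'

theorem lineCategory_act_right {a b : Fin N} (hab : a ≠ b) (p q : ℝ) {n n' : ℕ} (hn : 1 ≤ n)
    (hn' : 1 ≤ n') (w : SubHom L.V b b 0) (hw : (w : StepSpace) = theta p ^ n - theta q ^ n') :
    (L.lineCategory.m (cons (H := SubHom L.V) (L.vElt a b) (single w)) : StepSpace)
      = (L.actCoeff a b p n - L.actCoeff a b q n') • L.e a b := by
  rw [lineCategory_m_pair, gmul_zero_right, hw, L.coe_vElt hab, add_zero, mul_comm]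
  exact L.projOp_theta_pow_mul_e hab p q hn hn'

theorem e_mul_e_swap {a b : Fin N} (h : L.t a < L.t b) :
    L.e a b * L.e b a = delta (L.xv a b) := by
  rw [L.e_lt h, L.e_gt h, L.xv_comm b a, smul_mul_assoc, expf_mul_delta, smul_smul, ← Real.exp_add,
    neg_add_cancel, Real.exp_zero, one_smul]

theorem lineCategory_point {a b : Fin N} (hab : a ≠ b) :
    (L.lineCategory.m (cons (H := SubHom L.V) (L.vElt a b)
      (single (H := SubHom L.V) (L.vElt b a))) : StepSpace) = delta (L.xv a b) := by
  rw [lineCategory_m_pair, projOp_self, L.coe_vElt hab, L.coe_vElt hab.symm, LinearMap.id_apply]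
  by_cases h : L.t a < L.t b
  · rw [L.vdeg_lt h, gmul_zero_left, L.e_mul_e_swap h]
  · have h' := L.lt_of_not_lt hab h
    rw [L.vdeg_lt h', gmul_zero_right, mul_comm, L.e_mul_e_swap h', L.xv_comm]

theorem tree_three (x y z : Letter N) : L.tree [x, y, z]
    = wsign [x] • (x.val * L.incl [y, z]) + wsign [x, y] • (L.incl [x, y] * z.val) := by
  simp only [tree, splitSum, incl_nil, incl_single]
  simp

theorem incl_pair (x y : Letter N) :
    L.incl [x, y] = - (wsign [x] • L.hForms x.src y.tgt (x.val * y.val)) := by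
  rw [incl_cons_cons, tree, ← map_smul]
  simp only [splitSum, incl_nil, incl_single, lastTgt]
  simp

/-- The homotopy from b to a subtracts its integral as a step at the same point v_ab, and
multiplication by e^{f_ab} undoes the conjugation. For u = ϑⁿ the value is -ϑ(1 - ϑⁿ)/(n+1), the
source of the triple products. -/
theorem homotopyOp_mul_delta_mul_e {a b : Fin N} (h : L.t a < L.t b) (u : StepSpace) :
    L.homotopyOp b a (u * delta (L.xv a b)) * L.e a b
      = aeval (theta (L.xv a b)) (integ (u (L.xv a b)))
        - (integ (u (L.xv a b))).eval 1 • theta (L.xv a b) := by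
  have hx := L.xv_mem_Sall (L.ne_of_lt h)
  rw [homotopyOp_apply, L.stepHomotopy_gt h, mul_left_comm, expf_mul_delta, mul_smul_comm, map_smul,
    map_smul, L.prim_mul_delta hx, L.total_mul_delta hx, L.xv_comm b a, smul_assoc, ← smul_sub,
    L.e_lt h, mul_smul_comm, mul_smul_comm, smul_mul_assoc, smul_smul, ← Real.exp_add,
    neg_add_cancel, Real.exp_zero, one_smul, mul_right_comm, expf_mul_swap, one_mul]

theorem homotopyOp_theta_mul_e {a b : Fin N} (h : L.t a < L.t b) (p q : ℝ) {n n' : ℕ} (hn : 1 ≤ n)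
    (hn' : 1 ≤ n') :
    L.homotopyOp b a ((theta p ^ n - theta q ^ n') * delta (L.xv a b)) * L.e a b
      = - (L.tripleValue a b p n - L.tripleValue a b q n') := by
  have key : ∀ (p : ℝ) {n : ℕ}, 1 ≤ n →
      L.homotopyOp b a (theta p ^ n * delta (L.xv a b)) * L.e a b = - L.tripleValue a b p n := by
    intro p n hn
    rw [L.homotopyOp_mul_delta_mul_e h, tripleValue, Pi.pow_apply]
    rcases lt_trichotomy p (L.xv a b) with hp | hp | hp
    · rw [theta_apply_of_gt hp, if_neg hp.ne, one_pow, integ_one]; simp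
    · rw [if_pos hp, ← hp, theta_apply_self, X_pow_eq_monomial, integ_monomial, eval_monomial,
        aeval_monomial, one_pow, mul_one, mul_one, Algebra.algebraMap_eq_smul_one, smul_mul_assoc,
        one_mul, mul_sub, mul_one, smul_sub, pow_succ', neg_sub]
    · rw [theta_apply_of_lt hp, if_neg hp.ne', zero_pow (by omega)]; simp
  rw [sub_mul, map_sub, sub_mul, key p hn, key q hn']
  abel

/-- The letter of the base element `[v_{ab}]`. -/
noncomputable def baseLetter (a b : Fin N) : Letter N :=
  ⟨a, b, L.vdeg a b, emb (L.vdeg a b) (L.e a b)⟩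

theorem toWord_cons_vElt {a b c : Fin N} (h : a ≠ b) (p : HomPath (SubHom L.V) b c) :
    toWord L.V (cons (H := SubHom L.V) (L.vElt a b) p) = L.baseLetter a b :: toWord L.V p := by
  rw [toWord, L.coe_vElt h]; rfl

theorem baseLetter_lt {a b : Fin N} (h : L.t a < L.t b) :
    L.baseLetter a b = ⟨a, b, 0, emb 0 (L.e a b)⟩ := by rw [baseLetter, L.vdeg_lt h]

theorem baseLetter_gt {a b : Fin N} (h : L.t b < L.t a) :
    L.baseLetter a b = ⟨a, b, 1, emb 1 (delta (L.xv a b))⟩ := by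
  rw [baseLetter, L.vdeg_gt h, L.e_gt h]

theorem emb_zero_mul (u v : StepSpace) : emb 0 u * emb 0 v = emb 0 (u * v) :=
  (TrivSqZeroExt.inl_mul StepSpace u v).symm

theorem emb_one_mul (u v : StepSpace) : emb 1 u * emb 0 v = emb 1 (u * v) := by
  rw [emb_one_deg, emb_one_deg, emb_zero_deg, TrivSqZeroExt.inr_mul_inl]
  rfl

theorem emb_mul_one (u v : StepSpace) : emb 0 u * emb 1 v = emb 1 (u * v) := by
  rw [mul_comm, emb_one_mul, mul_comm]

/-- In this and the three following products only one of the two trees survives: h vanishes on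
products of degree zero and on closed words, which leaves the tree in which the step function is
multiplied with the delta form [v_ba] before h is applied. -/
theorem lineCategory_triple₁ {a b : Fin N} (h : L.t a < L.t b) (p q : ℝ) {n n' : ℕ} (hn : 1 ≤ n)
    (hn' : 1 ≤ n') (w : SubHom L.V a a 0) (hw : (w : StepSpace) = theta p ^ n - theta q ^ n') :
    (L.lineCategory.m (cons (H := SubHom L.V) (L.vElt b a) (cons w
      (single (H := SubHom L.V) (L.vElt a b)))) : StepSpace)
      = L.tripleValue a b p n - L.tripleValue a b q n' := by
  have hab := L.ne_of_lt h
  rw [coe_lineCategory_m, L.toWord_cons_vElt hab.symm, toWord, single, L.toWord_cons_vElt hab, toWord, L.baseLetter_gt h, L.baseLetter_lt h, L.xv_comm b a]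
  simp only [sdeg, suspExp, length, L.vdeg_lt h, L.vdeg_gt h, prod, lastTgt, pForms_self, tree_three,
    incl_pair, hw, wsign, wdeg]
  simp only [emb_one_mul, emb_zero_mul, L.hForms_emb_of_ne _ _ zero_ne_one, hForms_emb_one]
  have key := L.homotopyOp_theta_mul_e h p q hn hn'
  rw [mul_comm _ (delta _)] at key
  norm_num [component, emb_zero_deg]
  rw [key, neg_neg]

theorem lineCategory_triple₂ {a b : Fin N} (h : L.t a < L.t b) (p q : ℝ) {n n' : ℕ} (hn : 1 ≤ n)
    (hn' : 1 ≤ n') (w : SubHom L.V b b 0) (hw : (w : StepSpace) = theta p ^ n - theta q ^ n') :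
    (L.lineCategory.m (cons w (cons (H := SubHom L.V) (L.vElt b a)
      (single (H := SubHom L.V) (L.vElt a b)))) : StepSpace)
      = L.tripleValue a b p n - L.tripleValue a b q n' := by
  have hab := L.ne_of_lt h
  rw [coe_lineCategory_m, toWord, L.toWord_cons_vElt hab.symm, single, L.toWord_cons_vElt hab, toWord, L.baseLetter_gt h, L.baseLetter_lt h, L.xv_comm b a]
  simp only [sdeg, suspExp, length, L.vdeg_lt h, L.vdeg_gt h, prod, lastTgt, pForms_self, tree_three,
    incl_pair, hw, wsign, wdeg]
  simp only [emb_one_mul, emb_mul_one, hForms_emb_one, hForms_self]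
  have key := L.homotopyOp_theta_mul_e h p q hn hn'
  norm_num [component, emb_zero_deg]
  rw [key]; abel

theorem lineCategory_triple₃ {a b : Fin N} (h : L.t a < L.t b) (p q : ℝ) {n n' : ℕ} (hn : 1 ≤ n)
    (hn' : 1 ≤ n') (w : SubHom L.V b b 0) (hw : (w : StepSpace) = theta p ^ n - theta q ^ n') :
    (L.lineCategory.m (cons (H := SubHom L.V) (L.vElt a b) (cons w
      (single (H := SubHom L.V) (L.vElt b a)))) : StepSpace)
      = -(L.tripleValue a b p n - L.tripleValue a b q n') := by
  have hab := L.ne_of_lt h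
  rw [coe_lineCategory_m, L.toWord_cons_vElt hab, toWord, single, L.toWord_cons_vElt hab.symm, toWord, L.baseLetter_gt h, L.baseLetter_lt h, L.xv_comm b a]
  simp only [sdeg, suspExp, length, L.vdeg_lt h, L.vdeg_gt h, prod, lastTgt, pForms_self, tree_three,
    incl_pair, hw, wsign, wdeg]
  simp only [emb_mul_one, emb_zero_mul, L.hForms_emb_of_ne _ _ zero_ne_one, hForms_emb_one]
  have key := L.homotopyOp_theta_mul_e h p q hn hn'
  rw [mul_comm] at key
  norm_num [component, emb_zero_deg]
  rw [key]; abel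

theorem lineCategory_triple₄ {a b : Fin N} (h : L.t a < L.t b) (p q : ℝ) {n n' : ℕ} (hn : 1 ≤ n)
    (hn' : 1 ≤ n') (w : SubHom L.V a a 0) (hw : (w : StepSpace) = theta p ^ n - theta q ^ n') :
    (L.lineCategory.m (cons (H := SubHom L.V) (L.vElt a b) (cons (H := SubHom L.V) (L.vElt b a)
      (single w))) : StepSpace)
      = -(L.tripleValue a b p n - L.tripleValue a b q n') := by
  have hab := L.ne_of_lt h
  rw [coe_lineCategory_m, L.toWord_cons_vElt hab, L.toWord_cons_vElt hab.symm, single, toWord, toWord, L.baseLetter_gt h, L.baseLetter_lt h, L.xv_comm b a]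
  simp only [sdeg, suspExp, length, L.vdeg_lt h, L.vdeg_gt h, prod, lastTgt, pForms_self, tree_three,
    incl_pair, hw, wsign, wdeg]
  simp only [emb_one_mul, emb_mul_one, hForms_emb_one, hForms_self]
  have key := L.homotopyOp_theta_mul_e h p q hn hn'
  rw [mul_comm, mul_comm _ (delta _)] at key
  norm_num [component, emb_zero_deg]
  rw [key]; abel

/-! ### Vanishing of products that involve endomorphisms. -/

theorem incl_of_forall_loop {a : Fin N} {w : List (Letter N)}
    (h : ∀ x ∈ w, x.src = a ∧ x.tgt = a) (h2 : 2 ≤ w.length) : L.incl w = 0 := by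
  match w, h2 with
  | x :: y :: l, _ =>
    have hlast : lastTgt y l = a := by
      have h' : ∀ z ∈ y :: l, z.tgt = a := fun z hz => (h z (List.mem_cons_of_mem _ hz)).2
      clear h
      induction l generalizing y with
      | nil => exact h' y (by simp)
      | cons z l ih => exact ih z (by simp) fun u hu => h' u (List.mem_cons_of_mem _ hu)
    rw [incl_cons_cons, (h x (by simp)).1, hlast, hForms_self]
    simp

theorem tree_eq_zero_of_forall {w : List (Letter N)}
    (h : ∀ p q, p ++ q = w → L.incl p = 0 ∨ L.incl q = 0) : L.tree w = 0 := by
  refine splitSum_eq_zero fun p q hpq => ?_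
  rcases h p q hpq with h | h <;> simp [h]

/-- Every cut leaves a factor of at least two letters, on which g is zero because h_aa = 0. -/
theorem tree_of_forall_loop {a : Fin N} {w : List (Letter N)}
    (h : ∀ x ∈ w, x.src = a ∧ x.tgt = a) (h3 : 3 ≤ w.length) : L.tree w = 0 := by
  refine L.tree_eq_zero_of_forall fun p q hpq => ?_
  subst hpq
  rw [List.length_append] at h3
  by_cases hp : 2 ≤ p.length
  · exact Or.inl (L.incl_of_forall_loop (fun x hx => h x (List.mem_append_left _ hx)) hp)
  · exact Or.inr (L.incl_of_forall_loop (fun x hx => h x (List.mem_append_right _ hx)) (by omega))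

theorem prod_eq_zero_of_tree {w : List (Letter N)} (h2 : 2 ≤ w.length) (h : L.tree w = 0) :
    L.prod w = 0 := by
  match w, h2 with
  | x :: y :: l, _ => rw [prod, h, map_zero]

theorem incl_eq_zero_of_tree {w : List (Letter N)} (h2 : 2 ≤ w.length) (h : L.tree w = 0) :
    L.incl w = 0 := by
  match w, h2 with
  | x :: y :: l, _ => rw [incl_cons_cons, h, map_zero, neg_zero]

theorem toWord_loops {a : Fin N} (l : List (Σ r : ℤ, SubHom L.V a a r)) :
    ∀ x ∈ toWord L.V (loops (H := SubHom L.V) l), x.src = a ∧ x.tgt = a := by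
  induction l with
  | nil => simp [loops, toWord]
  | cons w l ih =>
    intro x hx
    simp only [loops, toWord, List.mem_cons] at hx
    rcases hx with rfl | hx
    · exact ⟨rfl, rfl⟩
    · exact ih x hx

theorem length_loops {a : Fin N} (l : List (Σ r : ℤ, SubHom L.V a a r)) :
    (loops (H := SubHom L.V) l).length = l.length := by
  induction l with
  | nil => rfl
  | cons w l ih => simp [loops, length, ih]

theorem lineCategory_higher_self {a : Fin N} (l : List (Σ r : ℤ, SubHom L.V a a r))
    (h3 : 3 ≤ l.length) : L.lineCategory.m (loops (H := SubHom L.V) l) = 0 := by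
  have h3' : 3 ≤ (toWord L.V (loops (H := SubHom L.V) l)).length := by
    rwa [length_toWord, length_loops]
  exact L.lineCategory_m_eq_zero (L.prod_eq_zero_of_tree (by omega)
    (L.tree_of_forall_loop (L.toWord_loops l) h3'))

/-- Degree count. Only letters of degree zero lower the suspended degree, each by one. If
endomorphisms of degree zero account for all of it, no step between different lines has degree zero,
so slopes never increase along the word; equal slopes at the ends then leave no such step at all.
The first alternative disposes of zero letters, whose formal degree carries no information. -/
theorem sdeg_le_neg_numTheta {a b : Fin N} (p : HomPath (SubHom L.V) a b) :
    (∃ x ∈ toWord L.V p, x.val = 0) ∨ p.sdeg ≤ -p.numTheta ∧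
      (p.sdeg = -p.numTheta → L.t b ≤ L.t a ∧
        (L.t b = L.t a → ∀ x ∈ toWord L.V p, x.src = a ∧ x.tgt = a)) := by
  induction p with
  | nil => right; simp [sdeg, numTheta, toWord]
  | @cons a b c r w p ih =>
    by_cases hw : (w : StepSpace) = 0
    · exact Or.inl ⟨_, List.mem_cons_self, by rw [hw, map_zero]⟩
    rcases ih with ⟨x, hx, hx0⟩ | ⟨h1, h2⟩
    · exact Or.inl ⟨x, List.mem_cons_of_mem _ hx, hx0⟩
    right
    simp only [sdeg, numTheta, toWord, List.forall_mem_cons]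
    by_cases hab : a = b
    · subst hab
      by_cases h0 : r = 0
      · subst h0
        rw [if_pos ⟨rfl, rfl⟩]
        push_cast
        refine ⟨by omega, fun h => ?_⟩
        obtain ⟨h3, h4⟩ := h2 (by omega)
        exact ⟨h3, fun h => ⟨by simp, h4 h⟩⟩
      · have h5 : r = 1 := by
          by_contra h5
          exact hw (by simpa using (L.V_eq_bot (a := a) (b := a) h0 h5).le w.2)
        subst h5
        rw [if_neg (by simp)]
        push_cast
        refine ⟨by omega, fun h => ?_⟩
        obtain ⟨h3, h4⟩ := h2 (by omega)
        exact ⟨h3, fun h => ⟨by simp, h4 h⟩⟩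
    · rw [if_neg fun h => hab h.1]
      have hr : r = L.vdeg a b := by
        by_contra hr
        exact hw (by simpa using (L.V_of_ne_bot hab hr).le w.2)
      push_cast
      by_cases hlt : L.t a < L.t b
      · rw [L.vdeg_lt hlt] at hr
        exact ⟨by omega, fun h => by omega⟩
      · have hgt := L.lt_of_not_lt hab hlt
        rw [L.vdeg_gt hgt] at hr
        refine ⟨by omega, fun h => ?_⟩
        obtain ⟨h3, h4⟩ := h2 (by omega)
        exact ⟨by linarith, fun h => by linarith⟩

/-- The output lies in degree 0 or 1, so the suspended degree of the word is at least -2, and two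
degree zero endomorphisms make it exactly -2. Then the word consists of endomorphisms of one line,
or it ends at a smaller slope, where V_ab has no part of degree zero. -/
theorem lineCategory_two_theta {a b : Fin N} (p : HomPath (SubHom L.V) a b) (h2 : 2 ≤ p.numTheta)
    (h3 : 3 ≤ p.length) : L.lineCategory.m p = 0 := by
  refine L.lineCategory_m_eq_zero ?_
  have hlen : 3 ≤ (toWord L.V p).length := by rwa [length_toWord]
  rcases L.sdeg_le_neg_numTheta p with ⟨x, hx, hx0⟩ | ⟨h4, h5⟩
  · obtain ⟨u, v, huv⟩ := List.append_of_mem hx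
    rw [huv]
    have := L.isMultilinear_prod.zero u v x.src x.tgt x.deg
    rw [← hx0] at this
    exact this.trans hx0
  obtain ⟨u, hu, huw⟩ := L.prod_toWord_mem p
  by_cases h6 : p.sdeg + 2 = 0
  · obtain ⟨h7, h8⟩ := h5 (by omega)
    by_cases h9 : L.t b = L.t a
    · exact L.prod_eq_zero_of_tree (by omega) (L.tree_of_forall_loop (h8 h9) hlen)
    · have hlt := lt_of_le_of_ne h7 h9
      have := (L.V_of_ne_bot (L.ne_of_lt hlt).symm (r := p.sdeg + 2)
        (by rw [L.vdeg_gt hlt]; omega)).le hu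
      rw [← huw, (Submodule.mem_bot ℝ).mp this, map_zero]
  · have := (L.V_eq_bot (a := a) (b := b) h6 (by omega)).le hu
    rw [← huw, (Submodule.mem_bot ℝ).mp this, map_zero]

/-- Words of degree one endomorphisms of `a`. -/
def IsLoops (a : Fin N) (u : List (Letter N)) : Prop :=
  ∀ x ∈ u, x.src = a ∧ x.tgt = a ∧ x.deg = 1 ∧ x.val ∈ L.vForms x.src x.tgt x.deg

variable {L}

theorem IsLoops.append_iff {a : Fin N} {u v : List (Letter N)} :
    L.IsLoops a (u ++ v) ↔ L.IsLoops a u ∧ L.IsLoops a v := by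
  exact List.forall_mem_append

theorem IsLoops.isWord {a : Fin N} {u : List (Letter N)} (h : L.IsLoops a u) : L.IsWord a a u := by
  induction u with
  | nil => rfl
  | cons x u ih =>
    obtain ⟨h1, h2, -, h4⟩ := h x List.mem_cons_self
    exact ⟨h1, h4, h2.symm ▸ ih fun y hy => h y (List.mem_cons_of_mem _ hy)⟩

theorem IsLoops.wdeg {a : Fin N} {u : List (Letter N)} (h : L.IsLoops a u) : wdeg u = 0 := by
  induction u with
  | nil => rfl
  | cons x u ih =>
    rw [LineConfig.wdeg, ih fun y hy => h y (List.mem_cons_of_mem _ hy),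
      (h x List.mem_cons_self).2.2.1]
    rfl

theorem IsWord.append {a b c : Fin N} {p q : List (Letter N)} (hp : L.IsWord a b p)
    (hq : L.IsWord b c q) : L.IsWord a c (p ++ q) := (IsWord.append_iff L).mpr ⟨b, hp, hq⟩

/-- On two or more letters g is a value of h, hence purely of degree zero, and the degree of g
exceeds the suspended degree of the word by one. -/
theorem IsWord.incl_eq_zero {a b : Fin N} {w : List (Letter N)} (hw : L.IsWord a b w)
    (h2 : 2 ≤ w.length) (hd : LineConfig.wdeg w ≠ -1) : L.incl w = 0 := by
  match w, h2 with
  | x :: y :: l, _ =>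
    obtain ⟨u, hu, huw⟩ := (L.incl_mem hw (List.cons_ne_nil _ _)).1
    by_cases h1 : LineConfig.wdeg (x :: y :: l) + 1 = 1
    · have := L.incl_snd_of_long x y l
      rw [← huw, h1] at this ⊢
      rw [show u = 0 from this, map_zero]
    · rw [← huw, emb_of_ne (by omega) h1]; rfl

/-- This is where h_aa = 0 enters. -/
theorem IsWord.incl_closed {a : Fin N} {w : List (Letter N)} (hw : L.IsWord a a w)
    (h2 : 2 ≤ w.length) : L.incl w = 0 := by
  match w, h2 with
  | x :: y :: l, _ =>
    have hl : LineConfig.lastTgt y l = a := hw.lastTgt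
    rw [incl_cons_cons, hl, hw.1, hForms_self]
    simp

theorem isLoops_toWord {a : Fin N} (l : List (SubHom L.V a a 1)) :
    L.IsLoops a (toWord L.V (loops1 (H := SubHom L.V) l)) := by
  induction l with
  | nil => intro x hx; simp [loops1, loops, toWord] at hx
  | cons w l ih =>
    intro x hx
    simp only [loops1, List.map_cons, loops, toWord, List.mem_cons] at hx
    rcases hx with rfl | hx
    · exact ⟨rfl, rfl, rfl, _, w.2, rfl⟩
    · exact ih x hx

theorem toWord_loops1_ne_nil {a : Fin N} {l : List (SubHom L.V a a 1)} (h : l ≠ []) :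
    toWord L.V (loops1 (H := SubHom L.V) l) ≠ [] := by
  match l, h with
  | w :: l, _ => exact List.cons_ne_nil _ _

/-- A letter from `a` to `b` in the category of lines. -/
structure IsLetter (L : LineConfig N) (a b : Fin N) (r : ℤ) (x : Letter N) : Prop where
  src : x.src = a
  tgt : x.tgt = b
  deg : x.deg = r
  mem : x.val ∈ L.vForms x.src x.tgt x.deg

theorem IsLetter.cons {a b c : Fin N} {r : ℤ} {x : Letter N} {w : List (Letter N)}
    (hx : L.IsLetter a b r x) (hw : L.IsWord b c w) : L.IsWord a c (x :: w) :=
  ⟨hx.src, hx.mem, hx.tgt.symm ▸ hw⟩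

theorem isLetter_toWord {a b : Fin N} {r : ℤ} (w : SubHom L.V a b r) :
    L.IsLetter a b r ⟨a, b, r, emb r w⟩ := ⟨rfl, rfl, rfl, _, w.2, rfl⟩

theorem IsLetter.wdeg_cons {a b : Fin N} {r : ℤ} {x : Letter N} (hx : L.IsLetter a b r x)
    (w : List (Letter N)) : LineConfig.wdeg (x :: w) = r - 1 + LineConfig.wdeg w := by
  rw [LineConfig.wdeg, hx.deg]

/-- A step function and a one-form morphism separated by delta forms. -/
theorem tree_separated {a b c : Fin N} {r r' : ℤ} {x y : Letter N} (hx : L.IsLetter a c r x)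
    (hy : L.IsLetter c b r' y) (h : r = 0 ∧ r' = 1 ∧ a = c ∨ r = 1 ∧ r' = 0 ∧ c = b)
    {u₂ : List (Letter N)} (h₂ : L.IsLoops c u₂) (h0 : u₂ ≠ []) {u₁ u₃ : List (Letter N)}
    (h₁ : L.IsLoops a u₁) (h₃ : L.IsLoops b u₃) : L.tree (u₁ ++ x :: (u₂ ++ y :: u₃)) = 0 := by
  suffices H : ∀ n (u₁ u₃ : List (Letter N)), u₁.length + u₃.length = n → L.IsLoops a u₁ →
      L.IsLoops b u₃ → L.tree (u₁ ++ x :: (u₂ ++ y :: u₃)) = 0 from H _ u₁ u₃ rfl h₁ h₃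
  intro n
  induction n using Nat.strong_induction_on with
  | _ n ih =>
    intro u₁ u₃ hn h₁ h₃
    have hincl : ∀ v₁ v₃ : List (Letter N), v₁.length + v₃.length < n → L.IsLoops a v₁ →
        L.IsLoops b v₃ → L.incl (v₁ ++ x :: (u₂ ++ y :: v₃)) = 0 := fun v₁ v₃ hv hv₁ hv₃ =>
      L.incl_eq_zero_of_tree (by simp; omega) (ih _ hv v₁ v₃ rfl hv₁ hv₃)
    rw [tree, splitSum_append_cons, splitSum_append_cons,
      splitSum_eq_zero, splitSum_eq_zero, splitSum_eq_zero]
    · simp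
    · intro p q hpq
      subst hpq
      rcases q with _ | ⟨z, q⟩
      · rw [incl_nil, mul_zero, smul_zero]
      have := hincl u₁ p (by simp at hn; omega) h₁ (IsLoops.append_iff.mp h₃).1
      rw [this, zero_mul, smul_zero]
    · intro p q hpq
      have hp := (IsLoops.append_iff.mp (hpq ▸ h₂)).1
      have hq := (IsLoops.append_iff.mp (hpq ▸ h₂)).2
      have hlen : 1 ≤ p.length + q.length := by
        rw [← List.length_append, hpq]; exact List.length_pos_iff.mpr h0
      -- A cut between the two letters. If all the separating delta forms go with the step function,
      -- that factor is closed and has at least two letters; otherwise the other factor has at least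
      -- two letters and suspended degree 0. Either way g vanishes on one factor.
      rcases h with ⟨rfl, rfl, rfl⟩ | ⟨rfl, rfl, rfl⟩
      · by_cases hq0 : q = []
        · have h4 : L.incl (u₁ ++ x :: p) = 0 :=
            (h₁.isWord.append (hx.cons hp.isWord)).incl_closed (by
              subst hq0; simp at hlen ⊢; omega)
          rw [h4, zero_mul, smul_zero]
        · have h4 : L.incl (q ++ y :: u₃) = 0 :=
            (hq.isWord.append (hy.cons h₃.isWord)).incl_eq_zero (by
              have := List.length_pos_iff.mpr hq0; simp; omega)
              (by rw [wdeg_append, hq.wdeg, hy.wdeg_cons, h₃.wdeg]; norm_num)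
          rw [h4, mul_zero, smul_zero]
      · by_cases hp0 : p = []
        · have h4 : L.incl (q ++ y :: u₃) = 0 :=
            (hq.isWord.append (hy.cons h₃.isWord)).incl_closed (by
              subst hp0; simp at hlen ⊢; omega)
          rw [h4, mul_zero, smul_zero]
        · have h4 : L.incl (u₁ ++ x :: p) = 0 :=
            (h₁.isWord.append (hx.cons hp.isWord)).incl_eq_zero (by
              have := List.length_pos_iff.mpr hp0; simp; omega)
              (by rw [wdeg_append, h₁.wdeg, hx.wdeg_cons, hp.wdeg]; norm_num)
          rw [h4, zero_mul, smul_zero]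
    · intro p q hpq
      subst hpq
      rcases p with _ | ⟨z, p⟩
      · rw [incl_nil, zero_mul, smul_zero]
      rw [hincl q u₃ (by simp at hn; omega) (IsLoops.append_iff.mp h₁).2 h₃, mul_zero, smul_zero]

theorem incl_separated {a b c : Fin N} {r r' : ℤ} {x y : Letter N} (hx : L.IsLetter a c r x)
    (hy : L.IsLetter c b r' y) (h : r = 0 ∧ r' = 1 ∧ a = c ∨ r = 1 ∧ r' = 0 ∧ c = b)
    {u₁ u₂ u₃ : List (Letter N)} (h₁ : L.IsLoops a u₁) (h₂ : L.IsLoops c u₂) (h0 : u₂ ≠ [])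
    (h₃ : L.IsLoops b u₃) : L.incl (u₁ ++ x :: (u₂ ++ y :: u₃)) = 0 :=
  L.incl_eq_zero_of_tree (by simp; omega) (tree_separated hx hy h h₂ h0 h₁ h₃)

/-- Two letters of degree zero. -/
theorem tree_two_zeros {a b c : Fin N} {x y : Letter N} (hx : L.IsLetter a c 0 x)
    (hy : L.IsLetter c b 0 y) {u₁ u₂ u₃ : List (Letter N)} (h₁ : L.IsLoops a u₁)
    (h₂ : L.IsLoops c u₂) (h₃ : L.IsLoops b u₃)
    (h : a = c ∧ u₁ ≠ [] ∨ c = b ∧ u₃ ≠ []) : L.tree (u₁ ++ x :: (u₂ ++ y :: u₃)) = 0 := by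
  rw [tree, splitSum_append_cons, splitSum_append_cons,
    splitSum_eq_zero, splitSum_eq_zero, splitSum_eq_zero]
  · simp
  · intro p q hpq
    have hp := (IsLoops.append_iff.mp (hpq ▸ h₃)).1
    -- A cut outside the two letters leaves both in one factor, of suspended degree -2.
    have h4 : L.incl (u₁ ++ x :: (u₂ ++ y :: p)) = 0 :=
      (h₁.isWord.append (hx.cons (h₂.isWord.append (hy.cons hp.isWord)))).incl_eq_zero
        (by simp; omega) (by
          rw [wdeg_append, hx.wdeg_cons, wdeg_append, hy.wdeg_cons, h₁.wdeg, h₂.wdeg, hp.wdeg]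
          norm_num)
    rw [h4, zero_mul, smul_zero]
  · intro p q hpq
    have hp := (IsLoops.append_iff.mp (hpq ▸ h₂)).1
    have hq := (IsLoops.append_iff.mp (hpq ▸ h₂)).2
    -- The factor containing the degree zero endomorphism is closed, and the outer delta forms make
    -- it longer than one letter.
    rcases h with ⟨rfl, h0⟩ | ⟨rfl, h0⟩
    · have h4 : L.incl (u₁ ++ x :: p) = 0 :=
        (h₁.isWord.append (hx.cons hp.isWord)).incl_closed (by
          have := List.length_pos_iff.mpr h0; simp; omega)
      rw [h4, zero_mul, smul_zero]
    · have h4 : L.incl (q ++ y :: u₃) = 0 :=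
        (hq.isWord.append (hy.cons h₃.isWord)).incl_closed (by
          have := List.length_pos_iff.mpr h0; simp; omega)
      rw [h4, mul_zero, smul_zero]
  · intro p q hpq
    have hq := (IsLoops.append_iff.mp (hpq ▸ h₁)).2
    have h4 : L.incl (q ++ x :: (u₂ ++ y :: u₃)) = 0 :=
      (hq.isWord.append (hx.cons (h₂.isWord.append (hy.cons h₃.isWord)))).incl_eq_zero
        (by simp; omega) (by
          rw [wdeg_append, hx.wdeg_cons, wdeg_append, hy.wdeg_cons, hq.wdeg, h₂.wdeg, h₃.wdeg]
          norm_num)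
    rw [h4, mul_zero, smul_zero]

/-- Three letters of total suspended degree `-2`. -/
theorem tree_three_letters {a b c e : Fin N} {r₁ r₂ r₃ : ℤ} {x y z : Letter N}
    (hx : L.IsLetter a b r₁ x) (hy : L.IsLetter b c r₂ y) (hz : L.IsLetter c e r₃ z)
    (hr : r₁ + r₂ + r₃ = 1) {u₁ u₂ u₃ u₄ : List (Letter N)} (h₁ : L.IsLoops a u₁)
    (h₂ : L.IsLoops b u₂) (h₃ : L.IsLoops c u₃) (h₄ : L.IsLoops e u₄)
    (hl : ∀ p q, p ++ q = u₂ → L.incl (u₁ ++ x :: p) = 0 ∨ L.incl (q ++ y :: (u₃ ++ z :: u₄)) = 0)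
    (hr' : ∀ p q, p ++ q = u₃ → L.incl (u₁ ++ x :: (u₂ ++ y :: p)) = 0 ∨ L.incl (q ++ z :: u₄) = 0) :
    L.tree (u₁ ++ x :: (u₂ ++ y :: (u₃ ++ z :: u₄))) = 0 := by
  rw [tree, splitSum_append_cons, splitSum_append_cons, splitSum_append_cons,
    splitSum_eq_zero, splitSum_eq_zero, splitSum_eq_zero, splitSum_eq_zero]
  · simp
  · intro p q hpq
    have hp := (IsLoops.append_iff.mp (hpq ▸ h₄)).1
    have h4 : L.incl (u₁ ++ x :: (u₂ ++ y :: (u₃ ++ z :: p))) = 0 :=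
      (h₁.isWord.append (hx.cons (h₂.isWord.append (hy.cons (h₃.isWord.append
        (hz.cons hp.isWord)))))).incl_eq_zero
        (by simp; omega) (by
          rw [wdeg_append, hx.wdeg_cons, wdeg_append, hy.wdeg_cons, wdeg_append, hz.wdeg_cons,
            h₁.wdeg, h₂.wdeg, h₃.wdeg, hp.wdeg]
          omega)
    rw [h4, zero_mul, smul_zero]
  · intro p q hpq
    rcases hr' p q hpq with h | h <;> simp [h]
  · intro p q hpq
    rcases hl p q hpq with h | h <;> simp [h]
  · intro p q hpq
    have hq := (IsLoops.append_iff.mp (hpq ▸ h₁)).2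
    have h4 : L.incl (q ++ x :: (u₂ ++ y :: (u₃ ++ z :: u₄))) = 0 :=
      (hq.isWord.append (hx.cons (h₂.isWord.append (hy.cons (h₃.isWord.append
        (hz.cons h₄.isWord)))))).incl_eq_zero
        (by simp; omega) (by
          rw [wdeg_append, hx.wdeg_cons, wdeg_append, hy.wdeg_cons, wdeg_append, hz.wdeg_cons,
            hq.wdeg, h₂.wdeg, h₃.wdeg, h₄.wdeg]
          omega)
    rw [h4, mul_zero, smul_zero]

theorem isLetter_vElt {a b : Fin N} (h : a ≠ b) :
    L.IsLetter a b (L.vdeg a b) (L.baseLetter a b) :=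
  ⟨rfl, rfl, rfl, _, by rw [baseLetter, L.V_of_ne h]; exact Submodule.mem_span_singleton_self _,
    rfl⟩

theorem isLetter_lt {a b : Fin N} (h : L.t a < L.t b) : L.IsLetter a b 0 (L.baseLetter a b) :=
  L.vdeg_lt h ▸ isLetter_vElt (L.ne_of_lt h)

theorem isLetter_gt {a b : Fin N} (h : L.t b < L.t a) : L.IsLetter a b 1 (L.baseLetter a b) :=
  L.vdeg_gt h ▸ isLetter_vElt (L.ne_of_lt h).symm

variable (L)

theorem lineCategory_typeA_zero {a b : Fin N} (hab : a ≠ b) (l₁ l₂ : List (SubHom L.V a a 1))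
    (l₃ : List (SubHom L.V b b 1)) (w : SubHom L.V a a 0)
    (h : L.t a < L.t b ∧ l₁ ≠ [] ∨ L.t b < L.t a ∧ l₂ ≠ []) :
    L.lineCategory.m ((loops1 l₁).append (cons w ((loops1 l₂).append
      (cons (H := SubHom L.V) (L.vElt a b) (loops1 l₃))))) = 0 := by
  refine L.lineCategory_m_eq_zero ?_
  rw [toWord_append, toWord, toWord_append, L.toWord_cons_vElt hab]
  refine L.prod_eq_zero_of_tree (by simp; omega) ?_
  rcases h with ⟨h, h0⟩ | ⟨h, h0⟩
  · exact tree_two_zeros (isLetter_toWord w) (isLetter_lt h) (isLoops_toWord l₁) (isLoops_toWord l₂)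
      (isLoops_toWord l₃) (Or.inl ⟨rfl, toWord_loops1_ne_nil h0⟩)
  · exact tree_separated (isLetter_toWord w) (isLetter_gt h) (Or.inl ⟨rfl, rfl, rfl⟩)
      (isLoops_toWord l₂) (toWord_loops1_ne_nil h0) (isLoops_toWord l₁) (isLoops_toWord l₃)

theorem lineCategory_typeB_zero {a b : Fin N} (hab : a ≠ b) (l₁ : List (SubHom L.V a a 1))
    (l₂ l₃ : List (SubHom L.V b b 1)) (w : SubHom L.V b b 0)
    (h : L.t a < L.t b ∧ l₃ ≠ [] ∨ L.t b < L.t a ∧ l₂ ≠ []) :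
    L.lineCategory.m ((loops1 l₁).append (cons (H := SubHom L.V) (L.vElt a b) ((loops1 l₂).append
      (cons w (loops1 l₃))))) = 0 := by
  refine L.lineCategory_m_eq_zero ?_
  rw [toWord_append, L.toWord_cons_vElt hab, toWord_append, toWord]
  refine L.prod_eq_zero_of_tree (by simp; omega) ?_
  rcases h with ⟨h, h0⟩ | ⟨h, h0⟩
  · exact tree_two_zeros (isLetter_lt h) (isLetter_toWord w) (isLoops_toWord l₁) (isLoops_toWord l₂)
      (isLoops_toWord l₃) (Or.inr ⟨rfl, toWord_loops1_ne_nil h0⟩)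
  · exact tree_separated (isLetter_gt h) (isLetter_toWord w) (Or.inr ⟨rfl, rfl, rfl⟩)
      (isLoops_toWord l₂) (toWord_loops1_ne_nil h0) (isLoops_toWord l₁) (isLoops_toWord l₃)

/-- The suspended degree is -2, so only cuts between the three letters of interest matter. Each of
them has a factor on which g vanishes: one with both letters of degree zero, of suspended degree -2,
or one in which delta forms separate the step function from a base element of degree one. -/
theorem lineCategory_typeC₁_zero {a b : Fin N} (hab : a ≠ b) (l₁ l₄ : List (SubHom L.V a a 1))
    (l₂ l₃ : List (SubHom L.V b b 1)) (w : SubHom L.V b b 0)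
    (h : L.t a < L.t b ∧ l₃ ≠ [] ∨ L.t b < L.t a ∧ l₂ ≠ []) :
    L.lineCategory.m ((loops1 l₁).append (cons (H := SubHom L.V) (L.vElt a b) ((loops1 l₂).append
      (cons w ((loops1 l₃).append (cons (H := SubHom L.V) (L.vElt b a) (loops1 l₄))))))) = 0 := by
  refine L.lineCategory_m_eq_zero ?_
  rw [toWord_append, L.toWord_cons_vElt hab, toWord_append, toWord, toWord_append,
    L.toWord_cons_vElt hab.symm]
  have h₁ := isLoops_toWord l₁
  have h₂ := isLoops_toWord l₂
  have h₃ := isLoops_toWord l₃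
  have h₄ := isLoops_toWord l₄
  have hw := isLetter_toWord w
  refine L.prod_eq_zero_of_tree (by simp; omega) ?_
  rcases h with ⟨h, h0⟩ | ⟨h, h0⟩
  · refine tree_three_letters (isLetter_lt h) hw (isLetter_gt h) rfl h₁ h₂ h₃ h₄
      (fun p q hpq => Or.inr ?_) fun p q hpq => Or.inl ?_
    · exact incl_separated hw (isLetter_gt h) (Or.inl ⟨rfl, rfl, rfl⟩)
        (IsLoops.append_iff.mp (hpq ▸ h₂)).2 h₃ (toWord_loops1_ne_nil h0) h₄
    · have hp := (IsLoops.append_iff.mp (hpq ▸ h₃)).1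
      refine (h₁.isWord.append ((isLetter_lt h).cons (h₂.isWord.append
        (hw.cons hp.isWord)))).incl_eq_zero (by simp; omega) ?_
      rw [wdeg_append, (isLetter_lt h).wdeg_cons, wdeg_append, hw.wdeg_cons, h₁.wdeg, h₂.wdeg,
        hp.wdeg]
      norm_num
  · refine tree_three_letters (isLetter_gt h) hw (isLetter_lt h) rfl h₁ h₂ h₃ h₄
      (fun p q hpq => Or.inr ?_) fun p q hpq => Or.inl ?_
    · have hq := (IsLoops.append_iff.mp (hpq ▸ h₂)).2
      refine (hq.isWord.append (hw.cons (h₃.isWord.append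
        ((isLetter_lt h).cons h₄.isWord)))).incl_eq_zero (by simp; omega) ?_
      rw [wdeg_append, hw.wdeg_cons, wdeg_append, (isLetter_lt h).wdeg_cons, hq.wdeg, h₃.wdeg,
        h₄.wdeg]
      norm_num
    · exact incl_separated (isLetter_gt h) hw (Or.inr ⟨rfl, rfl, rfl⟩) h₁ h₂
        (toWord_loops1_ne_nil h0) (IsLoops.append_iff.mp (hpq ▸ h₃)).1

/-- A cut between the step function and [v_ab] leaves a closed right factor; a cut between the two
base elements leaves a left factor in which delta forms separate the step function from [v_ab]. -/
theorem lineCategory_typeC₂_zero {a b : Fin N} (h : L.t b < L.t a)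
    (l₁ l₂ l₄ : List (SubHom L.V a a 1)) (l₃ : List (SubHom L.V b b 1)) (w : SubHom L.V a a 0)
    (h0 : l₂ ≠ []) :
    L.lineCategory.m ((loops1 l₁).append (cons w ((loops1 l₂).append
      (cons (H := SubHom L.V) (L.vElt a b) ((loops1 l₃).append
        (cons (H := SubHom L.V) (L.vElt b a) (loops1 l₄))))))) = 0 := by
  refine L.lineCategory_m_eq_zero ?_
  have hab := L.ne_of_lt h
  rw [toWord_append, toWord, toWord_append, L.toWord_cons_vElt hab.symm, toWord_append,
    L.toWord_cons_vElt hab]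
  have h₁ := isLoops_toWord l₁
  have h₂ := isLoops_toWord l₂
  have h₃ := isLoops_toWord l₃
  have h₄ := isLoops_toWord l₄
  have hw := isLetter_toWord w
  refine L.prod_eq_zero_of_tree (by simp; omega) (tree_three_letters hw (isLetter_gt h)
    (isLetter_lt h) rfl h₁ h₂ h₃ h₄ (fun p q hpq => Or.inr ?_) fun p q hpq => Or.inl ?_)
  · exact ((IsLoops.append_iff.mp (hpq ▸ h₂)).2.isWord.append ((isLetter_gt h).cons
      (h₃.isWord.append ((isLetter_lt h).cons h₄.isWord)))).incl_closed (by simp; omega)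
  · exact incl_separated hw (isLetter_gt h) (Or.inl ⟨rfl, rfl, rfl⟩) h₁ h₂
      (toWord_loops1_ne_nil h0) (IsLoops.append_iff.mp (hpq ▸ h₃)).1

/-- The mirror image of the preceding case: now the left factor is closed, or the right factor is
separated. -/
theorem lineCategory_typeC₃_zero {a b : Fin N} (h : L.t a < L.t b)
    (l₁ l₃ l₄ : List (SubHom L.V a a 1)) (l₂ : List (SubHom L.V b b 1)) (w : SubHom L.V a a 0)
    (h0 : l₃ ≠ []) :
    L.lineCategory.m ((loops1 l₁).append (cons (H := SubHom L.V) (L.vElt a b) ((loops1 l₂).append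
      (cons (H := SubHom L.V) (L.vElt b a) ((loops1 l₃).append (cons w (loops1 l₄))))))) = 0 := by
  refine L.lineCategory_m_eq_zero ?_
  have hab := L.ne_of_lt h
  rw [toWord_append, L.toWord_cons_vElt hab, toWord_append, L.toWord_cons_vElt hab.symm,
    toWord_append, toWord]
  have h₁ := isLoops_toWord l₁
  have h₂ := isLoops_toWord l₂
  have h₃ := isLoops_toWord l₃
  have h₄ := isLoops_toWord l₄
  have hw := isLetter_toWord w
  refine L.prod_eq_zero_of_tree (by simp; omega) (tree_three_letters (isLetter_lt h) (isLetter_gt h)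
    hw rfl h₁ h₂ h₃ h₄ (fun p q hpq => Or.inr ?_) fun p q hpq => Or.inl ?_)
  · exact incl_separated (isLetter_gt h) hw (Or.inr ⟨rfl, rfl, rfl⟩)
      (IsLoops.append_iff.mp (hpq ▸ h₂)).2 h₃ (toWord_loops1_ne_nil h0) h₄
  · exact (h₁.isWord.append ((isLetter_lt h).cons (h₂.isWord.append ((isLetter_gt h).cons
      (IsLoops.append_iff.mp (hpq ▸ h₃)).1.isWord)))).incl_closed (by simp; omega)

end LineConfig

/-! ## Two-sided step functions -/

namespace LineConfig

open StepSpace HomPath Polynomial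

variable {ε : ℝ}

theorem thetaPM_one (p : ℝ) : thetaPM 1 p = theta p := if_pos rfl

theorem thetaPM_neg_one (p : ℝ) : thetaPM (-1) p = 1 - theta p := if_neg (by norm_num)

theorem neg_sign (hε : ε = 1 ∨ ε = -1) : -ε = 1 ∨ -ε = -1 := by
  rcases hε with rfl | rfl
  · exact Or.inr rfl
  · exact Or.inl (neg_neg 1)

theorem thetaPM_apply_of_lt (hε : ε = 1 ∨ ε = -1) {p x : ℝ} (h : ε * x < ε * p) :
    thetaPM ε p x = 0 := by
  rcases hε with rfl | rfl
  · rw [thetaPM_one, theta_apply_of_lt (by linarith)]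
  · rw [thetaPM_neg_one, Pi.sub_apply, theta_apply_of_gt (by linarith)]; simp

theorem thetaPM_apply_of_gt (hε : ε = 1 ∨ ε = -1) {p x : ℝ} (h : ε * p < ε * x) :
    thetaPM ε p x = 1 := by
  rcases hε with rfl | rfl
  · rw [thetaPM_one, theta_apply_of_gt (by linarith)]
  · rw [thetaPM_neg_one, Pi.sub_apply, theta_apply_of_lt (by linarith)]; simp

theorem thetaPM_neg (hε : ε = 1 ∨ ε = -1) (p : ℝ) : thetaPM (-ε) p = 1 - thetaPM ε p := by
  rcases hε with rfl | rfl
  · rw [thetaPM_one, thetaPM_neg_one]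
  · rw [neg_neg, thetaPM_one, thetaPM_neg_one, sub_sub_cancel]

theorem d_thetaPM (hε : ε = 1 ∨ ε = -1) (p : ℝ) : d (thetaPM ε p) = ε • delta p := by
  rcases hε with rfl | rfl
  · rw [thetaPM_one, d_theta, one_smul]
  · have : d (1 : StepSpace) = 0 := by simpa using d_algebraMap 1
    rw [thetaPM_neg_one, map_sub, d_theta, this, zero_sub, neg_one_smul]

theorem thetaPM_mul (hε : ε = 1 ∨ ε = -1) {p q : ℝ} (h : ε * p < ε * q) :
    thetaPM ε p * thetaPM ε q = thetaPM ε q := by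
  rcases hε with rfl | rfl
  · rw [thetaPM_one, thetaPM_one, theta_mul_theta (by linarith)]
  · have := theta_mul_theta (p := q) (q := p) (by linarith)
    rw [thetaPM_neg_one, thetaPM_neg_one]
    linear_combination this

theorem thetaPM_mem {S : Set ℝ} (ε : ℝ) {p : ℝ} (hp : p ∈ S) : thetaPM ε p ∈ tildeA0 S := by
  rw [thetaPM]
  split_ifs
  · exact theta_mem hp
  · exact sub_mem (one_mem _) (theta_mem hp)

variable {N : ℕ} (L : LineConfig N)

/-- The line `L_a` as a function. -/
def lineAt (a : Fin N) (x : ℝ) : ℝ := L.t a * x + L.s a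

theorem lineAt_sub {a b : Fin N} (h : a ≠ b) (x : ℝ) :
    L.lineAt b x - L.lineAt a x = (L.t b - L.t a) * (x - L.xv a b) := by
  have : L.t a - L.t b ≠ 0 := sub_ne_zero.mpr (L.slopes a b h)
  rw [lineAt, lineAt, xv]
  field_simp
  ring

theorem lineAt_xv {a b : Fin N} (h : a ≠ b) : L.lineAt a (L.xv a b) = L.lineAt b (L.xv a b) := by
  have := L.lineAt_sub h (L.xv a b)
  rw [sub_self, mul_zero] at this
  linarith

theorem eq_xv {a b : Fin N} (h : a ≠ b) {x : ℝ} (hx : L.lineAt a x = L.lineAt b x) :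
    x = L.xv a b := by
  have h1 := L.lineAt_sub h x
  rw [hx, sub_self, eq_comm, mul_eq_zero, sub_eq_zero, sub_eq_zero] at h1
  exact h1.resolve_left (L.slopes a b h).symm

theorem lineAt_generic {a b c : Fin N} {x : ℝ} (h1 : L.lineAt a x = L.lineAt b x)
    (h2 : L.lineAt b x = L.lineAt c x) : a = b ∨ b = c ∨ a = c := by
  by_contra! h
  exact L.generic a b c h.1 h.2.1 h.2.2 ⟨x, L.lineAt a x, rfl, h1, h1.trans h2⟩

/-- The step function that is `1` where `ε L_a < ε L_b` and `0` where `ε L_b < ε L_a`. -/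
noncomputable def sideStep (ε : ℝ) (a b : Fin N) : StepSpace :=
  thetaPM (if L.t a < L.t b then ε else -ε) (L.xv a b)

theorem sideStep_lt (ε : ℝ) {a b : Fin N} (h : L.t a < L.t b) :
    L.sideStep ε a b = thetaPM ε (L.xv a b) := by rw [sideStep, if_pos h]

theorem sideStep_gt (ε : ℝ) {a b : Fin N} (h : L.t b < L.t a) :
    L.sideStep ε a b = thetaPM (-ε) (L.xv a b) := by rw [sideStep, if_neg h.not_gt]

theorem sideStep_swap (ε : ℝ) {a b : Fin N} (h : a ≠ b) :
    L.sideStep (-ε) b a = L.sideStep ε a b := by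
  by_cases hlt : L.t a < L.t b
  · rw [L.sideStep_lt _ hlt, L.sideStep_gt _ hlt, neg_neg, xv_comm]
  · have h' := L.lt_of_not_lt h hlt
    rw [L.sideStep_gt _ h', L.sideStep_lt _ h', xv_comm]

theorem sideStep_mem (ε : ℝ) {a b : Fin N} (h : a ≠ b) : L.sideStep ε a b ∈ tildeA0 L.Sall :=
  thetaPM_mem _ (L.xv_mem_Sall h)

theorem sideStep_apply_of_pos (hε : ε = 1 ∨ ε = -1) {a b : Fin N} (hab : a ≠ b) {x : ℝ}
    (h : ε * L.lineAt a x < ε * L.lineAt b x) : L.sideStep ε a b x = 1 := by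
  have h1 := L.lineAt_sub hab x
  have h2 : 0 < (L.t b - L.t a) * (ε * x - ε * L.xv a b) := by
    have : (L.t b - L.t a) * (ε * x - ε * L.xv a b)
      = ε * ((L.t b - L.t a) * (x - L.xv a b)) := by ring
    rw [this, ← h1]; linarith
  by_cases hlt : L.t a < L.t b
  · rw [L.sideStep_lt _ hlt, thetaPM_apply_of_gt hε]
    have := pos_of_mul_pos_right h2 (by linarith); linarith
  · have h' := L.lt_of_not_lt hab hlt
    rw [L.sideStep_gt _ h', thetaPM_apply_of_gt (neg_sign hε)]
    by_contra hc
    nlinarith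

theorem sideStep_apply_of_neg (hε : ε = 1 ∨ ε = -1) {a b : Fin N} (hab : a ≠ b) {x : ℝ}
    (h : ε * L.lineAt b x < ε * L.lineAt a x) : L.sideStep ε a b x = 0 := by
  have h1 := L.sideStep_apply_of_pos (neg_sign hε) (a := a) (b := b) hab (x := x) (by linarith)
  have h2 : L.sideStep (-ε) a b = 1 - L.sideStep ε a b := by
    rw [sideStep, sideStep]
    split_ifs
    · exact thetaPM_neg hε _
    · exact thetaPM_neg (neg_sign hε) _
  rw [h2, Pi.sub_apply, Pi.one_apply] at h1
  linear_combination -h1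

/-- Step functions that vanish far to the left and far to the right. -/
def VanishesAtEnds (u : StepSpace) : Prop := (∃ R, ∀ x < R, u x = 0) ∧ ∃ R, ∀ x > R, u x = 0

theorem VanishesAtEnds.mul_left {u : StepSpace} (h : VanishesAtEnds u) (w : StepSpace) :
    VanishesAtEnds (w * u) := by
  obtain ⟨⟨R, h⟩, R', h'⟩ := h
  exact ⟨⟨R, fun x hx => by rw [Pi.mul_apply, h x hx, mul_zero]⟩, R', fun x hx => by
    rw [Pi.mul_apply, h' x hx, mul_zero]⟩

theorem vanishesAtEnds_thetaPM_mul (hε : ε = 1 ∨ ε = -1) (p q : ℝ) :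
    VanishesAtEnds (thetaPM ε p * thetaPM (-ε) q) := by
  have H : ∀ p q, VanishesAtEnds (thetaPM 1 p * thetaPM (-1) q) := fun p q =>
    ⟨⟨p, fun x hx => by
      rw [Pi.mul_apply, thetaPM_apply_of_lt (Or.inl rfl) (by linarith), zero_mul]⟩, q, fun x hx => by
      rw [Pi.mul_apply, thetaPM_apply_of_lt (Or.inr rfl) (by linarith), mul_zero]⟩
  rcases hε with rfl | rfl
  · exact H p q
  · rw [neg_neg, mul_comm]; exact H q p

theorem exists_lt_Sfin (R : ℝ) : ∃ x < R, ∀ p ∈ L.Sfin, x < p := by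
  obtain ⟨M, hM⟩ := L.Sfin.finite_toSet.bddBelow
  exact ⟨min R M - 1, by linarith [min_le_left R M], fun p hp => by
    linarith [min_le_right R M, hM hp]⟩

theorem exists_gt_Sfin (R : ℝ) : ∃ x > R, ∀ p ∈ L.Sfin, p < x := by
  obtain ⟨M, hM⟩ := L.Sfin.finite_toSet.bddAbove
  exact ⟨max R M + 1, by linarith [le_max_left R M], fun p hp => by
    linarith [le_max_right R M, hM hp]⟩

theorem VanishesAtEnds.prim_d {u : StepSpace} (hu : u ∈ tildeA0 L.Sall) (h : VanishesAtEnds u) :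
    prim L.Sfin (d u) = u ∧ total L.Sfin (d u) = 0 := by
  rw [← coe_Sfin] at hu
  obtain ⟨c, hc⟩ := exists_eq_add_prim hu
  obtain ⟨⟨R, hR⟩, R', hR'⟩ := h
  obtain ⟨x, hx, hxS⟩ := L.exists_lt_Sfin R
  obtain ⟨y, hy, hyS⟩ := L.exists_gt_Sfin R'
  have h1 := congrFun hc x
  have h2 := congrFun hc y
  rw [hR x hx, Pi.add_apply, prim_apply_of_lt _ hxS, add_zero, Pi.algebraMap_apply,
    Polynomial.algebraMap_eq, eq_comm, C_eq_zero] at h1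
  rw [hR' y hy, Pi.add_apply, prim_apply_of_gt _ hyS, Pi.algebraMap_apply,
    Polynomial.algebraMap_eq, h1, C_0, zero_add, eq_comm, C_eq_zero] at h2
  rw [h1, map_zero, zero_add] at hc
  exact ⟨hc.symm, h2⟩

/-- The value of u at v_ab is zero, so the normalising constant of the homotopy cancels the constant
of integration. -/
theorem stepHomotopy_d_of_lt {a b : Fin N} (h : L.t a < L.t b) {u : StepSpace}
    (hu : u ∈ tildeA0 L.Sall) (h0 : u (L.xv a b) = 0) : L.stepHomotopy a b (d u) = u := by
  rw [← coe_Sfin] at hu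
  obtain ⟨c, hc⟩ := exists_eq_add_prim hu
  have h1 := congrFun hc (L.xv a b)
  rw [h0, Pi.add_apply, Pi.algebraMap_apply, Polynomial.algebraMap_eq, eq_comm,
    ← eq_neg_iff_add_eq_zero] at h1
  have h2 := congrArg (eval (1 / 2)) h1
  rw [eval_C, eval_neg] at h2
  rw [L.stepHomotopy_lt h, ← neg_eq_iff_eq_neg.mpr h2, map_neg, sub_neg_eq_add, add_comm, ← hc]

theorem stepHomotopy_d_of_gt {a b : Fin N} (h : L.t b < L.t a) {u : StepSpace}
    (hu : u ∈ tildeA0 L.Sall) (h0 : VanishesAtEnds u) : L.stepHomotopy a b (d u) = u := by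
  obtain ⟨h1, h2⟩ := h0.prim_d L hu
  rw [L.stepHomotopy_gt h, h1, h2, zero_smul, sub_zero]

theorem stepHomotopy_delta_xv {a b : Fin N} (h : L.t b < L.t a) :
    L.stepHomotopy a b (delta (L.xv a b)) = 0 := by
  have hx := L.xv_mem_Sall (L.ne_of_lt h).symm
  rw [L.stepHomotopy_gt h, L.prim_delta hx, L.total_delta hx, one_smul, sub_self]

/-- A one-form `Φ dΘ`, with `Φ` the step function of the side of `L_a` on which `L_b` lies and `Θ` vanishing at the other
end. -/
theorem stepHomotopy_sideStep_mul (hε : ε = 1 ∨ ε = -1) {a b : Fin N} (hab : a ≠ b)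
    {u : StepSpace} (hu : u ∈ tildeA0 L.Sall) {p : ℝ} {w : StepSpace} (hp : u = w * thetaPM ε p)
    (hlt : L.t a < L.t b → u (L.xv a b) = 0) {c : ℝ} (hgt : L.t b < L.t a → u (L.xv a b) = C c) :
    L.stepHomotopy a b (L.sideStep ε a b * d u) = u * L.sideStep ε a b := by
  have hmem := mul_mem hu (L.sideStep_mem ε hab)
  -- Integration by parts. The differential of the side function is ±δ_{v_ab}. For t_a < t_b it is
  -- multiplied by u(v_ab) = 0; for t_a > t_b it gives a multiple of δ_{v_ab}, which the homotopy
  -- kills. The exact term has a primitive that the homotopy returns unchanged: zero at v_ab in the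
  -- first case, zero at both ends in the second.
  have h1 : L.sideStep ε a b * d u = d (u * L.sideStep ε a b) - u * d (L.sideStep ε a b) := by
    rw [d_mul]; ring
  by_cases h : L.t a < L.t b
  · have h2 : u * d (L.sideStep ε a b) = 0 := by
      rw [L.sideStep_lt _ h, d_thetaPM hε, mul_smul_comm,
        mul_delta u _ 0 (by rw [hlt h, C_0]), zero_smul, smul_zero]
    rw [h1, h2, sub_zero, L.stepHomotopy_d_of_lt h hmem]
    rw [Pi.mul_apply, hlt h, zero_mul]
  · have h' := L.lt_of_not_lt hab h
    rw [h1, map_sub, L.stepHomotopy_d_of_gt h' hmem, L.sideStep_gt _ h', d_thetaPM (neg_sign hε),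
      mul_smul_comm, mul_delta u _ c (hgt h'), map_smul, map_smul, L.stepHomotopy_delta_xv h',
      smul_zero, smul_zero, sub_zero]
    rw [L.sideStep_gt _ h', hp, mul_assoc]
    exact (vanishesAtEnds_thetaPM_mul hε _ _).mul_left _

/-- The same integration by parts: the exact term has integral zero because its primitive vanishes
at both ends, and the delta form at v_ab contributes the value there. -/
theorem total_sideStep_mul (hε : ε = 1 ∨ ε = -1) {a b : Fin N} (h : L.t b < L.t a)
    {u : StepSpace} (hu : u ∈ tildeA0 L.Sall) {p : ℝ} {w : StepSpace} (hp : u = w * thetaPM ε p)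
    {c : ℝ} (hc : u (L.xv a b) = C c) :
    total L.Sfin (L.sideStep ε a b * d u) = ε * c := by
  have hab := (L.ne_of_lt h).symm
  have hmem := mul_mem hu (L.sideStep_mem ε hab)
  have h1 : L.sideStep ε a b * d u = d (u * L.sideStep ε a b) - u * d (L.sideStep ε a b) := by
    rw [d_mul]; ring
  have h2 : VanishesAtEnds (u * L.sideStep ε a b) := by
    rw [L.sideStep_gt _ h, hp, mul_assoc]
    exact (vanishesAtEnds_thetaPM_mul hε _ _).mul_left _
  rw [h1, map_sub, (h2.prim_d L hmem).2, L.sideStep_gt _ h, d_thetaPM (neg_sign hε), mul_smul_comm,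
    mul_delta u _ c hc, map_smul, map_smul, L.total_delta (L.xv_mem_Sall hab)]
  simp

end LineConfig

/-! ## Words of base elements -/

namespace LineConfig

open StepSpace HomPath Polynomial

variable {N : ℕ} (L : LineConfig N) (o : ℕ → Fin N)

/-- The `x`-coordinate of the intersection of the `i`-th and the next line of a sequence. -/
noncomputable def vx (i : ℕ) : ℝ := L.xv (o i) (o (i + 1))

/-- The slope increases after the `i`-th line of a sequence. -/
def Asc (i : ℕ) : Prop := L.t (o i) < L.t (o (i + 1))

/-- The word of the base elements `[v_{oₜ oₜ₊₁}]`, `i ≤ t < j`. -/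
noncomputable def seg (i j : ℕ) : List (Letter N) :=
  (List.range' i (j - i)).map fun t => L.baseLetter (o t) (o (t + 1))

theorem seg_self (i : ℕ) : L.seg o i i = [] := by simp [seg]

theorem seg_succ (i : ℕ) : L.seg o i (i + 1) = [L.baseLetter (o i) (o (i + 1))] := by simp [seg]

theorem length_seg (i j : ℕ) : (L.seg o i j).length = j - i := by simp [seg]

theorem seg_cons {i j : ℕ} (h : i < j) :
    L.seg o i j = L.baseLetter (o i) (o (i + 1)) :: L.seg o (i + 1) j := by
  obtain ⟨n, rfl⟩ := Nat.exists_eq_add_of_lt h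
  have h1 : i + n + 1 - i = n + 1 := by omega
  have h2 : i + n + 1 - (i + 1) = n := by omega
  rw [seg, seg, h1, h2, List.range'_succ, List.map_cons]

theorem splitSum_seg {M : Type*} [AddCommMonoid M] (f : List (Letter N) → List (Letter N) → M)
    {i j : ℕ} (h : i ≤ j) :
    splitSum f (L.seg o i j) = ∑ t ∈ Finset.Icc i j, f (L.seg o i t) (L.seg o t j) := by
  induction h using Nat.decreasingInduction generalizing f with
  | self => simp [seg_self, splitSum]
  | of_succ i h ih =>
    rw [L.seg_cons o h, splitSum, ih, ← Finset.add_sum_Ioc_eq_sum_Icc (by omega : i ≤ j),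
      seg_self, L.seg_cons o h]
    refine congrArg _ ?_
    refine Finset.sum_congr (by ext; simp) fun t ht => ?_
    rw [L.seg_cons o (i := i) (j := t) (by simp at ht; omega)]

variable {L o}

theorem wdeg_seg {i j : ℕ} (h : i ≤ j) : wdeg (L.seg o i j)
    = ∑ t ∈ Finset.Ico i j, (L.vdeg (o t) (o (t + 1)) - 1) := by
  induction h using Nat.decreasingInduction with
  | self => simp [seg_self, wdeg]
  | of_succ i h ih =>
    rw [L.seg_cons o h, wdeg, ih, Finset.sum_eq_sum_Ico_succ_bot h]
    rfl

theorem isWord_seg (ho : ∀ t, o t ≠ o (t + 1)) {i j : ℕ} (h : i ≤ j) :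
    L.IsWord (o i) (o j) (L.seg o i j) := by
  induction h using Nat.decreasingInduction with
  | self => rw [seg_self]; rfl
  | of_succ i h ih => rw [L.seg_cons o h]; exact (isLetter_vElt (ho i)).cons ih

theorem incl_seg_of_long (ho : ∀ t, o t ≠ o (t + 1)) {i j : ℕ} (h : i + 2 ≤ j) :
    L.incl (L.seg o i j) = - L.hForms (o i) (o j) (L.tree (L.seg o i j)) := by
  have h2 := (isWord_seg ho (L := L) (by omega : i + 1 ≤ j))
  rw [L.seg_cons o (by omega : i < j), L.seg_cons o (by omega : i + 1 < j)] at *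
  rw [incl_cons_cons, h2.lastTgt]
  rfl

theorem prod_seg_of_long (ho : ∀ t, o t ≠ o (t + 1)) {i j : ℕ} (h : i + 2 ≤ j) :
    L.prod (L.seg o i j) = L.pForms (o i) (o j) (L.tree (L.seg o i j)) := by
  have h2 := (isWord_seg ho (L := L) (by omega : i + 1 ≤ j))
  rw [L.seg_cons o (by omega : i < j), L.seg_cons o (by omega : i + 1 < j)] at *
  rw [prod, h2.lastTgt]
  rfl

theorem vdeg_of_asc {t : ℕ} (h : L.Asc o t) : L.vdeg (o t) (o (t + 1)) = 0 := L.vdeg_lt h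

theorem vdeg_of_not_asc {t : ℕ} (h : ¬ L.Asc o t) : L.vdeg (o t) (o (t + 1)) = 1 := if_neg h

theorem vdeg_sub_one (t : ℕ) [Decidable (L.Asc o t)] :
    L.vdeg (o t) (o (t + 1)) - 1 = if L.Asc o t then -1 else 0 := by
  split_ifs with h
  · rw [vdeg_of_asc h]; rfl
  · rw [vdeg_of_not_asc h]; rfl

theorem wdeg_seg_of_not_asc {i j : ℕ} (h : i ≤ j) (hd : ∀ t, i ≤ t → t < j → ¬ L.Asc o t) :
    wdeg (L.seg o i j) = 0 := by
  rw [wdeg_seg h]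
  refine Finset.sum_eq_zero fun t ht => ?_
  rw [Finset.mem_Ico] at ht
  rw [vdeg_of_not_asc (hd t ht.1 ht.2), sub_self]

theorem wdeg_seg_append {i j k : ℕ} (h : i ≤ j) (h' : j ≤ k) :
    wdeg (L.seg o i k) = wdeg (L.seg o i j) + wdeg (L.seg o j k) := by
  rw [wdeg_seg h, wdeg_seg h', wdeg_seg (h.trans h'), Finset.sum_Ico_consecutive _ h h']

theorem wdeg_seg_succ {m : ℕ} (h : L.Asc o m) : wdeg (L.seg o m (m + 1)) = -1 := by
  rw [wdeg_seg (by omega)]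
  simp [vdeg_of_asc h]

theorem incl_seg_of_not_asc (ho : ∀ t, o t ≠ o (t + 1)) {i j : ℕ} (h : i + 2 ≤ j)
    (hd : ∀ t, i ≤ t → t < j → ¬ L.Asc o t) : L.incl (L.seg o i j) = 0 :=
  (isWord_seg ho (by omega)).incl_eq_zero (by rw [length_seg]; omega)
    (by rw [wdeg_seg_of_not_asc (by omega) hd]; norm_num)

/-- Among the steps `i ≤ t < j` there is exactly one ascent, at `m`. -/
structure OneAscent (L : LineConfig N) (o : ℕ → Fin N) (i m j : ℕ) : Prop where
  le : i ≤ m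
  lt : m < j
  asc : L.Asc o m
  desc : ∀ t, i ≤ t → t < j → t ≠ m → ¬ L.Asc o t

theorem OneAscent.tail {i m j : ℕ} (h : OneAscent L o i m j) {i' : ℕ} (h1 : i ≤ i') (h2 : i' ≤ m) :
    OneAscent L o i' m j := ⟨h2, h.lt, h.asc, fun t ht => h.desc t (by omega)⟩

theorem OneAscent.init {i m j : ℕ} (h : OneAscent L o i m j) {j' : ℕ} (h1 : j' ≤ j) (h2 : m < j') :
    OneAscent L o i m j' := ⟨h.le, h2, h.asc, fun t ht ht' => h.desc t ht (by omega)⟩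

theorem OneAscent.wdeg {i m j : ℕ} (h : OneAscent L o i m j) : wdeg (L.seg o i j) = -1 := by
  have := h.le
  have := h.lt
  rw [wdeg_seg_append (j := m) h.le (by omega),
    wdeg_seg_append (i := m) (j := m + 1) (by omega) (by omega), wdeg_seg_succ h.asc, wdeg_seg_of_not_asc h.le fun t ht ht' => h.desc t ht (by omega) (by omega),
    wdeg_seg_of_not_asc (by omega) fun t ht ht' => h.desc t (by omega) ht' (by omega)]
  rfl

theorem tree_seg_eq_sum {i j : ℕ} (h : i ≤ j) : L.tree (L.seg o i j)
    = ∑ t ∈ Finset.Icc i j, wsign (L.seg o i t) • (L.incl (L.seg o i t) * L.incl (L.seg o t j)) :=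
  L.splitSum_seg o _ h

/-- Each cut leaves one factor without ascent, and on it g vanishes unless it is a single letter; so
only the first or the last letter can be split off. The sign is + when the left factor is one
descent, of suspended degree 0, and - when it contains the ascent. -/
theorem OneAscent.tree_seg (ho : ∀ t, o t ≠ o (t + 1)) {i m j : ℕ} (h : OneAscent L o i m j) :
    L.tree (L.seg o i j)
      = (if i < m then (L.baseLetter (o i) (o (i + 1))).val * L.incl (L.seg o (i + 1) j) else 0)
        - (if m + 1 < j then
            L.incl (L.seg o i (j - 1)) * (L.baseLetter (o (j - 1)) (o j)).val else 0) := by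
  have h1 := h.le
  have h2 := h.lt
  have key : ∀ t ∈ Finset.Icc i j,
      wsign (L.seg o i t) • (L.incl (L.seg o i t) * L.incl (L.seg o t j))
      = (if t = i + 1 then (if i < m then
          (L.baseLetter (o i) (o (i + 1))).val * L.incl (L.seg o (i + 1) j) else 0) else 0)
        - (if t = j - 1 then (if m + 1 < j then
            L.incl (L.seg o i (j - 1)) * (L.baseLetter (o (j - 1)) (o j)).val else 0) else 0) := by
    intro t ht
    rw [Finset.mem_Icc] at ht
    by_cases htm : t ≤ m
    · rw [show (if t = j - 1 then (if m + 1 < j then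
            L.incl (L.seg o i (j - 1)) * (L.baseLetter (o (j - 1)) (o j)).val else 0) else 0) = 0 by
          split_ifs <;> first | omega | rfl, sub_zero]
      by_cases ht1 : t = i + 1
      · subst ht1
        rw [if_pos rfl, if_pos (by omega), seg_succ, incl_single, ← seg_succ, wsign,
          wdeg_seg_of_not_asc (by omega) fun t h3 h4 => h.desc t h3 (by omega) (by omega), zpow_zero,
          one_smul]
      · rw [if_neg ht1]
        rcases ht.1.eq_or_lt with rfl | h3
        · rw [seg_self, incl_nil, zero_mul, smul_zero]
        · rw [incl_seg_of_not_asc ho (by omega) fun t h3 h4 => h.desc t h3 (by omega) (by omega),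
            zero_mul, smul_zero]
    · rw [show (if t = i + 1 then (if i < m then
          (L.baseLetter (o i) (o (i + 1))).val * L.incl (L.seg o (i + 1) j) else 0) else 0) = 0 by
          split_ifs <;> first | omega | rfl, zero_sub]
      by_cases ht1 : t = j - 1
      · subst ht1
        obtain ⟨n, rfl⟩ : ∃ n, j = n + 1 := ⟨j - 1, by omega⟩
        rw [Nat.add_sub_cancel] at htm ⊢
        rw [if_pos rfl, if_pos (by omega), seg_succ, incl_single, wsign,
          (h.init (j' := n) (by omega) (by omega)).wdeg, zpow_neg_one]
        norm_num
      · rw [if_neg ht1, neg_zero]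
        rcases ht.2.eq_or_lt with rfl | h3
        · rw [seg_self, incl_nil, mul_zero, smul_zero]
        · rw [incl_seg_of_not_asc (i := t) ho (by omega)
            fun t h3 h4 => h.desc t (by omega) (by omega) (by omega), mul_zero, smul_zero]
  rw [tree_seg_eq_sum (by omega), Finset.sum_congr rfl key, Finset.sum_sub_distrib,
    Finset.sum_ite_eq', Finset.sum_ite_eq', if_pos (Finset.mem_Icc.mpr (by omega)),
    if_pos (Finset.mem_Icc.mpr (by omega))]

end LineConfig

/-! ## Words with one letter of degree zero -/

namespace LineConfig

open StepSpace HomPath Polynomial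

variable {N : ℕ} {L : LineConfig N} {o : ℕ → Fin N} {ε : ℝ} {i m j : ℕ}

/-- The points `x_t` move in the direction `ε` away from `x_m` on both sides of `m`. -/
structure Rising (L : LineConfig N) (o : ℕ → Fin N) (ε : ℝ) (i m j : ℕ) : Prop where
  right : ∀ t, m ≤ t → t + 1 < j → ε * L.vx o t < ε * L.vx o (t + 1)
  left : ∀ t, i ≤ t → t < m → ε * L.vx o (t + 1) < ε * L.vx o t

theorem Rising.tail (h : Rising L o ε i m j) {i' : ℕ} (h1 : i ≤ i') : Rising L o ε i' m j :=
  ⟨h.right, fun t ht => h.left t (by omega)⟩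

theorem Rising.init (h : Rising L o ε i m j) {j' : ℕ} (h1 : j' ≤ j) : Rising L o ε i m j' :=
  ⟨fun t ht ht' => h.right t ht (by omega), h.left⟩

theorem Rising.lt_right (h : Rising L o ε i m j) {t : ℕ} (h1 : m < t) (h2 : t < j) :
    ε * L.vx o m < ε * L.vx o t := by
  induction t, h1 using Nat.le_induction with
  | base => exact h.right m le_rfl h2
  | succ t ht ih => exact (ih (by omega)).trans (h.right t (by omega) h2)

theorem Rising.lt_left (h : Rising L o ε i m j) {t : ℕ} (h1 : t < m) (h2 : i ≤ t) :
    ε * L.vx o m < ε * L.vx o t := by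
  obtain ⟨n, rfl⟩ := Nat.exists_eq_add_of_lt h1
  clear h1
  induction n generalizing t with
  | zero => exact h.left t h2 (by omega)
  | succ n ih =>
    have h3 := h.left t h2 (by omega)
    rw [show t + (n + 1) + 1 = t + 1 + n + 1 by omega] at h ⊢
    exact (ih (by omega) h).trans h3

theorem lineAt_vx (ho : ∀ t, o t ≠ o (t + 1)) (t : ℕ) :
    L.lineAt (o t) (L.vx o t) = L.lineAt (o (t + 1)) (L.vx o t) := L.lineAt_xv (ho t)

theorem lineAt_sub_eq_sum (ho : ∀ t, o t ≠ o (t + 1)) (h : i ≤ j) (x : ℝ) :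
    L.lineAt (o j) x - L.lineAt (o i) x
      = ∑ t ∈ Finset.Ico i j, (L.t (o (t + 1)) - L.t (o t)) * (x - L.vx o t) := by
  rw [← Finset.sum_Ico_sub (fun t => L.lineAt (o t) x) h]
  exact Finset.sum_congr rfl fun t _ => L.lineAt_sub (ho t) x

theorem lt_of_not_asc (ho : ∀ t, o t ≠ o (t + 1)) {t : ℕ} (h : ¬ L.Asc o t) :
    L.t (o (t + 1)) < L.t (o t) := L.lt_of_not_lt (ho t) h

/-- A rising word with at least two letters separates its end lines at `x_m`. -/
theorem Rising.separation (ho : ∀ t, o t ≠ o (t + 1)) (ha : OneAscent L o i m j)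
    (h : Rising L o ε i m j) (h2 : i + 2 ≤ j) :
    ε * L.lineAt (o i) (L.vx o m) < ε * L.lineAt (o j) (L.vx o m) := by
  -- The height difference of the end lines at x_m is a telescoping sum. After multiplication by ε
  -- each descent contributes positively, since its point lies beyond x_m, and the ascent at m
  -- contributes nothing.
  have h3 := lineAt_sub_eq_sum (L := L) ho (i := i) (j := j) (by omega) (L.vx o m)
  have h4 : 0 < ∑ t ∈ Finset.Ico i j,
      (L.t (o t) - L.t (o (t + 1))) * (ε * L.vx o t - ε * L.vx o m) := by
    have key : ∀ t, i ≤ t → t < j → t ≠ m →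
        0 < (L.t (o t) - L.t (o (t + 1))) * (ε * L.vx o t - ε * L.vx o m) := fun t h5 h6 h7 =>
      mul_pos (sub_pos.mpr (lt_of_not_asc ho (ha.desc t h5 h6 h7)))
        (sub_pos.mpr (h7.lt_or_gt.elim (fun h8 => h.lt_left h8 h5) fun h8 => h.lt_right h8 h6))
    refine Finset.sum_pos' (fun t ht => ?_) ?_
    · rw [Finset.mem_Ico] at ht
      by_cases htm : t = m
      · rw [htm, sub_self, mul_zero]
      · exact (key t ht.1 ht.2 htm).le
    · have := ha.le
      have := ha.lt
      by_cases hi : i = m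
      · exact ⟨m + 1, Finset.mem_Ico.mpr (by omega), key _ (by omega) (by omega) (by omega)⟩
      · exact ⟨i, Finset.mem_Ico.mpr (by omega), key _ (by omega) (by omega) (by omega)⟩
  have h5 : ε * (L.lineAt (o j) (L.vx o m) - L.lineAt (o i) (L.vx o m)) =
      ∑ t ∈ Finset.Ico i j, (L.t (o t) - L.t (o (t + 1))) * (ε * L.vx o t - ε * L.vx o m) := by
    rw [h3, Finset.mul_sum]
    exact Finset.sum_congr rfl fun t _ => by ring
  linarith

theorem Rising.ne (ho : ∀ t, o t ≠ o (t + 1)) (ha : OneAscent L o i m j)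
    (h : Rising L o ε i m j) : o i ≠ o j := by
  have := ha.le
  have := ha.lt
  by_cases h2 : i + 2 ≤ j
  · intro h3
    have := h.separation ho ha h2
    rw [h3] at this
    exact lt_irrefl _ this
  · obtain rfl : j = i + 1 := by omega
    exact ho i

/-- Otherwise the lines o_i, o_{i+1} and o_j are concurrent at x_i, so two of them coincide; this is
excluded because rising words are never closed, neither the whole word nor its tail. -/
theorem Rising.lineAt_first_ne (ho : ∀ t, o t ≠ o (t + 1)) (ha : OneAscent L o i m j)
    (h : Rising L o ε i m j) (hi : i < m) :
    L.lineAt (o i) (L.vx o i) ≠ L.lineAt (o j) (L.vx o i) := fun h1 => by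
  have h2 := lineAt_vx ho i (L := L)
  rcases L.lineAt_generic h2 (h2.symm.trans h1) with h3 | h3 | h3
  · exact ho i h3
  · exact (h.tail (Nat.le_succ i)).ne ho (ha.tail (Nat.le_succ i) hi) h3
  · exact h.ne ho ha h3

theorem Rising.lineAt_last_ne (ho : ∀ t, o t ≠ o (t + 1)) {n : ℕ} (ha : OneAscent L o i m (n + 1))
    (h : Rising L o ε i m (n + 1)) (hn : m < n) :
    L.lineAt (o i) (L.vx o n) ≠ L.lineAt (o (n + 1)) (L.vx o n) := fun h1 => by
  have h2 := lineAt_vx ho n (L := L)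
  rcases L.lineAt_generic h1 h2.symm with h3 | h3 | h3
  · exact h.ne ho ha h3
  · exact ho n h3.symm
  · exact (h.init (Nat.le_succ n)).ne ho (ha.init (Nat.le_succ n) hn) h3

/-- The product of the step functions at the first and last point of a word, as far as these are
not the point with index `m`. -/
noncomputable def edgeStep (L : LineConfig N) (o : ℕ → Fin N) (ε : ℝ) (i m j : ℕ) : StepSpace :=
  (if i < m then thetaPM ε (L.vx o i) else 1) * (if m + 1 < j then thetaPM ε (L.vx o (j - 1)) else 1)

theorem edgeStep_apply_eq_zero (hε : ε = 1 ∨ ε = -1) {x : ℝ}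
    (h : i < m ∧ ε * x < ε * L.vx o i ∨ m + 1 < j ∧ ε * x < ε * L.vx o (j - 1)) :
    edgeStep L o ε i m j x = 0 := by
  rw [edgeStep, Pi.mul_apply]
  rcases h with ⟨h, hx⟩ | ⟨h, hx⟩
  · rw [if_pos h, thetaPM_apply_of_lt hε hx, zero_mul]
  · rw [if_pos h, thetaPM_apply_of_lt hε hx, mul_zero]

theorem edgeStep_apply_eq_one (hε : ε = 1 ∨ ε = -1) {x : ℝ}
    (h1 : i < m → ε * L.vx o i < ε * x) (h2 : m + 1 < j → ε * L.vx o (j - 1) < ε * x) :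
    edgeStep L o ε i m j x = 1 := by
  have h3 : (if i < m then thetaPM ε (L.vx o i) else 1) x = 1 := by
    split_ifs with h
    · exact thetaPM_apply_of_gt hε (h1 h)
    · rfl
  have h4 : (if m + 1 < j then thetaPM ε (L.vx o (j - 1)) else 1) x = 1 := by
    split_ifs with h
    · exact thetaPM_apply_of_gt hε (h2 h)
    · rfl
  rw [edgeStep, Pi.mul_apply, h3, h4, mul_one]

theorem edgeStep_mem (ho : ∀ t, o t ≠ o (t + 1)) : edgeStep L o ε i m j ∈ tildeA0 L.Sall := by
  refine mul_mem ?_ ?_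
  · split_ifs
    · exact thetaPM_mem _ (L.xv_mem_Sall (ho _))
    · exact one_mem _
  · split_ifs
    · exact thetaPM_mem _ (L.xv_mem_Sall (ho _))
    · exact one_mem _

theorem edgeStep_eq_mul (h : i < m ∨ m + 1 < j) :
    ∃ (w : StepSpace) (p : ℝ), edgeStep L o ε i m j = w * thetaPM ε p := by
  by_cases h2 : m + 1 < j
  · exact ⟨_, _, by rw [edgeStep, if_pos h2]⟩
  · exact ⟨_, _, by rw [edgeStep, if_pos (h.resolve_right h2), mul_comm]⟩

theorem mul_delta_congr {u w : StepSpace} {p : ℝ} (h : u p = w p) : u * delta p = w * delta p := by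
  funext x
  rw [Pi.mul_apply, Pi.mul_apply]
  by_cases hx : x = p
  · rw [hx, h]
  · rw [delta_apply_of_ne hx, mul_zero, mul_zero]

/-- The sign of a rising word. -/
noncomputable def riseSign (ε : ℝ) (i m j : ℕ) : ℝ :=
  if ε = 1 then (-1) ^ (m - i) else (-1) ^ (j - 1 - m)

theorem riseSign_tail (hε : ε = 1 ∨ ε = -1) (h : i < m) :
    riseSign ε (i + 1) m j = -ε * riseSign ε i m j := by
  obtain ⟨n, hn⟩ : ∃ n, m - i = n + 1 := ⟨m - i - 1, by omega⟩
  have h2 : m - (i + 1) = n := by omega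
  rcases hε with rfl | rfl
  · rw [riseSign, riseSign, if_pos rfl, if_pos rfl, h2, hn, pow_succ]; ring
  · rw [riseSign, riseSign, if_neg (by norm_num), if_neg (by norm_num)]; ring

theorem riseSign_init (hε : ε = 1 ∨ ε = -1) {n : ℕ} (h : m < n) :
    riseSign ε i m n = ε * riseSign ε i m (n + 1) := by
  obtain ⟨l, hl⟩ : ∃ l, n - m = l + 1 := ⟨n - m - 1, by omega⟩
  have h2 : n - 1 - m = l := by omega
  rcases hε with rfl | rfl
  · rw [riseSign, riseSign, if_pos rfl, if_pos rfl, one_mul]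
  · rw [riseSign, riseSign, if_neg (by norm_num), if_neg (by norm_num), Nat.add_sub_cancel, h2, hl,
      pow_succ]; ring

theorem riseSign_single (ε : ℝ) : riseSign ε m m (m + 1) = 1 := by simp [riseSign]

/-- The value of the perturbed inclusion on a rising word, up to an exponential factor. -/
noncomputable def amp (L : LineConfig N) (o : ℕ → Fin N) (ε : ℝ) (i m j : ℕ) : StepSpace :=
  if j = i + 1 then 1
  else riseSign ε i m j • (edgeStep L o ε i m j * L.sideStep ε (o i) (o j))

/-- Away from the crossing the side function depends only on the order of the two heights, so a line
may be exchanged for another one through the same point. -/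
theorem sideStep_congr (hε : ε = 1 ∨ ε = -1) {a b a' b' : Fin N} {x : ℝ}
    (ha : L.lineAt a x = L.lineAt a' x) (hb : L.lineAt b x = L.lineAt b' x)
    (h : L.lineAt a x ≠ L.lineAt b x) : L.sideStep ε a b x = L.sideStep ε a' b' x := by
  have h1 : a ≠ b := by rintro rfl; exact h rfl
  have h2 : a' ≠ b' := by rintro rfl; exact h (ha.trans hb.symm)
  have hε0 : ε ≠ 0 := by rcases hε with rfl | rfl <;> norm_num
  rcases lt_or_gt_of_ne (fun e => h (mul_left_cancel₀ hε0 e)) with h3 | h3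
  · rw [L.sideStep_apply_of_pos hε h1 h3, L.sideStep_apply_of_pos hε h2 (by rwa [← ha, ← hb])]
  · rw [L.sideStep_apply_of_neg hε h1 h3, L.sideStep_apply_of_neg hε h2 (by rwa [← ha, ← hb])]

/-- At x_i the lines o_i and o_{i+1} meet, so the side function of the tail may be replaced by that
of the whole word, and a step at x_{i+1} is already 1 there. The delta form itself is ε times the
differential of the new outer step. -/
theorem Rising.delta_mul_amp (hε : ε = 1 ∨ ε = -1) (ho : ∀ t, o t ≠ o (t + 1))
    (ha : OneAscent L o i m j) (h : Rising L o ε i m j) (hi : i < m) :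
    amp L o ε (i + 1) m j * delta (L.vx o i)
      = (-(riseSign ε i m j)) • (L.sideStep ε (o i) (o j)
        * ((if m + 1 < j then thetaPM ε (L.vx o (j - 1)) else 1)
          * d (thetaPM ε (L.vx o i)))) := by
  have hm := ha.lt
  have ha' := ha.tail (Nat.le_succ i) hi
  have h' := h.tail (Nat.le_succ i)
  rw [d_thetaPM hε, mul_smul_comm, mul_smul_comm, smul_smul, ← mul_assoc, ← smul_mul_assoc]
  refine mul_delta_congr ?_
  have hs := riseSign_tail hε hi (j := j)
  have h1 := lineAt_vx ho i (L := L)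
  have h2 := h.lineAt_first_ne ho ha hi
  rw [amp, Pi.smul_apply, show -riseSign ε i m j * ε = riseSign ε (i + 1) m j by rw [hs]; ring,
    Pi.mul_apply]
  split_ifs with h3 h4
  · omega
  -- Here the tail is the ascent alone and carries no side function. The side function of the whole
  -- word equals 1 at x_i, because x_i lies beyond x_{i+1} in the direction ε and the slope rises
  -- there.
  · obtain rfl : m = i + 1 := by omega
    subst h3
    have h5 : L.sideStep ε (o i) (o (i + 1 + 1)) (L.vx o i) = 1 := by
      refine L.sideStep_apply_of_pos hε (h.ne ho ha) ?_
      have h6 := L.lineAt_sub (ho (i + 1)) (L.vx o i)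
      have h7 := mul_pos (sub_pos.mpr ha.asc) (sub_pos.mpr (h.left i le_rfl hi))
      have h8 : ε * (L.lineAt (o (i + 1 + 1)) (L.vx o i) - L.lineAt (o (i + 1)) (L.vx o i))
        = (L.t (o (i + 1 + 1)) - L.t (o (i + 1))) * (ε * L.vx o i - ε * L.vx o (i + 1)) := by
        rw [h6, vx, vx]; ring
      rw [h1]; linarith
    rw [h5, riseSign_single, one_smul, one_mul]
  all_goals
    rw [Pi.smul_apply, Pi.mul_apply, mul_comm, edgeStep, Pi.mul_apply,
      sideStep_congr hε h1.symm rfl (h1 ▸ h2)]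
    have h6 : (if i + 1 < m then thetaPM ε (L.vx o (i + 1)) else 1) (L.vx o i) = 1 := by
      split_ifs with h7
      · exact thetaPM_apply_of_gt hε (h.left i le_rfl hi)
      · rfl
    rw [h6, one_mul]
    simp [*]

theorem Rising.amp_mul_delta (hε : ε = 1 ∨ ε = -1) (ho : ∀ t, o t ≠ o (t + 1)) {n : ℕ}
    (ha : OneAscent L o i m (n + 1)) (h : Rising L o ε i m (n + 1)) (hn : m < n) :
    amp L o ε i m n * delta (L.vx o n)
      = riseSign ε i m (n + 1) • (L.sideStep ε (o i) (o (n + 1))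
        * ((if i < m then thetaPM ε (L.vx o i) else 1) * d (thetaPM ε (L.vx o n)))) := by
  have hm := ha.le
  have ha' := ha.init (Nat.le_succ n) hn
  have h' := h.init (Nat.le_succ n)
  rw [d_thetaPM hε, mul_smul_comm, mul_smul_comm, smul_smul, ← mul_assoc, ← smul_mul_assoc]
  refine mul_delta_congr ?_
  have hs := riseSign_init hε hn (i := i)
  have h1 := lineAt_vx ho n (L := L)
  have h2 := h.lineAt_last_ne ho ha hn
  have hp : ε * L.vx o (n - 1) < ε * L.vx o n := by
    have := h.right (n - 1) (by omega) (by omega)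
    rwa [Nat.sub_add_cancel (by omega)] at this
  rw [amp, Pi.smul_apply, mul_comm _ ε, ← hs, Pi.mul_apply]
  split_ifs with h3 h4
  · omega
  · obtain rfl : i = m := by omega
    subst h3
    have h5 : L.sideStep ε (o i) (o (i + 1 + 1)) (L.vx o (i + 1)) = 1 := by
      refine L.sideStep_apply_of_pos hε (h.ne ho ha) ?_
      have h6 := L.lineAt_sub (ho i) (L.vx o (i + 1))
      have h7 := mul_pos (sub_pos.mpr ha.asc) (sub_pos.mpr hp)
      have h8 : ε * (L.lineAt (o (i + 1)) (L.vx o (i + 1)) - L.lineAt (o i) (L.vx o (i + 1)))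
        = (L.t (o (i + 1)) - L.t (o i)) * (ε * L.vx o (i + 1) - ε * L.vx o (i + 1 - 1)) := by
        rw [h6, Nat.add_sub_cancel, vx, vx]; ring
      rw [← h1]; linarith
    rw [h5, riseSign_single, one_smul, one_mul]
  all_goals
    rw [Pi.smul_apply, Pi.mul_apply, mul_comm, edgeStep, Pi.mul_apply,
      sideStep_congr hε rfl h1 (h1 ▸ h2)]
    have h6 : (if m + 1 < n then thetaPM ε (L.vx o (n - 1)) else 1) (L.vx o n) = 1 := by
      split_ifs with h7
      · exact thetaPM_apply_of_gt hε hp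
      · rfl
    rw [h6, mul_one]
    simp [*]

/-- The exponential factor of a word. -/
noncomputable def segCoeff (L : LineConfig N) (o : ℕ → Fin N) (i j : ℕ) : ℝ :=
  Real.exp (-∑ t ∈ Finset.Ico i j, L.f (o t) (o (t + 1)) (L.vx o t))

theorem segCoeff_succ (i : ℕ) :
    segCoeff L o i (i + 1) = Real.exp (-L.f (o i) (o (i + 1)) (L.vx o i)) := by
  simp [segCoeff]

theorem segCoeff_mul {k : ℕ} (h : i ≤ j) (h' : j ≤ k) :
    segCoeff L o i j * segCoeff L o j k = segCoeff L o i k := by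
  rw [segCoeff, segCoeff, segCoeff, ← Real.exp_add, ← neg_add, Finset.sum_Ico_consecutive _ h h']

theorem val_baseLetter_asc {t : ℕ} (h : L.Asc o t) :
    (L.baseLetter (o t) (o (t + 1))).val = emb 0 (segCoeff L o t (t + 1) • L.expf (o t) (o (t + 1))) := by
  rw [L.baseLetter_lt h, L.e_lt h, segCoeff_succ]; rfl

theorem val_baseLetter_desc (ho : ∀ t, o t ≠ o (t + 1)) {t : ℕ} (h : ¬ L.Asc o t) :
    (L.baseLetter (o t) (o (t + 1))).val = emb 1 (segCoeff L o t (t + 1) •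
      (L.expf (o t) (o (t + 1)) * delta (L.vx o t))) := by
  rw [L.baseLetter_gt (lt_of_not_asc ho h), segCoeff_succ, expf_mul_delta, smul_smul, ← Real.exp_add,
    neg_add_cancel, Real.exp_zero, one_smul]
  rfl

theorem smul_expf_mul_mul {a b c : Fin N} (k l : ℝ) (u w : StepSpace) :
    (k • (L.expf a b * u)) * (l • (L.expf b c * w)) = (k * l) • (L.expf a c * (u * w)) := by
  rw [smul_mul_smul_comm, ← L.expf_mul a b c]
  congr 1; ring

/-- The value of the perturbed inclusion on a word with one letter of degree zero. -/
def InclFormula (L : LineConfig N) (o : ℕ → Fin N) (i m j : ℕ) : Prop :=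
  (∀ ε : ℝ, (ε = 1 ∨ ε = -1) → Rising L o ε i m j →
    L.incl (L.seg o i j) = emb 0 (segCoeff L o i j • (L.expf (o i) (o j) * amp L o ε i m j))) ∧
  ((∀ ε : ℝ, (ε = 1 ∨ ε = -1) → ¬ Rising L o ε i m j) → L.incl (L.seg o i j) = 0)

theorem d_edgeStep : d (edgeStep L o ε i m j)
    = (if i < m then (if m + 1 < j then thetaPM ε (L.vx o (j - 1)) else 1)
        * d (thetaPM ε (L.vx o i)) else 0)
      + if m + 1 < j then (if i < m then thetaPM ε (L.vx o i) else 1)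
        * d (thetaPM ε (L.vx o (j - 1))) else 0 := by
  have : d (1 : StepSpace) = 0 := by simpa using d_algebraMap 1
  rw [edgeStep, d_mul]
  split_ifs <;> simp [this, add_comm]

/-- Splitting off the first or the last letter gives the two terms of the Leibniz rule for the
product of the two outer steps. The opposite signs of the two terms in the tree sum are compensated
by `riseSign_tail` and `riseSign_init`. -/
theorem tree_seg_of_rising (hε : ε = 1 ∨ ε = -1) (ho : ∀ t, o t ≠ o (t + 1))
    (ha : OneAscent L o i m j) (h : Rising L o ε i m j)
    (hl : i < m → InclFormula L o (i + 1) m j) (hr : m + 1 < j → InclFormula L o i m (j - 1)) :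
    L.tree (L.seg o i j) = emb 1 (segCoeff L o i j • (L.expf (o i) (o j) *
      ((-riseSign ε i m j) • (L.sideStep ε (o i) (o j) * d (edgeStep L o ε i m j))))) := by
  have h1 := ha.le
  have h2 := ha.lt
  have hL : (if i < m then (L.baseLetter (o i) (o (i + 1))).val * L.incl (L.seg o (i + 1) j) else 0)
      = emb 1 (segCoeff L o i j • (L.expf (o i) (o j) *
      ((-riseSign ε i m j) • (L.sideStep ε (o i) (o j) *
        if i < m then (if m + 1 < j then thetaPM ε (L.vx o (j - 1)) else 1)
        * d (thetaPM ε (L.vx o i)) else 0)))) := by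
    split_ifs with h3 h4 <;> try simp
    all_goals
      have h5 := h.delta_mul_amp hε ho ha h3
      simp only [h4, if_true, if_false, one_mul] at h5
      rw [(hl h3).1 ε hε (h.tail (Nat.le_succ i)),
        val_baseLetter_desc ho (ha.desc i le_rfl (by omega) (by omega)), emb_one_mul,
        smul_expf_mul_mul, segCoeff_mul (by omega) (by omega), mul_comm (delta _), h5]
      simp
  have hR : (if m + 1 < j then
        L.incl (L.seg o i (j - 1)) * (L.baseLetter (o (j - 1)) (o j)).val else 0)
      = emb 1 (segCoeff L o i j • (L.expf (o i) (o j) *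
      (riseSign ε i m j • (L.sideStep ε (o i) (o j) *
        if m + 1 < j then (if i < m then thetaPM ε (L.vx o i) else 1)
        * d (thetaPM ε (L.vx o (j - 1))) else 0)))) := by
    split_ifs with h3 h4 <;> try simp
    all_goals
      obtain ⟨n, rfl⟩ : ∃ n, j = n + 1 := ⟨j - 1, by omega⟩
      simp only [Nat.add_sub_cancel] at *
      have h5 := h.amp_mul_delta hε ho ha (by omega)
      simp only [h4, if_true, if_false, one_mul] at h5
      rw [(hr h3).1 ε hε (h.init (Nat.le_succ n)),
        val_baseLetter_desc ho (ha.desc n (by omega) (by omega) (by omega)), emb_mul_one,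
        smul_expf_mul_mul, segCoeff_mul (by omega) (by omega), h5]
      try simp
  rw [ha.tree_seg ho, hL, hR, ← map_sub, ← smul_sub, ← mul_sub, d_edgeStep, neg_smul, neg_smul,
    ← neg_add', ← smul_add, ← mul_add]

/-- Equal consecutive points would put three lines through one point; consecutive lines being
distinct, genericity would make the outer two coincide. -/
theorem vx_ne_succ (ho : ∀ t, o t ≠ o (t + 1)) {t : ℕ} (h : o t ≠ o (t + 2)) :
    L.vx o t ≠ L.vx o (t + 1) := fun h1 => by
  have h2 := lineAt_vx ho t (L := L)
  have h3 := lineAt_vx ho (t + 1) (L := L)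
  rw [← h1] at h3
  rcases L.lineAt_generic h2 h3 with h4 | h4 | h4
  · exact ho _ h4
  · exact ho _ h4
  · exact h h4

theorem vx_ne_succ_of_desc (ho : ∀ t, o t ≠ o (t + 1)) {t : ℕ} (h : ¬ L.Asc o t)
    (h' : ¬ L.Asc o (t + 1)) : L.vx o t ≠ L.vx o (t + 1) :=
  vx_ne_succ ho fun e => by
    have h1 := lt_of_not_asc ho h
    have h2 := lt_of_not_asc ho h'
    rw [e] at h1
    exact lt_asymm h1 h2

theorem mul_lt_mul_sign (hε : ε = 1 ∨ ε = -1) {x y : ℝ} (h : ¬ ε * x < ε * y) (hne : x ≠ y) :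
    ε * y < ε * x := by
  refine lt_of_le_of_ne (not_lt.mp h) fun e => hne ?_
  rcases hε with rfl | rfl <;> linarith

theorem amp_mul_delta_eq_zero {p : ℝ} {i' j' : ℕ} (h : j' ≠ i' + 1)
    (h0 : edgeStep L o ε i' m j' p = 0) : amp L o ε i' m j' * delta p = 0 := by
  rw [mul_delta_congr (w := 0), zero_mul]
  rw [amp, if_neg h, Pi.smul_apply, Pi.mul_apply, h0, zero_mul, smul_zero]; rfl

/-- The tail rises, but x_i does not lie beyond x_{i+1}; hence an outer step of the tail is zero at
x_i. The length bound ensures that the tail is more than the ascent alone, so that it has an outer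
step. -/
theorem Rising.delta_mul_amp_eq_zero (hε : ε = 1 ∨ ε = -1) (ho : ∀ t, o t ≠ o (t + 1))
    (ha : OneAscent L o i m j) (hi : i < m) (h : Rising L o ε (i + 1) m j)
    (hn : ¬ Rising L o ε i m j) (h3 : i + 3 ≤ j) :
    amp L o ε (i + 1) m j * delta (L.vx o i) = 0 := by
  have h1 : ¬ ε * L.vx o (i + 1) < ε * L.vx o i := fun h4 => hn ⟨h.right, fun t ht ht' => by
    rcases ht.eq_or_lt with rfl | h5
    · exact h4
    · exact h.left t h5 ht'⟩
  refine amp_mul_delta_eq_zero (by omega) (edgeStep_apply_eq_zero hε ?_)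
  rcases (Nat.succ_le_of_lt hi).eq_or_lt with h4 | h4
  · right
    refine ⟨by omega, (not_lt.mp h1).trans_lt ?_⟩
    have := h.lt_right (t := j - 1) (by omega) (by omega)
    rwa [← h4] at this
  · left
    have := ha.lt
    exact ⟨h4, mul_lt_mul_sign hε h1 (vx_ne_succ_of_desc ho
      (ha.desc i le_rfl (by omega) (by omega))
      (ha.desc (i + 1) (by omega) (by omega) (by omega))).symm⟩

theorem Rising.amp_mul_delta_eq_zero (hε : ε = 1 ∨ ε = -1) (ho : ∀ t, o t ≠ o (t + 1)) {n : ℕ}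
    (ha : OneAscent L o i m (n + 1)) (hm : m < n) (h : Rising L o ε i m n)
    (hn : ¬ Rising L o ε i m (n + 1)) (h3 : i + 2 ≤ n) :
    amp L o ε i m n * delta (L.vx o n) = 0 := by
  obtain ⟨l, rfl⟩ : ∃ l, n = l + 1 := ⟨n - 1, by omega⟩
  have h1 : ¬ ε * L.vx o l < ε * L.vx o (l + 1) := fun h4 => hn ⟨fun t ht ht' => by
    rcases (by omega : t = l ∨ t < l) with rfl | h5
    · exact h4
    · exact h.right t ht (by omega), h.left⟩
  have := ha.le
  refine LineConfig.amp_mul_delta_eq_zero (by omega) (edgeStep_apply_eq_zero hε ?_)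
  rcases (by omega : l = m ∨ m < l) with rfl | h4
  · left
    exact ⟨by omega, (not_lt.mp h1).trans_lt (h.lt_left (t := i) (by omega) le_rfl)⟩
  · right
    exact ⟨by omega, mul_lt_mul_sign hε h1 (vx_ne_succ_of_desc ho
      (ha.desc l (by omega) (by omega) (by omega))
      (ha.desc (l + 1) (by omega) (by omega) (by omega)))⟩

/-- The length bound is essential: the word [v_ab], [v_ba] does not rise, as its points coincide,
but its tree sum is δ_{v_ab} up to sign. -/
theorem tree_seg_of_not_rising (ho : ∀ t, o t ≠ o (t + 1))
    (ha : OneAscent L o i m j) (h : ∀ ε : ℝ, (ε = 1 ∨ ε = -1) → ¬ Rising L o ε i m j)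
    (h3 : i + 3 ≤ j)
    (hl : i < m → InclFormula L o (i + 1) m j) (hr : m + 1 < j → InclFormula L o i m (j - 1)) :
    L.tree (L.seg o i j) = 0 := by
  have h1 := ha.le
  have h2 := ha.lt
  rw [ha.tree_seg ho, sub_eq_zero]
  trans 0
  · split_ifs with h4
    · by_cases hR : ∃ ε : ℝ, (ε = 1 ∨ ε = -1) ∧ Rising L o ε (i + 1) m j
      · obtain ⟨ε, hε, hR⟩ := hR
        rw [(hl h4).1 ε hε hR, val_baseLetter_desc ho (ha.desc i le_rfl (by omega) (by omega)),
          emb_one_mul, smul_expf_mul_mul, mul_comm (delta _),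
          hR.delta_mul_amp_eq_zero hε ho ha h4 (h ε hε) h3]
        simp
      · rw [(hl h4).2 fun ε hε hR' => hR ⟨ε, hε, hR'⟩, mul_zero]
    · rfl
  · split_ifs with h4
    · obtain ⟨n, rfl⟩ : ∃ n, j = n + 1 := ⟨j - 1, by omega⟩
      rw [Nat.add_sub_cancel] at *
      by_cases hR : ∃ ε : ℝ, (ε = 1 ∨ ε = -1) ∧ Rising L o ε i m n
      · obtain ⟨ε, hε, hR⟩ := hR
        rw [(hr h4).1 ε hε hR, val_baseLetter_desc ho (ha.desc n (by omega) (by omega) (by omega)),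
          emb_mul_one, smul_expf_mul_mul,
          hR.amp_mul_delta_eq_zero hε ho ha (by omega) (h ε hε) (by omega)]
        simp
      · rw [(hr h4).2 fun ε hε hR' => hR ⟨ε, hε, hR'⟩, zero_mul]
    · rfl

/-- Separation at x_m together with an increase of the end slopes places the crossing of the end
lines before x_m in the direction ε, where every outer step is still zero. -/
theorem Rising.edgeStep_xv_eq_zero (hε : ε = 1 ∨ ε = -1) (ho : ∀ t, o t ≠ o (t + 1))
    (ha : OneAscent L o i m j) (h : Rising L o ε i m j) (h2 : i + 2 ≤ j)
    (hlt : L.t (o i) < L.t (o j)) : edgeStep L o ε i m j (L.xv (o i) (o j)) = 0 := by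
  have h3 := h.separation ho ha h2
  have h4 := L.lineAt_sub (h.ne ho ha) (L.vx o m)
  have h5 : 0 < (L.t (o j) - L.t (o i)) * (ε * L.vx o m - ε * L.xv (o i) (o j)) := by
    have : (L.t (o j) - L.t (o i)) * (ε * L.vx o m - ε * L.xv (o i) (o j))
      = ε * ((L.t (o j) - L.t (o i)) * (L.vx o m - L.xv (o i) (o j))) := by ring
    rw [this, ← h4]; linarith
  have h6 := pos_of_mul_pos_right h5 (by linarith)
  have := ha.le
  have := ha.lt
  refine edgeStep_apply_eq_zero hε ?_
  by_cases h7 : i < m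
  · exact Or.inl ⟨h7, by linarith [h.lt_left h7 le_rfl]⟩
  · exact Or.inr ⟨by omega, by linarith [h.lt_right (t := j - 1) (by omega) (by omega)]⟩

/-- By genericity the crossing of the end lines is none of the outer points whose steps occur, so no
step jumps there and the value is a constant, 0 or 1. The inequalities recorded in the first case
are those that close up the polygon. -/
theorem Rising.edgeStep_xv (hε : ε = 1 ∨ ε = -1) (ho : ∀ t, o t ≠ o (t + 1))
    (ha : OneAscent L o i m j) (h : Rising L o ε i m j) :
    (edgeStep L o ε i m j (L.xv (o i) (o j)) = 1 ∧
      (i < m → ε * L.vx o i < ε * L.xv (o i) (o j)) ∧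
      (m + 1 < j → ε * L.vx o (j - 1) < ε * L.xv (o i) (o j))) ∨
    (edgeStep L o ε i m j (L.xv (o i) (o j)) = 0 ∧
      ¬ ((i < m → ε * L.vx o i < ε * L.xv (o i) (o j)) ∧
      (m + 1 < j → ε * L.vx o (j - 1) < ε * L.xv (o i) (o j)))) := by
  have hxv := L.lineAt_xv (h.ne ho ha)
  by_cases h1 : (i < m → ε * L.vx o i < ε * L.xv (o i) (o j)) ∧
      (m + 1 < j → ε * L.vx o (j - 1) < ε * L.xv (o i) (o j))
  · exact Or.inl ⟨edgeStep_apply_eq_one hε h1.1 h1.2, h1⟩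
  · refine Or.inr ⟨edgeStep_apply_eq_zero hε ?_, h1⟩
    rw [not_and_or, Classical.not_imp, Classical.not_imp] at h1
    refine h1.imp (fun h2 => ⟨h2.1, mul_lt_mul_sign hε h2.2 fun e => ?_⟩)
      fun h2 => ⟨h2.1, mul_lt_mul_sign hε h2.2 fun e => ?_⟩
    · exact h.lineAt_first_ne ho ha h2.1 (by rw [e, hxv])
    · obtain ⟨n, rfl⟩ : ∃ n, j = n + 1 := ⟨j - 1, by omega⟩
      rw [Nat.add_sub_cancel] at *
      exact h.lineAt_last_ne ho ha (by omega) (by rw [e, hxv])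

/-- Induction on the length. For a rising word the tree sum is the side function times the
differential of the outer steps, and the homotopy turns this into the product of the outer steps
with the side function. For a word that does not rise the tree sum is zero, except on two letters,
where g vanishes for another reason. -/
theorem inclFormula (ho : ∀ t, o t ≠ o (t + 1)) (ha : OneAscent L o i m j) :
    InclFormula L o i m j := by
  suffices H : ∀ n i j, j - i = n → OneAscent L o i m j → InclFormula L o i m j from H _ i j rfl ha
  intro n
  induction n using Nat.strong_induction_on with
  | _ n ih =>
    intro i j hn ha
    have h1 := ha.le
    have h2 := ha.lt
    have hl : i < m → InclFormula L o (i + 1) m j := fun h =>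
      ih (j - (i + 1)) (by omega) _ _ rfl (ha.tail (Nat.le_succ i) h)
    have hr : m + 1 < j → InclFormula L o i m (j - 1) := fun h =>
      ih (j - 1 - i) (by omega) _ _ rfl (ha.init (Nat.sub_le j 1) (by omega))
    by_cases h3 : j = i + 1
    · subst h3
      obtain rfl : i = m := by omega
      refine ⟨fun ε _ _ => ?_, fun h => (h 1 (Or.inl rfl) ⟨by omega, by omega⟩).elim⟩
      rw [seg_succ, incl_single, val_baseLetter_asc ha.asc, amp, if_pos rfl, mul_one]
    refine ⟨fun ε hε hR => ?_, fun h => ?_⟩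
    -- At the crossing of the end lines the outer steps have a constant value, 0 or 1, which is read
    -- off as a constant coefficient; for increasing end slopes it is 0, as the integration by parts
    -- requires.
    · have hmul := L.stepHomotopy_sideStep_mul hε (hR.ne ho ha) (edgeStep_mem ho (ε := ε))
        (edgeStep_eq_mul (L := L) (o := o) (ε := ε) (by omega : i < m ∨ m + 1 < j)).choose_spec.choose_spec
        (fun hlt => hR.edgeStep_xv_eq_zero hε ho ha (by omega) hlt)
        (c := ((edgeStep L o ε i m j) (L.xv (o i) (o j))).coeff 0) (fun _ => by
          rcases hR.edgeStep_xv hε ho ha with h4 | h4 <;> rw [h4.1] <;> simp)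
      rw [incl_seg_of_long ho (by omega), tree_seg_of_rising hε ho ha hR hl hr, hForms_emb_one,
        map_smul, homotopyOp_apply, expf_swap_mul_expf_mul, LinearMap.map_smul (L.stepHomotopy _ _),
        hmul, amp, if_neg h3, neg_smul, mul_neg, smul_neg, map_neg, neg_neg]
    · by_cases h4 : i + 3 ≤ j
      · exact L.incl_eq_zero_of_tree (by rw [length_seg]; omega)
          (tree_seg_of_not_rising ho ha h h4 hl hr)
      · obtain rfl : j = i + 2 := by omega
        -- A word of two letters rises in one of the two directions as soon as its points differ.
        -- Equal points force a closed word, and on closed words g vanishes.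
        have h5 : o i = o (i + 2) := by
          by_contra h5
          have h6 := vx_ne_succ ho h5 (L := L)
          rcases (by omega : m = i ∨ m = i + 1) with rfl | rfl
          · refine h6 (le_antisymm (not_lt.mp fun h7 => ?_) (not_lt.mp fun h7 => ?_))
            · refine h (-1) (Or.inr rfl) ⟨fun t ht ht' => ?_, fun t ht ht' => by omega⟩
              obtain rfl : t = m := by omega
              linarith
            · refine h 1 (Or.inl rfl) ⟨fun t ht ht' => ?_, fun t ht ht' => by omega⟩
              obtain rfl : t = m := by omega
              linarith
          · refine h6 (le_antisymm (not_lt.mp fun h7 => ?_) (not_lt.mp fun h7 => ?_))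
            · refine h 1 (Or.inl rfl) ⟨fun t ht ht' => by omega, fun t ht ht' => ?_⟩
              obtain rfl : t = i := by omega
              linarith
            · refine h (-1) (Or.inr rfl) ⟨fun t ht ht' => by omega, fun t ht ht' => ?_⟩
              obtain rfl : t = i := by omega
              linarith
        have h6 := isWord_seg ho (L := L) (by omega : i ≤ i + 2)
        rw [← h5] at h6
        exact h6.incl_closed (by rw [length_seg]; omega)

/-- The tree sum of a word with one letter of degree zero, if it rises. -/
theorem Rising.tree_seg (hε : ε = 1 ∨ ε = -1) (ho : ∀ t, o t ≠ o (t + 1))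
    (ha : OneAscent L o i m j) (h : Rising L o ε i m j) :
    L.tree (L.seg o i j) = emb 1 (segCoeff L o i j • (L.expf (o i) (o j) *
      ((-riseSign ε i m j) • (L.sideStep ε (o i) (o j) * d (edgeStep L o ε i m j))))) :=
  tree_seg_of_rising hε ho ha h (fun h => inclFormula ho (ha.tail (Nat.le_succ i) h))
    fun h => inclFormula ho (ha.init (Nat.sub_le j 1) (by omega))

theorem OneAscent.tree_seg_eq_zero (ho : ∀ t, o t ≠ o (t + 1))
    (ha : OneAscent L o i m j) (h : ∀ ε : ℝ, (ε = 1 ∨ ε = -1) → ¬ Rising L o ε i m j)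
    (h3 : i + 3 ≤ j) : L.tree (L.seg o i j) = 0 :=
  tree_seg_of_not_rising ho ha h h3 (fun h => inclFormula ho (ha.tail (Nat.le_succ i) h))
    fun h => inclFormula ho (ha.init (Nat.sub_le j 1) (by omega))

/-- The product of a word with one letter of degree zero, if it rises and the slopes decrease. -/
theorem Rising.prod_seg (hε : ε = 1 ∨ ε = -1) (ho : ∀ t, o t ≠ o (t + 1))
    (ha : OneAscent L o i m j) (h : Rising L o ε i m j) (h2 : i + 2 ≤ j)
    (hgt : L.t (o j) < L.t (o i)) {c : ℝ} (hc : edgeStep L o ε i m j (L.xv (o i) (o j)) = C c) :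
    L.prod (L.seg o i j) = emb 1 ((segCoeff L o i j * (-riseSign ε i m j * (ε * c))
      * Real.exp (L.f (o i) (o j) (L.xv (o i) (o j)))) • delta (L.xv (o i) (o j))) := by
  have := ha.le
  have := ha.lt
  have htot := L.total_sideStep_mul hε hgt (edgeStep_mem ho (ε := ε))
    (edgeStep_eq_mul (L := L) (o := o) (ε := ε) (by omega : i < m ∨ m + 1 < j)).choose_spec.choose_spec
    hc
  rw [prod_seg_of_long ho h2, h.tree_seg hε ho ha, pForms_emb, map_smul, projOp_gt_one _ hgt,
    expf_swap_mul_expf_mul, LinearMap.map_smul (total _), htot, expf_mul_delta, map_smul, map_smul,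
    smul_smul, ← map_smul, smul_smul, smul_eq_mul]

end LineConfig

/-! ## Words with two letters of degree zero -/

namespace LineConfig

open StepSpace HomPath Polynomial

variable {N : ℕ} {L : LineConfig N} {o : ℕ → Fin N} {ε : ℝ} {i m n j k t : ℕ}

/-- Among the steps `t < k` there are exactly two ascents, at `m < n`. -/
structure TwoAscents (L : LineConfig N) (o : ℕ → Fin N) (m n k : ℕ) : Prop where
  lt : m < n
  lt' : n < k
  asc : L.Asc o m
  asc' : L.Asc o n
  desc : ∀ t < k, t ≠ m → t ≠ n → ¬ L.Asc o t

theorem TwoAscents.left (h : TwoAscents L o m n k) (h1 : m < t) (h2 : t ≤ n) :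
    OneAscent L o 0 m t :=
  ⟨Nat.zero_le _, h1, h.asc, fun s _ hs hsm => h.desc s (by have := h.lt'; omega) hsm (by omega)⟩

theorem TwoAscents.right (h : TwoAscents L o m n k) (h1 : m < t) (h2 : t ≤ n) :
    OneAscent L o t n k :=
  ⟨h2, h.lt', h.asc', fun s hs hs' hsn => h.desc s hs' (by omega) hsn⟩

/-- A cut outside the range from m to n leaves both ascents in one factor, of suspended degree -2,
where g vanishes. For the other cuts the left factor has suspended degree -1, whence the sign. -/
theorem TwoAscents.tree_seg (ho : ∀ t, o t ≠ o (t + 1)) (h : TwoAscents L o m n k) :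
    L.tree (L.seg o 0 k)
      = - ∑ t ∈ Finset.Ioc m n, L.incl (L.seg o 0 t) * L.incl (L.seg o t k) := by
  have hm := h.lt
  have hn := h.lt'
  have hw : wdeg (L.seg o 0 k) = -2 := by
    rw [wdeg_seg_append (j := n) (by omega) (by omega), (h.left hm le_rfl).wdeg,
      (h.right hm le_rfl).wdeg]; rfl
  rw [tree_seg_eq_sum (Nat.zero_le k), ← Finset.sum_neg_distrib]
  symm
  refine (Finset.sum_congr rfl fun t ht => ?_).trans
    (Finset.sum_subset (fun t ht => ?_) fun t ht ht' => ?_)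
  · rw [Finset.mem_Ioc] at ht
    rw [wsign, (h.left ht.1 ht.2).wdeg, zpow_neg_one]
    norm_num
  · rw [Finset.mem_Ioc] at ht
    exact Finset.mem_Icc.mpr ⟨Nat.zero_le _, by omega⟩
  · rw [Finset.mem_Icc] at ht
    rw [Finset.mem_Ioc, not_and_or, not_lt, not_le] at ht'
    have hw' := wdeg_seg_append (L := L) (o := o) ht.1 ht.2
    rcases ht' with ht' | ht'
    · have h1 : wdeg (L.seg o 0 t) = 0 := wdeg_seg_of_not_asc (Nat.zero_le t) fun s _ hs =>
        h.desc s (by omega) (by omega) (by omega)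
      rw [(isWord_seg ho (L := L) ht.2).incl_eq_zero (by rw [length_seg]; omega) (by omega), mul_zero,
        smul_zero]
    · have h1 : wdeg (L.seg o t k) = 0 := wdeg_seg_of_not_asc ht.2 fun s hs hs' =>
        h.desc s (by omega) (by omega) (by omega)
      rw [(isWord_seg ho (L := L) ht.1).incl_eq_zero (by rw [length_seg]; omega) (by omega), zero_mul,
        smul_zero]

/-- For increasing end slopes the side function is a step in the direction ε at a point before x_m,
and therefore it is absorbed by an outer step. -/
theorem Rising.edgeStep_mul_sideStep (hε : ε = 1 ∨ ε = -1) (ho : ∀ t, o t ≠ o (t + 1))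
    (ha : OneAscent L o i m j) (h : Rising L o ε i m j) (h2 : i + 2 ≤ j)
    (hlt : L.t (o i) < L.t (o j)) :
    edgeStep L o ε i m j * L.sideStep ε (o i) (o j) = edgeStep L o ε i m j := by
  have h3 := h.separation ho ha h2
  have h4 := L.lineAt_sub (h.ne ho ha) (L.vx o m)
  have h5 : 0 < (L.t (o j) - L.t (o i)) * (ε * L.vx o m - ε * L.xv (o i) (o j)) := by
    have : (L.t (o j) - L.t (o i)) * (ε * L.vx o m - ε * L.xv (o i) (o j))
      = ε * ((L.t (o j) - L.t (o i)) * (L.vx o m - L.xv (o i) (o j))) := by ring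
    rw [this, ← h4]; linarith
  have h6 := pos_of_mul_pos_right h5 (by linarith)
  have := ha.le
  have := ha.lt
  rw [L.sideStep_lt _ hlt, edgeStep]
  by_cases h7 : i < m
  · rw [if_pos h7, mul_right_comm, mul_comm (thetaPM ε (L.vx o i)) (thetaPM ε _),
      thetaPM_mul hε (by linarith [h.lt_left h7 le_rfl])]
  · rw [if_pos (by omega : m + 1 < j), mul_assoc, mul_comm (thetaPM ε (L.vx o _)) (thetaPM ε _),
      thetaPM_mul hε (by linarith [h.lt_right (t := j - 1) (by omega) (by omega)])]

/-- If the word begins with its ascent, the step at the first point is missing from the definition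
but may be inserted, since the step at the last point lies beyond it and absorbs it. -/
theorem Rising.edgeStep_eq_first (hε : ε = 1 ∨ ε = -1) (ha : OneAscent L o i m j)
    (h : Rising L o ε i m j) (h2 : i + 2 ≤ j) :
    edgeStep L o ε i m j = thetaPM ε (L.vx o i)
      * if m + 1 < j then thetaPM ε (L.vx o (j - 1)) else 1 := by
  have := ha.le
  have := ha.lt
  rw [edgeStep]
  split_ifs with h7 h8 h8
  · rfl
  · rfl
  · obtain rfl : i = m := by omega
    rw [one_mul, thetaPM_mul hε (h.lt_right (t := j - 1) (by omega) (by omega))]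
  · omega

theorem Rising.edgeStep_eq_last (hε : ε = 1 ∨ ε = -1) (ha : OneAscent L o i m j)
    (h : Rising L o ε i m j) (h2 : i + 2 ≤ j) :
    edgeStep L o ε i m j = (if i < m then thetaPM ε (L.vx o i) else 1)
      * thetaPM ε (L.vx o (j - 1)) := by
  have := ha.le
  have := ha.lt
  rw [edgeStep]
  split_ifs with h7 h8 h8
  · rfl
  · obtain rfl : m = j - 1 := by omega
    rw [mul_one, mul_comm, thetaPM_mul hε (h.lt_left (t := i) (by omega) le_rfl)]
  · rfl
  · omega

/-- The part of the product of two rising words at the point where they are joined. -/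
noncomputable def joinStep (L : LineConfig N) (o : ℕ → Fin N) (ε : ℝ) (m n t : ℕ) : StepSpace :=
  (if m + 1 < t then thetaPM ε (L.vx o (t - 1)) else 1)
    * if t < n then thetaPM (-ε) (L.vx o t) else 1

/-- Nested steps absorb each other, so every summand is the difference of two consecutive steps. The
sum telescopes from 1 at m to 0 at n. -/
theorem sum_joinStep (hε : ε = 1 ∨ ε = -1) (hmn : m < n)
    (h : ∀ t, m ≤ t → t < n → ε * L.vx o t < ε * L.vx o (t + 1)) :
    ∑ t ∈ Finset.Ioc m n, joinStep L o ε m n t = 1 := by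
  let g : ℕ → StepSpace := fun t =>
    if t ≤ m then 1 else if t < n then thetaPM ε (L.vx o t) else 0
  have key : ∀ t ∈ Finset.Ico m n, joinStep L o ε m n (t + 1) = g t - g (t + 1) := by
    intro t ht
    rw [Finset.mem_Ico] at ht
    simp only [joinStep, g, Nat.add_sub_cancel]
    by_cases h1 : t ≤ m
    · rw [if_neg (by omega), if_pos h1, if_neg (by omega : ¬ t + 1 ≤ m), one_mul]
      split_ifs
      · rw [thetaPM_neg hε]
      · rw [sub_zero]
    · rw [if_pos (by omega), if_neg h1, if_pos ht.2, if_neg (by omega : ¬ t + 1 ≤ m)]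
      split_ifs
      · rw [thetaPM_neg hε, mul_sub, mul_one, thetaPM_mul hε (h t ht.1 ht.2)]
      · rw [sub_zero, mul_one]
  have hsum : ∑ t ∈ Finset.Ioc m n, joinStep L o ε m n t
      = ∑ t ∈ Finset.Ico m n, joinStep L o ε m n (t + 1) := by
    rw [Finset.sum_Ico_add' (fun t => joinStep L o ε m n t) m n 1]
    exact Finset.sum_congr (by ext; simp) fun _ _ => rfl
  rw [hsum, Finset.sum_congr rfl fun t ht => (key t ht).trans (neg_sub _ _).symm,
    Finset.sum_neg_distrib, Finset.sum_Ico_sub g hmn.le]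
  simp [g, hmn]

theorem amp_of_long (h : i + 2 ≤ j) : amp L o ε i m j
    = riseSign ε i m j • (edgeStep L o ε i m j * L.sideStep ε (o i) (o j)) := if_neg (by omega)

theorem amp_succ : amp L o ε i m (i + 1) = 1 := if_pos rfl

/-- Two rising words that form a closed word. -/
theorem amp_mul_amp_closed (hε : ε = 1 ∨ ε = -1) (ho : ∀ t, o t ≠ o (t + 1))
    (ha : OneAscent L o 0 m t) (ha' : OneAscent L o t n k) (h : Rising L o ε 0 m t)
    (h' : Rising L o (-ε) t n k) (hk : o 0 = o k) :
    amp L o ε 0 m t * amp L o (-ε) t n k = (riseSign ε 0 m t * riseSign (-ε) t n k) •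
      (thetaPM ε (L.vx o 0) * thetaPM (-ε) (L.vx o (k - 1)) * joinStep L o ε m n t) := by
  have hε' := neg_sign hε
  have h1 := ha.lt
  have h2 := ha'.le
  have h3 := ha'.lt
  have hne := h.ne ho ha
  have hs : L.sideStep (-ε) (o t) (o k) = L.sideStep ε (o 0) (o t) := by
    rw [← hk, L.sideStep_swap ε hne]
  -- For a closed word the two factors have the same side function, since the end lines are
  -- exchanged together with the direction. The factor with increasing end slopes absorbs it into
  -- its outer steps, or, if that factor is one letter, the side function is itself the required
  -- step.
  by_cases hlt : L.t (o 0) < L.t (o t)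
  · have hk2 : t + 2 ≤ k := by
      by_contra hc
      obtain rfl : k = t + 1 := by omega
      obtain rfl : t = n := by omega
      have h4 : L.t (o t) < L.t (o (t + 1)) := ha'.asc
      rw [← hk] at h4
      exact lt_asymm h4 hlt
    rw [amp_of_long hk2, hs, h'.edgeStep_eq_last hε' ha' hk2, joinStep]
    by_cases ht : t = 1
    · subst ht
      obtain rfl : m = 0 := by omega
      rw [amp_succ, riseSign_single, L.sideStep_lt _ hlt, if_neg (by omega : ¬ 0 + 1 < 1), one_mul,
        one_mul, show L.xv (o 0) (o 1) = L.vx o 0 from rfl]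
      refine congrArg _ ?_
      ring
    · have h4 := h.edgeStep_mul_sideStep hε ho ha (by omega) hlt
      rw [amp_of_long (by omega), h4, smul_mul_smul_comm, mul_comm (_ * _) (L.sideStep _ _ _),
        ← mul_assoc, h4, h.edgeStep_eq_first hε ha (by omega)]
      refine congrArg _ ?_
      ring
  · have hgt := L.lt_of_not_lt hne hlt
    have ht2 : 0 + 2 ≤ t := by
      by_contra hc
      obtain rfl : t = 1 := by omega
      obtain rfl : m = 0 := by omega
      exact hlt ha.asc
    rw [amp_of_long ht2, h.edgeStep_eq_first hε ha ht2, joinStep]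
    by_cases hk1 : k = t + 1
    · subst hk1
      obtain rfl : t = n := by omega
      rw [amp_succ, riseSign_single, ← hs, L.sideStep_lt _ ha'.asc, if_neg (lt_irrefl _), mul_one,
        mul_one, mul_one, Nat.add_sub_cancel, show L.xv (o t) (o (t + 1)) = L.vx o t from rfl]
      refine congrArg _ ?_
      ring
    · have h4 := h'.edgeStep_mul_sideStep hε' ho ha' (by omega) (hk ▸ hgt)
      rw [hs] at h4
      rw [amp_of_long (by omega), hs, h4, smul_mul_smul_comm, mul_assoc _ (L.sideStep _ _ _),
        mul_comm (L.sideStep _ _ _), h4, h'.edgeStep_eq_last hε' ha' (by omega)]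
      refine congrArg _ ?_
      ring

theorem amp_eq_smul_mul (hsingle : j = i + 1 → i = m) :
    ∃ w : StepSpace, amp L o ε i m j = riseSign ε i m j • (edgeStep L o ε i m j * w) ∧
      ((w = 1 ∧ j = i + 1) ∨ w = L.sideStep ε (o i) (o j)) := by
  by_cases h : j = i + 1
  · refine ⟨1, ?_, Or.inl ⟨rfl, h⟩⟩
    subst h
    obtain rfl := hsingle rfl
    rw [amp_succ, riseSign_single, edgeStep, if_neg (lt_irrefl _), if_neg (lt_irrefl _)]
    simp
  · exact ⟨_, by rw [amp, if_neg h], Or.inr rfl⟩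

/-- Two rising words that form an open word, at the intersection of its end lines. -/
theorem amp_mul_amp_open (hε : ε = 1 ∨ ε = -1) (ho : ∀ t, o t ≠ o (t + 1))
    (ha : OneAscent L o 0 m t) (ha' : OneAscent L o t n k) (h : Rising L o ε 0 m t)
    (h' : Rising L o (-ε) t n k) (hlt : L.t (o 0) < L.t (o k))
    (h0 : ε * L.vx o 0 < ε * L.xv (o 0) (o k)) (hk : ε * L.xv (o 0) (o k) < ε * L.vx o (k - 1)) :
    (amp L o ε 0 m t * amp L o (-ε) t n k) (L.xv (o 0) (o k))
      = (riseSign ε 0 m t * riseSign (-ε) t n k) • joinStep L o ε m n t (L.xv (o 0) (o k)) := by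
  have hε' := neg_sign hε
  have h1 := ha.lt
  have h2 := ha'.le
  have h3 := ha'.lt
  have hne := h.ne ho ha
  have hne' := h'.ne ho ha'
  have hy := L.lineAt_xv (L.ne_of_lt hlt)
  set y := L.xv (o 0) (o k)
  have hyt : L.lineAt (o 0) y ≠ L.lineAt (o t) y := fun e => by
    rcases L.lineAt_generic e (e.symm.trans hy) with h4 | h4 | h4
    · exact hne h4
    · exact hne' h4
    · exact L.ne_of_lt hlt h4
  have hs : L.sideStep (-ε) (o t) (o k) y = L.sideStep ε (o 0) (o t) y := by
    rw [L.sideStep_swap ε hne'.symm]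
    exact sideStep_congr hε hy.symm rfl (hy ▸ hyt)
  have he : edgeStep L o ε 0 m t y
      = (if m + 1 < t then thetaPM ε (L.vx o (t - 1)) else 1) y := by
    rw [edgeStep, Pi.mul_apply]
    have : (if 0 < m then thetaPM ε (L.vx o 0) else 1) y = 1 := by
      split_ifs
      · exact thetaPM_apply_of_gt hε h0
      · rfl
    rw [this, one_mul]
  have he' : edgeStep L o (-ε) t n k y = (if t < n then thetaPM (-ε) (L.vx o t) else 1) y := by
    rw [edgeStep, Pi.mul_apply]
    have : (if n + 1 < k then thetaPM (-ε) (L.vx o (k - 1)) else 1) y = 1 := by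
      split_ifs
      · exact thetaPM_apply_of_gt hε' (by linarith)
      · rfl
    rw [this, mul_one]
  have hJ : joinStep L o ε m n t y = edgeStep L o ε 0 m t y * edgeStep L o (-ε) t n k y := by
    rw [he, he', joinStep, Pi.mul_apply]
  obtain ⟨w, hw, hw'⟩ := amp_eq_smul_mul (L := L) (o := o) (ε := ε) (i := 0) (m := m) (j := t)
    (by omega)
  obtain ⟨v, hv, hv'⟩ := amp_eq_smul_mul (L := L) (o := o) (ε := -ε) (i := t) (m := n) (j := k)
    (by omega)
  -- At y the two side functions agree and have the value 0 or 1. Where the value is 0, the factor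
  -- with increasing end slopes has vanishing outer steps, so that nothing is lost by dropping the
  -- side functions; that factor cannot be a single letter in this case.
  have key : edgeStep L o ε 0 m t y * edgeStep L o (-ε) t n k y * (w y * v y)
      = edgeStep L o ε 0 m t y * edgeStep L o (-ε) t n k y := by
    have hcases : L.sideStep ε (o 0) (o t) y = 1 ∨ L.sideStep ε (o 0) (o t) y = 0 := by
      have hε0 : ε ≠ 0 := by rcases hε with rfl | rfl <;> norm_num
      rcases lt_or_gt_of_ne (fun e => hyt (mul_left_cancel₀ hε0 e)) with h3 | h3
      · exact Or.inl (L.sideStep_apply_of_pos hε hne h3)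
      · exact Or.inr (L.sideStep_apply_of_neg hε hne h3)
    rcases hcases with h4 | h4
    · have hw1 : w y = 1 := by
        rcases hw' with h5 | h5
        · rw [h5.1]; rfl
        · rw [h5, h4]
      have hv1 : v y = 1 := by
        rcases hv' with h5 | h5
        · rw [h5.1]; rfl
        · rw [h5, hs, h4]
      rw [hw1, hv1, mul_one, mul_one]
    · have h5 : edgeStep L o ε 0 m t y * edgeStep L o (-ε) t n k y = 0 := by
        by_cases hlt' : L.t (o 0) < L.t (o t)
        · by_cases ht : t = 1
          · subst ht
            rw [L.sideStep_lt _ hlt'] at h4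
            exact absurd ((thetaPM_apply_of_gt hε h0).symm.trans h4) one_ne_zero
          · have h6 := congrFun (h.edgeStep_mul_sideStep hε ho ha (by omega) hlt') y
            rw [Pi.mul_apply, h4, mul_zero] at h6
            rw [← h6, zero_mul]
        · have hlt'' : L.t (o t) < L.t (o k) := (not_lt.mp hlt').trans_lt hlt
          by_cases ht : k = t + 1
          · subst ht
            rw [← hs, L.sideStep_lt _ hlt'', thetaPM_apply_of_gt hε'] at h4
            · exact absurd h4 one_ne_zero
            · rw [Nat.add_sub_cancel, vx] at hk; linarith
          · have h6 := congrFun (h'.edgeStep_mul_sideStep hε' ho ha' (by omega) hlt'') y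
            rw [Pi.mul_apply, hs, h4, mul_zero] at h6
            rw [← h6, mul_zero]
      rw [h5, zero_mul]
  rw [hw, hv, smul_mul_smul_comm, Pi.smul_apply, hJ, ← key]
  simp only [Pi.mul_apply]
  congr 1
  ring

end LineConfig

/-! ## Convex sequences of lines -/

namespace LineConfig

open StepSpace HomPath Polynomial

variable {N : ℕ} {L : LineConfig N} {o : ℕ → Fin N} {ε : ℝ} {i m n j k t : ℕ}

/-- Along a cyclic sequence of `K` lines the points `x_t` move in the direction `ε` from `x_m` to
`x_n` and in the opposite direction from `x_n` to `x_{K + m}`. -/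
structure IsConvexSeq (L : LineConfig N) (o : ℕ → Fin N) (ε : ℝ) (m n K : ℕ) : Prop where
  right : ∀ t, m ≤ t → t < n → ε * L.vx o t < ε * L.vx o (t + 1)
  left : ∀ t, n ≤ t → t < K + m → ε * L.vx o (t + 1) < ε * L.vx o t

theorem vx_add_period {K : ℕ} (hper : ∀ t, o (t + K) = o t) (t : ℕ) :
    L.vx o (t + K) = L.vx o t := by
  rw [vx, vx, hper, Nat.add_right_comm, hper]

theorem IsConvexSeq.rising_left {K : ℕ} (hper : ∀ t, o (t + K) = o t)
    (h : IsConvexSeq L o ε m n K) (hn : n ≤ K) (ht : t ≤ n + 1) : Rising L o ε 0 m t :=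
  ⟨fun s hs hs' => h.right s hs (by omega), fun s _ hs => by
    have := h.left (s + K) (by omega) (by omega)
    rwa [Nat.add_right_comm, vx_add_period hper, vx_add_period hper] at this⟩

theorem IsConvexSeq.rising_right {K : ℕ} (h : IsConvexSeq L o ε m n K) (hk : k ≤ K) (ht : m ≤ t) :
    Rising L o (-ε) t n k :=
  ⟨fun s hs hs' => by linarith [h.left s hs (by omega)], fun s hs hs' => by
    linarith [h.right s (by omega) hs']⟩

theorem amp_apply_ne_zero (h2 : i + 2 ≤ j) {x : ℝ} (h : amp L o ε i m j x ≠ 0) :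
    edgeStep L o ε i m j x ≠ 0 ∧ L.sideStep ε (o i) (o j) x ≠ 0 := by
  rw [amp_of_long h2, Pi.smul_apply, Pi.mul_apply] at h
  have := right_ne_zero_of_smul h
  exact ⟨left_ne_zero_of_mul this, right_ne_zero_of_mul this⟩

theorem le_of_sideStep_ne_zero (hε : ε = 1 ∨ ε = -1) {a b : Fin N} (hab : a ≠ b) {x : ℝ}
    (h : L.sideStep ε a b x ≠ 0) : ε * L.lineAt a x ≤ ε * L.lineAt b x :=
  not_lt.mp fun hc => h (L.sideStep_apply_of_neg hε hab hc)

theorem le_of_edgeStep_ne_zero (hε : ε = 1 ∨ ε = -1) {x : ℝ} (h : edgeStep L o ε i m j x ≠ 0) :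
    (i < m → ε * L.vx o i ≤ ε * x) ∧ (m + 1 < j → ε * L.vx o (j - 1) ≤ ε * x) :=
  ⟨fun h1 => not_lt.mp fun hc => h (edgeStep_apply_eq_zero hε (Or.inl ⟨h1, hc⟩)),
    fun h1 => not_lt.mp fun hc => h (edgeStep_apply_eq_zero hε (Or.inr ⟨h1, hc⟩))⟩

/-- Two rising words are joined at a point between the adjacent and the outer points. -/
structure Joined (L : LineConfig N) (o : ℕ → Fin N) (ε : ℝ) (m n k t : ℕ) (x : ℝ) : Prop where
  rising : Rising L o ε 0 m t
  rising' : Rising L o (-ε) t n k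
  prev : ε * L.vx o (t - 1) ≤ ε * x
  next : ε * x ≤ ε * L.vx o t
  first : ε * L.vx o 0 ≤ ε * x
  last : ε * x ≤ ε * L.vx o (k - 1)

theorem rising_single (ε : ℝ) : Rising L o ε m m (m + 1) := ⟨by omega, by omega⟩

/-- The first letter of a word of two rising words, if it is a whole word. -/
theorem le_of_single_left (hε : ε = 1 ∨ ε = -1) (ho : ∀ t, o t ≠ o (t + 1)) (h0 : L.Asc o 0)
    (ha' : OneAscent L o 1 n k) (h' : Rising L o (-ε) 1 n k) {x : ℝ}
    (hx : L.lineAt (o 0) x = L.lineAt (o k) x) (hs : L.sideStep (-ε) (o 1) (o k) x ≠ 0) :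
    ε * L.vx o 0 ≤ ε * x := by
  have h1 := le_of_sideStep_ne_zero (neg_sign hε) (h'.ne ho ha') hs
  have h2 := L.lineAt_sub (ho 0) x
  have h3 : 0 < L.t (o (0 + 1)) - L.t (o 0) := sub_pos.mpr h0
  by_contra hc
  have h4 := mul_pos h3 (sub_pos.mpr (not_le.mp hc))
  have h5 : ε * (L.lineAt (o (0 + 1)) x - L.lineAt (o 0) x)
      = - ((L.t (o (0 + 1)) - L.t (o 0)) * (ε * L.vx o 0 - ε * x)) := by
    rw [h2, vx]; ring
  rw [← hx] at h1
  rw [zero_add] at h5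
  rw [zero_add] at h4
  linarith

theorem le_of_single_right (hε : ε = 1 ∨ ε = -1) (ho : ∀ t, o t ≠ o (t + 1)) (hn : L.Asc o t)
    (ha : OneAscent L o 0 m t) (h : Rising L o ε 0 m t) {x : ℝ}
    (hx : L.lineAt (o 0) x = L.lineAt (o (t + 1)) x) (hs : L.sideStep ε (o 0) (o t) x ≠ 0) :
    ε * x ≤ ε * L.vx o t := by
  have h1 := le_of_sideStep_ne_zero hε (h.ne ho ha) hs
  have h2 := L.lineAt_sub (ho t) x
  have h3 : 0 < L.t (o (t + 1)) - L.t (o t) := sub_pos.mpr hn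
  by_contra hc
  have h4 := mul_pos h3 (sub_pos.mpr (not_le.mp hc))
  have h5 : ε * (L.lineAt (o (t + 1)) x - L.lineAt (o t) x)
      = (L.t (o (t + 1)) - L.t (o t)) * (ε * x - ε * L.vx o t) := by
    rw [h2, vx]; ring
  rw [hx] at h1
  linarith

/-- Nonvanishing outer steps put x on the correct side of the outer points. A factor consisting of
one letter has no such steps; then the position of x follows from the side function of the other
factor, and for two single letters from the two ascents and the crossing of the end lines at x. -/
theorem exists_joined (ho : ∀ t, o t ≠ o (t + 1)) (ha : OneAscent L o 0 m t)
    (ha' : OneAscent L o t n k) {ε₁ ε₂ : ℝ} (hε₁ : ε₁ = 1 ∨ ε₁ = -1) (hε₂ : ε₂ = 1 ∨ ε₂ = -1)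
    (h : Rising L o ε₁ 0 m t) (h' : Rising L o ε₂ t n k) {x : ℝ}
    (hx : L.lineAt (o 0) x = L.lineAt (o k) x)
    (hne : amp L o ε₁ 0 m t x * amp L o ε₂ t n k x ≠ 0) (hk : L.t (o 0) ≤ L.t (o k)) :
    ∃ ε, (ε = 1 ∨ ε = -1) ∧ Joined L o ε m n k t x := by
  have h1 := ha.lt
  have h2 := ha'.le
  have h3 := ha'.lt
  have hA := left_ne_zero_of_mul hne
  have hA' := right_ne_zero_of_mul hne
  by_cases ht : t = 1
  · subst ht
    obtain rfl : m = 0 := by omega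
    by_cases hk2 : k = 2
    · subst hk2
      obtain rfl : n = 1 := by omega
      have h4 := L.lineAt_sub (ho 0) x
      have h5 := L.lineAt_sub (ho 1) x
      have h6 : 0 < L.t (o (0 + 1)) - L.t (o 0) := sub_pos.mpr ha.asc
      have h7 : 0 < L.t (o (1 + 1)) - L.t (o 1) := sub_pos.mpr ha'.asc
      have h8 : (L.t (o (0 + 1)) - L.t (o 0)) * (x - L.vx o 0)
        + (L.t (o (1 + 1)) - L.t (o 1)) * (x - L.vx o 1) = 0 := by
        rw [vx, vx, ← h4, ← h5]
        have : L.lineAt (o 0) x = L.lineAt (o (1 + 1)) x := hx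
        rw [this]; ring
      rcases le_total (L.vx o 0) (L.vx o 1) with h9 | h9
      · have hx0 : L.vx o 0 ≤ x := by
          by_contra hc
          nlinarith [mul_pos h6 (by linarith : 0 < L.vx o 0 - x),
            mul_pos h7 (by linarith : 0 < L.vx o 1 - x)]
        have hx1 : x ≤ L.vx o 1 := by
          by_contra hc
          nlinarith [mul_pos h7 (by linarith : 0 < x - L.vx o 1),
            mul_pos h6 (by linarith : 0 < x - L.vx o 0)]
        exact ⟨1, Or.inl rfl, rising_single _, rising_single _, by simpa using hx0,
          by simpa using hx1, by simpa using hx0, by simpa using hx1⟩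
      · have hx0 : x ≤ L.vx o 0 := by
          by_contra hc
          nlinarith [mul_pos h6 (by linarith : 0 < x - L.vx o 0),
            mul_pos h7 (by linarith : 0 < x - L.vx o 1)]
        have hx1 : L.vx o 1 ≤ x := by
          by_contra hc
          nlinarith [mul_pos h7 (by linarith : 0 < L.vx o 1 - x),
            mul_pos h6 (by linarith : 0 < L.vx o 0 - x)]
        exact ⟨-1, Or.inr rfl, rising_single _, rising_single _, by simpa using hx0,
          by simpa using hx1, by simpa using hx0, by simpa using hx1⟩
    · have hε := neg_sign hε₂
      obtain ⟨he, hs⟩ := amp_apply_ne_zero (by omega) hA'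
      obtain ⟨e1, e2⟩ := le_of_edgeStep_ne_zero hε₂ he
      have h' : Rising L o (-(-ε₂)) 1 n k := by rwa [neg_neg]
      have h4 := le_of_single_left hε ho ha.asc ha' h' hx (by rwa [neg_neg])
      have h5 : n + 1 < k → -ε₂ * x ≤ -ε₂ * L.vx o (k - 1) := fun h => by linarith [e2 h]
      have h6 : 1 < n → -ε₂ * x ≤ -ε₂ * L.vx o 1 := fun h => by linarith [e1 h]
      refine ⟨-ε₂, hε, rising_single _, h', h4, ?_, h4, ?_⟩
      · rcases h2.eq_or_lt with rfl | h7
        · linarith [h5 (by omega), h'.lt_right (t := k - 1) (by omega) (by omega)]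
        · exact h6 h7
      · rcases (by omega : n + 1 < k ∨ n = k - 1) with h7 | rfl
        · exact h5 h7
        · linarith [h6 (by omega), h'.lt_left (t := 1) (by omega) le_rfl]
  · obtain ⟨he, hs⟩ := amp_apply_ne_zero (by omega) hA
    obtain ⟨e1, e2⟩ := le_of_edgeStep_ne_zero hε₁ he
    have h4 : ε₁ * L.vx o (t - 1) ≤ ε₁ * x := by
      rcases (by omega : m + 1 < t ∨ m = t - 1) with h7 | rfl
      · exact e2 h7
      · linarith [e1 (by omega), h.lt_left (t := 0) (by omega) le_rfl]
    have h5 : ε₁ * L.vx o 0 ≤ ε₁ * x := by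
      rcases Nat.eq_zero_or_pos m with rfl | h7
      · linarith [e2 (by omega), h.lt_right (t := t - 1) (by omega) (by omega)]
      · exact e1 h7
    by_cases hk1 : k = t + 1
    · subst hk1
      obtain rfl : t = n := by omega
      have h6 := le_of_single_right hε₁ ho ha'.asc ha h hx hs
      exact ⟨ε₁, hε₁, h, rising_single _, h4, h6, h5, by simpa using h6⟩
    · obtain ⟨he', hs'⟩ := amp_apply_ne_zero (by omega) hA'
      obtain ⟨e1', e2'⟩ := le_of_edgeStep_ne_zero hε₂ he'
      have hcases : ε₂ = -ε₁ ∨ ε₂ = ε₁ := by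
        rcases hε₁ with rfl | rfl <;> rcases hε₂ with rfl | rfl <;> norm_num
      rcases hcases with rfl | rfl
      · have h5' : n + 1 < k → ε₁ * x ≤ ε₁ * L.vx o (k - 1) := fun h => by linarith [e2' h]
        have h6' : t < n → ε₁ * x ≤ ε₁ * L.vx o t := fun h => by linarith [e1' h]
        refine ⟨ε₁, hε₁, h, h', h4, ?_, h5, ?_⟩
        · rcases h2.eq_or_lt with rfl | h7
          · linarith [h5' (by omega), h'.lt_right (t := k - 1) (by omega) (by omega)]
          · exact h6' h7
        · rcases (by omega : n + 1 < k ∨ n = k - 1) with h7 | rfl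
          · exact h5' h7
          · linarith [h6' (by omega), h'.lt_left (t := t) (by omega) le_rfl]
      -- Two factors rising in the same direction: their side functions force all three end lines
      -- o_0, o_t, o_k to the same height at x. Genericity leaves only o_0 = o_k, and then the
      -- factor with increasing end slopes has vanishing outer steps at x.
      · exfalso
        have hε0 : ε₂ ≠ 0 := by rcases hε₂ with rfl | rfl <;> norm_num
        have h6 := le_of_sideStep_ne_zero hε₁ (h.ne ho ha) hs
        have h7 := le_of_sideStep_ne_zero hε₂ (h'.ne ho ha') hs'
        rw [← hx] at h7
        have h8 := mul_left_cancel₀ hε0 (le_antisymm h6 h7)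
        rcases L.lineAt_generic h8 (h8.symm.trans hx) with h9 | h9 | h9
        · exact h.ne ho ha h9
        · exact h'.ne ho ha' h9
        · by_cases hlt : L.t (o 0) < L.t (o t)
          · refine he ?_
            rw [L.eq_xv (h.ne ho ha) h8]
            exact h.edgeStep_xv_eq_zero hε₁ ho ha (by omega) hlt
          · have hgt := L.lt_of_not_lt (h.ne ho ha) hlt
            refine he' ?_
            rw [L.eq_xv (h'.ne ho ha') (h8.symm.trans hx)]
            exact h'.edgeStep_xv_eq_zero hε₂ ho ha' (by omega) (h9 ▸ hgt)

/-- Equality would make o_{t-1} and o_{t+1} coincide, so exactly one of the two adjacent letters is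
an ascent. The strict inequalities of the rising word containing it, or the fact that rising words
are not closed, then give a contradiction. -/
theorem Joined.prev_lt_next (hε : ε = 1 ∨ ε = -1) (ho : ∀ t, o t ≠ o (t + 1)) (ha : OneAscent L o 0 m t)
    (ha' : OneAscent L o t n k) {x : ℝ} (hx : L.lineAt (o 0) x = L.lineAt (o k) x)
    (h : Joined L o ε m n k t x) : ε * L.vx o (t - 1) < ε * L.vx o t := by
  have hε0 : ε ≠ 0 := by rcases hε with rfl | rfl <;> norm_num
  refine lt_of_le_of_ne (h.prev.trans h.next) fun e => ?_
  have h1 := ha.lt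
  have h2 := ha'.le
  have h3 := ha'.lt
  obtain rfl : x = L.vx o t := mul_left_cancel₀ hε0 (le_antisymm h.next (e ▸ h.prev))
  have e' := mul_left_cancel₀ hε0 e
  obtain ⟨l, rfl⟩ : ∃ l, t = l + 1 := ⟨t - 1, by omega⟩
  rw [Nat.add_sub_cancel] at e e'
  have h4 : o l = o (l + 2) := by
    by_contra hc
    exact vx_ne_succ ho hc e'
  by_cases hl : L.Asc o l
  · obtain rfl : l = m := by
      by_contra hc
      exact ha.desc l (Nat.zero_le l) (by omega) hc hl
    rcases Nat.eq_zero_or_pos l with rfl | h5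
    · have h6 : L.lineAt (o 0) (L.vx o (0 + 1)) = L.lineAt (o 1) (L.vx o (0 + 1)) := by
        rw [← e']; exact lineAt_vx ho 0
      have h7 : ¬ L.Asc o 1 := fun h7 => by
        have h8 : L.t (o 0) < L.t (o (0 + 1)) := hl
        rw [h4] at h8
        exact lt_asymm h8 h7
      have hn : 1 ≠ n := by rintro rfl; exact h7 ha'.asc
      rcases L.lineAt_generic h6 (h6.symm.trans hx) with h8 | h8 | h8
      · exact ho 0 h8
      · exact h.rising'.ne ho ha' h8
      · exact (h.rising'.tail (i' := 2) (by omega)).ne ho (ha'.tail (by omega) (by omega))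
          (h4.symm.trans h8)
    · have := h.rising.lt_left (t := 0) h5 le_rfl
      linarith [h.first]
  · have h5 : L.Asc o (l + 1) := by
      have h6 := lt_of_not_asc ho hl
      rw [h4] at h6
      exact h6
    obtain rfl : l + 1 = n := by
      by_contra hc
      exact ha'.desc (l + 1) le_rfl (by omega) hc h5
    have hlm : l ≠ m := by rintro rfl; exact hl ha.asc
    rcases (by omega : l + 1 + 1 < k ∨ k = l + 1 + 1) with h6 | rfl
    · have := h.rising'.lt_right (t := k - 1) (by omega) (by omega)
      linarith [h.last]
    · have h6 := lineAt_vx ho (l + 1) (L := L)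
      rcases L.lineAt_generic hx h6.symm with h8 | h8 | h8
      · exact (h.rising.init (Nat.le_succ l)).ne ho (ha.init (by omega) (by omega)) (h8.trans h4.symm)
      · exact ho _ h8.symm
      · exact h.rising.ne ho ha h8

theorem Joined.right_lt (hε : ε = 1 ∨ ε = -1) (ho : ∀ t, o t ≠ o (t + 1)) (ha : OneAscent L o 0 m t)
    (ha' : OneAscent L o t n k) {x : ℝ} (hx : L.lineAt (o 0) x = L.lineAt (o k) x)
    (h : Joined L o ε m n k t x) (s : ℕ) (hs : m ≤ s) (hs' : s < n) :
    ε * L.vx o s < ε * L.vx o (s + 1) := by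
  rcases lt_trichotomy (s + 1) t with h1 | rfl | h1
  · exact h.rising.right s hs h1
  · exact h.prev_lt_next hε ho ha ha' hx
  · linarith [h.rising'.left s (by omega) hs']

/-- Equality makes o_0, o_1 and o_k concurrent, and increasing end slopes leave only o_1 = o_k, with
the ascent at the very beginning. Then the second factor is closed, or x_{t-1} lies strictly beyond
x; neither is possible. -/
theorem Joined.first_lt (hε : ε = 1 ∨ ε = -1) (ho : ∀ t, o t ≠ o (t + 1)) (ha : OneAscent L o 0 m t)
    (ha' : OneAscent L o t n k) {x : ℝ} (hx : L.lineAt (o 0) x = L.lineAt (o k) x)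
    (h : Joined L o ε m n k t x) (hlt : L.t (o 0) < L.t (o k)) : ε * L.vx o 0 < ε * x := by
  have hε0 : ε ≠ 0 := by rcases hε with rfl | rfl <;> norm_num
  refine lt_of_le_of_ne h.first fun e => ?_
  obtain rfl := mul_left_cancel₀ hε0 e
  have h1 := ha.lt
  have h6 := lineAt_vx ho 0 (L := L)
  rcases L.lineAt_generic h6 (h6.symm.trans hx) with h8 | h8 | h8
  · exact ho 0 h8
  · have h9 : L.Asc o 0 := by rw [← h8] at hlt; exact hlt
    obtain rfl : 0 = m := by
      by_contra hc
      exact ha.desc 0 le_rfl (by omega) hc h9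
    by_cases ht : t = 1
    · subst ht
      exact h.rising'.ne ho ha' h8
    · linarith [h.prev, h.rising.lt_right (t := t - 1) (by omega) (by omega)]
  · exact (L.ne_of_lt hlt) h8

theorem Joined.lt_last (hε : ε = 1 ∨ ε = -1) (ho : ∀ t, o t ≠ o (t + 1)) (ha : OneAscent L o 0 m t)
    (ha' : OneAscent L o t n k) {x : ℝ} (hx : L.lineAt (o 0) x = L.lineAt (o k) x)
    (h : Joined L o ε m n k t x) (hlt : L.t (o 0) < L.t (o k)) : ε * x < ε * L.vx o (k - 1) := by
  have hε0 : ε ≠ 0 := by rcases hε with rfl | rfl <;> norm_num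
  refine lt_of_le_of_ne h.last fun e => ?_
  obtain rfl := mul_left_cancel₀ hε0 e
  have h1 := ha.lt
  have h2 := ha'.le
  have h3 := ha'.lt
  obtain ⟨l, rfl⟩ : ∃ l, k = l + 1 := ⟨k - 1, by omega⟩
  rw [Nat.add_sub_cancel] at *
  have h6 := lineAt_vx ho l (L := L)
  rcases L.lineAt_generic hx h6.symm with h8 | h8 | h8
  · exact (L.ne_of_lt hlt) h8
  · exact ho _ h8.symm
  · have h9 : L.Asc o l := by rw [h8] at hlt; exact hlt
    obtain rfl : l = n := by
      by_contra hc
      exact ha'.desc l (by omega) (by omega) hc h9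
    rcases h2.eq_or_lt with rfl | h10
    · exact h.rising.ne ho ha h8
    · linarith [h.next, h.rising'.lt_left (t := t) (by omega) le_rfl]

theorem Joined.first_lt_last (hε : ε = 1 ∨ ε = -1) (ho : ∀ t, o t ≠ o (t + 1))
    (ha : OneAscent L o 0 m t) (ha' : OneAscent L o t n k) {x : ℝ}
    (h : Joined L o ε m n k t x) (hk : o 0 = o k) : ε * L.vx o 0 < ε * L.vx o (k - 1) := by
  have hε0 : ε ≠ 0 := by rcases hε with rfl | rfl <;> norm_num
  refine lt_of_le_of_ne (h.first.trans h.last) fun e => ?_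
  obtain rfl : x = L.vx o 0 := mul_left_cancel₀ hε0 (le_antisymm (e ▸ h.last) h.first)
  have e' := mul_left_cancel₀ hε0 e
  have h1 := ha.lt
  have h2 := ha'.le
  have h3 := ha'.lt
  obtain ⟨l, rfl⟩ : ∃ l, k = l + 1 := ⟨k - 1, by omega⟩
  rw [Nat.add_sub_cancel] at *
  have h6 := lineAt_vx ho 0 (L := L)
  have h7 := lineAt_vx ho l (L := L)
  rw [← e', ← hk] at h7
  rcases L.lineAt_generic h6.symm h7.symm with h8 | h8 | h8
  · exact ho 0 h8.symm
  · exact ho l (h8.symm.trans hk)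
  · rcases Nat.eq_zero_or_pos m with rfl | hm
    · have h9 : ¬ L.Asc o l := fun h9 => by
        have h10 : L.t (o l) < L.t (o (l + 1)) := h9
        have h11 : L.t (o 0) < L.t (o (0 + 1)) := ha.asc
        rw [← hk, ← h8] at h10
        exact lt_asymm h10 h11
      have hnl : n ≠ l := by rintro rfl; exact h9 ha'.asc
      by_cases ht : t = 1
      · subst ht
        exact (h.rising'.init (Nat.le_succ l)).ne ho (ha'.init (by omega) (by omega)) h8
      · linarith [h.prev, h.rising.lt_right (t := t - 1) (by omega) (by omega)]
    · have h9 : L.Asc o l := by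
        have h10 := lt_of_not_asc ho (ha.desc 0 le_rfl (by omega) (by omega))
        rw [h8, hk] at h10
        exact h10
      obtain rfl : l = n := by
        by_contra hc
        exact ha'.desc l (by omega) (by omega) hc h9
      rcases h2.eq_or_lt with rfl | h10
      · exact (h.rising.tail (Nat.zero_le 1)).ne ho (ha.tail (Nat.zero_le 1) (by omega)) h8
      · linarith [h.next, h.rising'.lt_left (t := t) (by omega) le_rfl]

theorem Joined.isConvexSeq_closed (hε : ε = 1 ∨ ε = -1) (ho : ∀ t, o t ≠ o (t + 1))
    (ha : OneAscent L o 0 m t) (ha' : OneAscent L o t n k) {x : ℝ}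
    (h : Joined L o ε m n k t x) (hper : ∀ t, o (t + k) = o t) : IsConvexSeq L o ε m n k := by
  have hk : o 0 = o k := by simpa using (hper 0).symm
  refine ⟨h.right_lt hε ho ha ha' (by rw [hk]), fun s hs hs' => ?_⟩
  rcases lt_trichotomy (s + 1) k with h1 | h1 | h1
  · linarith [h.rising'.right s hs h1]
  · have := h.first_lt_last hε ho ha ha' hk
    rwa [← h1, Nat.add_sub_cancel, ← vx_add_period hper 0, zero_add, ← h1] at this
  · obtain ⟨r, rfl⟩ : ∃ r, s = r + k := ⟨s - k, by omega⟩
    rw [Nat.add_right_comm, vx_add_period hper, vx_add_period hper]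
    exact h.rising.left r (Nat.zero_le r) (by omega)

theorem vx_last (hper : ∀ t, o (t + (k + 1)) = o t) : L.vx o k = L.xv (o 0) (o k) := by
  have := hper 0
  rw [zero_add] at this
  rw [vx, this, xv_comm]

theorem Joined.isConvexSeq_open (hε : ε = 1 ∨ ε = -1) (ho : ∀ t, o t ≠ o (t + 1))
    (ha : OneAscent L o 0 m t) (ha' : OneAscent L o t n k)
    (h : Joined L o ε m n k t (L.xv (o 0) (o k))) (hper : ∀ t, o (t + (k + 1)) = o t)
    (hlt : L.t (o 0) < L.t (o k)) : IsConvexSeq L o ε m n (k + 1) := by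
  have hx := L.lineAt_xv (L.ne_of_lt hlt)
  have hy := vx_last (L := L) hper
  have h3 := ha'.lt
  refine ⟨h.right_lt hε ho ha ha' hx, fun s hs hs' => ?_⟩
  rcases lt_trichotomy (s + 1) k with h1 | h1 | h1
  · linarith [h.rising'.right s hs h1]
  · have := h.lt_last hε ho ha ha' hx hlt
    rwa [← hy, ← h1, Nat.add_sub_cancel] at this
  · rcases (by omega : s = k ∨ k + 1 ≤ s) with rfl | h2
    · have := h.first_lt hε ho ha ha' hx hlt
      rwa [← hy, ← vx_add_period hper 0, zero_add] at this
    · obtain ⟨r, rfl⟩ : ∃ r, s = r + (k + 1) := ⟨s - (k + 1), by omega⟩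
      rw [Nat.add_right_comm, vx_add_period hper, vx_add_period hper]
      exact h.rising.left r (Nat.zero_le r) (by omega)

/-- The sign of two joined rising words. -/
noncomputable def joinSign (ε : ℝ) (m n k : ℕ) : ℝ :=
  if ε = 1 then (-1) ^ (m + (k - 1 - n)) else (-1) ^ (n - 1 - m)

/-- The sign does not depend on the cut t, so it factors out of the sum over cuts. -/
theorem riseSign_mul_riseSign (hε : ε = 1 ∨ ε = -1) (h : m < t) (h' : t ≤ n) :
    riseSign ε 0 m t * riseSign (-ε) t n k = joinSign ε m n k := by
  rcases hε with rfl | rfl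
  · rw [riseSign, riseSign, joinSign, if_pos rfl, if_neg (by norm_num), if_pos rfl, pow_add,
      Nat.sub_zero]
  · rw [riseSign, riseSign, joinSign, if_neg (by norm_num), if_pos (by norm_num),
      if_neg (by norm_num), ← pow_add]
    congr 1
    omega

theorem incl_mul_incl (ho : ∀ t, o t ≠ o (t + 1)) (h : TwoAscents L o m n k) (h1 : m < t)
    (h2 : t ≤ n) {ε₁ ε₂ : ℝ} (hε₁ : ε₁ = 1 ∨ ε₁ = -1) (hε₂ : ε₂ = 1 ∨ ε₂ = -1)
    (hr : Rising L o ε₁ 0 m t) (hr' : Rising L o ε₂ t n k) :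
    L.incl (L.seg o 0 t) * L.incl (L.seg o t k) = emb 0 (segCoeff L o 0 k •
      (L.expf (o 0) (o k) * (amp L o ε₁ 0 m t * amp L o ε₂ t n k))) := by
  rw [(inclFormula ho (h.left h1 h2)).1 ε₁ hε₁ hr, (inclFormula ho (h.right h1 h2)).1 ε₂ hε₂ hr',
    emb_zero_mul, smul_expf_mul_mul, segCoeff_mul (Nat.zero_le t) (h2.trans h.lt'.le)]

theorem TwoAscents.prod_seg (ho : ∀ t, o t ≠ o (t + 1)) (h : TwoAscents L o m n k) :
    L.prod (L.seg o 0 k) = - ∑ t ∈ Finset.Ioc m n,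
      L.pForms (o 0) (o k) (L.incl (L.seg o 0 t) * L.incl (L.seg o t k)) := by
  have := h.lt
  have := h.lt'
  rw [prod_seg_of_long ho (by omega), h.tree_seg ho, map_neg, map_sum]

/-- All cuts share the sign, the exponential factor and the two outer steps; the remaining factors,
depending on the cut, add up to 1. -/
theorem TwoAscents.prod_seg_closed (hε : ε = 1 ∨ ε = -1) (ho : ∀ t, o t ≠ o (t + 1))
    (h : TwoAscents L o m n k) (hper : ∀ t, o (t + k) = o t) (hc : IsConvexSeq L o ε m n k) :
    L.prod (L.seg o 0 k) = emb 0 ((-joinSign ε m n k * segCoeff L o 0 k) •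
      (thetaPM ε (L.vx o 0) * thetaPM (-ε) (L.vx o (k - 1)))) := by
  have hk : o 0 = o k := by simpa using (hper 0).symm
  have h1 := h.lt'
  have key : ∀ t ∈ Finset.Ioc m n,
      L.pForms (o 0) (o k) (L.incl (L.seg o 0 t) * L.incl (L.seg o t k))
      = emb 0 ((joinSign ε m n k * segCoeff L o 0 k) • (thetaPM ε (L.vx o 0)
        * thetaPM (-ε) (L.vx o (k - 1)) * joinStep L o ε m n t)) := by
    intro t ht
    rw [Finset.mem_Ioc] at ht
    have hr := hc.rising_left hper (by omega) (t := t) (by omega)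
    have hr' := hc.rising_right le_rfl (t := t) (by omega)
    rw [incl_mul_incl ho h ht.1 ht.2 hε (neg_sign hε) hr hr',
      amp_mul_amp_closed hε ho (h.left ht.1 ht.2) (h.right ht.1 ht.2) hr hr' hk, ← hk, pForms_self,
      expf_self, one_mul, smul_smul, riseSign_mul_riseSign hε ht.1 ht.2, mul_comm (segCoeff _ _ _ _)]
  rw [h.prod_seg ho, Finset.sum_congr rfl key, ← map_sum, ← Finset.smul_sum, ← Finset.mul_sum,
    sum_joinStep hε h.lt hc.right, mul_one, ← map_neg, ← neg_smul, neg_mul]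

/-- Here the projection evaluates at the crossing of the end lines with jump variable 1/2. The
joining steps may jump at that point, but their sum is 1 as a step function, so the value of a
single one is irrelevant. -/
theorem TwoAscents.prod_seg_open (hε : ε = 1 ∨ ε = -1) (ho : ∀ t, o t ≠ o (t + 1))
    (h : TwoAscents L o m n k) (hper : ∀ t, o (t + (k + 1)) = o t) (hlt : L.t (o 0) < L.t (o k))
    (hc : IsConvexSeq L o ε m n (k + 1)) :
    L.prod (L.seg o 0 k)
      = emb 0 ((-joinSign ε m n k * segCoeff L o 0 k) • L.expf (o 0) (o k)) := by
  have h1 := h.lt'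
  have hy := vx_last (L := L) hper
  have h0 : ε * L.vx o 0 < ε * L.xv (o 0) (o k) := by
    have h2 := hc.left k (by omega) (by omega)
    have h3 := vx_add_period (L := L) hper 0
    rwa [hy, ← zero_add (k + 1), h3] at h2
  have hk : ε * L.xv (o 0) (o k) < ε * L.vx o (k - 1) := by
    have := hc.left (k - 1) (by omega) (by omega)
    rwa [Nat.sub_add_cancel (by omega), hy] at this
  have key : ∀ t ∈ Finset.Ioc m n,
      L.pForms (o 0) (o k) (L.incl (L.seg o 0 t) * L.incl (L.seg o t k))
      = (joinSign ε m n k * segCoeff L o 0 k *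
        ((joinStep L o ε m n t) (L.xv (o 0) (o k))).eval (1 / 2)) • emb 0 (L.expf (o 0) (o k)) := by
    intro t ht
    rw [Finset.mem_Ioc] at ht
    have hr := hc.rising_left hper (by omega) (t := t) (by omega)
    have hr' := hc.rising_right (Nat.le_succ k) (t := t) (by omega)
    rw [incl_mul_incl ho h ht.1 ht.2 hε (neg_sign hε) hr hr', pForms_emb, projOp_lt_zero _ hlt,
      mul_smul_comm, expf_swap_mul_expf_mul, Pi.smul_apply,
      amp_mul_amp_open hε ho (h.left ht.1 ht.2) (h.right ht.1 ht.2) hr hr' hlt h0 hk,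
      riseSign_mul_riseSign hε ht.1 ht.2, map_smul, eval_smul, eval_smul, smul_eq_mul, smul_eq_mul]
    congr 1
    ring
  have hsum := congrArg (eval (1 / 2)) (congrFun (sum_joinStep hε h.lt hc.right) (L.xv (o 0) (o k)))
  rw [Finset.sum_apply, eval_finsetSum, Pi.one_apply, eval_one] at hsum
  rw [h.prod_seg ho, Finset.sum_congr rfl key, ← Finset.sum_smul, ← Finset.mul_sum, hsum, mul_one,
    ← neg_smul, neg_mul, map_smul]

theorem TwoAscents.prod_seg_eq_zero (ho : ∀ t, o t ≠ o (t + 1)) (h : TwoAscents L o m n k)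
    (H : ∀ t, m < t → t ≤ n → ∀ ε₁ ε₂ : ℝ, (ε₁ = 1 ∨ ε₁ = -1) → (ε₂ = 1 ∨ ε₂ = -1) →
      Rising L o ε₁ 0 m t → Rising L o ε₂ t n k →
      L.pForms (o 0) (o k) (emb 0 (segCoeff L o 0 k •
        (L.expf (o 0) (o k) * (amp L o ε₁ 0 m t * amp L o ε₂ t n k)))) = 0) :
    L.prod (L.seg o 0 k) = 0 := by
  rw [h.prod_seg ho, neg_eq_zero]
  refine Finset.sum_eq_zero fun t ht => ?_
  rw [Finset.mem_Ioc] at ht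
  by_cases h1 : ∃ ε : ℝ, (ε = 1 ∨ ε = -1) ∧ Rising L o ε 0 m t
  · by_cases h2 : ∃ ε : ℝ, (ε = 1 ∨ ε = -1) ∧ Rising L o ε t n k
    · obtain ⟨ε₁, hε₁, h1⟩ := h1
      obtain ⟨ε₂, hε₂, h2⟩ := h2
      rw [incl_mul_incl ho h ht.1 ht.2 hε₁ hε₂ h1 h2]
      exact H t ht.1 ht.2 ε₁ ε₂ hε₁ hε₂ h1 h2
    · rw [(inclFormula ho (h.right ht.1 ht.2)).2 fun ε hε hR => h2 ⟨ε, hε, hR⟩, mul_zero, map_zero]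
  · rw [(inclFormula ho (h.left ht.1 ht.2)).2 fun ε hε hR => h1 ⟨ε, hε, hR⟩, zero_mul, map_zero]

/-- A point at which some cut contributes would join its two factors to a convex sequence, so all
contributions vanish identically. -/
theorem TwoAscents.prod_seg_closed_eq_zero (ho : ∀ t, o t ≠ o (t + 1))
    (h : TwoAscents L o m n k) (hper : ∀ t, o (t + k) = o t)
    (hc : ∀ ε : ℝ, (ε = 1 ∨ ε = -1) → ¬ IsConvexSeq L o ε m n k) : L.prod (L.seg o 0 k) = 0 := by
  have hk : o 0 = o k := by simpa using (hper 0).symm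
  refine h.prod_seg_eq_zero ho fun t h1 h2 ε₁ ε₂ hε₁ hε₂ hr hr' => ?_
  have : amp L o ε₁ 0 m t * amp L o ε₂ t n k = 0 := by
    funext x
    by_contra hne
    obtain ⟨ε, hε, hJ⟩ := exists_joined ho (h.left h1 h2) (h.right h1 h2) hε₁ hε₂ hr hr'
      (by rw [hk]) hne (by rw [hk])
    exact hc ε hε (hJ.isConvexSeq_closed hε ho (h.left h1 h2) (h.right h1 h2) hper)
  rw [this, mul_zero, smul_zero, map_zero, map_zero]

theorem TwoAscents.prod_seg_open_eq_zero (ho : ∀ t, o t ≠ o (t + 1))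
    (h : TwoAscents L o m n k) (hper : ∀ t, o (t + (k + 1)) = o t) (hlt : L.t (o 0) < L.t (o k))
    (hc : ∀ ε : ℝ, (ε = 1 ∨ ε = -1) → ¬ IsConvexSeq L o ε m n (k + 1)) :
    L.prod (L.seg o 0 k) = 0 := by
  refine h.prod_seg_eq_zero ho fun t h1 h2 ε₁ ε₂ hε₁ hε₂ hr hr' => ?_
  have : (amp L o ε₁ 0 m t * amp L o ε₂ t n k) (L.xv (o 0) (o k)) = 0 := by
    by_contra hne
    obtain ⟨ε, hε, hJ⟩ := exists_joined ho (h.left h1 h2) (h.right h1 h2) hε₁ hε₂ hr hr'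
      (L.lineAt_xv (L.ne_of_lt hlt)) hne hlt.le
    exact hc ε hε (hJ.isConvexSeq_open hε ho (h.left h1 h2) (h.right h1 h2) hper hlt)
  rw [pForms_emb, projOp_lt_zero _ hlt, mul_smul_comm, expf_swap_mul_expf_mul, Pi.smul_apply, this]
  simp

end LineConfig

/-! ### Removal of repetitions in a periodic sequence of points. -/

section CyclicReduction

open Classical

variable {P : ℕ → ℝ × ℝ} {K : ℕ}

/-- The number `t` is the last one of a run of equal points. -/
def IsRunEnd (P : ℕ → ℝ × ℝ) (t : ℕ) : Prop := P t ≠ P (t + 1)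

/-- Each run of equal points is represented by its last index instead of its first, which makes the
description insensitive to where the cyclic sequence starts. -/
theorem destutter'_map_range' (P : ℕ → ℝ × ℝ) (n s : ℕ) :
    ((List.range' (s + 1) n).map P).destutter' (· ≠ ·) (P s)
      = ((List.range' s n).filter (IsRunEnd P)).map P ++ [P (s + n)] := by
  induction n generalizing s with
  | zero => simp
  | succ n ih =>
    have e : s + 1 + n = s + (n + 1) := by omega
    rw [List.range'_succ, List.map_cons, List.range'_succ]
    by_cases h : IsRunEnd P s
    · rw [List.destutter'_cons_pos _ h, ih, List.filter_cons_of_pos (by simpa using h), e]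
      rfl
    · rw [List.destutter'_cons_neg _ h, List.filter_cons_of_neg (by simpa using h),
        not_not.mp h, ih, e]

theorem head?_map_filter_range' (P : ℕ → ℝ × ℝ) (n s : ℕ) :
    (((List.range' s n).filter (IsRunEnd P)).map P ++ [P (s + n)]).head? = some (P s) := by
  induction n generalizing s with
  | zero => simp
  | succ n ih =>
    have e : s + 1 + n = s + (n + 1) := by omega
    rw [List.range'_succ]
    by_cases h : IsRunEnd P s
    · rw [List.filter_cons_of_pos (by simpa using h)]
      rfl
    · rw [List.filter_cons_of_neg (by simpa using h), not_not.mp h, ← e, ih]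

/-- The last index of the period ends a run exactly when its point differs from P 0 = P K, and this
is the case distinction in the definition of the reduction. -/
theorem cyclicReduction_map_range (hK : 0 < K) (hP : P K = P 0) :
    cyclicReduction ((List.range K).map P) = ((List.range K).filter (IsRunEnd P)).map P := by
  obtain ⟨n, rfl⟩ := Nat.exists_eq_add_one.mpr hK
  have h1 : ((List.range (n + 1)).map P).destutter (· ≠ ·)
      = ((List.range n).filter (IsRunEnd P)).map P ++ [P n] := by
    rw [List.range_eq_range', List.range'_succ, List.map_cons, List.destutter_cons',
      destutter'_map_range', List.range_eq_range', zero_add]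
  have h2 : (((List.range n).filter (IsRunEnd P)).map P ++ [P n]).head? = some (P 0) := by
    rw [List.range_eq_range']
    simpa using head?_map_filter_range' P n 0
  unfold cyclicReduction
  simp only [h1, h2, List.getLast?_append, List.getLast?_singleton, Option.some_or,
    List.dropLast_concat]
  rw [List.range_succ, List.filter_append, List.map_append]
  by_cases h : IsRunEnd P n
  · rw [if_neg, List.filter_singleton]
    · simp [h]
    · intro e
      exact h (by rw [hP, Option.some.inj e])
  · rw [if_pos, List.filter_singleton]
    · simp [h]
    · rw [not_not.mp h, hP]

theorem length_filter_range (q : ℕ → Prop) (K : ℕ) :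
    ((List.range K).filter q).length = Nat.count q K := by
  rw [Nat.count, List.countP_eq_length_filter]

theorem getD_filter_range {q : ℕ → Prop} {k : ℕ} (hk : k < K) (hq : q k) (P : ℕ → ℝ × ℝ) :
    (((List.range K).filter q).map P).getD (Nat.count q k) 0 = P k := by
  induction K with
  | zero => omega
  | succ K ih =>
    rw [List.range_succ, List.filter_append, List.map_append]
    have hlen : (((List.range K).filter q).map P).length = Nat.count q K := by
      rw [List.length_map, length_filter_range]
    rcases (Nat.lt_succ_iff_lt_or_eq.mp hk) with h | rfl
    · rw [List.getD_append _ _ _ _ (by rw [hlen]; exact Nat.count_strict_mono hq h), ih h]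
    · rw [List.getD_append_right _ _ _ _ hlen.le, hlen, Nat.sub_self]
      simp [hq]

theorem isRunEnd_add_period (hP : ∀ t, P (t + K) = P t) (t : ℕ) :
    IsRunEnd P (t + K) ↔ IsRunEnd P t := by
  unfold IsRunEnd
  rw [hP, add_right_comm, hP]

theorem getD_cyclicReduction_of_isRunEnd (hK : 0 < K) (hP : ∀ t, P (t + K) = P t) {k : ℕ}
    (h : IsRunEnd P k) :
    (cyclicReduction ((List.range K).map P)).getD
      (Nat.count (IsRunEnd P) k % (cyclicReduction ((List.range K).map P)).length) 0 = P k := by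
  rw [cyclicReduction_map_range hK (by simpa using hP 0), List.length_map, length_filter_range]
  induction k using Nat.strong_induction_on with
  | _ k ih =>
    by_cases hk : k < K
    · rw [Nat.mod_eq_of_lt (Nat.count_strict_mono h hk)]
      exact getD_filter_range hk h P
    · obtain ⟨l, rfl⟩ := Nat.exists_eq_add_of_le (not_lt.mp hk)
      rw [add_comm, isRunEnd_add_period hP] at h
      have h2 : (fun t => IsRunEnd P (K + t)) = IsRunEnd P := by
        funext t
        rw [add_comm, isRunEnd_add_period hP]
      rw [Nat.count_add, add_comm K l, hP, Nat.add_mod_left, ← ih l (by omega) h]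
      simp only [h2]

/-- The cyclic reduction of a periodic sequence of points, read as a periodic sequence. -/
theorem getD_cyclicReduction (hK : 0 < K) (hP : ∀ t, P (t + K) = P t) {k d : ℕ}
    (h : IsRunEnd P (k + d)) :
    (cyclicReduction ((List.range K).map P)).getD
      (Nat.count (IsRunEnd P) k % (cyclicReduction ((List.range K).map P)).length) 0 = P k := by
  induction d generalizing k with
  | zero => exact getD_cyclicReduction_of_isRunEnd hK hP h
  | succ d ih =>
    by_cases hk : IsRunEnd P k
    · exact getD_cyclicReduction_of_isRunEnd hK hP hk
    · have h1 := ih (k := k + 1) (by rwa [add_right_comm])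
      rwa [Nat.count_succ, if_neg hk, add_zero, ← not_not.mp hk] at h1

theorem IsCCPolygon.exists_isRunEnd (hK : 0 < K) (hP : ∀ t, P (t + K) = P t)
    (h : IsCCPolygon ((List.range K).map P)) : ∃ t, IsRunEnd P t := by
  by_contra! hc
  refine h.1 ?_
  rw [cyclicReduction_map_range hK (by simpa using hP 0)]
  simp [hc]

theorem exists_isRunEnd_add (hK : 0 < K) (hP : ∀ t, P (t + K) = P t) (h : ∃ t, IsRunEnd P t)
    (k : ℕ) : ∃ d, IsRunEnd P (k + d) := by
  obtain ⟨t, ht⟩ := h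
  have h1 : ∀ n, IsRunEnd P (t + K * n) := fun n => by
    induction n with
    | zero => exact ht
    | succ n ih => rw [mul_add, mul_one, ← add_assoc, isRunEnd_add_period hP]; exact ih
  have h2 : k ≤ t + K * k := by nlinarith
  obtain ⟨d, hd⟩ := Nat.exists_eq_add_of_le h2
  exact ⟨d, hd ▸ h1 k⟩

/-- The position in the reduced polygon is the number of run ends passed so far. As k and k' are
consecutive run ends, the three points are consecutive vertices of the reduction. -/
theorem IsCCPolygon.turnsRight (hK : 0 < K) (hP : ∀ t, P (t + K) = P t)
    (h : IsCCPolygon ((List.range K).map P)) {k k' : ℕ} (hkk' : k < k') (hk : IsRunEnd P k)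
    (hc : ∀ t, k < t → t < k' → ¬ IsRunEnd P t) (hk' : IsRunEnd P k') :
    TurnsRight (P k) (P (k + 1)) (P (k' + 1)) := by
  have hd := fun n => exists_isRunEnd_add hK hP (h.exists_isRunEnd hK hP) n
  have hg : ∀ n, (cyclicReduction ((List.range K).map P)).getD
      (Nat.count (IsRunEnd P) n % (cyclicReduction ((List.range K).map P)).length) 0 = P n :=
    fun n => (hd n).elim fun d h => getD_cyclicReduction hK hP h
  have h1 : Nat.count (IsRunEnd P) (k + 1) = Nat.count (IsRunEnd P) k + 1 := by
    rw [Nat.count_succ, if_pos hk]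
  have h2 : Nat.count (IsRunEnd P) (k' + 1) = Nat.count (IsRunEnd P) k + 2 := by
    have : Nat.count (IsRunEnd P) k' = Nat.count (IsRunEnd P) (k + 1) := by
      clear hk'
      induction k', hkk' using Nat.le_induction with
      | base => rfl
      | succ n hn ih =>
        rw [Nat.count_succ, if_neg (hc n hn (Nat.lt_succ_self n)), add_zero,
          ih fun t h3 h4 => hc t h3 (by omega)]
    rw [Nat.count_succ, if_pos hk', this, h1]
  have h3 := h.2 (Nat.count (IsRunEnd P) k % (cyclicReduction ((List.range K).map P)).length)
    (Nat.mod_lt _ (List.length_pos_iff.mpr h.1))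
  rwa [Nat.mod_add_mod, Nat.mod_add_mod, ← h1, ← h2, hg, hg, hg] at h3

theorem isCCPolygon_map_range (hK : 0 < K) (hP : ∀ t, P (t + K) = P t)
    (hq : ∀ t, IsRunEnd P t) (h : ∀ t, TurnsRight (P t) (P (t + 1)) (P (t + 2))) :
    IsCCPolygon ((List.range K).map P) := by
  have h1 : cyclicReduction ((List.range K).map P) = (List.range K).map P := by
    rw [cyclicReduction_map_range hK (by simpa using hP 0)]
    simp [hq]
  have h2 : ∀ t, P (t % K) = P t := fun t => (Function.Periodic.map_mod_nat hP t)
  have hg : ∀ t, ((List.range K).map P).getD (t % K) 0 = P t := fun t => by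
    rw [List.getD_eq_getElem _ _ (by simpa using Nat.mod_lt t hK)]
    simp [h2]
  refine ⟨by rw [h1]; simpa using hK.ne', fun i hi => ?_⟩
  simp only [h1, List.length_map, List.length_range] at hi ⊢
  have h3 := hg i
  rw [Nat.mod_eq_of_lt hi] at h3
  rw [hg, hg, h3]
  exact h i

end CyclicReduction

theorem forall_of_periodic {K : ℕ} {Q : ℕ → Prop} (hQ : ∀ t, Q (t + K) ↔ Q t) (m : ℕ)
    (hK : 0 < K) (h : ∀ t, m ≤ t → t < K + m → Q t) (t : ℕ) : Q t := by
  have h1 : ∀ d s, Q (s + K * d) ↔ Q s := fun d s => by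
    induction d with
    | zero => rfl
    | succ d ih => rw [mul_add, mul_one, ← add_assoc, hQ, ih]
  have h2 : m ≤ t + K * m := by nlinarith
  obtain ⟨r, hr⟩ := Nat.exists_eq_add_of_le h2
  rw [← h1 m t, hr, ← Nat.mod_add_div r K, ← add_assoc, h1]
  have := Nat.mod_lt r hK
  exact h _ (by omega) (by omega)

/-- No edge is vertical, so the cross product and the scalar product both contain the product of the
two horizontal displacements as a factor. -/
theorem turnsRight_iff {p q r : ℝ × ℝ} {c c' : ℝ} (h : q.2 - p.2 = c * (q.1 - p.1))
    (h' : r.2 - q.2 = c' * (r.1 - q.1)) :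
    TurnsRight p q r ↔ (q.1 - p.1) * (r.1 - q.1) * (c' - c) < 0 ∨
      ((q.1 - p.1) * (r.1 - q.1) * (c' - c) = 0 ∧
        0 < (q.1 - p.1) * (r.1 - q.1) * (1 + c * c')) := by
  unfold TurnsRight
  simp only [h, h']
  rw [show (q.1 - p.1) * (c' * (r.1 - q.1)) - c * (q.1 - p.1) * (r.1 - q.1)
      = (q.1 - p.1) * (r.1 - q.1) * (c' - c) by ring,
    show (q.1 - p.1) * (r.1 - q.1) + c * (q.1 - p.1) * (c' * (r.1 - q.1))
      = (q.1 - p.1) * (r.1 - q.1) * (1 + c * c') by ring]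

/-! ### Convex sequences are clockwise convex polygons. -/

namespace LineConfig

open StepSpace

variable {N : ℕ} {L : LineConfig N} {o : ℕ → Fin N} {ε : ℝ} {i j k m n K t : ℕ}

/-- The point `v_{oₜ oₜ₊₁}`. -/
noncomputable def pt (L : LineConfig N) (o : ℕ → Fin N) (t : ℕ) : ℝ × ℝ := L.v (o t) (o (t + 1))

/-- The points `v_{oₜ oₜ₊₁}`, `t < K`, with their degrees. -/
noncomputable def ptList (L : LineConfig N) (o : ℕ → Fin N) (K : ℕ) : List ((ℝ × ℝ) × ℤ) :=
  (List.range K).map fun t => (L.pt o t, L.vdeg (o t) (o (t + 1)))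

theorem map_fst_ptList : (L.ptList o K).map Prod.fst = (List.range K).map (L.pt o) := by
  simp [ptList]

theorem pt_snd (ho : ∀ t, o t ≠ o (t + 1)) (t : ℕ) :
    (L.pt o t).2 = L.t (o (t + 1)) * L.vx o t + L.s (o (t + 1)) := L.lineAt_xv (ho t)

theorem pt_snd_sub (ho : ∀ t, o t ≠ o (t + 1)) (t : ℕ) : (L.pt o (t + 1)).2 - (L.pt o t).2
    = L.t (o (t + 1)) * ((L.pt o (t + 1)).1 - (L.pt o t).1) := by
  rw [pt_snd ho t]
  change L.t (o (t + 1)) * L.vx o (t + 1) + L.s (o (t + 1)) - _ =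
    L.t (o (t + 1)) * (L.vx o (t + 1) - L.vx o t)
  ring

theorem pt_add_period (hper : ∀ t, o (t + K) = o t) (t : ℕ) : L.pt o (t + K) = L.pt o t := by
  rw [pt, hper, add_right_comm, hper, pt]

theorem isRunEnd_pt_iff (ho : ∀ t, o t ≠ o (t + 1)) :
    IsRunEnd (L.pt o) t ↔ L.vx o t ≠ L.vx o (t + 1) := by
  refine not_congr ⟨fun h => congrArg Prod.fst h, fun h => Prod.ext h ?_⟩
  rw [pt_snd ho, h]
  rfl

theorem asc_add_period (hper : ∀ t, o (t + K) = o t) (t : ℕ) : L.Asc o (t + K) ↔ L.Asc o t := by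
  rw [Asc, hper, add_right_comm, hper, Asc]

/-- The letters of degree zero in one period. -/
def AscAt (L : LineConfig N) (o : ℕ → Fin N) (K m n : ℕ) : Prop :=
  ∀ t < K, L.Asc o t ↔ t = m ∨ t = n

theorem AscAt.symm (h : AscAt L o K m n) : AscAt L o K n m := fun t ht => (h t ht).trans or_comm

theorem AscAt.not_asc_of_lt (h : AscAt L o K m n) (hn : n < K) (h1 : m < t) (h2 : t < n) :
    ¬ L.Asc o t := fun hc => by
  rcases (h t (by omega)).mp hc with h3 | h3 <;> omega

theorem AscAt.not_asc_of_gt (hper : ∀ t, o (t + K) = o t) (h : AscAt L o K m n) (hm : m < n)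
    (hn : n < K) (h1 : n < t) (h2 : t < K + m) : ¬ L.Asc o t := fun hc => by
  by_cases h3 : t < K
  · rcases (h t h3).mp hc with h3 | h3 <;> omega
  · obtain ⟨s, rfl⟩ := Nat.exists_eq_add_of_le (not_lt.mp h3)
    rw [add_comm, asc_add_period hper] at hc
    rcases (h s (by omega)).mp hc with h3 | h3 <;> omega

theorem IsConvexSeq.le_right (h : IsConvexSeq L o ε m n K) {s : ℕ} (h1 : m ≤ s) (h2 : s ≤ t)
    (h3 : t ≤ n) : ε * L.vx o s ≤ ε * L.vx o t := by
  induction t, h2 using Nat.le_induction with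
  | base => exact le_rfl
  | succ t ht ih => exact (ih (by omega)).trans (h.right t (by omega) (by omega)).le

theorem IsConvexSeq.le_left (h : IsConvexSeq L o ε m n K) {s : ℕ} (h1 : n ≤ s) (h2 : s ≤ t)
    (h3 : t ≤ K + m) : ε * L.vx o t ≤ ε * L.vx o s := by
  induction t, h2 using Nat.le_induction with
  | base => exact le_rfl
  | succ t ht ih => exact (h.left t (by omega) (by omega)).le.trans (ih (by omega))

theorem IsConvexSeq.mem_Icc (hper : ∀ t, o (t + K) = o t) (h : IsConvexSeq L o ε m n K)
    (hm : m < n) (hn : n < K) (t : ℕ) :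
    ε * L.vx o m ≤ ε * L.vx o t ∧ ε * L.vx o t ≤ ε * L.vx o n := by
  refine forall_of_periodic (K := K) (Q := fun t => ε * L.vx o m ≤ ε * L.vx o t ∧
    ε * L.vx o t ≤ ε * L.vx o n) (fun t => by simp only [vx_add_period hper]) m (by omega)
    (fun t h1 h2 => ?_) t
  by_cases h3 : t ≤ n
  · exact ⟨h.le_right le_rfl h1 h3, h.le_right h1 h3 le_rfl⟩
  · have h4 := h.le_left (s := t) (t := K + m) (by omega) h2.le le_rfl
    rw [add_comm K m, vx_add_period hper] at h4
    exact ⟨h4, h.le_left le_rfl (by omega) h2.le⟩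

/-- The turns of a convex sequence. -/
theorem IsConvexSeq.turn (hε : ε = 1 ∨ ε = -1) (ho : ∀ t, o t ≠ o (t + 1))
    (hper : ∀ t, o (t + K) = o t) (h : IsConvexSeq L o ε m n K) (hm : m < n) (hn : n < K)
    (ha : AscAt L o K m n) (t : ℕ) :
    (L.vx o (t + 1) - L.vx o t) * (L.vx o (t + 2) - L.vx o (t + 1))
      * (L.t (o (t + 2)) - L.t (o (t + 1))) < 0 := by
  have hp := vx_add_period (L := L) hper
  refine forall_of_periodic (K := K) (Q := fun t => (L.vx o (t + 1) - L.vx o t) *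
      (L.vx o (t + 2) - L.vx o (t + 1)) * (L.t (o (t + 2)) - L.t (o (t + 1))) < 0)
    (fun t => by simp only [add_right_comm _ K, hp, hper]) m (by omega) (fun t h1 h2 => ?_) t
  have hsq : ε * ε = 1 := by rcases hε with rfl | rfl <;> norm_num
  have hdesc : ¬ L.Asc o (t + 1) → 0 < (ε * L.vx o (t + 1) - ε * L.vx o t) *
      (ε * L.vx o (t + 2) - ε * L.vx o (t + 1)) →
      (L.vx o (t + 1) - L.vx o t) * (L.vx o (t + 2) - L.vx o (t + 1))
        * (L.t (o (t + 2)) - L.t (o (t + 1))) < 0 := fun h3 h4 => by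
    have h5 : L.t (o (t + 2)) < L.t (o (t + 1)) := lt_of_not_asc ho h3
    refine mul_neg_of_pos_of_neg ?_ (sub_neg.mpr h5)
    linear_combination h4 + (L.vx o (t + 1) - L.vx o t) * (L.vx o (t + 2) - L.vx o (t + 1)) * hsq
  have hasc : L.Asc o (t + 1) → (ε * L.vx o (t + 1) - ε * L.vx o t) *
      (ε * L.vx o (t + 2) - ε * L.vx o (t + 1)) < 0 →
      (L.vx o (t + 1) - L.vx o t) * (L.vx o (t + 2) - L.vx o (t + 1))
        * (L.t (o (t + 2)) - L.t (o (t + 1))) < 0 := fun h3 h4 => by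
    have h5 : L.t (o (t + 1)) < L.t (o (t + 2)) := h3
    refine mul_neg_of_neg_of_pos ?_ (sub_pos.mpr h5)
    linear_combination h4 - (L.vx o (t + 1) - L.vx o t) * (L.vx o (t + 2) - L.vx o (t + 1)) * hsq
  -- Along a monotone stretch the direction is kept and the slope decreases; at an extremum the
  -- direction is reversed and the slope increases. In both cases the product of the three
  -- differences is negative.
  rcases lt_trichotomy (t + 1) n with h3 | h3 | h3
  · have h4 := h.right t h1 (by omega)
    have h5 := h.right (t + 1) (by omega) h3
    exact hdesc (ha.not_asc_of_lt hn (by omega) h3)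
      (mul_pos (sub_pos.mpr h4) (sub_pos.mpr h5))
  · have h4 := h.right t h1 (by omega)
    have h5 := h.left (t + 1) (by omega) (by omega)
    exact hasc (h3 ▸ (ha n hn).mpr (Or.inr rfl))
      (mul_neg_of_pos_of_neg (sub_pos.mpr h4) (sub_neg.mpr h5))
  · have h4 := h.left t (by omega) h2
    by_cases h6 : t + 1 < K + m
    · have h5 := h.left (t + 1) (by omega) h6
      exact hdesc (ha.not_asc_of_gt hper hm hn (by omega) h6)
        (mul_pos_of_neg_of_neg (sub_neg.mpr h4) (sub_neg.mpr h5))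
    · have h7 : t + 1 = m + K := by omega
      have h5 : ε * L.vx o (t + 1) < ε * L.vx o (t + 2) := by
        rw [show t + 2 = m + 1 + K by omega, h7, hp, hp]
        exact h.right m le_rfl hm
      refine hasc ?_ (mul_neg_of_neg_of_pos (sub_neg.mpr h4) (sub_pos.mpr h5))
      rw [h7, asc_add_period hper]
      exact (ha m (by omega)).mpr (Or.inl rfl)

theorem IsConvexSeq.isCCPolygonWith (hε : ε = 1 ∨ ε = -1) (ho : ∀ t, o t ≠ o (t + 1))
    (hper : ∀ t, o (t + K) = o t) (h : IsConvexSeq L o ε m n K) (hm : m < n) (hn : n < K)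
    (ha : AscAt L o K m n) : ∃ i j, IsCCPolygonWith (L.ptList o K) i j := by
  have hturn := h.turn hε ho hper hm hn ha
  have hcc : IsCCPolygon ((L.ptList o K).map Prod.fst) := by
    rw [map_fst_ptList]
    refine isCCPolygon_map_range (by omega) (pt_add_period hper) (fun t => ?_) fun t => ?_
    · rw [isRunEnd_pt_iff ho]
      intro h1
      simpa [h1] using hturn t
    · exact (turnsRight_iff (pt_snd_sub ho t) (pt_snd_sub ho (t + 1))).mpr (Or.inl (hturn t))
  have hI := h.mem_Icc hper hm hn
  have hlen : (L.ptList o K).length = K := by simp [ptList]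
  have hdeg : ∀ k (hk : k < (L.ptList o K).length),
      ((L.ptList o K)[k]).2 = if k = m ∨ k = n then 0 else 1 := fun k hk => by
    simp only [ptList, List.getElem_map, List.getElem_range]
    split_ifs with h1
    · exact vdeg_of_asc ((ha k (hlen ▸ hk)).mpr h1)
    · exact vdeg_of_not_asc fun h2 => h1 ((ha k (hlen ▸ hk)).mp h2)
  have hx : ∀ k (hk : k < (L.ptList o K).length), ((L.ptList o K)[k]).1.1 = L.vx o k :=
    fun k hk => by simp [ptList, pt, vx, v]
  rcases hε with rfl | rfl
  · exact ⟨m, n, hcc, by omega, by omega, by omega, hdeg,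
      fun k hk => by rw [hx, hx]; linarith [(hI k).1],
      fun k hk => by rw [hx, hx]; linarith [(hI k).2]⟩
  · exact ⟨n, m, hcc, by omega, by omega, by omega,
      fun k hk => by rw [hdeg k hk]; exact if_congr or_comm rfl rfl,
      fun k hk => by rw [hx, hx]; linarith [(hI k).2],
      fun k hk => by rw [hx, hx]; linarith [(hI k).1]⟩

end LineConfig

/-! ### Clockwise convex polygons are convex sequences. -/

namespace LineConfig

open StepSpace

variable {N : ℕ} {L : LineConfig N} {o : ℕ → Fin N} {ε : ℝ} {i j k m n K t : ℕ}

theorem exists_last_of_exists {Q : ℕ → Prop} {e T : ℕ} (he : e ≤ T) (h : Q e) :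
    ∃ k ≤ T, Q k ∧ ∀ t, k < t → t ≤ T → ¬ Q t := by
  classical
  exact ⟨Nat.findGreatest Q T, Nat.findGreatest_le T, Nat.findGreatest_spec he h,
    fun t h1 h2 => Nat.findGreatest_is_greatest h1 h2⟩

/-- In a run of equal points the lines alternate. -/
theorem alternate_of_run {k' : ℕ} (h : ∀ t, k < t → t < k' → o t = o (t + 2)) (d : ℕ)
    (hd : k + 1 + 2 * d ≤ k') :
    o (k + 1 + 2 * d) = o (k + 1) ∧ o (k + 1 + 2 * d + 1) = o (k + 2) := by
  induction d with
  | zero => exact ⟨rfl, rfl⟩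
  | succ d ih =>
    obtain ⟨h1, h2⟩ := ih (by omega)
    have h3 := h (k + 1 + 2 * d) (by omega) (by omega)
    have h4 := h (k + 1 + 2 * d + 1) (by omega) (by omega)
    exact ⟨by rw [← h1, h3]; rfl, by rw [← h2, h4]; rfl⟩

/-- The points of smallest and of largest first coordinate are the ones of degree zero. -/
structure Extremal (L : LineConfig N) (o : ℕ → Fin N) (K i j : ℕ) : Prop where
  hi : i < K
  hj : j < K
  asc : AscAt L o K i j
  min : ∀ t, L.vx o i ≤ L.vx o t
  max : ∀ t, L.vx o t ≤ L.vx o j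

theorem extremal_of_isCCPolygonWith (hper : ∀ t, o (t + K) = o t)
    (h : IsCCPolygonWith (L.ptList o K) i j) : Extremal L o K i j := by
  have hlen : (L.ptList o K).length = K := by simp [ptList]
  have hi : i < K := hlen ▸ h.hi
  have hj : j < K := hlen ▸ h.hj
  have hx : ∀ k (hk : k < (L.ptList o K).length), ((L.ptList o K)[k]).1.1 = L.vx o k :=
    fun k hk => by simp [ptList, pt, vx, v]
  have hp := vx_add_period (L := L) hper
  refine ⟨hi, hj, fun t ht => ?_, fun t => ?_, fun t => ?_⟩
  · have h1 := h.deg t (by rwa [hlen])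
    simp only [ptList, List.getElem_map, List.getElem_range] at h1
    constructor
    · intro h2
      by_contra h3
      rw [vdeg_of_asc h2, if_neg h3] at h1
      exact zero_ne_one h1
    · intro h2
      by_contra h3
      rw [vdeg_of_not_asc h3, if_pos h2] at h1
      exact one_ne_zero h1
  · refine forall_of_periodic (K := K) (Q := fun t => L.vx o i ≤ L.vx o t)
      (fun t => by rw [hp]) 0 (by omega) (fun t _ ht => ?_) t
    have h1 := h.left t (by omega)
    rwa [hx, hx] at h1
  · refine forall_of_periodic (K := K) (Q := fun t => L.vx o t ≤ L.vx o j)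
      (fun t => by rw [hp]) 0 (by omega) (fun t _ ht => ?_) t
    have h1 := h.right t (by omega)
    rwa [hx, hx] at h1

theorem Extremal.mod_of_asc (hper : ∀ t, o (t + K) = o t) (h : Extremal L o K i j)
    (ht : L.Asc o t) : t % K = i ∧ L.vx o t = L.vx o i ∨ t % K = j ∧ L.vx o t = L.vx o j := by
  have hK : 0 < K := by have := h.hi; omega
  have h1 : L.Asc o (t % K) := by
    rw [← Function.Periodic.map_mod_nat
      (f := L.Asc o) (fun t => propext (asc_add_period hper t)) t] at ht
    exact ht
  have h2 : L.vx o (t % K) = L.vx o t := Function.Periodic.map_mod_nat (vx_add_period hper) t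
  rcases (h.asc _ (Nat.mod_lt t hK)).mp h1 with h3 | h3
  · exact Or.inl ⟨h3, by rw [← h2, h3]⟩
  · exact Or.inr ⟨h3, by rw [← h2, h3]⟩

/-- In a run of equal points the lines alternate between two, so one of any two consecutive letters
is an ascent, and the run sits at an extremum of the first coordinate. There the polygon reverses
its horizontal direction, and a right turn needs the outgoing slope to exceed the incoming one. In a
run of even length these slopes are equal; in one of odd length greater than one the first and the
last letter are ascents at the same extremum, so the run would fill a whole period. -/
theorem Extremal.isRunEnd (ho : ∀ t, o t ≠ o (t + 1)) (hper : ∀ t, o (t + K) = o t)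
    (h : Extremal L o K i j) (hcc : IsCCPolygon ((List.range K).map (L.pt o))) (t : ℕ) :
    IsRunEnd (L.pt o) t := by
  have hK : 0 < K := by have := h.hi; omega
  have hP := pt_add_period (L := L) hper
  have hp := vx_add_period (L := L) hper
  have hE := hcc.exists_isRunEnd hK hP
  by_contra ht
  obtain ⟨e, he⟩ := hE
  have he' : IsRunEnd (L.pt o) (e % K) := by
    rwa [Function.Periodic.map_mod_nat (f := IsRunEnd (L.pt o))
      (fun t => propext (isRunEnd_add_period hP t)) e]
  obtain ⟨k, hk1, hk2, hk3⟩ := exists_last_of_exists (T := t + K)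
    (by have := Nat.mod_lt e hK; omega) he'
  have hex := exists_isRunEnd_add hK hP ⟨e, he⟩ (t + K)
  classical
  have hd1 := Nat.find_spec hex
  have hd2 := fun s => Nat.find_min (m := s) hex
  set d := Nat.find hex
  have htK : ¬ IsRunEnd (L.pt o) (t + K) := by rwa [isRunEnd_add_period hP]
  have hd0 : d ≠ 0 := fun h0 => htK (by simpa [h0] using hd1)
  have hkt : k ≠ t + K := fun h0 => htK (h0 ▸ hk2)
  obtain ⟨k', hk'⟩ : ∃ k', k' = t + K + d := ⟨_, rfl⟩
  rw [← hk'] at hd1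
  have hrun : ∀ s, k < s → s < k' → ¬ IsRunEnd (L.pt o) s := fun s h1 h2 => by
    by_cases h3 : s ≤ t + K
    · exact hk3 s h1 h3
    · have := hd2 (s - (t + K)) (by omega)
      rwa [Nat.add_sub_cancel' (by omega)] at this
  have heq : ∀ s, k < s → s < k' → L.vx o s = L.vx o (s + 1) := fun s h1 h2 =>
    not_not.mp fun h3 => hrun s h1 h2 ((isRunEnd_pt_iff ho).mpr h3)
  have halt := alternate_of_run (o := o) (k := k) (k' := k') fun s h1 h2 => not_not.mp fun h3 =>
    vx_ne_succ (L := L) ho h3 (heq s h1 h2)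
  have hconst : ∀ s, k + 1 ≤ s → s ≤ k' → L.vx o s = L.vx o (k + 1) := fun s h1 => by
    induction s, h1 using Nat.le_induction with
    | base => exact fun _ => rfl
    | succ s hs ih => exact fun h2 => by rw [← heq s (by omega) (by omega), ih (by omega)]
  have hΔ := (isRunEnd_pt_iff ho).mp hk2
  have hΔ' := (isRunEnd_pt_iff ho).mp hd1
  have hk'x : L.vx o k' = L.vx o (k + 1) := hconst k' (by omega) le_rfl
  have hpt : L.pt o (k + 1) = L.pt o k' := by
    have : ∀ s, k + 1 ≤ s → s ≤ k' → L.pt o (k + 1) = L.pt o s := fun s h1 => by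
      induction s, h1 using Nat.le_induction with
      | base => exact fun _ => rfl
      | succ s hs ih =>
        exact fun h2 => (ih (by omega)).trans (not_not.mp (hrun s (by omega) (by omega)))
    exact this k' (by omega) le_rfl
  -- Some letter of the run is an ascent, so the run lies at the left or at the right extremum, and
  -- the horizontal displacements before and after it have opposite signs.
  have hneg : (L.vx o (k + 1) - L.vx o k) * (L.vx o (k' + 1) - L.vx o (k + 1)) < 0 := by
    have hasc : ∃ s, k + 1 ≤ s ∧ s ≤ k' ∧ L.Asc o s := by
      by_cases h1 : L.Asc o (k + 1)
      · exact ⟨k + 1, le_rfl, by omega, h1⟩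
      · refine ⟨k + 2, by omega, by omega, ?_⟩
        have h2 := lt_of_not_asc ho h1
        have h3 : o (k + 1) = o (k + 3) := not_not.mp fun h3 =>
          vx_ne_succ (L := L) ho h3 (heq (k + 1) (by omega) (by omega))
        rw [h3] at h2
        exact h2
    obtain ⟨s, h1, h2, h3⟩ := hasc
    rw [hk'x] at hΔ'
    rcases h.mod_of_asc hper h3 with ⟨-, h4⟩ | ⟨-, h4⟩ <;> rw [hconst s h1 h2] at h4
    · exact mul_neg_of_neg_of_pos (sub_neg.mpr (lt_of_le_of_ne (h4 ▸ h.min k) hΔ.symm))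
        (sub_pos.mpr (lt_of_le_of_ne (h4 ▸ h.min (k' + 1)) hΔ'))
    · exact mul_neg_of_pos_of_neg (sub_pos.mpr (lt_of_le_of_ne (h4 ▸ h.max k) hΔ))
        (sub_neg.mpr (lt_of_le_of_ne (h4 ▸ h.max (k' + 1)) hΔ'.symm))
  have hturn := hcc.turnsRight hK hP (by omega : k < k') hk2 hrun hd1
  have hs : (L.pt o (k' + 1)).2 - (L.pt o (k + 1)).2
      = L.t (o (k' + 1)) * ((L.pt o (k' + 1)).1 - (L.pt o (k + 1)).1) := by
    rw [hpt]
    exact pt_snd_sub ho k'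
  rw [turnsRight_iff (pt_snd_sub ho k) hs] at hturn
  change (L.vx o (k + 1) - L.vx o k) * (L.vx o (k' + 1) - L.vx o (k + 1)) * _ < 0 ∨
    ((L.vx o (k + 1) - L.vx o k) * (L.vx o (k' + 1) - L.vx o (k + 1)) * _ = 0 ∧
      0 < (L.vx o (k + 1) - L.vx o k) * (L.vx o (k' + 1) - L.vx o (k + 1)) * _) at hturn
  -- A vanishing cross product would mean equal slopes, hence turning back along the same direction,
  -- for which the scalar product is negative; so the turn is strict.
  have hlt : L.t (o (k + 1)) < L.t (o (k' + 1)) := by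
    rcases hturn with h1 | ⟨h1, h2⟩
    · exact sub_pos.mp (pos_of_mul_neg_right h1 hneg.le)
    · have h3 := sub_eq_zero.mp ((mul_eq_zero.mp h1).resolve_left hneg.ne)
      rw [h3] at h2
      nlinarith [mul_self_nonneg (L.t (o (k + 1)))]
  obtain ⟨c, hc⟩ : ∃ c, k' = k + 1 + 2 * c ∨ k' = k + 2 + 2 * c := by
    obtain ⟨r, hr⟩ := Nat.exists_eq_add_of_le (by omega : k + 1 ≤ k')
    rcases Nat.even_or_odd' r with ⟨c, hc | hc⟩
    · exact ⟨c, Or.inl (by omega)⟩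
    · exact ⟨c, Or.inr (by omega)⟩
  rcases hc with hc | hc
  -- Odd length: the first and the last letter of the run are ascents at the same extremum, hence
  -- equal modulo the period, although only one letter per period is allowed there. So the run would
  -- contain the translate of the run end k.
  · obtain ⟨h1, h2⟩ := halt c hc.ge
    rw [← hc] at h1 h2
    rw [h2] at hlt
    have ha1 : L.Asc o (k + 1) := hlt
    have ha2 : L.Asc o k' := by rw [Asc, h1, h2]; exact hlt
    have hij : L.vx o i ≠ L.vx o j := fun hij =>
      hΔ (le_antisymm ((h.max k).trans (hij ▸ h.min _)) ((h.max _).trans (hij ▸ h.min k)))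
    have hmod : (k + 1) % K = k' % K := by
      rcases h.mod_of_asc hper ha1 with ⟨h3, h4⟩ | ⟨h3, h4⟩ <;>
      rcases h.mod_of_asc hper ha2 with ⟨h5, h6⟩ | ⟨h5, h6⟩
      · rw [h3, h5]
      · exact absurd (h4.symm.trans (hk'x.symm.trans h6)) hij
      · exact absurd (h6.symm.trans (hk'x.trans h4)) hij
      · rw [h3, h5]
    have hle : K ≤ k' - (k + 1) := Nat.le_of_dvd (by omega)
      ((Nat.modEq_iff_dvd' (by omega)).mp hmod)
    exact hrun (k + K) (by omega) (by omega) ((isRunEnd_add_period hP k).mpr hk2)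
  -- Even length: by alternation the outgoing line is the incoming one, so their slopes cannot
  -- differ.
  · obtain ⟨h1, h2⟩ := halt c (by omega)
    have h3 : o (k' + 1) = o (k + 1) := by
      have h4 := heq (k + 1 + 2 * c) (by omega) (by omega)
      have h5 : o (k + 1 + 2 * c) = o (k + 1 + 2 * c + 2) :=
        not_not.mp fun h3 => vx_ne_succ (L := L) ho h3 h4
      rw [← h1, h5]
      congr 1
      omega
    rw [h3] at hlt
    exact lt_irrefl _ hlt

/-- A sequence whose turns are the ones of a convex sequence. -/
theorem isConvexSeq_of_turn (hε : ε = 1 ∨ ε = -1) (ho : ∀ t, o t ≠ o (t + 1))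
    (hper : ∀ t, o (t + K) = o t) (hm : m < n) (hn : n < K) (ha : AscAt L o K m n)
    (hturn : ∀ t, (L.vx o (t + 1) - L.vx o t) * (L.vx o (t + 2) - L.vx o (t + 1))
      * (L.t (o (t + 2)) - L.t (o (t + 1))) < 0)
    (h1 : ε * L.vx o m < ε * L.vx o (m + 1)) (h2 : ε * L.vx o (n + 1) < ε * L.vx o n) :
    IsConvexSeq L o ε m n K := by
  have hsq : ε * ε = 1 := by rcases hε with rfl | rfl <;> norm_num
  have hstep : ∀ s, ¬ L.Asc o (s + 1) → 0 < (ε * L.vx o (s + 1) - ε * L.vx o s) *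
      (ε * L.vx o (s + 2) - ε * L.vx o (s + 1)) := fun s hs => by
    have h3 := pos_of_mul_neg_left (hturn s) (sub_neg.mpr (lt_of_not_asc ho hs)).le
    linear_combination h3 - (L.vx o (s + 1) - L.vx o s) * (L.vx o (s + 2) - L.vx o (s + 1)) * hsq
  constructor
  · intro t ht
    induction t, ht using Nat.le_induction with
    | base => exact fun _ => h1
    | succ t ht ih =>
      intro h3
      have h4 := hstep t (ha.not_asc_of_lt hn (by omega) h3)
      exact sub_pos.mp ((pos_iff_pos_of_mul_pos h4).mp (sub_pos.mpr (ih (by omega))))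
  · intro t ht
    induction t, ht using Nat.le_induction with
    | base => exact fun _ => h2
    | succ t ht ih =>
      intro h3
      have h4 := hstep t (ha.not_asc_of_gt hper hm hn (by omega) h3)
      exact sub_neg.mp ((neg_iff_neg_of_mul_pos h4).mp (sub_neg.mpr (ih (by omega))))

/-- In the absence of repetitions every turn is strict, as a straight turn would require two
consecutive lines of equal slope. The two extrema fix the direction at m and n, and whether the left
or the right one comes first decides the sign ε. -/
theorem isConvexSeq_of_isCCPolygonWith (ho : ∀ t, o t ≠ o (t + 1))
    (hper : ∀ t, o (t + K) = o t) (h : IsCCPolygonWith (L.ptList o K) i j) :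
    ∃ m n, m < n ∧ n < K ∧ AscAt L o K m n ∧ ∃ ε : ℝ, (ε = 1 ∨ ε = -1) ∧
      IsConvexSeq L o ε m n K ∧ ccSign i j = -ε := by
  have hE := extremal_of_isCCPolygonWith hper h
  have hi := hE.hi
  have hj := hE.hj
  have hcc := h.convex
  rw [map_fst_ptList] at hcc
  have hP := pt_add_period (L := L) hper
  have hq := hE.isRunEnd ho hper hcc
  have hΔ := fun t => (isRunEnd_pt_iff ho).mp (hq t)
  have hturn : ∀ t, (L.vx o (t + 1) - L.vx o t) * (L.vx o (t + 2) - L.vx o (t + 1))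
      * (L.t (o (t + 2)) - L.t (o (t + 1))) < 0 := fun t => by
    have h1 := hcc.turnsRight (by omega) hP (Nat.lt_succ_self t) (hq t) (by omega) (hq (t + 1))
    rw [turnsRight_iff (pt_snd_sub ho t) (pt_snd_sub ho (t + 1))] at h1
    refine h1.resolve_right fun h2 => ?_
    exact mul_ne_zero (mul_ne_zero (sub_ne_zero.mpr (hΔ t).symm) (sub_ne_zero.mpr (hΔ (t + 1)).symm))
      (sub_ne_zero.mpr (L.slopes _ _ (ho (t + 1)).symm)) h2.1
  have h1 : L.vx o i < L.vx o (i + 1) := lt_of_le_of_ne (hE.min _) (hΔ i)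
  have h2 : L.vx o (j + 1) < L.vx o j := lt_of_le_of_ne (hE.max _) (hΔ j).symm
  rcases lt_or_gt_of_ne h.ne with h3 | h3
  · exact ⟨i, j, h3, hj, hE.asc, 1, Or.inl rfl, isConvexSeq_of_turn (Or.inl rfl) ho hper h3 hj
      hE.asc hturn (by simpa using h1) (by simpa using h2), if_pos h3⟩
  · exact ⟨j, i, h3, hi, hE.asc.symm, -1, Or.inr rfl, isConvexSeq_of_turn (Or.inr rfl) ho hper h3 hi
      hE.asc.symm hturn (by simpa using h2) (by simpa using h1), by
        rw [ccSign, if_neg (by omega), neg_neg]⟩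

end LineConfig

/-! ### The exponents and the enclosed area. -/

namespace LineConfig

open StepSpace

variable {N : ℕ} {L : LineConfig N} {o : ℕ → Fin N} {ε : ℝ} {i j k m n K t : ℕ}

theorem polygonArea_map_range {P : ℕ → ℝ × ℝ} (hP : ∀ t, P (t + K) = P t) :
    polygonArea ((List.range K).map P)
      = |∑ t ∈ Finset.range K, ((P t).1 * (P (t + 1)).2 - (P (t + 1)).1 * (P t).2)| / 2 := by
  have h1 : ((List.range K).map P).rotate 1 = (List.range K).map fun t => P (t + 1) := by
    refine List.ext_getElem (by simp) fun k h1 h2 => ?_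
    rw [List.getElem_rotate]
    simp only [List.getElem_map, List.getElem_range, List.length_map, List.length_range]
    exact Function.Periodic.map_mod_nat hP (k + 1)
  rw [polygonArea, h1, List.zipWith_map, List.zipWith_self]
  rfl

theorem sum_range_sub_of_periodic {g : ℕ → ℝ} (hg : g K = g 0) :
    ∑ t ∈ Finset.range K, (g (t + 1) - g t) = 0 := by
  rw [Finset.sum_range_sub, hg, sub_self]

/-- The sum of the heights is the area of a convex sequence. -/
theorem IsConvexSeq.polygonArea_eq (hε : ε = 1 ∨ ε = -1) (ho : ∀ t, o t ≠ o (t + 1))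
    (hper : ∀ t, o (t + K) = o t) (h : IsConvexSeq L o ε m n K) (hm : m < n) (hn : n < K)
    (ha : AscAt L o K m n) :
    polygonArea ((L.ptList o K).map Prod.fst)
      = ∑ t ∈ Finset.range K, L.f (o t) (o (t + 1)) (L.vx o t) := by
  have hp := vx_add_period (L := L) hper
  have hP := pt_add_period (L := L) hper
  have hsq : ε * ε = 1 := by rcases hε with rfl | rfl <;> norm_num
  have hp0 : L.vx o K = L.vx o 0 := by simpa using hp 0
  have hP0 : L.pt o K = L.pt o 0 := by simpa using hP 0
  have ho0 : o K = o 0 := by simpa using hper 0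
  have hy : ∀ t, (L.pt o (t + 1)).2 = L.t (o (t + 1)) * L.vx o (t + 1) + L.s (o (t + 1)) :=
    fun t => rfl
  -- After cyclic summation by parts each edge contributes the integral of its line, the area of a
  -- trapezoid. The auxiliary sequence telescopes away the difference from the shoelace terms.
  have h1 : ∑ t ∈ Finset.range K, L.f (o t) (o (t + 1)) (L.vx o t)
      = -(∑ t ∈ Finset.range K, (L.vx o t * (L.pt o (t + 1)).2
        - L.vx o (t + 1) * (L.pt o t).2)) / 2 := by
    have h2 := sum_range_sub_of_periodic (K := K) (g := fun t => (L.t (o t) / 2 * L.vx o t ^ 2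
      + L.s (o t) * L.vx o t + L.r (o t)) - L.vx o t * (L.pt o t).2 / 2) (by simp only [hp0, hP0, ho0])
    rw [← sub_eq_zero, neg_div, sub_neg_eq_add, Finset.sum_div, ← Finset.sum_add_distrib, ← neg_zero,
      ← h2, ← Finset.sum_neg_distrib]
    refine Finset.sum_congr rfl fun t _ => ?_
    simp only [f, hy, pt_snd ho t]
    ring
  -- The shoelace sum with the base point moved to v_m, that is, as a fan of triangles with apex
  -- v_m.
  have h2 : ∑ t ∈ Finset.range K, (L.vx o (t + 1) - L.vx o t) *
        (L.lineAt (o (t + 1)) (L.vx o m) - L.lineAt (o m) (L.vx o m))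
      = -(∑ t ∈ Finset.range K, (L.vx o t * (L.pt o (t + 1)).2
        - L.vx o (t + 1) * (L.pt o t).2)) := by
    have h3 := sum_range_sub_of_periodic (K := K) (g := fun t => L.vx o m * (L.pt o t).2
      - L.lineAt (o m) (L.vx o m) * L.vx o t) (by simp only [hp0, hP0])
    rw [← sub_eq_zero, sub_neg_eq_add, ← Finset.sum_add_distrib, ← h3]
    refine Finset.sum_congr rfl fun t _ => ?_
    simp only [lineAt, hy, pt_snd ho t]
    ring
  -- Every triangle of the fan has the same orientation: along either stretch the slopes decrease
  -- and all points lie beyond x_m, so the edge line passes v_m on the side matching the direction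
  -- of travel.
  have h3 : ∀ t, 0 ≤ (L.vx o (t + 1) - L.vx o t) *
      (L.lineAt (o (t + 1)) (L.vx o m) - L.lineAt (o m) (L.vx o m)) := by
    refine forall_of_periodic (K := K) (Q := fun t => 0 ≤ (L.vx o (t + 1) - L.vx o t) *
      (L.lineAt (o (t + 1)) (L.vx o m) - L.lineAt (o m) (L.vx o m)))
      (fun t => by simp only [add_right_comm _ K, hp, hper]) m (by omega) fun t ht1 ht2 => ?_
    have hI := fun s => (h.mem_Icc hper hm hn s).1
    have hsum : ∀ i j, (∀ s, i ≤ s → s < j → ¬ L.Asc o s) →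
        0 ≤ ε * ∑ s ∈ Finset.Ico i j, (L.t (o (s + 1)) - L.t (o s)) * (L.vx o m - L.vx o s) :=
      fun i j hs => by
        rw [Finset.mul_sum]
        refine Finset.sum_nonneg fun s hs' => ?_
        rw [Finset.mem_Ico] at hs'
        have h4 := lt_of_not_asc ho (hs s hs'.1 hs'.2)
        nlinarith [hI s, mul_nonneg_of_nonpos_of_nonpos (sub_neg.mpr h4).le (sub_nonpos.mpr (hI s))]
    by_cases h4 : t < n
    · have h5 := hsum (m + 1) (t + 1) fun s hs hs' => ha.not_asc_of_lt hn (by omega) (by omega)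
      rw [← lineAt_sub_eq_sum ho (by omega), ← lineAt_vx ho m] at h5
      have h6 := mul_nonneg (sub_pos.mpr (h.right t ht1 h4)).le h5
      linear_combination h6 + (L.vx o (t + 1) - L.vx o t) *
        (L.lineAt (o (t + 1)) (L.vx o m) - L.lineAt (o m) (L.vx o m)) * hsq
    · have h5 := hsum (t + 1) (m + K) fun s hs hs' =>
        ha.not_asc_of_gt hper hm hn (by omega) (by omega)
      rw [← lineAt_sub_eq_sum ho (by omega), hper] at h5
      have h6 := mul_nonneg_of_nonpos_of_nonpos
        (sub_neg.mpr (h.left t (not_lt.mp h4) ht2)).le (neg_nonpos.mpr h5)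
      linear_combination h6 + (L.vx o (t + 1) - L.vx o t) *
        (L.lineAt (o (t + 1)) (L.vx o m) - L.lineAt (o m) (L.vx o m)) * hsq
  have h4 := Finset.sum_nonneg fun t (_ : t ∈ Finset.range K) => h3 t
  rw [h2] at h4
  rw [map_fst_ptList, polygonArea_map_range hP, h1, ← abs_of_nonneg h4, abs_neg]
  rfl

theorem segCoeff_mul_exp (h : o (k + 1) = o 0) :
    segCoeff L o 0 k * Real.exp (L.f (o 0) (o k) (L.vx o k))
      = Real.exp (-∑ t ∈ Finset.range (k + 1), L.f (o t) (o (t + 1)) (L.vx o t)) := by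
  rw [segCoeff, ← Real.exp_add, Finset.sum_range_succ, Finset.range_eq_Ico, h]
  congr 1
  unfold f
  ring

theorem segCoeff_zero :
    segCoeff L o 0 k = Real.exp (-∑ t ∈ Finset.range k, L.f (o t) (o (t + 1)) (L.vx o t)) := by
  rw [segCoeff, Finset.range_eq_Ico]

end LineConfig

/-! ### Lists of lines as periodic sequences; ascents and suspension signs. -/

namespace LineConfig

open StepSpace HomPath

variable {N : ℕ} {L : LineConfig N} {o : ℕ → Fin N} {ε : ℝ} {i j k m n K t : ℕ} {a : Fin N}
  {l : List (Fin N)}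

theorem lastObj_eq (c : Fin N) : lastObj a l = (a :: l).getD l.length c := by
  induction l generalizing a with
  | nil => rfl
  | cons b l ih => rw [lastObj, ih]; rfl

theorem toWord_basePath (c : Fin N) (hc : (a :: l).IsChain (· ≠ ·))
    (h : ∀ s ≤ l.length, o (i + s) = (a :: l).getD s c) :
    toWord L.V (L.basePath a l) = L.seg o i (i + l.length) := by
  induction l generalizing a i with
  | nil => rw [List.length_nil, add_zero, seg_self]; rfl
  | cons b l ih =>
    rw [List.isChain_cons_cons] at hc
    have h0 : o i = a := by simpa using h 0 (by simp)
    have h1 : o (i + 1) = b := by simpa using h 1 (by simp)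
    rw [basePath, seg_cons _ _ (by simp), h0, h1, List.length_cons, ← add_assoc, add_right_comm,
      ← ih hc.2 fun s hs => by
        rw [add_assoc, add_comm 1 s, h (s + 1) (by simpa using hs)]; simp]
    exact L.toWord_cons_vElt hc.1 _

theorem edgePoints_eq (c : Fin N) (h : ∀ s ≤ l.length, o (i + s) = (a :: l).getD s c) :
    L.edgePoints a l = (List.range' i l.length).map
      fun t => (L.pt o t, L.vdeg (o t) (o (t + 1))) := by
  induction l generalizing a i with
  | nil => rfl
  | cons b l ih =>
    have h0 : o i = a := by simpa using h 0 (by simp)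
    have h1 : o (i + 1) = b := by simpa using h 1 (by simp)
    rw [edgePoints, List.length_cons, List.range'_succ, List.map_cons, pt, h0, h1,
      ih (i := i + 1) fun s hs => by
        rw [add_assoc, add_comm 1 s, h (s + 1) (by simpa using hs)]; simp]

/-- A periodic sequence of lines that continues a cyclic sequence `a, a₂, …, a_{k+1}`. -/
structure IsObjSeq (L : LineConfig N) (a : Fin N) (l : List (Fin N)) (o : ℕ → Fin N) (K : ℕ) :
    Prop where
  ne : ∀ t, o t ≠ o (t + 1)
  per : ∀ t, o (t + K) = o t
  first : o 0 = a
  last : o l.length = lastObj a l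
  word : toWord L.V (L.basePath a l) = L.seg o 0 l.length
  points : L.polygon a l = L.ptList o K

/-- If the list closes up, its length is the period; otherwise one more step, from the last line
back to a, supplies the additional vertex v_{a_{k+1}a_1}. -/
theorem exists_isObjSeq (L : LineConfig N) (h2 : 2 ≤ l.length) (hc : (a :: l).IsChain (· ≠ ·)) :
    ∃ o, IsObjSeq L a l o (if a = lastObj a l then l.length else l.length + 1) := by
  obtain ⟨K, hK⟩ : ∃ K, K = if a = lastObj a l then l.length else l.length + 1 := ⟨_, rfl⟩
  rw [← hK]
  have hK1 : 0 < K := by rw [hK]; split_ifs <;> omega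
  let o : ℕ → Fin N := fun t => (a :: l).getD (t % K) a
  have hper : ∀ t, o (t + K) = o t := fun t => by simp [o]
  have h0 : o 0 = a := by simp [o]
  have hs : ∀ s ≤ l.length, o (0 + s) = (a :: l).getD s a := fun s hs => by
    rw [zero_add]
    by_cases h : s < K
    · simp only [o, Nat.mod_eq_of_lt h]
    · have h1 : a = lastObj a l := by
        by_contra h1
        rw [if_neg h1] at hK
        omega
      rw [if_pos h1] at hK
      obtain rfl : s = l.length := by omega
      rw [← lastObj_eq, ← h1]
      simp [o, hK]
  have hlast : o l.length = lastObj a l := by rw [lastObj_eq a, ← hs _ le_rfl, zero_add]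
  refine ⟨o, ?_, hper, h0, hlast, ?_, ?_⟩
  · refine forall_of_periodic (K := K) (Q := fun t => o t ≠ o (t + 1))
      (fun t => by rw [add_right_comm, hper, hper]) 0 hK1 fun t _ ht => ?_
    by_cases h : t < l.length
    · have h3 := hs t h.le
      have h4 := hs (t + 1) h
      rw [zero_add] at h3 h4
      rw [h3, h4, List.getD_eq_getElem _ _ (by simp; omega), List.getD_eq_getElem _ _ (by simp; omega)]
      exact hc.getElem t (by simp; omega)
    · have h1 : a ≠ lastObj a l := fun h1 => by
        rw [if_pos h1] at hK
        omega
      rw [if_neg h1] at hK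
      obtain rfl : t = l.length := by omega
      rw [hlast, ← hK, ← zero_add K, hper, h0]
      exact h1.symm
  · rw [toWord_basePath a hc hs, zero_add]
  · rw [polygon, edgePoints_eq a hs, ptList, List.range_eq_range']
    by_cases h1 : a = lastObj a l
    · rw [if_pos h1] at hK ⊢
      rw [hK]
    · rw [if_neg h1] at hK ⊢
      rw [hK, List.range'_1_concat, List.map_append, zero_add]
      have h3 : o (l.length + 1) = a := by rw [← hK, ← zero_add K, hper, h0]
      simp [pt, hlast, h3]

theorem wsusp_seg {i j : ℕ} (h : i ≤ j) : wsusp (L.seg o i j)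
    = ∑ t ∈ Finset.Ico i j, ((j : ℤ) - 1 - t) * (L.vdeg (o t) (o (t + 1)) - 1) := by
  induction h using Nat.decreasingInduction with
  | self => simp [seg_self, wsusp]
  | of_succ i h ih =>
    rw [L.seg_cons o h, wsusp, ih, length_seg, Finset.sum_eq_sum_Ico_succ_bot h]
    congr 2
    omega

theorem OneAscent.wsusp (h : OneAscent L o 0 m k) :
    wsusp (L.seg o 0 k) = -((k - 1 - m : ℕ) : ℤ) := by
  have hm := h.lt
  rw [wsusp_seg (Nat.zero_le k), Finset.sum_eq_single_of_mem m (by simpa using hm)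
    fun t ht htm => by
      rw [vdeg_of_not_asc (h.desc t (Nat.zero_le t) (Finset.mem_Ico.mp ht).2 htm)]; simp,
    vdeg_of_asc h.asc]
  omega

theorem TwoAscents.wsusp (h : TwoAscents L o m n k) :
    wsusp (L.seg o 0 k) = -((k - 1 - m + (k - 1 - n) : ℕ) : ℤ) := by
  have hm := h.lt
  have hn := h.lt'
  rw [wsusp_seg (Nat.zero_le k), ← Finset.sum_subset (s₁ := {m, n})
    (fun t ht => by
      simp only [Finset.mem_insert, Finset.mem_singleton] at ht
      simp only [Finset.mem_Ico]; omega)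
    fun t ht htm => by
      simp only [Finset.mem_insert, Finset.mem_singleton, not_or] at htm
      rw [vdeg_of_not_asc (h.desc t (Finset.mem_Ico.mp ht).2 htm.1 htm.2)]; simp,
    Finset.sum_pair (by omega), vdeg_of_asc h.asc, vdeg_of_asc h.asc']
  omega

theorem TwoAscents.wdeg (h : TwoAscents L o m n k) : wdeg (L.seg o 0 k) = -2 := by
  have hm := h.lt
  rw [wdeg_seg_append (j := n) (Nat.zero_le n) h.lt'.le, (h.left hm le_rfl).wdeg,
    (h.right hm le_rfl).wdeg]
  rfl

/-- A word of degree `-1` or `-2` has one or two letters of degree zero. -/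
theorem exists_ascents (L : LineConfig N) (o : ℕ → Fin N) (k : ℕ) :
    (∃ m, OneAscent L o 0 m k) ∨ (∃ m n, TwoAscents L o m n k) ∨
      wdeg (L.seg o 0 k) ≠ -1 ∧ wdeg (L.seg o 0 k) ≠ -2 := by
  classical
  have h : wdeg (L.seg o 0 k) = -(((Finset.range k).filter (L.Asc o)).card : ℤ) := by
    rw [wdeg_seg (Nat.zero_le k), Finset.range_eq_Ico, Finset.card_filter]
    push_cast
    rw [← Finset.sum_neg_distrib]
    refine Finset.sum_congr rfl fun t _ => ?_
    rw [vdeg_sub_one]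
    split_ifs <;> rfl
  have hmem : ∀ t, t ∈ (Finset.range k).filter (L.Asc o) ↔ t < k ∧ L.Asc o t := by simp
  by_cases h1 : ((Finset.range k).filter (L.Asc o)).card = 1
  · obtain ⟨m, hm⟩ := Finset.card_eq_one.mp h1
    rw [hm] at hmem
    simp only [Finset.mem_singleton] at hmem
    exact Or.inl ⟨m, Nat.zero_le m, ((hmem m).mp rfl).1, ((hmem m).mp rfl).2,
      fun t _ ht htm hc => htm ((hmem t).mpr ⟨ht, hc⟩)⟩
  by_cases h2 : ((Finset.range k).filter (L.Asc o)).card = 2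
  · obtain ⟨m, n, hmn, hm⟩ := Finset.card_eq_two.mp h2
    rw [hm] at hmem
    simp only [Finset.mem_insert, Finset.mem_singleton] at hmem
    have h3 := (hmem m).mp (Or.inl rfl)
    have h4 := (hmem n).mp (Or.inr rfl)
    have h5 : ∀ t < k, t ≠ m → t ≠ n → ¬ L.Asc o t := fun t ht htm htn hc =>
      ((hmem t).mpr ⟨ht, hc⟩).elim htm htn
    rcases lt_or_gt_of_ne hmn with h6 | h6
    · exact Or.inr (Or.inl ⟨m, n, h6, h4.1, h3.2, h4.2, h5⟩)
    · exact Or.inr (Or.inl ⟨n, m, h6, h3.1, h4.2, h3.2, fun t ht h7 h8 => h5 t ht h8 h7⟩)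
  · refine Or.inr (Or.inr ⟨?_, ?_⟩) <;> rw [h] <;> omega

theorem OneAscent.ascAt (h : OneAscent L o 0 m k) (hk : L.Asc o k) : AscAt L o (k + 1) m k :=
  fun t ht => by
    constructor
    · intro hc
      by_contra! hne
      exact h.desc t (Nat.zero_le t) (by omega) hne.1 hc
    · rintro (rfl | rfl)
      · exact h.asc
      · exact hk

theorem TwoAscents.ascAt (h : TwoAscents L o m n k) : AscAt L o k m n := fun t ht => by
  constructor
  · intro hc
    by_contra! hne
    exact h.desc t ht hne.1 hne.2 hc
  · rintro (rfl | rfl)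
    · exact h.asc
    · exact h.asc'

theorem TwoAscents.ascAt_succ (h : TwoAscents L o m n k) (hk : ¬ L.Asc o k) :
    AscAt L o (k + 1) m n := fun t ht => by
  have := h.lt
  have := h.lt'
  rcases Nat.lt_succ_iff_lt_or_eq.mp ht with h1 | rfl
  · exact h.ascAt t h1
  · exact ⟨fun hc => absurd hc hk, fun hc => by omega⟩

theorem AscAt.oneAscent (h : AscAt L o (k + 1) m k) (hm : m < k) : OneAscent L o 0 m k :=
  ⟨Nat.zero_le m, hm, (h m (by omega)).mpr (Or.inl rfl), fun t _ ht htm hc => by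
    rcases (h t (by omega)).mp hc with h1 | h1 <;> omega⟩

theorem AscAt.twoAscents (h : AscAt L o K m n) (hm : m < n) (hn : n < k) (hk : k ≤ K) :
    TwoAscents L o m n k :=
  ⟨hm, hn, (h m (by omega)).mpr (Or.inl rfl), (h n (by omega)).mpr (Or.inr rfl),
    fun t ht h1 h2 hc => by rcases (h t (by omega)).mp hc with h3 | h3 <;> omega⟩

/-- A convex sequence with the last point of degree zero. -/
theorem isConvexSeq_succ_iff (ho : ∀ t, o t ≠ o (t + 1))
    (hper : ∀ t, o (t + (k + 1)) = o t) (ha : OneAscent L o 0 m k) (h2 : 2 ≤ k)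
    (hlt : L.t (o k) < L.t (o 0)) :
    IsConvexSeq L o ε m k (k + 1) ↔ Rising L o ε 0 m k ∧
      (0 < m → ε * L.vx o 0 < ε * L.xv (o 0) (o k)) ∧
      (m + 1 < k → ε * L.vx o (k - 1) < ε * L.xv (o 0) (o k)) := by
  have hy := vx_last (L := L) hper
  have hy0 : L.vx o (k + 1) = L.vx o 0 := by simpa using vx_add_period (L := L) hper 0
  have hm := ha.lt
  constructor
  · intro h
    refine ⟨h.rising_left hper (by omega) (by omega), fun _ => ?_, fun _ => ?_⟩
    · have h1 := h.left k le_rfl (by omega)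
      rwa [hy0, hy] at h1
    · have h1 := h.right (k - 1) (by omega) (by omega)
      rwa [Nat.sub_add_cancel (by omega), hy] at h1
  · rintro ⟨h, h3, h4⟩
    -- On a side where m has no neighbour in the word, x_m itself is the outer point. Separation of
    -- the end lines at x_m, with decreasing end slopes, places it before the closing vertex.
    have hs : ε * L.vx o m < ε * L.xv (o 0) (o k) := by
      have h5 := h.separation ho ha h2
      have h6 := L.lineAt_sub (L.ne_of_lt hlt).symm (L.vx o m)
      have h7 : 0 < (L.t (o k) - L.t (o 0)) * (ε * (L.vx o m - L.xv (o 0) (o k))) := by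
        linear_combination h5 + ε * h6
      have h8 := neg_of_mul_pos_right h7 (sub_neg.mpr hlt).le
      linarith
    constructor
    · intro t h5 h6
      by_cases h7 : t + 1 < k
      · exact h.right t h5 h7
      · obtain rfl : k = t + 1 := by omega
        rw [hy]
        by_cases h8 : m = t
        · exact h8 ▸ hs
        · exact h4 (by omega)
    · intro t h5 h6
      rcases h5.eq_or_lt with rfl | h7
      · rw [hy0, hy]
        by_cases h8 : m = 0
        · exact h8 ▸ hs
        · exact h3 (by omega)
      · obtain ⟨s, rfl⟩ := Nat.exists_eq_add_of_lt h7
        have h8 := vx_add_period (L := L) hper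
        rw [show k + s + 1 + 1 = s + 1 + (k + 1) by ring, show k + s + 1 = s + (k + 1) by ring, h8, h8]
        exact h.left s (Nat.zero_le s) (by omega)

end LineConfig

/-! ### The products of base elements as polygon formulas. -/

namespace LineConfig

open StepSpace HomPath

variable {N : ℕ} {L : LineConfig N} {o : ℕ → Fin N} {ε : ℝ} {i j k m n K t : ℕ} {a : Fin N}
  {l : List (Fin N)}

theorem neg_one_zpow_neg (n : ℕ) : (-1 : ℝ) ^ (-(n : ℤ)) = (-1) ^ n := by
  rw [zpow_neg, zpow_natCast, ← inv_pow, inv_neg_one]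

theorem IsObjSeq.sdeg (h : IsObjSeq L a l o K) :
    (L.basePath a l).sdeg = wdeg (L.seg o 0 l.length) := by
  rw [← h.word]
  exact (wdeg_toWord (W := L.V) _).symm

theorem IsObjSeq.suspExp (h : IsObjSeq L a l o K) :
    (L.basePath a l).suspExp = wsusp (L.seg o 0 l.length) := by
  rw [← h.word]
  exact (wsusp_toWord (W := L.V) _).symm

theorem IsObjSeq.coe_m (h : IsObjSeq L a l o K) {r : ℤ} {u : StepSpace}
    (hu : L.prod (L.seg o 0 l.length) = emb r u) (hr : wdeg (L.seg o 0 l.length) + 2 = r)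
    (h01 : r ≠ 0 → r ≠ 1 → u = 0) :
    (L.lineCategory.m (L.basePath a l) : StepSpace)
      = (-1 : ℝ) ^ wsusp (L.seg o 0 l.length) • u := by
  have h1 := L.coe_lineCategory_m (L.basePath a l)
  have h2 : (L.basePath a l).sdeg + 2 = r := by rw [h.sdeg, hr]
  refine h1.trans ?_
  rw [h.word, hu, h2, component_emb h01, h.suspExp]

theorem IsObjSeq.m_eq_zero (h : IsObjSeq L a l o K) (hp : L.prod (L.seg o 0 l.length) = 0) :
    L.lineCategory.m (L.basePath a l) = 0 :=
  L.lineCategory_m_eq_zero (by rw [h.word, hp])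

theorem m_eq_zero_of_bot (h : L.V a (lastObj a l) ((L.basePath a l).sdeg + 2) = ⊥) :
    L.lineCategory.m (L.basePath a l) = 0 :=
  Subtype.ext ((Submodule.mem_bot ℝ).mp (h ▸ (L.lineCategory.m (L.basePath a l)).2))

/-- With σ = -ε the suspension sign, the sign of the rising word and the ε from the integral over
the side function combine to σ^k. -/
theorem sign_oneAscent (hε : ε = 1 ∨ ε = -1) (hm : m < k) :
    (-1 : ℝ) ^ (-((k - 1 - m : ℕ) : ℤ)) * (-riseSign ε 0 m k * ε) = (-ε) ^ k := by
  rw [neg_one_zpow_neg]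
  obtain ⟨d, rfl⟩ := Nat.exists_eq_add_of_lt hm
  have h1 : m + d + 1 - 1 - m = d := by omega
  have h2 : (-1 : ℝ) ^ d * (-1) ^ d = 1 := by rw [← mul_pow]; simp
  rw [h1]
  rcases hε with rfl | rfl
  · rw [riseSign, if_pos rfl, Nat.sub_zero, pow_succ, pow_add]; ring
  · rw [riseSign, if_neg (by norm_num), h1]
    simp [h2]

theorem sign_twoAscents (hε : ε = 1 ∨ ε = -1) (hm : m < n) (hn : n < k) :
    (-1 : ℝ) ^ (-((k - 1 - m + (k - 1 - n) : ℕ) : ℤ)) * -joinSign ε m n k = (-ε) ^ k := by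
  rw [neg_one_zpow_neg]
  obtain ⟨d, rfl⟩ := Nat.exists_eq_add_of_lt hm
  obtain ⟨e, rfl⟩ := Nat.exists_eq_add_of_lt hn
  have h1 : m + d + 1 + e + 1 - 1 - m = d + e + 1 := by omega
  have h2 : m + d + 1 + e + 1 - 1 - (m + d + 1) = e := by omega
  have h3 : ∀ s : ℕ, (-1 : ℝ) ^ s * (-1) ^ s = 1 := fun s => by rw [← mul_pow]; simp
  rw [h1, h2]
  rcases hε with rfl | rfl
  · rw [joinSign, if_pos rfl, h2]
    simp only [pow_add, pow_one]
    linear_combination ((-1 : ℝ) ^ d * (-1) ^ e * (-1) ^ m) * h3 e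
  · rw [joinSign, if_neg (by norm_num), show m + d + 1 - 1 - m = d by omega, neg_neg, one_pow]
    simp only [pow_add, pow_one]
    linear_combination h3 d * (-1) ^ e * (-1) ^ e + h3 e

theorem lineCategory_polygon_closed (h2 : 2 ≤ l.length) (hc : (a :: l).IsChain (· ≠ ·))
    (hl : a = lastObj a l) (hcc : IsCCPolygonWith (L.polygon a l) i j) :
    (L.lineCategory.m (L.basePath a l) : StepSpace)
      = (ccSign i j ^ l.length * Real.exp (-polygonArea ((L.polygon a l).map Prod.fst)))
          • (thetaPM (-ccSign i j) (L.polygon a l).headI.1.1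
              * thetaPM (ccSign i j) (L.polygon a l).getLastI.1.1) := by
  obtain ⟨o, h⟩ := L.exists_isObjSeq h2 hc
  rw [if_pos hl] at h
  rw [h.points] at hcc
  obtain ⟨m, n, hm, hn, ha, ε, hε, hC, hs⟩ := isConvexSeq_of_isCCPolygonWith h.ne h.per hcc
  have hT := ha.twoAscents hm hn le_rfl
  have hhead : (L.polygon a l).headI.1.1 = L.vx o 0 := by
    obtain ⟨k, hk⟩ : ∃ k, l.length = k + 1 := ⟨l.length - 1, by omega⟩
    rw [h.points, ptList, hk, List.range_eq_range', List.range'_succ]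
    rfl
  have hlast : (L.polygon a l).getLastI.1.1 = L.vx o (l.length - 1) := by
    obtain ⟨k, hk⟩ : ∃ k, l.length = k + 1 := ⟨l.length - 1, by omega⟩
    rw [h.points, ptList, hk, List.range_succ, List.map_append, List.getLastI_eq_getLast?_getD]
    simp [pt, vx, v]
  rw [h.coe_m (hT.prod_seg_closed hε h.ne h.per hC) (by rw [hT.wdeg]; rfl) (fun h0 => absurd rfl h0),
    hhead, hlast, hs, neg_neg, h.points, hC.polygonArea_eq hε h.ne h.per hm hn ha, segCoeff_zero,
    hT.wsusp, smul_smul, ← mul_assoc, sign_twoAscents hε hm hn]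

/-- The closing vertex either has degree one, and then the word contains both extrema as ascents, or
degree zero, and then it is the second extremum itself and the word has a single ascent. In both
cases the exponential value at the closing vertex completes the exponent to the area. -/
theorem lineCategory_polygon_open (h2 : 2 ≤ l.length) (hc : (a :: l).IsChain (· ≠ ·))
    (hl : a ≠ lastObj a l) (hcc : IsCCPolygonWith (L.polygon a l) i j) :
    (L.lineCategory.m (L.basePath a l) : StepSpace)
      = (ccSign i j ^ l.length * Real.exp (-polygonArea ((L.polygon a l).map Prod.fst)))
          • L.e a (lastObj a l) := by
  obtain ⟨o, h⟩ := L.exists_isObjSeq h2 hc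
  rw [if_neg hl] at h
  rw [h.points] at hcc
  obtain ⟨m, n, hm, hn, ha, ε, hε, hC, hs⟩ := isConvexSeq_of_isCCPolygonWith h.ne h.per hcc
  have hper0 : o (l.length + 1) = o 0 := by simpa using h.per 0
  have hk : L.Asc o l.length ↔ L.t (lastObj a l) < L.t a := by rw [Asc, hper0, h.first, h.last]
  have hA := segCoeff_mul_exp (L := L) hper0
  have hy := vx_last (L := L) h.per
  rw [h.points, hC.polygonArea_eq hε h.ne h.per hm hn ha, ← hA, hs, hy, h.first, h.last]
  rcases Nat.lt_succ_iff_lt_or_eq.mp hn with h3 | h3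
  · have hT := ha.twoAscents hm h3 (Nat.le_succ _)
    have hlt : L.t a < L.t (lastObj a l) := L.lt_of_not_lt hl.symm fun h4 => by
      rcases (ha l.length (Nat.lt_succ_self _)).mp (hk.mpr h4) with h5 | h5 <;> omega
    have hP := hT.prod_seg_open hε h.ne h.per (by rwa [h.first, h.last]) hC
    rw [h.coe_m hP (by rw [hT.wdeg]; rfl) (fun h0 => absurd rfl h0), hT.wsusp, smul_smul, ← mul_assoc,
      sign_twoAscents hε hm h3, L.e_lt hlt, smul_smul, h.first, h.last]
    congr 1
    rw [mul_assoc, mul_assoc, ← Real.exp_add, add_neg_cancel, Real.exp_zero, mul_one]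
  · subst h3
    have hO := ha.oneAscent hm
    have hlt : L.t (lastObj a l) < L.t a := hk.mp ((ha _ (Nat.lt_succ_self _)).mpr (Or.inr rfl))
    have hlt' : L.t (o l.length) < L.t (o 0) := by rwa [h.first, h.last]
    obtain ⟨hR, he⟩ := (isConvexSeq_succ_iff h.ne h.per hO h2 hlt').mp hC
    have h1 := ((hR.edgeStep_xv hε h.ne hO).resolve_right fun h5 => h5.2 he).1
    have hP := hR.prod_seg hε h.ne hO (by omega) hlt' (c := 1) (by rw [h1, Polynomial.C_1])
    rw [h.coe_m hP (by rw [hO.wdeg]; rfl) (fun _ h0 => absurd rfl h0), hO.wsusp, smul_smul,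
      L.e_gt hlt, h.first, h.last]
    congr 1
    rw [← sign_oneAscent hε hm]
    ring

/-- Degree reasons leave words with one or two ascents. For one ascent, a word that does not rise
has a vanishing tree sum, and a rising word either completes to a convex sequence or has zero outer
steps at the closing vertex. Words of two letters with different end lines always rise, so that the
exception in `tree_seg_of_not_rising` does not occur. For two ascents a nonzero cut would produce a
convex sequence. -/
theorem lineCategory_polygon_zero (h2 : 2 ≤ l.length) (hc : (a :: l).IsChain (· ≠ ·))
    (hcc : ¬ ∃ i j, IsCCPolygonWith (L.polygon a l) i j)
    (hpt : ¬ (l.length = 2 ∧ a = lastObj a l)) : L.lineCategory.m (L.basePath a l) = 0 := by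
  obtain ⟨o, h⟩ := L.exists_isObjSeq h2 hc
  rw [h.points] at hcc
  have hsdeg := h.sdeg
  have htree : ∀ {m}, OneAscent L o 0 m l.length → 3 ≤ l.length →
      (∀ ε : ℝ, (ε = 1 ∨ ε = -1) → ¬ Rising L o ε 0 m l.length) →
      L.lineCategory.m (L.basePath a l) = 0 := fun hO h3 hR =>
    h.m_eq_zero (by rw [prod_seg_of_long h.ne (by omega), hO.tree_seg_eq_zero h.ne hR (by omega),
      map_zero])
  rcases exists_ascents L o l.length with ⟨m, hO⟩ | ⟨m, n, hT⟩ | ⟨hd1, hd2⟩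
  · by_cases hl : a = lastObj a l
    · refine htree hO (by omega) fun ε _ hR => hR.ne h.ne hO ?_
      rw [h.first, h.last, ← hl]
    · rw [if_neg hl] at h
      have hper0 : o (l.length + 1) = o 0 := by simpa using h.per 0
      by_cases hlt : L.t a < L.t (lastObj a l)
      · refine m_eq_zero_of_bot (L.V_of_ne_bot hl ?_)
        rw [hsdeg, hO.wdeg, L.vdeg_lt hlt]
        norm_num
      · have hlt' : L.t (o l.length) < L.t (o 0) := by
          rw [h.first, h.last]
          exact L.lt_of_not_lt hl hlt
        have hasc : L.Asc o l.length := by rwa [Asc, hper0]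
        by_cases hR : ∃ ε : ℝ, (ε = 1 ∨ ε = -1) ∧ Rising L o ε 0 m l.length
        · obtain ⟨ε, hε, hR⟩ := hR
          rcases hR.edgeStep_xv hε h.ne hO with ⟨-, he⟩ | ⟨he, -⟩
          · refine absurd ?_ hcc
            rw [if_neg hl]
            exact ((isConvexSeq_succ_iff h.ne h.per hO h2 hlt').mpr ⟨hR, he⟩).isCCPolygonWith hε h.ne
              h.per hO.lt (Nat.lt_succ_self _) (hO.ascAt hasc)
          · refine h.m_eq_zero ?_
            rw [hR.prod_seg hε h.ne hO (by omega) hlt' (c := 0) (by rw [he, Polynomial.C_0])]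
            simp
        · by_cases h3 : 3 ≤ l.length
          · exact htree hO h3 fun ε hε hR' => hR ⟨ε, hε, hR'⟩
          · refine absurd ?_ hR
            have hl2 : l.length = 2 := by omega
            have hm := hO.lt
            rw [hl2] at hm ⊢
            have hne : L.vx o 0 ≠ L.vx o 1 := vx_ne_succ h.ne (by
              rw [zero_add, ← hl2, h.first, h.last]; exact hl)
            have key : ∀ ε : ℝ, (m = 0 → ε * L.vx o 0 < ε * L.vx o 1) →
                (m = 1 → ε * L.vx o 1 < ε * L.vx o 0) → Rising L o ε 0 m 2 := fun ε h4 h5 => by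
              constructor
              · intro t ht ht'
                obtain rfl : t = 0 := by omega
                exact h4 (by omega)
              · intro t _ ht
                obtain rfl : t = 0 := by omega
                exact h5 (by omega)
            rcases (by omega : m = 0 ∨ m = 1) with h6 | h6 <;>
            rcases lt_or_gt_of_ne hne with h7 | h7
            · exact ⟨1, Or.inl rfl, key 1 (fun _ => by simpa using h7) (by omega)⟩
            · exact ⟨-1, Or.inr rfl, key (-1) (fun _ => by simpa using h7) (by omega)⟩
            · exact ⟨-1, Or.inr rfl, key (-1) (by omega) (fun _ => by simpa using h7)⟩
            · exact ⟨1, Or.inl rfl, key 1 (by omega) (fun _ => by simpa using h7)⟩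
  · have hm := hT.lt
    have hn := hT.lt'
    by_cases hl : a = lastObj a l
    · rw [if_pos hl] at h hcc
      exact h.m_eq_zero (hT.prod_seg_closed_eq_zero h.ne h.per fun ε hε hC => hcc
        (hC.isCCPolygonWith hε h.ne h.per hm hn hT.ascAt))
    · rw [if_neg hl] at h hcc
      have hper0 : o (l.length + 1) = o 0 := by simpa using h.per 0
      by_cases hlt : L.t a < L.t (lastObj a l)
      · have hlt' : L.t (o 0) < L.t (o l.length) := by rwa [h.first, h.last]
        have hasc : ¬ L.Asc o l.length := by rw [Asc, hper0]; exact hlt'.not_gt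
        exact h.m_eq_zero (hT.prod_seg_open_eq_zero h.ne h.per hlt' fun ε hε hC => hcc
          (hC.isCCPolygonWith hε h.ne h.per hm (by omega) (hT.ascAt_succ hasc)))
      · refine m_eq_zero_of_bot (L.V_of_ne_bot hl ?_)
        rw [hsdeg, hT.wdeg, L.vdeg_gt (L.lt_of_not_lt hl hlt)]
        norm_num
  · refine m_eq_zero_of_bot (L.V_eq_bot ?_ ?_) <;> rw [hsdeg] <;> omega

end LineConfig

/-! ### The product formulas collected, and the main theorem. -/

namespace LineConfig
variable {N : ℕ} (L : LineConfig N)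
theorem isLineProducts_lineCategory : L.IsLineProducts L.lineCategory where
  diff_self _ _ w := L.lineCategory_m_single w
  diff_ne _ _ _ w h := L.lineCategory_m_single_of_ne w h
  mul_self _ _ _ w w' := L.lineCategory_m_loops_pair w w'
  higher_self _ l h := L.lineCategory_higher_self l h
  two_theta _ _ p h2 h3 := L.lineCategory_two_theta p h2 h3
  typeA_zero _ _ hab l₁ l₂ l₃ w h := L.lineCategory_typeA_zero hab l₁ l₂ l₃ w h
  typeB_zero _ _ hab l₁ l₂ l₃ w h := L.lineCategory_typeB_zero hab l₁ l₂ l₃ w h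
  typeC₁_zero _ _ hab l₁ l₄ l₂ l₃ w h := L.lineCategory_typeC₁_zero hab l₁ l₄ l₂ l₃ w h
  typeC₂_zero _ _ hab l₁ l₂ l₄ l₃ w h := L.lineCategory_typeC₂_zero hab l₁ l₂ l₄ l₃ w h
  typeC₃_zero _ _ hab l₁ l₃ l₄ l₂ w h := L.lineCategory_typeC₃_zero hab l₁ l₃ l₄ l₂ w h
  act_left _ _ hab p _ q _ _ _ hn hn' w hw := L.lineCategory_act_left hab p q hn hn' w hw
  act_right _ _ hab p _ q _ _ _ hn hn' w hw := L.lineCategory_act_right hab p q hn hn' w hw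
  triple₁ _ _ h p _ q _ _ _ hn hn' w hw := L.lineCategory_triple₁ h p q hn hn' w hw
  triple₂ _ _ h p _ q _ _ _ hn hn' w hw := L.lineCategory_triple₂ h p q hn hn' w hw
  triple₃ _ _ h p _ q _ _ _ hn hn' w hw := L.lineCategory_triple₃ h p q hn hn' w hw
  triple₄ _ _ h p _ q _ _ _ hn hn' w hw := L.lineCategory_triple₄ h p q hn hn' w hw
  polygon_open _ _ h2 hc hl _ _ hcc := lineCategory_polygon_open h2 hc hl hcc
  polygon_closed _ _ h2 hc hl _ _ hcc := lineCategory_polygon_closed h2 hc hl hcc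
  point _ _ hab := L.lineCategory_point hab
  polygon_zero _ _ h2 hc hcc hpt := lineCategory_polygon_zero h2 hc hcc hpt
end LineConfig

theorem mainTheorem2 (N : ℕ) (hN : 2 ≤ N) (L : LineConfig N) :
    L.deRham.IsDGCategory ∧
    ∃ (h : ∀ a b r, L.OmegaHom a b r →ₗ[ℝ] L.OmegaHom a b (r - 1))
      (P : ∀ a b r, L.OmegaHom a b r →ₗ[ℝ] L.OmegaHom a b r),
      L.IsHomotopy h ∧ (∀ h', L.IsHomotopy h' → h' = h) ∧
      L.IsProjection P ∧ IsContraction L.deRham h P ∧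
      (∀ a b r, a ≠ b → (LinearMap.range (P a b r)).map (L.Omega a b r).subtype = L.V a b r) ∧
      ∃ (C : AInftyData L.VHom) (G : FunctorData C L.deRham),
        C.IsAInfty ∧ L.IsLineProducts C ∧
        G.IsAInftyFunctor ∧ G.IsHomotopyEquivalence ∧
        (∀ a, G.obj a = a) ∧
        (∀ a b r (w : L.VHom a b r), (G.g (HomPath.single w) : StepSpace) = w) ∧
        G.IsPerturbation h P := by
  refine ⟨L.isDGCategory_deRham, L.homotopyMap, L.projMap, L.isHomotopy_homotopyMap,
    fun h' hh' => L.isHomotopy_unique L.isHomotopy_homotopyMap hh', L.isProjection_projMap,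
    L.isContraction_homotopyMap, fun a b r hab => L.map_range_projMap r hab, L.lineCategory,
    L.lineFunctor, L.isAInfty_lineCategory, L.isLineProducts_lineCategory,
    L.isAInftyFunctor_lineFunctor, L.isHomotopyEquivalence_lineFunctor hN, fun _ => rfl,
    fun a b r w => ?_, L.isPerturbation_lineFunctor⟩
  exact L.lineFunctor_single w
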